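/- Let $\Bbbk$ be a field and $H$ a quasitriangular Hopf algebra over $\Bbbk$ with invertible antipode and universal R-matrix $R=R^{(1)}\otimes R^{(2)}$, $R^{-1}=R^{-(1)}\otimes R^{-(2)}$; the braiding on left $H$-modules is $\Psi(v\otimes w)=(R^{(2)}\triangleright w)\otimes(R^{(1)}\triangleright v)$. Let $C,B$ be Hopf algebras with invertible antipodes in the braided monoidal category of left $H$-modules. Assume they are weakly dual: there is an $H$-linear pairing $\mathrm{ev}\colon C\otimes B\to\Bbbk$ with $$\mathrm{ev}(cc',b)=\mathrm{ev}(c',b_{(1)})\,\mathrm{ev}(c,b_{(2)}),\quad \mathrm{ev}(c,bb')=\mathrm{ev}(c_{(2)},b)\,\mathrm{ev}(c_{(1)},b'),$$ $$\mathrm{ev}(1,b)=\varepsilon(b),\quad \mathrm{ev}(c,1)=\varepsilon(c),\quad \mathrm{ev}(Sc,b)=\mathrm{ev}(c,Sb).$$ Let $\mathrm{Drin}_H(C,B)$ be the braided Drinfeld double, i.e. the $\Bbbk$-algebra generated by the algebras $C,H,B$ with relations $hb=(h_{(1)}\triangleright b)h_{(2)}$, $hc=(h_{(1)}\triangleright c)h_{(2)}$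 and $$(R^{-(1)}\triangleright b_{(2)})(R^{-(2)}\triangleright c_{(1)})\,\mathrm{ev}(c_{(2)},b_{(1)})=R^{-(1)}c_{(2)}b_{(1)}R^{(2)}\,\mathrm{ev}(R^{-(2)}\triangleright c_{(1)},R^{(1)}\triangleright b_{(2)}).$$ It has a unique bialgebra structure for which $\Delta(h)=h_{(1)}\otimes h_{(2)}$, $\Delta(b)=b_{(1)}R^{(2)}\otimes(R^{(1)}\triangleright b_{(2)})$, $\Delta(c)=R^{-(1)}c_{(2)}\otimes(R^{-(2)}\triangleright c_{(1)})$ and the counit restricts to the counits of $H$, $B$ and $C$. For a bialgebra $A$ in a braided category (unit object $I$), with multiplication $m$ and with $\Delta_{A\otimes A}$ formed with the braiding, a right 2-cocycle is a convolution-invertible morphism $\sigma\colon A\otimes A\to I$ such that $$\sigma(\mathrm{Id}\otimes m\otimes\sigma)(\mathrm{Id}\otimes\Delta_{A\otimes A})=\sigma(m\otimes\sigma\otimes\mathrm{Id})(\Delta_{A\otimes A}\otimes\mathrm{Id}),\qquad \sigma(1\otimes\mathrm{Id})=\varepsilon=\sigma(\mathrm{Id}\otimes 1).$$ Two 2-cocycles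 are cohomologous, $\sigma\sim\sigma'$, if $\sigma'=\sigma^\beta$ for some convolution-invertible morphism $\beta\colon A\to I$ with $\beta(1)=1$, where $$\sigma^\beta=(\beta^{-*}m\otimes\sigma)(\mathrm{Id}\otimes\Psi_{A,A}\otimes\mathrm{Id})(\Delta\otimes\beta\otimes\Delta\otimes\beta)(\Delta\otimes\Delta).$$ Write $C^2_H(B,\Bbbk)$ and $H^2_H(B,\Bbbk)=C^2_H(B,\Bbbk)/{\sim}$ for the 2-cocycles over $B$ in $H$-modules and their classes. Write $C^2_H({}^{\mathrm{cop}}C,\Bbbk)$ and $H^2_H({}^{\mathrm{cop}}C,\Bbbk)$ for those over ${}^{\mathrm{cop}}C$, which is $C$ with the same product and the coproduct $\Psi^{-1}\Delta_C$, a bialgebra for the inverse braiding $\Psi^{-1}$. Write $C^2$ and $H^2$ for the case of ordinary bialgebras over $\Bbbk$. **Theorem.** For all $\sigma\in C^2_H(B,\Bbbk)$ and $\tau\in C^2_H({}^{\mathrm{cop}}C,\Bbbk)$ there is a unique bilinear form $\sigma\circ\tau$ on $\mathrm{Drin}_H(C,B)$ such that for all $b,b'\in B$, $h,h'\in H$,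 $c,c'\in C$ $$\sigma\circ\tau(bhc,b'h'c')=\sigma(b,hR^{-(1)}\triangleright b'_{(2)})\,\mathrm{ev}(c_{(2)},b'_{(1)})\,\tau(R^{-(2)}\triangleright c_{(1)},h'\triangleright c').$$ It satisfies $\sigma\circ\tau(b,b')=\sigma(b,b')$, $\sigma\circ\tau(c,c')=\tau(c,c')$, $\sigma\circ\tau(h,h')=\varepsilon(hh')$, and $\sigma\circ\tau\in C^2(\mathrm{Drin}_H(C,B),\Bbbk)$. If $\sigma\sim\sigma'$ and $\tau\sim\tau'$, then $\sigma\circ\tau\sim\sigma'\circ\tau'$. Hence there is an induced map $$H^2_H(B,\Bbbk)\times H^2_H({}^{\mathrm{cop}}C,\Bbbk)\to H^2(\mathrm{Drin}_H(C,B),\Bbbk),\qquad ([\sigma],[\tau])\mapsto[\sigma\circ\tau].$$ -/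

import Mathlib

open scoped TensorProduct

namespace BraidedDouble

/-! ### Modules over a quasitriangular Hopf algebra and their braiding -/

section Braiding

variable {k H : Type*} [Field k] [Ring H] [HopfAlgebra k H]

/-- `R ∈ H ⊗ H` (invertible) is a universal R-matrix:
`(Δ ⊗ id) R = R₁₃ R₂₃`, `(id ⊗ Δ) R = R₁₃ R₁₂` and `R Δ(h) = Δᵒᵖ(h) R`. -/
structure IsUniversalRMatrix (R : (H ⊗[k] H)ˣ) : Prop where
  comul_left :
    TensorProduct.map Coalgebra.comul LinearMap.id (R : H ⊗[k] H) =
      Algebra.TensorProduct.map (Algebra.TensorProduct.includeLeft : H →ₐ[k] H ⊗[k] H)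
          (AlgHom.id k H) (R : H ⊗[k] H) *
        Algebra.TensorProduct.map (Algebra.TensorProduct.includeRight : H →ₐ[k] H ⊗[k] H)
          (AlgHom.id k H) (R : H ⊗[k] H)
  comul_right :
    TensorProduct.map LinearMap.id Coalgebra.comul (R : H ⊗[k] H) =
      Algebra.TensorProduct.map (AlgHom.id k H)
          (Algebra.TensorProduct.includeRight : H →ₐ[k] H ⊗[k] H) (R : H ⊗[k] H) *
        Algebra.TensorProduct.map (AlgHom.id k H)
          (Algebra.TensorProduct.includeLeft : H →ₐ[k] H ⊗[k] H) (R : H ⊗[k] H)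
  quasi_cocomm : ∀ h : H,
    (R : H ⊗[k] H) * Coalgebra.comul (R := k) h =
      TensorProduct.comm k H H (Coalgebra.comul (R := k) h) * (R : H ⊗[k] H)

variable {V W : Type*}
  [AddCommGroup V] [Module k V] [Module H V] [IsScalarTower k H V]
  [AddCommGroup W] [Module k W] [Module H W] [IsScalarTower k H W]

/-- The componentwise action of `x ∈ H ⊗ H` on `V ⊗ W`:
`(p ⊗ q) · (v ⊗ w) = (p ▷ v) ⊗ (q ▷ w)`. -/
noncomputable def act₂ (x : H ⊗[k] H) : V ⊗[k] W →ₗ[k] V ⊗[k] W :=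
  TensorProduct.homTensorHomMap (RingHom.id k) V W V W
    (TensorProduct.map (Algebra.lsmul k k V).toLinearMap (Algebra.lsmul k k W).toLinearMap x)

/-- The braiding `Ψ (v ⊗ w) = (R⁽²⁾ ▷ w) ⊗ (R⁽¹⁾ ▷ v)` of the category of `H`-modules. -/
noncomputable def braid (R : (H ⊗[k] H)ˣ) : V ⊗[k] W →ₗ[k] W ⊗[k] V :=
  (TensorProduct.comm k V W).toLinearMap ∘ₗ act₂ (R : H ⊗[k] H)

/-- The inverse braiding `v ⊗ w ↦ (R⁻⁽¹⁾ ▷ w) ⊗ (R⁻⁽²⁾ ▷ v)`; as a map `V ⊗ W → W ⊗ V` it is the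
inverse of `braid R : W ⊗ V → V ⊗ W`. -/
noncomputable def braidInv (R : (H ⊗[k] H)ˣ) : V ⊗[k] W →ₗ[k] W ⊗[k] V :=
  act₂ ((R⁻¹ : (H ⊗[k] H)ˣ) : H ⊗[k] H) ∘ₗ (TensorProduct.comm k V W).toLinearMap

variable (H) in
/-- `f : V → k` is a morphism from the `H`-module `V` to the trivial module. -/
def IsInvariant (f : V →ₗ[k] k) : Prop :=
  ∀ (h : H) (v : V), f (h • v) = Coalgebra.counit (R := k) h * f v

variable (H) in
/-- `f : V ⊗ W → k` is a morphism of `H`-modules, where `H` acts diagonally on `V ⊗ W` through its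
coproduct and trivially on `k`. -/
def IsInvariant₂ (f : V ⊗[k] W →ₗ[k] k) : Prop :=
  ∀ (h : H) (x : V ⊗[k] W),
    f (act₂ (Coalgebra.comul (R := k) h) x) = Coalgebra.counit (R := k) h * f x

end Braiding

section Tensor

variable {k : Type*} [Field k] {A : Type*} [AddCommGroup A] [Module k A]

/-- The coproduct of `A ⊗ A` for a coproduct `Δ` and a braiding `ψ` on `A`:
`Δ_{A ⊗ A} = (id ⊗ ψ ⊗ id) (Δ ⊗ Δ)`. -/
noncomputable def comulTensor (Δ : A →ₗ[k] A ⊗[k] A) (ψ : A ⊗[k] A →ₗ[k] A ⊗[k] A) :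
    A ⊗[k] A →ₗ[k] (A ⊗[k] A) ⊗[k] (A ⊗[k] A) :=
  (TensorProduct.assoc k A A (A ⊗[k] A)).symm.toLinearMap ∘ₗ
    LinearMap.lTensor A
      ((TensorProduct.assoc k A A A).toLinearMap ∘ₗ LinearMap.rTensor A ψ ∘ₗ
        (TensorProduct.assoc k A A A).symm.toLinearMap) ∘ₗ
    (TensorProduct.assoc k A A (A ⊗[k] A)).toLinearMap ∘ₗ
    TensorProduct.map Δ Δ

end Tensor

/-! ### Hopf algebras in the category of modules, weak duality -/

section Hopf

variable {k H : Type*} [Field k] [Ring H] [HopfAlgebra k H]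

/-- A Hopf algebra with invertible antipode in the braided monoidal category of `H`-modules.
The underlying object is an `H`-module with a `k`-algebra and a `k`-coalgebra structure. -/
structure BraidedHopf (R : (H ⊗[k] H)ˣ) (B : Type*) [Ring B] [Algebra k B] [Coalgebra k B]
    [Module H B] [IsScalarTower k H B] where
  /-- the product is a morphism of `H`-modules -/
  smul_mul : ∀ (h : H) (x : B ⊗[k] B),
    h • LinearMap.mul' k B x = LinearMap.mul' k B (act₂ (Coalgebra.comul (R := k) h) x)
  /-- the unit is a morphism of `H`-modules -/
  smul_one : ∀ h : H, h • (1 : B) = Coalgebra.counit (R := k) h • (1 : B)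
  /-- the coproduct is a morphism of `H`-modules -/
  comul_smul : ∀ (h : H) (b : B),
    Coalgebra.comul (R := k) (h • b) =
      act₂ (Coalgebra.comul (R := k) h) (Coalgebra.comul (R := k) b)
  /-- the counit is a morphism of `H`-modules -/
  counit_smul : IsInvariant H (Coalgebra.counit (R := k) (A := B))
  /-- the braided bialgebra condition -/
  comul_mul :
    (Coalgebra.comul (R := k) (A := B)) ∘ₗ LinearMap.mul' k B =
      TensorProduct.map (LinearMap.mul' k B) (LinearMap.mul' k B) ∘ₗ
        comulTensor Coalgebra.comul (braid R)
  comul_one : Coalgebra.comul (R := k) (1 : B) = 1 ⊗ₜ[k] 1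
  counit_mul : ∀ x y : B,
    Coalgebra.counit (R := k) (x * y) =
      Coalgebra.counit (R := k) x * Coalgebra.counit (R := k) y
  counit_one : Coalgebra.counit (R := k) (1 : B) = 1
  /-- the antipode -/
  antipode : B →ₗ[k] B
  antipode_smul : ∀ (h : H) (b : B), antipode (h • b) = h • antipode b
  mul_antipode_left : ∀ b : B,
    LinearMap.mul' k B (LinearMap.rTensor B antipode (Coalgebra.comul (R := k) b)) =
      algebraMap k B (Coalgebra.counit (R := k) b)
  mul_antipode_right : ∀ b : B,
    LinearMap.mul' k B (LinearMap.lTensor B antipode (Coalgebra.comul (R := k) b)) =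
      algebraMap k B (Coalgebra.counit (R := k) b)
  antipode_bijective : Function.Bijective antipode

variable {B C : Type*}
  [Ring B] [Algebra k B] [Coalgebra k B] [Module H B] [IsScalarTower k H B]
  [Ring C] [Algebra k C] [Coalgebra k C] [Module H C] [IsScalarTower k H C]

/-- `(c ⊗ c') ⊗ (b ⊗ b') ↦ ev(c' ⊗ b) • (c ⊗ b')`, that is, `id ⊗ ev ⊗ id`. -/
noncomputable def contract (ev : C ⊗[k] B →ₗ[k] k) :
    (C ⊗[k] C) ⊗[k] (B ⊗[k] B) →ₗ[k] C ⊗[k] B :=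
  LinearMap.lTensor C
      ((TensorProduct.lid k B).toLinearMap ∘ₗ LinearMap.rTensor B ev ∘ₗ
        (TensorProduct.assoc k C B B).symm.toLinearMap) ∘ₗ
    (TensorProduct.assoc k C C (B ⊗[k] B)).toLinearMap

/-- A weak duality pairing `ev : C ⊗ B → k` of Hopf algebras in the category of `H`-modules, with
the categorical convention `ev^{⊗2} = ev (id ⊗ ev ⊗ id)`. -/
structure IsWeakDuality {R : (H ⊗[k] H)ˣ} (hC : BraidedHopf R C) (hB : BraidedHopf R B)
    (ev : C ⊗[k] B →ₗ[k] k) : Prop where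
  invariant : IsInvariant₂ H ev
  mul_left : ∀ (x : C ⊗[k] C) (b : B),
    ev (LinearMap.mul' k C x ⊗ₜ b) = ev (contract ev (x ⊗ₜ Coalgebra.comul (R := k) b))
  mul_right : ∀ (c : C) (y : B ⊗[k] B),
    ev (c ⊗ₜ LinearMap.mul' k B y) = ev (contract ev (Coalgebra.comul (R := k) c ⊗ₜ y))
  one_left : ∀ b : B, ev (1 ⊗ₜ b) = Coalgebra.counit (R := k) b
  one_right : ∀ c : C, ev (c ⊗ₜ 1) = Coalgebra.counit (R := k) c
  antipode : ∀ (c : C) (b : B), ev (hC.antipode c ⊗ₜ b) = ev (c ⊗ₜ hB.antipode b)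

end Hopf

/-! ### Right 2-cocycles and cohomology

One definition covers all cases.  `A` is an algebra with an `H`-action, `Δ` and `ε` are a coproduct
and a counit on `A`, and `ψ` is the braiding on `A ⊗ A`.
* For a bialgebra `B` in `H`-modules: `Δ = Δ_B`, `ψ = Ψ`.
* For the co-opposite of `C`, which is a bialgebra for the inverse braiding:
  `Δ = Ψ⁻¹ Δ_C`, `ψ = Ψ⁻¹`.
* For an ordinary bialgebra over `k`: `H = k` (so that invariance just says `k`-linear)
  and `ψ` is the flip. -/

section Cocycle

variable {k : Type*} (H : Type*) [Field k] [Ring H] [HopfAlgebra k H]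
  {A : Type*} [Ring A] [Algebra k A] [Module H A] [IsScalarTower k H A]
  (Δ : A →ₗ[k] A ⊗[k] A) (ε : A →ₗ[k] k) (ψ : A ⊗[k] A →ₗ[k] A ⊗[k] A)

/-- Convolution product of linear forms with respect to a coproduct `Δ`. -/
noncomputable def conv {k X : Type*} [Field k] [AddCommGroup X] [Module k X]
    (Δ : X →ₗ[k] X ⊗[k] X) (f g : X →ₗ[k] k) : X →ₗ[k] k :=
  LinearMap.mul' k k ∘ₗ TensorProduct.map f g ∘ₗ Δ

/-- The twisted product `m_σ = (m ⊗ σ) Δ_{A ⊗ A}`. -/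
noncomputable def twistMul {k A : Type*} [Field k] [Ring A] [Algebra k A]
    (Δ : A →ₗ[k] A ⊗[k] A) (ψ : A ⊗[k] A →ₗ[k] A ⊗[k] A) (σ : A ⊗[k] A →ₗ[k] k) :
    A ⊗[k] A →ₗ[k] A :=
  (TensorProduct.rid k A).toLinearMap ∘ₗ
    TensorProduct.map (LinearMap.mul' k A) σ ∘ₗ comulTensor Δ ψ

/-- A right 2-cocycle: a convolution-invertible morphism `σ : A ⊗ A → k` with
`σ (id ⊗ m ⊗ σ) (id ⊗ Δ_{A ⊗ A}) = σ (m ⊗ σ ⊗ id) (Δ_{A ⊗ A} ⊗ id)` and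
`σ (1 ⊗ id) = ε = σ (id ⊗ 1)`. -/
structure IsTwoCocycle (σ : A ⊗[k] A →ₗ[k] k) : Prop where
  invariant : IsInvariant₂ H σ
  conv_invertible : ∃ σ' : A ⊗[k] A →ₗ[k] k, IsInvariant₂ H σ' ∧
    conv (comulTensor Δ ψ) σ σ' = LinearMap.mul' k k ∘ₗ TensorProduct.map ε ε ∧
    conv (comulTensor Δ ψ) σ' σ = LinearMap.mul' k k ∘ₗ TensorProduct.map ε ε
  cocycle : ∀ a b c : A,
    σ (a ⊗ₜ twistMul Δ ψ σ (b ⊗ₜ c)) = σ (twistMul Δ ψ σ (a ⊗ₜ b) ⊗ₜ c)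
  one_left : ∀ a : A, σ (1 ⊗ₜ a) = ε a
  one_right : ∀ a : A, σ (a ⊗ₜ 1) = ε a

/-- The set of right 2-cocycles. -/
def TwoCocycle : Type _ := {σ : A ⊗[k] A →ₗ[k] k // IsTwoCocycle H Δ ε ψ σ}

/-- `β' = β^{-*}`, for morphisms `β, β' : A → k` with `β(1) = 1`. -/
structure IsUnitalInvertible (β β' : A →ₗ[k] k) : Prop where
  invariant : IsInvariant H β
  invariant' : IsInvariant H β'
  map_one : β 1 = 1
  conv_right : conv Δ β β' = ε
  conv_left : conv Δ β' β = ε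

/-- The coboundary twist
`σ^β = (β^{-*} m ⊗ σ) (id ⊗ ψ ⊗ id) (Δ ⊗ β ⊗ Δ ⊗ β) (Δ ⊗ Δ)`, where `β' = β^{-*}` and
`(Δ ⊗ β) Δ = Δ (id ⊗ β) Δ`. -/
noncomputable def coboundaryTwist {k A : Type*} [Field k] [Ring A] [Algebra k A]
    (Δ : A →ₗ[k] A ⊗[k] A) (ψ : A ⊗[k] A →ₗ[k] A ⊗[k] A)
    (β β' : A →ₗ[k] k) (σ : A ⊗[k] A →ₗ[k] k) : A ⊗[k] A →ₗ[k] k :=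
  conv (comulTensor Δ ψ) (β' ∘ₗ LinearMap.mul' k A) σ ∘ₗ
    TensorProduct.map
      ((TensorProduct.rid k A).toLinearMap ∘ₗ LinearMap.lTensor A β ∘ₗ Δ)
      ((TensorProduct.rid k A).toLinearMap ∘ₗ LinearMap.lTensor A β ∘ₗ Δ)

variable {H Δ ε ψ} in
/-- `σ ∼ σ'`: there is a unital convolution-invertible morphism `β` with `σ' = σ^β`. -/
def Cohomologous (σ σ' : TwoCocycle H Δ ε ψ) : Prop :=
  ∃ β β' : A →ₗ[k] k, IsUnitalInvertible H Δ ε β β' ∧ σ'.1 = coboundaryTwist Δ ψ β β' σ.1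

/-- The second cohomology: 2-cocycles modulo being cohomologous. -/
def Cohomology₂ : Type _ := Quot (Cohomologous (H := H) (Δ := Δ) (ε := ε) (ψ := ψ))

end Cocycle

section CocycleBraided

variable {k H : Type*} [Field k] [Ring H] [HopfAlgebra k H] (R : (H ⊗[k] H)ˣ)
  (B : Type*) [Ring B] [Algebra k B] [Coalgebra k B] [Module H B] [IsScalarTower k H B]

/-- The co-opposite coproduct `Ψ⁻¹ Δ`. -/
noncomputable def comulCop : B →ₗ[k] B ⊗[k] B := braidInv R ∘ₗ Coalgebra.comul

/-- `C²_H(B, k)`. -/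
abbrev C2 : Type _ :=
  TwoCocycle H (Coalgebra.comul (R := k) (A := B)) Coalgebra.counit (braid R)

/-- `C²_H(ᶜᵒᵖB, k)`; the co-opposite is a bialgebra for the inverse braiding. -/
abbrev C2cop : Type _ :=
  TwoCocycle H (comulCop R B) (Coalgebra.counit (R := k) (A := B)) (braidInv R)

/-- `H²_H(B, k)`. -/
abbrev H2 : Type _ :=
  Cohomology₂ H (Coalgebra.comul (R := k) (A := B)) Coalgebra.counit (braid R)

/-- `H²_H(ᶜᵒᵖB, k)`. -/
abbrev H2cop : Type _ :=
  Cohomology₂ H (comulCop R B) (Coalgebra.counit (R := k) (A := B)) (braidInv R)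

end CocycleBraided

/-! ### The braided Drinfeld double -/

section Double

variable {k H B C : Type*} [Field k] [Ring H] [HopfAlgebra k H]
  [Ring B] [Algebra k B] [Coalgebra k B] [Module H B] [IsScalarTower k H B]
  [Ring C] [Algebra k C] [Coalgebra k C] [Module H C] [IsScalarTower k H C]

/-- For `x = Σ p ⊗ q ∈ H ⊗ H`, the map `v ↦ Σ p ⊗ (q ▷ v)`. -/
noncomputable def coactBy {V : Type*} [AddCommGroup V] [Module k V] [Module H V]
    [IsScalarTower k H V] (x : H ⊗[k] H) : V →ₗ[k] H ⊗[k] V :=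
  act₂ x ∘ₗ TensorProduct.mk k H V 1

/-- `c ⊗ b ↦ (R⁻⁽¹⁾ ▷ b₍₂₎) ⊗ (R⁻⁽²⁾ ▷ c₍₁₎) ev(c₍₂₎, b₍₁₎)`. -/
noncomputable def cross (R : (H ⊗[k] H)ˣ) (ev : C ⊗[k] B →ₗ[k] k) :
    C ⊗[k] B →ₗ[k] B ⊗[k] C :=
  braidInv R ∘ₗ contract ev ∘ₗ TensorProduct.map Coalgebra.comul Coalgebra.comul

section Maps

variable {A : Type*} [Ring A] [Algebra k A]

/-- `b ↦ b₍₁₎ R⁽²⁾ ⊗ (R⁽¹⁾ ▷ b₍₂₎)`, the first leg being multiplied in an algebra `A` that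
receives `B` and `H`. -/
noncomputable def deltaB (R : (H ⊗[k] H)ˣ) (jB : B →ₗ[k] A) (jH : H →ₗ[k] A) :
    B →ₗ[k] A ⊗[k] B :=
  LinearMap.rTensor B (LinearMap.mul' k A ∘ₗ TensorProduct.map jB jH) ∘ₗ
    (TensorProduct.assoc k B H B).symm.toLinearMap ∘ₗ
    LinearMap.lTensor B (coactBy (TensorProduct.comm k H H (R : H ⊗[k] H))) ∘ₗ
    Coalgebra.comul

/-- `c ↦ R⁻⁽¹⁾ c₍₂₎ ⊗ (R⁻⁽²⁾ ▷ c₍₁₎)`, the first leg being multiplied in an algebra `A` that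
receives `C` and `H`. -/
noncomputable def deltaC (R : (H ⊗[k] H)ˣ) (jC : C →ₗ[k] A) (jH : H →ₗ[k] A) :
    C →ₗ[k] A ⊗[k] C :=
  LinearMap.rTensor C
      (LinearMap.mul' k A ∘ₗ TensorProduct.map jH jC ∘ₗ (TensorProduct.comm k C H).toLinearMap) ∘ₗ
    (TensorProduct.assoc k C H C).symm.toLinearMap ∘ₗ
    LinearMap.lTensor C (coactBy ((R⁻¹ : (H ⊗[k] H)ˣ) : H ⊗[k] H)) ∘ₗ
    (TensorProduct.comm k C C).toLinearMap ∘ₗ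
    Coalgebra.comul

/-- `(a ⊗ c) ⊗ (a' ⊗ b) ↦ ev(c, b) • (a * a')`. -/
noncomputable def mulEv (ev : C ⊗[k] B →ₗ[k] k) :
    (A ⊗[k] C) ⊗[k] (A ⊗[k] B) →ₗ[k] A :=
  (TensorProduct.rid k A).toLinearMap ∘ₗ
    TensorProduct.map (LinearMap.mul' k A) ev ∘ₗ
    (TensorProduct.tensorTensorTensorComm k A C A B).toLinearMap

end Maps

/-- The inclusion of `B` into the tensor algebra on `B × H × C`. -/
noncomputable def preB : B →ₗ[k] TensorAlgebra k (B × H × C) :=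
  TensorAlgebra.ι k ∘ₗ LinearMap.inl k B (H × C)

/-- The inclusion of `H`. -/
noncomputable def preH : H →ₗ[k] TensorAlgebra k (B × H × C) :=
  TensorAlgebra.ι k ∘ₗ LinearMap.inr k B (H × C) ∘ₗ LinearMap.inl k H C

/-- The inclusion of `C`. -/
noncomputable def preC : C →ₗ[k] TensorAlgebra k (B × H × C) :=
  TensorAlgebra.ι k ∘ₗ LinearMap.inr k B (H × C) ∘ₗ LinearMap.inr k H C

/-- The defining relations of the braided Drinfeld double: `B`, `H`, `C` are mapped
multiplicatively and unitally, `h b = (h₍₁₎ ▷ b) h₍₂₎`, `h c = (h₍₁₎ ▷ c) h₍₂₎`, and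
`(R⁻⁽¹⁾ ▷ b₍₂₎) (R⁻⁽²⁾ ▷ c₍₁₎) ev(c₍₂₎, b₍₁₎)
  = R⁻⁽¹⁾ c₍₂₎ b₍₁₎ R⁽²⁾ ev(R⁻⁽²⁾ ▷ c₍₁₎, R⁽¹⁾ ▷ b₍₂₎)`. -/
inductive DrinRel (R : (H ⊗[k] H)ˣ) (ev : C ⊗[k] B →ₗ[k] k) :
    TensorAlgebra k (B × H × C) → TensorAlgebra k (B × H × C) → Prop
  | mul_B (b b' : B) : DrinRel R ev (preB (b * b')) (preB b * preB b')
  | one_B : DrinRel R ev (preB (1 : B)) 1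
  | mul_H (h h' : H) : DrinRel R ev (preH (h * h')) (preH h * preH h')
  | one_H : DrinRel R ev (preH (1 : H)) 1
  | mul_C (c c' : C) : DrinRel R ev (preC (c * c')) (preC c * preC c')
  | one_C : DrinRel R ev (preC (1 : C)) 1
  | HB (h : H) (b : B) : DrinRel R ev (preH h * preB b)
      (LinearMap.mul' k _ (TensorProduct.map preB preH
        (LinearMap.rTensor H ((Algebra.lsmul k k B).toLinearMap.flip b)
          (Coalgebra.comul (R := k) h))))
  | HC (h : H) (c : C) : DrinRel R ev (preH h * preC c)
      (LinearMap.mul' k _ (TensorProduct.map preC preH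
        (LinearMap.rTensor H ((Algebra.lsmul k k C).toLinearMap.flip c)
          (Coalgebra.comul (R := k) h))))
  | cross (b : B) (c : C) : DrinRel R ev
      (LinearMap.mul' k _ (TensorProduct.map preB preC (BraidedDouble.cross R ev (c ⊗ₜ b))))
      (mulEv ev (deltaC R preC preH c ⊗ₜ deltaB R preB preH b))

/-- The underlying algebra of the braided Drinfeld double `Drin_H(C, B)`. -/
def Drin (R : (H ⊗[k] H)ˣ) (ev : C ⊗[k] B →ₗ[k] k) : Type _ := RingQuot (DrinRel R ev)

variable (R : (H ⊗[k] H)ˣ) (ev : C ⊗[k] B →ₗ[k] k)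

noncomputable instance : Ring (Drin R ev) := inferInstanceAs (Ring (RingQuot (DrinRel R ev)))

noncomputable instance : Algebra k (Drin R ev) :=
  inferInstanceAs (Algebra k (RingQuot (DrinRel R ev)))

/-- The structure map of `B` into `Drin_H(C, B)`. -/
noncomputable def inB : B →ₗ[k] Drin R ev :=
  (RingQuot.mkAlgHom k (DrinRel R ev)).toLinearMap ∘ₗ preB

/-- The structure map of `H`. -/
noncomputable def inH : H →ₗ[k] Drin R ev :=
  (RingQuot.mkAlgHom k (DrinRel R ev)).toLinearMap ∘ₗ preH

/-- The structure map of `C`. -/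
noncomputable def inC : C →ₗ[k] Drin R ev :=
  (RingQuot.mkAlgHom k (DrinRel R ev)).toLinearMap ∘ₗ preC

/-- The bialgebra structure of `Drin_H(C, B)`: coproduct and counit are algebra maps with the
prescribed values on the generators (hence there is at most one such structure), and they are
coassociative and counital. -/
@[ext]
structure DrinBialgebra where
  comul : Drin R ev →ₐ[k] Drin R ev ⊗[k] Drin R ev
  counit : Drin R ev →ₐ[k] k
  comul_H : ∀ h : H, comul (inH R ev h) =
    TensorProduct.map (inH R ev) (inH R ev) (Coalgebra.comul (R := k) h)
  comul_B : ∀ b : B, comul (inB R ev b) =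
    LinearMap.lTensor (Drin R ev) (inB R ev) (deltaB R (inB R ev) (inH R ev) b)
  comul_C : ∀ c : C, comul (inC R ev c) =
    LinearMap.lTensor (Drin R ev) (inC R ev) (deltaC R (inC R ev) (inH R ev) c)
  counit_H : ∀ h : H, counit (inH R ev h) = Coalgebra.counit (R := k) h
  counit_B : ∀ b : B, counit (inB R ev b) = Coalgebra.counit (R := k) b
  counit_C : ∀ c : C, counit (inC R ev c) = Coalgebra.counit (R := k) c
  coassoc : ∀ x : Drin R ev,
    TensorProduct.assoc k _ _ _ (LinearMap.rTensor _ comul.toLinearMap (comul x)) =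
      LinearMap.lTensor _ comul.toLinearMap (comul x)
  counit_left : ∀ x : Drin R ev,
    TensorProduct.lid k _ (LinearMap.rTensor _ counit.toLinearMap (comul x)) = x
  counit_right : ∀ x : Drin R ev,
    TensorProduct.rid k _ (LinearMap.lTensor _ counit.toLinearMap (comul x)) = x

variable {R ev}

/-- `C²(Drin_H(C, B), k)`: right 2-cocycles over an ordinary bialgebra. -/
abbrev C2Drin (D : DrinBialgebra R ev) : Type _ :=
  TwoCocycle k D.comul.toLinearMap D.counit.toLinearMap
    (TensorProduct.comm k (Drin R ev) (Drin R ev)).toLinearMap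

/-- `H²(Drin_H(C, B), k)`. -/
abbrev H2Drin (D : DrinBialgebra R ev) : Type _ :=
  Cohomology₂ k D.comul.toLinearMap D.counit.toLinearMap
    (TensorProduct.comm k (Drin R ev) (Drin R ev)).toLinearMap

/-- The explicit formula that defines `ω = σ ∘ τ`: for all `b, b' ∈ B`, `h, h' ∈ H`, `c, c' ∈ C`,
`ω(b h c, b' h' c') = σ(b, h R⁻⁽¹⁾ ▷ b'₍₂₎) ev(c₍₂₎, b'₍₁₎) τ(R⁻⁽²⁾ ▷ c₍₁₎, h' ▷ c')`. -/
def IsComposite (σ : B ⊗[k] B →ₗ[k] k) (τ : C ⊗[k] C →ₗ[k] k)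
    (ω : Drin R ev ⊗[k] Drin R ev →ₗ[k] k) : Prop :=
  ∀ (b b' : B) (h h' : H) (c c' : C),
    ω ((inB R ev b * inH R ev h * inC R ev c) ⊗ₜ (inB R ev b' * inH R ev h' * inC R ev c')) =
      LinearMap.mul' k k (TensorProduct.map
        (σ ∘ₗ TensorProduct.mk k B B b ∘ₗ (Algebra.lsmul k k B).toLinearMap h)
        (τ ∘ₗ (TensorProduct.mk k C C).flip (h' • c'))
        (cross R ev (c ⊗ₜ b')))

end Double

end BraidedDouble

open scoped TensorProduct

set_option linter.unusedSectionVars false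
set_option linter.unusedVariables false
set_option linter.unusedSimpArgs false

/-! The form σ ∘ τ is the cocycle of a comodule algebra over the double whose underlying comodule is
the double itself. A cocycle σ deforms the product of B into m_σ = (m ⊗ σ) Δ_{B ⊗ B}, which is
associative exactly because of the cocycle identity (`BrBialg.twistMul_assoc`), stays H-linear, and
stays a left comodule map (`BrBialg.comul_twistMul`). The co-opposite of C is a bialgebra for the
braiding of the reversed R-matrix R₂₁⁻¹ (`BrBialg.cop`), so τ deforms C in the same way.

The twisted double `Tw` is generated by B with m_σ, by C with m_τ and by H, with the straightened
cross relation c b = (R⁻⁽¹⁾ ▷ b₍₂₎)(R⁻⁽²⁾ ▷ c₍₁₎) ev(c₍₂₎, b₍₁₎). The right-hand side is a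
distributive law (`cross_mul_right`, `cross_mul_left`): ev meets only those coproduct legs on which
a twisted product is still the ordinary one. Hence `Tw` acts on B ⊗ C, and evaluation at 1 ⊗ 1
followed by counits gives a linear form `vac`. The formulas for the coproduct of the double define
an algebra map `Tw` → `Drin` ⊗ `Tw`, the coaction `Tw.coact`.

By the triangular decomposition `IsWeakDuality.word_bijective` the words b h c identify the double
with B ⊗ H ⊗ C. Sending words to words gives a comodule isomorphism θ from `Drin` to `Tw`, and ω(x,
y) = vac(θ(x) θ(y)) satisfies θ(m_ω(x, y)) = θ(x) θ(y), by `Tw.twistMul_form` and `Tw.theta_proj`.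
Associativity in `Tw` is then the cocycle identity for ω. On words ω is given by the asserted
formula (`Tw.composite_word`), because the counit of m_σ is σ. The same formula exhibits ω as a
convolution product of three forms built from ev, σ and τ (`Tw.composite_eq_conv`). Each is
invertible, the first because ev(S c, b) is the convolution inverse of ev, so ω is invertible.

For the triangular decomposition, words span since C can be moved to the right: the double relation
is solved for c b by contracting with the inverse of ev (`evR_evR`). They are independent since the
double maps to a tensor product of two algebras, one satisfying the straight cross relation and the
other the reverse one, and a word can be recovered from its image (`Drin.strip_word`). The calculus
of the product `star` explains why relations of these types combine under the coproduct.

If σ′ = σ^β and τ′ = τ^γ, then b ↦ b₍₁₎ β(b₍₂₎) and c ↦ γ(c₍₁₎) c₍₂₎ extend to a colinear algebra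
isomorphism from the twisted double of (σ′, τ′) to that of (σ, τ). Composing it with θ and `vac`
yields a linear form on the double, and this form is the required coboundary
(`Tw.exists_coboundary`). -/

namespace BraidedDouble

/-! ### Tensor legs and the componentwise action of H ⊗ H -/

section Legs
variable {k V W : Type*} [Field k] [AddCommGroup V] [Module k V] [AddCommGroup W] [Module k W]

/-- A finite family of pure tensors with sum `t`. -/
noncomputable def legs (t : V ⊗[k] W) : Finset (V × W) := (TensorProduct.exists_finset t).choose

theorem sum_legs (t : V ⊗[k] W) : ∑ i ∈ legs t, i.1 ⊗ₜ[k] i.2 = t :=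
  (TensorProduct.exists_finset t).choose_spec.symm

theorem map_legs {Z : Type*} [AddCommGroup Z] [Module k Z] (G : V ⊗[k] W →ₗ[k] Z) (t : V ⊗[k] W) :
    ∑ i ∈ legs t, G (i.1 ⊗ₜ i.2) = G t := by
  rw [← map_sum, sum_legs]

end Legs

section Action
variable {k H : Type*} [Field k] [Ring H] [HopfAlgebra k H]
variable {V W U Z : Type*}
  [AddCommGroup V] [Module k V] [Module H V] [IsScalarTower k H V]
  [AddCommGroup W] [Module k W] [Module H W] [IsScalarTower k H W]
  [AddCommGroup U] [Module k U] [Module H U] [IsScalarTower k H U]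
  [AddCommGroup Z] [Module k Z] [Module H Z] [IsScalarTower k H Z]

variable (H) in
/-- The orbit map `h ↦ h ▷ v`. -/
noncomputable def orb (v : V) : H →ₗ[k] V := (Algebra.lsmul k k V).toLinearMap.flip v

@[simp] theorem orb_apply (v : V) (h : H) : orb (k := k) H v h = h • v := rfl

@[simp] theorem act₂_tmul_tmul (p q : H) (v : V) (w : W) :
    act₂ (p ⊗ₜ[k] q) (v ⊗ₜ[k] w) = (p • v) ⊗ₜ[k] (q • w) := by
  simp [act₂]

theorem act₂_add (x y : H ⊗[k] H) :
    (act₂ (x + y) : V ⊗[k] W →ₗ[k] V ⊗[k] W) = act₂ x + act₂ y := by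
  simp [act₂]

theorem act₂_zero : (act₂ (0 : H ⊗[k] H) : V ⊗[k] W →ₗ[k] V ⊗[k] W) = 0 := by
  simp [act₂]

theorem act₂_tmul (x : H ⊗[k] H) (v : V) (w : W) :
    act₂ x (v ⊗ₜ[k] w) = TensorProduct.map (orb H v) (orb H w) x := by
  induction x using TensorProduct.induction_on with
  | zero => simp [act₂_zero]
  | tmul p q => simp
  | add x y hx hy => simp [act₂_add, hx, hy]

theorem act₂_legs (x : H ⊗[k] H) (v : V) (w : W) :
    act₂ x (v ⊗ₜ[k] w) = ∑ i ∈ legs x, (i.1 • v) ⊗ₜ[k] (i.2 • w) := by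
  rw [act₂_tmul, ← map_legs]; rfl

theorem comm_act₂ (x : H ⊗[k] H) (t : V ⊗[k] W) :
    TensorProduct.comm k V W (act₂ x t) =
      act₂ (TensorProduct.comm k H H x) (TensorProduct.comm k V W t) := by
  induction t using TensorProduct.induction_on with
  | zero => simp
  | add s t hs ht => simp [hs, ht]
  | tmul v w =>
    induction x using TensorProduct.induction_on with
    | zero => simp [act₂_zero]
    | add x x' hx hx' => simp [act₂_add, hx, hx']
    | tmul p' q' => simp

end Action

/-! ### The R-matrix, its reverse and the Yang–Baxter equation -/

section RMatrix
variable {k H : Type*} [Field k] [Ring H] [HopfAlgebra k H]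

/-- The flip of `R⁻¹`. -/
noncomputable def revR (R : (H ⊗[k] H)ˣ) : (H ⊗[k] H)ˣ :=
  Units.map (Algebra.TensorProduct.comm k H H).toAlgHom.toMonoidHom R⁻¹

theorem revR_val (R : (H ⊗[k] H)ˣ) :
    (revR R : H ⊗[k] H) = TensorProduct.comm k H H ((R⁻¹ : (H ⊗[k] H)ˣ) : H ⊗[k] H) := rfl

theorem revR_inv_val (R : (H ⊗[k] H)ˣ) :
    (((revR R)⁻¹ : (H ⊗[k] H)ˣ) : H ⊗[k] H) = TensorProduct.comm k H H (R : H ⊗[k] H) := rfl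

theorem comm_revR (R : (H ⊗[k] H)ˣ) :
    TensorProduct.comm k H H (revR R : H ⊗[k] H) = ((R⁻¹ : (H ⊗[k] H)ˣ) : H ⊗[k] H) := by
  simp [revR_val]

theorem revR_revR (R : (H ⊗[k] H)ˣ) : revR (revR R) = R := by
  ext; rw [revR_val, revR_inv_val]; simp

theorem comm_mul (x y : H ⊗[k] H) : TensorProduct.comm k H H (x * y) =
    TensorProduct.comm k H H x * TensorProduct.comm k H H y :=
  map_mul (Algebra.TensorProduct.comm k H H) x y

theorem comm_revR_mul (R : (H ⊗[k] H)ˣ) :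
    TensorProduct.comm k H H (revR R : H ⊗[k] H) * (R : H ⊗[k] H) = 1 := by
  rw [comm_revR]; simp

theorem mul_comm_revR (R : (H ⊗[k] H)ˣ) :
    (R : H ⊗[k] H) * TensorProduct.comm k H H (revR R : H ⊗[k] H) = 1 := by
  rw [comm_revR]; simp

namespace IsUniversalRMatrix
variable {R : (H ⊗[k] H)ˣ} 

theorem inv_eq_mul {A : Type*} [Ring A] [Algebra k A] {φ a b : H ⊗[k] H →ₐ[k] A}
    (h : φ (R : H ⊗[k] H) = a (R : H ⊗[k] H) * b (R : H ⊗[k] H)) :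
    φ ((R⁻¹ : (H ⊗[k] H)ˣ) : H ⊗[k] H) =
      b ((R⁻¹ : (H ⊗[k] H)ˣ) : H ⊗[k] H) * a ((R⁻¹ : (H ⊗[k] H)ˣ) : H ⊗[k] H) := by
  have h' : Units.map (φ : H ⊗[k] H →* A) R = Units.map (a : H ⊗[k] H →* A) R * Units.map (b : H ⊗[k] H →* A) R := Units.ext h
  have h'' : Units.map (φ : H ⊗[k] H →* A) R⁻¹ =
      Units.map (b : H ⊗[k] H →* A) R⁻¹ * Units.map (a : H ⊗[k] H →* A) R⁻¹ := by
    rw [map_inv, h', mul_inv_rev, map_inv, map_inv]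
  exact congrArg Units.val h''

/-- Inverting reverses the order of the two factors in each coproduct axiom and flipping exchanges
the two axioms. The inverse braiding is therefore the braiding of another quasitriangular structure
on H, and everything proved for B applies to the co-opposite of C. -/
theorem revR (hR : IsUniversalRMatrix R) : IsUniversalRMatrix (revR R) where
  comul_left := by
    have h := inv_eq_mul (R := R)
      (φ := Algebra.TensorProduct.map (AlgHom.id k H) (Bialgebra.comulAlgHom k H))
      (a := Algebra.TensorProduct.map (AlgHom.id k H)
          (Algebra.TensorProduct.includeRight : H →ₐ[k] H ⊗[k] H))
      (b := Algebra.TensorProduct.map (AlgHom.id k H)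
          (Algebra.TensorProduct.includeLeft : H →ₐ[k] H ⊗[k] H))
      hR.comul_right
    have h2 := congrArg (Algebra.TensorProduct.comm k H (H ⊗[k] H)) h
    rw [map_mul] at h2
    rw [revR_val]
    convert h2 using 1
    · generalize ((R⁻¹ : (H ⊗[k] H)ˣ) : H ⊗[k] H) = t
      induction t using TensorProduct.induction_on with
      | zero => simp
      | tmul x y => simp
      | add x y hx hy => simp only [map_add, hx, hy]
    · congr 1 <;>
      · generalize ((R⁻¹ : (H ⊗[k] H)ˣ) : H ⊗[k] H) = t
        induction t using TensorProduct.induction_on with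
        | zero => simp
        | tmul x y => simp
        | add x y hx hy => simp only [map_add, hx, hy]
  comul_right := by
    have h := inv_eq_mul (R := R)
      (φ := Algebra.TensorProduct.map (Bialgebra.comulAlgHom k H) (AlgHom.id k H))
      (a := Algebra.TensorProduct.map
          (Algebra.TensorProduct.includeLeft : H →ₐ[k] H ⊗[k] H) (AlgHom.id k H))
      (b := Algebra.TensorProduct.map
          (Algebra.TensorProduct.includeRight : H →ₐ[k] H ⊗[k] H) (AlgHom.id k H))
      hR.comul_left
    have h2 := congrArg (Algebra.TensorProduct.comm k (H ⊗[k] H) H) h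
    rw [map_mul] at h2
    rw [revR_val]
    convert h2 using 1
    · generalize ((R⁻¹ : (H ⊗[k] H)ˣ) : H ⊗[k] H) = t
      induction t using TensorProduct.induction_on with
      | zero => simp
      | tmul x y => simp
      | add x y hx hy => simp only [map_add, hx, hy]
    · congr 1 <;>
      · generalize ((R⁻¹ : (H ⊗[k] H)ˣ) : H ⊗[k] H) = t
        induction t using TensorProduct.induction_on with
        | zero => simp
        | tmul x y => simp
        | add x y hx hy => simp only [map_add, hx, hy]
  quasi_cocomm h := by
    have h1 := hR.quasi_cocomm h
    have h2 : Coalgebra.comul (R := k) h * ((R⁻¹ : (H ⊗[k] H)ˣ) : H ⊗[k] H) =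
        ((R⁻¹ : (H ⊗[k] H)ˣ) : H ⊗[k] H) * TensorProduct.comm k H H (Coalgebra.comul (R := k) h) := by
      rw [Units.mul_inv_eq_iff_eq_mul, mul_assoc, ← h1, Units.inv_mul_cancel_left]
    have h3 := congrArg (TensorProduct.comm k H H) h2
    rw [comm_mul, comm_mul] at h3
    rw [revR_val, h3]
    congr 1
    generalize (Coalgebra.comul (R := k) h) = t
    induction t using TensorProduct.induction_on with
    | zero => simp
    | tmul x y => simp
    | add x y hx hy => simp only [map_add, ← hx, ← hy]

section sums
variable {Z : Type*} [AddCommGroup Z] [Module k Z]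

theorem hexL (hR : IsUniversalRMatrix R) (G : (H ⊗[k] H) ⊗[k] H →ₗ[k] Z) :
    ∑ r ∈ legs (R : H ⊗[k] H), G (Coalgebra.comul r.1 ⊗ₜ r.2) =
      ∑ r ∈ legs (R : H ⊗[k] H), ∑ s ∈ legs (R : H ⊗[k] H),
        G ((r.1 ⊗ₜ s.1) ⊗ₜ (r.2 * s.2)) := by
  have := congrArg G hR.comul_left
  rw [← sum_legs (R : H ⊗[k] H)] at this
  simpa [Finset.sum_mul_sum] using this

theorem hexR (hR : IsUniversalRMatrix R) (G : H ⊗[k] (H ⊗[k] H) →ₗ[k] Z) :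
    ∑ r ∈ legs (R : H ⊗[k] H), G (r.1 ⊗ₜ Coalgebra.comul r.2) =
      ∑ r ∈ legs (R : H ⊗[k] H), ∑ s ∈ legs (R : H ⊗[k] H),
        G ((r.1 * s.1) ⊗ₜ (s.2 ⊗ₜ r.2)) := by
  have := congrArg G hR.comul_right
  rw [← sum_legs (R : H ⊗[k] H)] at this
  simpa [Finset.sum_mul_sum] using this

theorem qc (hR : IsUniversalRMatrix R) (G : H ⊗[k] H →ₗ[k] Z) (h : H) :
    ∑ r ∈ legs (R : H ⊗[k] H), ∑ x ∈ legs (Coalgebra.comul (R := k) h),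
        G ((r.1 * x.1) ⊗ₜ (r.2 * x.2)) =
      ∑ r ∈ legs (R : H ⊗[k] H), ∑ x ∈ legs (Coalgebra.comul (R := k) h),
        G ((x.2 * r.1) ⊗ₜ (x.1 * r.2)) := by
  have := congrArg G (hR.quasi_cocomm h)
  rw [← sum_legs (R : H ⊗[k] H), ← sum_legs (Coalgebra.comul (R := k) h)] at this
  rw [Finset.sum_comm (s := legs (R : H ⊗[k] H)) (t := legs (Coalgebra.comul (R := k) h))
    (f := fun r x => G ((x.2 * r.1) ⊗ₜ (x.1 * r.2)))]
  simpa [Finset.sum_mul_sum] using this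

end sums

end IsUniversalRMatrix

section
variable {V W : Type*}
  [AddCommGroup V] [Module k V] [Module H V] [IsScalarTower k H V]
  [AddCommGroup W] [Module k W] [Module H W] [IsScalarTower k H W]
variable (R : (H ⊗[k] H)ˣ)

theorem braidInv_eq : (braidInv R : V ⊗[k] W →ₗ[k] W ⊗[k] V) = braid (revR R) := by
  ext v w
  simp only [braidInv, braid, LinearMap.comp_apply, TensorProduct.AlgebraTensorModule.curry_apply,
    LinearMap.restrictScalars_self, TensorProduct.curry_apply, LinearEquiv.coe_coe]
  rw [comm_act₂, comm_revR]

theorem braid_tmul (v : V) (w : W) :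
    braid R (v ⊗ₜ[k] w) = ∑ r ∈ legs (R : H ⊗[k] H), (r.2 • w) ⊗ₜ[k] (r.1 • v) := by
  simp [braid, act₂_legs, map_sum]

end
end RMatrix
end BraidedDouble

namespace BraidedDouble
section RMatrix
variable {k H : Type*} [Field k] [Ring H] [HopfAlgebra k H]
variable {R : (H ⊗[k] H)ˣ} {Z : Type*} [AddCommGroup Z] [Module k Z]

namespace IsUniversalRMatrix

theorem rev_cancel (R : (H ⊗[k] H)ˣ) (G : H ⊗[k] H →ₗ[k] Z) :
    ∑ r ∈ legs (BraidedDouble.revR R : H ⊗[k] H), ∑ s ∈ legs (R : H ⊗[k] H),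
      G ((r.2 * s.1) ⊗ₜ (r.1 * s.2)) = G (1 ⊗ₜ 1) := by
  have := congrArg G (comm_revR_mul R)
  rw [← sum_legs (R : H ⊗[k] H), ← sum_legs (BraidedDouble.revR R : H ⊗[k] H)] at this
  simpa [Finset.sum_mul_sum, Algebra.TensorProduct.one_def] using this

theorem cancel_rev (R : (H ⊗[k] H)ˣ) (G : H ⊗[k] H →ₗ[k] Z) :
    ∑ s ∈ legs (R : H ⊗[k] H), ∑ r ∈ legs (BraidedDouble.revR R : H ⊗[k] H),
      G ((s.1 * r.2) ⊗ₜ (s.2 * r.1)) = G (1 ⊗ₜ 1) := by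
  have := congrArg G (mul_comm_revR R)
  rw [← sum_legs (R : H ⊗[k] H), ← sum_legs (BraidedDouble.revR R : H ⊗[k] H)] at this
  simpa [Finset.sum_mul_sum, Algebra.TensorProduct.one_def] using this

theorem counit_comul (h : H) :
    TensorProduct.map (Coalgebra.counit (R := k)) (Coalgebra.counit (R := k) (A := H))
      (Coalgebra.comul (R := k) h) = 1 ⊗ₜ Coalgebra.counit (R := k) h := by
  have := congrArg (TensorProduct.map LinearMap.id (Coalgebra.counit (R := k) (A := H)))
    (Coalgebra.rTensor_counit_comul (R := k) h)
  rw [LinearMap.rTensor, ← LinearMap.comp_apply, ← TensorProduct.map_comp] at this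
  simp only [LinearMap.id_comp, LinearMap.comp_id, TensorProduct.map_tmul, LinearMap.id_coe,
    id_eq] at this
  exact this

/-- Applying both counits to the doubled leg in the hexagon makes (ε ⊗ id) R idempotent. It is also
the image of a unit under an algebra map, and an invertible idempotent is 1. -/
theorem counit_left (hR : IsUniversalRMatrix R) (G : H →ₗ[k] Z) :
    ∑ r ∈ legs (R : H ⊗[k] H), Coalgebra.counit (R := k) r.1 • G r.2 = G 1 := by
  let φ : H ⊗[k] H →ₐ[k] H := (Algebra.TensorProduct.lid k H).toAlgHom.comp
    (Algebra.TensorProduct.map (Bialgebra.counitAlgHom k H) (AlgHom.id k H))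
  have hφ : ∀ a b : H, φ (a ⊗ₜ b) = Coalgebra.counit (R := k) a • b := fun a b => by simp [φ]
  have hu : IsUnit (φ R) := R.isUnit.map φ
  have h1 := hexL hR ((TensorProduct.lid k H).toLinearMap ∘ₗ TensorProduct.map
    ((TensorProduct.lid k k).toLinearMap ∘ₗ TensorProduct.map (Coalgebra.counit (R := k))
      (Coalgebra.counit (R := k) (A := H))) LinearMap.id)
  simp only [LinearMap.comp_apply, TensorProduct.map_tmul, counit_comul, LinearEquiv.coe_coe,
    TensorProduct.lid_tmul, LinearMap.id_apply] at h1
  have h2 : φ R * φ R = φ R := by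
    rw [← sum_legs (R : H ⊗[k] H), map_sum, Finset.sum_mul_sum]
    simp only [hφ]
    simp only [smul_eq_mul, one_mul] at h1
    rw [h1]
    simp only [smul_mul_smul_comm]
  have h3 : φ R = 1 := by
    have := hu.mul_left_cancel (h2.trans (mul_one _).symm)
    exact this
  rw [← h3, ← sum_legs (R : H ⊗[k] H), map_sum, map_sum]
  simp only [hφ, map_smul, sum_legs]

theorem counit_right (hR : IsUniversalRMatrix R) (G : H →ₗ[k] Z) :
    ∑ r ∈ legs (R : H ⊗[k] H), Coalgebra.counit (R := k) r.2 • G r.1 = G 1 := by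
  let φ : H ⊗[k] H →ₐ[k] H := (Algebra.TensorProduct.rid k k H).toAlgHom.comp
    (Algebra.TensorProduct.map (AlgHom.id k H) (Bialgebra.counitAlgHom k H))
  have hφ : ∀ a b : H, φ (a ⊗ₜ b) = Coalgebra.counit (R := k) b • a := fun a b => by simp [φ]
  have hu : IsUnit (φ R) := R.isUnit.map φ
  have h1 := hexR hR ((TensorProduct.rid k H).toLinearMap ∘ₗ TensorProduct.map LinearMap.id
    ((TensorProduct.lid k k).toLinearMap ∘ₗ TensorProduct.map (Coalgebra.counit (R := k))
      (Coalgebra.counit (R := k) (A := H))))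
  simp only [LinearMap.comp_apply, TensorProduct.map_tmul, counit_comul, LinearEquiv.coe_coe,
    TensorProduct.lid_tmul, TensorProduct.rid_tmul, LinearMap.id_apply] at h1
  have h2 : φ R * φ R = φ R := by
    rw [← sum_legs (R : H ⊗[k] H), map_sum, Finset.sum_mul_sum]
    simp only [hφ]
    simp only [smul_eq_mul, one_mul] at h1
    rw [h1]
    simp only [smul_mul_smul_comm, mul_comm]
  have h3 : φ R = 1 := by
    have := hu.mul_left_cancel (h2.trans (mul_one _).symm)
    exact this
  rw [← h3, ← sum_legs (R : H ⊗[k] H), map_sum, map_sum]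
  simp only [hφ, map_smul, sum_legs]

/-- The Yang-Baxter equation `R₁₂ R₁₃ R₂₃ = R₂₃ R₁₃ R₁₂`. -/
theorem yangBaxter (hR : IsUniversalRMatrix R) (G : (H ⊗[k] H) ⊗[k] H →ₗ[k] Z) :
    ∑ r ∈ legs (R : H ⊗[k] H), ∑ s ∈ legs (R : H ⊗[k] H), ∑ t ∈ legs (R : H ⊗[k] H),
        G (((r.1 * s.1) ⊗ₜ (r.2 * t.1)) ⊗ₜ (s.2 * t.2)) =
      ∑ r ∈ legs (R : H ⊗[k] H), ∑ s ∈ legs (R : H ⊗[k] H), ∑ t ∈ legs (R : H ⊗[k] H),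
        G (((s.1 * r.1) ⊗ₜ (t.1 * r.2)) ⊗ₜ (t.2 * s.2)) := by
  -- On both sides the two copies of R sharing the third slot fold back into (Δ ⊗ id) R. What
  -- remains is R Δ = Δᵒᵖ R in the first two slots.
  have h1 : ∀ r : H × H, ∑ s ∈ legs (R : H ⊗[k] H), ∑ t ∈ legs (R : H ⊗[k] H),
        G (((r.1 * s.1) ⊗ₜ (r.2 * t.1)) ⊗ₜ (s.2 * t.2)) =
      ∑ s ∈ legs (R : H ⊗[k] H), ∑ x ∈ legs (Coalgebra.comul (R := k) s.1),
        G (((r.1 * x.1) ⊗ₜ (r.2 * x.2)) ⊗ₜ s.2) := fun r => by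
    have := hexL hR (G ∘ₗ LinearMap.rTensor H (LinearMap.mulLeft k (r.1 ⊗ₜ[k] r.2)))
    simp only [LinearMap.comp_apply, LinearMap.rTensor_tmul, LinearMap.mulLeft_apply,
      Algebra.TensorProduct.tmul_mul_tmul] at this
    rw [← this]
    refine Finset.sum_congr rfl fun s _ => ?_
    conv_lhs => rw [← sum_legs (Coalgebra.comul (R := k) s.1)]
    simp [Finset.mul_sum, TensorProduct.sum_tmul]
  have h2 : ∀ r : H × H, ∑ s ∈ legs (R : H ⊗[k] H), ∑ t ∈ legs (R : H ⊗[k] H),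
        G (((s.1 * r.1) ⊗ₜ (t.1 * r.2)) ⊗ₜ (t.2 * s.2)) =
      ∑ s ∈ legs (R : H ⊗[k] H), ∑ x ∈ legs (Coalgebra.comul (R := k) s.1),
        G (((x.2 * r.1) ⊗ₜ (x.1 * r.2)) ⊗ₜ s.2) := fun r => by
    have := hexL hR (G ∘ₗ LinearMap.rTensor H (LinearMap.mulRight k (r.1 ⊗ₜ[k] r.2) ∘ₗ
      (TensorProduct.comm k H H).toLinearMap))
    simp only [LinearMap.comp_apply, LinearMap.rTensor_tmul, LinearMap.mulRight_apply,
      Algebra.TensorProduct.tmul_mul_tmul, LinearEquiv.coe_coe, TensorProduct.comm_tmul] at this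
    rw [Finset.sum_comm, ← this]
    refine Finset.sum_congr rfl fun s _ => ?_
    conv_lhs => rw [← sum_legs (Coalgebra.comul (R := k) s.1)]
    simp [Finset.sum_mul, TensorProduct.sum_tmul]
  simp only [h1, h2]
  rw [Finset.sum_comm]
  conv_rhs => rw [Finset.sum_comm]
  refine Finset.sum_congr rfl fun s _ => ?_
  exact qc hR (G ∘ₗ (TensorProduct.mk k (H ⊗[k] H) H).flip s.2) s.1

end IsUniversalRMatrix
end RMatrix
end BraidedDouble

namespace BraidedDouble

/-! ### Sweedler sums with linearity side goals left to `fun_prop` -/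

section Sweedler
variable {k : Type*} [Field k]

/-- Linearity of a plain function, as a predicate usable by `fun_prop`. -/
@[fun_prop]
def Lin (k : Type*) [Field k] {V W : Type*} [AddCommGroup V] [Module k V] [AddCommGroup W]
    [Module k W] (f : V → W) : Prop :=
  IsLinearMap k f

variable {V W U X Z : Type*} [AddCommGroup V] [Module k V] [AddCommGroup W] [Module k W]
  [AddCommGroup U] [Module k U] [AddCommGroup X] [Module k X] [AddCommGroup Z] [Module k Z]

namespace Lin

@[fun_prop]
theorem id' : Lin k (fun x : V => x) := ⟨fun _ _ => rfl, fun _ _ => rfl⟩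

@[fun_prop]
theorem comp {g : W → U} {f : V → W} (hg : Lin k g) (hf : Lin k f) : Lin k (fun x => g (f x)) :=
  ⟨fun x y => by rw [hf.1, hg.1], fun x y => by rw [hf.2, hg.2]⟩

@[fun_prop]
theorem linearMap (g : V →ₗ[k] W) : Lin k (fun x => g x) := ⟨map_add g, map_smul g⟩

@[fun_prop]
theorem linearMap_left {f : V → W →ₗ[k] U} (hf : Lin k f) (w : W) : Lin k (fun x => f x w) :=
  ⟨fun x y => by rw [hf.1]; rfl, fun x y => by rw [hf.2]; rfl⟩

@[fun_prop]
theorem tmul_left {f : V → W} (hf : Lin k f) (u : U) : Lin k (fun x => f x ⊗ₜ[k] u) :=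
  ⟨fun x y => by rw [hf.1, TensorProduct.add_tmul],
    fun x y => by rw [hf.2, TensorProduct.smul_tmul']⟩

@[fun_prop]
theorem tmul_right {f : V → W} (hf : Lin k f) (u : U) : Lin k (fun x => u ⊗ₜ[k] f x) :=
  ⟨fun x y => by rw [hf.1, TensorProduct.tmul_add],
    fun x y => by rw [hf.2, TensorProduct.tmul_smul]⟩

section
variable {A : Type*} [Ring A] [Algebra k A]

@[fun_prop]
theorem algHom {B : Type*} [Ring B] [Algebra k B] (g : A →ₐ[k] B) : Lin k (fun x => g x) :=
  ⟨map_add g, map_smul g⟩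

@[fun_prop]
theorem mul_left {f : V → A} (hf : Lin k f) (u : A) : Lin k (fun x => f x * u) :=
  ⟨fun x y => by rw [hf.1, add_mul], fun x y => by rw [hf.2, smul_mul_assoc]⟩

@[fun_prop]
theorem mul_right {f : V → A} (hf : Lin k f) (u : A) : Lin k (fun x => u * f x) :=
  ⟨fun x y => by rw [hf.1, mul_add], fun x y => by rw [hf.2, mul_smul_comm]⟩

variable [Module A W] [IsScalarTower k A W]

@[fun_prop]
theorem smul_left {f : V → A} (hf : Lin k f) (u : W) : Lin k (fun x => f x • u) :=
  ⟨fun x y => by rw [hf.1, add_smul], fun x y => by rw [hf.2, smul_assoc]⟩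

@[fun_prop]
theorem smul_right {f : V → W} (hf : Lin k f) (u : A) : Lin k (fun x => u • f x) :=
  ⟨fun x y => by rw [hf.1, smul_add], fun x y => by
    have := IsScalarTower.to_smulCommClass (R := k) (A := A) (M := W)
    rw [hf.2, smul_comm]⟩

end

@[fun_prop]
theorem kmul_left {f : V → k} (hf : Lin k f) (u : W) : Lin k (fun x => f x • u) :=
  ⟨fun x y => by rw [hf.1, add_smul], fun x y => by rw [hf.2, smul_assoc]⟩

@[fun_prop]
theorem kmul_right {f : V → W} (hf : Lin k f) (u : k) : Lin k (fun x => u • f x) :=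
  ⟨fun x y => by rw [hf.1, smul_add], fun x y => by rw [hf.2, smul_comm]⟩

end Lin

/-- `sw t f = ∑ f t₍₁₎ t₍₂₎`, the Sweedler sum of a function over the legs of a tensor. -/
noncomputable def sw (t : V ⊗[k] W) (f : V → W → Z) : Z := ∑ i ∈ legs t, f i.1 i.2

theorem sw_lin (G : V ⊗[k] W →ₗ[k] Z) (t : V ⊗[k] W) : sw t (fun a b => G (a ⊗ₜ b)) = G t :=
  map_legs G t

/-- A Sweedler sum depends on the chosen legs for a general `f`; for a bilinear one the choice drops
out. All substitution rules below rest on this. -/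
theorem sw_eq (t : V ⊗[k] W) (f : V → W → Z) (h1 : ∀ b, Lin k (fun a => f a b))
    (h2 : ∀ a, Lin k (fun b => f a b)) :
    sw t f = TensorProduct.lift (LinearMap.mk₂ k f (fun a a' b => (h1 b).1 a a')
      (fun c a b => (h1 b).2 c a) (fun a b b' => (h2 a).1 b b') (fun c a b => (h2 a).2 c b)) t := by
  rw [← sw_lin]; simp [sw]

theorem sw_tmul (v : V) (w : W) (f : V → W → Z) (h1 : ∀ b, Lin k (fun a => f a b))
    (h2 : ∀ a, Lin k (fun b => f a b)) : sw (v ⊗ₜ[k] w) f = f v w := by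
  rw [sw_eq _ _ h1 h2]; simp

@[fun_prop]
theorem Lin.sw_left {T : X → V ⊗[k] W} (hT : Lin k T) {f : V → W → Z}
    (h1 : ∀ b, Lin k (fun a => f a b)) (h2 : ∀ a, Lin k (fun b => f a b)) :
    Lin k (fun x => sw (T x) f) :=
  ⟨fun x y => by simp only [sw_eq _ _ h1 h2, hT.1, map_add],
    fun x y => by simp only [sw_eq _ _ h1 h2, hT.2, map_smul]⟩

@[fun_prop]
theorem Lin.sw_right (t : V ⊗[k] W) {f : X → V → W → Z} (hf : ∀ a b, Lin k (fun x => f x a b)) :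
    Lin k (fun x => sw t (f x)) :=
  ⟨fun x y => by simp only [sw, (hf _ _).1, Finset.sum_add_distrib],
    fun x y => by simp only [sw, (hf _ _).2, Finset.smul_sum]⟩

/-- Independent finite sums commute for any function, so reordering creates no linearity side goals.
-/
theorem sw_comm (s : V ⊗[k] W) (t : U ⊗[k] X) (f : V → W → U → X → Z) :
    sw s (fun a b => sw t (fun c d => f a b c d)) = sw t (fun c d => sw s (fun a b => f a b c d)) :=
  Finset.sum_comm

theorem sw_rot {V' W' : Type*} [AddCommGroup V'] [Module k V'] [AddCommGroup W'] [Module k W']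
    (s : V ⊗[k] W) (t : U ⊗[k] X) (u : V' ⊗[k] W') (f : V → W → U → X → V' → W' → Z) :
    sw s (fun a b => sw t (fun c d => sw u fun p q => f a b c d p q)) =
      sw u fun p q => sw s (fun a b => sw t (fun c d => f a b c d p q)) := by
  simp only [sw_comm t u, sw_comm s u]

theorem sw_sw (t : V ⊗[k] W) (G : V → W → U ⊗[k] X)
    (f : U → X → Z) (h1 : ∀ b, Lin k (fun a => f a b)) (h2 : ∀ a, Lin k (fun b => f a b)) :
    sw (sw t G) f = sw t (fun a b => sw (G a b) f) := by
  simp only [sw_eq _ _ h1 h2]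
  simp [sw]

theorem map_sw {F : Type*} [FunLike F Z U] [AddMonoidHomClass F Z U] (G : F) (t : V ⊗[k] W)
    (f : V → W → Z) : G (sw t f) = sw t (fun a b => G (f a b)) := map_sum _ _ _

theorem sw_tmul_left (t : V ⊗[k] W) (f : V → W → Z) (u : U) :
    sw t f ⊗ₜ[k] u = sw t (fun a b => f a b ⊗ₜ u) := TensorProduct.sum_tmul _ _ _

theorem tmul_sw (t : V ⊗[k] W) (f : V → W → Z) (u : U) :
    u ⊗ₜ[k] sw t f = sw t (fun a b => u ⊗ₜ f a b) := TensorProduct.tmul_sum _ _ _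

theorem sw_mul {A : Type*} [Ring A] (t : V ⊗[k] W) (f : V → W → A) (u : A) :
    sw t f * u = sw t (fun a b => f a b * u) := Finset.sum_mul _ _ _

theorem mul_sw {A : Type*} [Ring A] (t : V ⊗[k] W) (f : V → W → A) (u : A) :
    u * sw t f = sw t (fun a b => u * f a b) := Finset.mul_sum _ _ _

theorem kmul_sw (t : V ⊗[k] W) (f : V → W → k) (u : k) :
    u * sw t f = sw t (fun a b => u * f a b) := Finset.mul_sum _ _ _

theorem ksw_smul (t : V ⊗[k] W) (f : V → W → k) (u : Z) :
    sw t f • u = sw t (fun a b => f a b • u) := Finset.sum_smul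

theorem smul_sw {A : Type*} [Monoid A] [DistribMulAction A Z] (t : V ⊗[k] W) (f : V → W → Z)
    (u : A) : u • sw t f = sw t (fun a b => u • f a b) := Finset.smul_sum

theorem sw_congr {t : V ⊗[k] W} {f g : V → W → Z} (h : ∀ a b, f a b = g a b) : sw t f = sw t g := by
  simp only [sw, h]

theorem apply_eq_sw (G : V ⊗[k] W →ₗ[k] Z) (t : V ⊗[k] W) :
    G t = sw t (fun a b => G (a ⊗ₜ b)) := (sw_lin G t).symm

theorem eq_sw (t : V ⊗[k] W) : t = sw t (fun a b => a ⊗ₜ b) := (sum_legs t).symm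

theorem assoc_rTensor_apply (Δ : V →ₗ[k] W ⊗[k] U) (t : V ⊗[k] X) :
    TensorProduct.assoc k W U X (Δ.rTensor X t) =
      sw t fun a b => sw (Δ a) fun c d => c ⊗ₜ (d ⊗ₜ b) := by
  rw [← LinearEquiv.coe_coe, ← LinearMap.comp_apply, apply_eq_sw]
  refine sw_congr fun a b => ?_
  rw [LinearMap.comp_apply, LinearMap.rTensor_tmul, LinearEquiv.coe_coe]
  conv_lhs => rw [eq_sw (Δ a)]
  simp only [sw_tmul_left, map_sw, TensorProduct.assoc_tmul]

theorem lTensor_apply (Δ : V →ₗ[k] W ⊗[k] U) (t : X ⊗[k] V) :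
    Δ.lTensor X t = sw t fun a b => sw (Δ b) fun c d => a ⊗ₜ (c ⊗ₜ d) := by
  rw [apply_eq_sw]
  refine sw_congr fun a b => ?_
  rw [LinearMap.lTensor_tmul]
  conv_lhs => rw [eq_sw (Δ b)]
  simp only [tmul_sw]

theorem lid_rTensor_apply (ε : V →ₗ[k] k) (t : V ⊗[k] W) :
    TensorProduct.lid k W (ε.rTensor W t) = sw t fun a b => ε a • b := by
  rw [← LinearEquiv.coe_coe, ← LinearMap.comp_apply, apply_eq_sw]; rfl

theorem rid_lTensor_apply (ε : W →ₗ[k] k) (t : V ⊗[k] W) :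
    TensorProduct.rid k V (ε.lTensor V t) = sw t fun a b => ε b • a := by
  rw [← LinearEquiv.coe_coe, ← LinearMap.comp_apply, apply_eq_sw]
  exact sw_congr fun a b => by simp

/-- A coassociative coproduct in Sweedler form. -/
theorem sw_coassoc {Δ : V →ₗ[k] V ⊗[k] V}
    (hΔ : ∀ v, TensorProduct.assoc k V V V (Δ.rTensor V (Δ v)) = Δ.lTensor V (Δ v))
    (v : V) (f : V → V → V → Z) (h1 : ∀ b c, Lin k (fun a => f a b c))
    (h2 : ∀ a c, Lin k (fun b => f a b c)) (h3 : ∀ a b, Lin k (fun c => f a b c)) :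
    sw (Δ v) (fun a b => sw (Δ a) (fun c d => f c d b)) =
      sw (Δ v) (fun a b => sw (Δ b) (fun c d => f a c d)) := by
  have h2 := congrArg (fun t => sw t (fun a u => sw u (fun b c => f a b c)))
    ((assoc_rTensor_apply Δ _).symm.trans ((hΔ v).trans (lTensor_apply Δ _)))
  simpa (disch := fun_prop) only [sw_sw, sw_tmul] using h2

theorem sw_counit_left {Δ : V →ₗ[k] V ⊗[k] V} {ε : V →ₗ[k] k}
    (hΔ : ∀ v, TensorProduct.lid k V (ε.rTensor V (Δ v)) = v)
    (v : V) (f : V → Z) (h : Lin k f) : sw (Δ v) (fun a b => ε a • f b) = f v := by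
  conv_rhs => rw [← hΔ v, lid_rTensor_apply]
  simp only [sw, ← IsLinearMap.mk'_apply h, map_sum, map_smul]

theorem sw_counit_right {Δ : V →ₗ[k] V ⊗[k] V} {ε : V →ₗ[k] k}
    (hΔ : ∀ v, TensorProduct.rid k V (ε.lTensor V (Δ v)) = v)
    (v : V) (f : V → Z) (h : Lin k f) : sw (Δ v) (fun a b => ε b • f a) = f v := by
  conv_rhs => rw [← hΔ v, rid_lTensor_apply]
  simp only [sw, ← IsLinearMap.mk'_apply h, map_sum, map_smul]

/-- The linear map on a tensor product defined by a bilinear function. -/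
noncomputable def linOf (f : V → W → Z) (h1 : ∀ b, Lin k (fun a => f a b))
    (h2 : ∀ a, Lin k (fun b => f a b)) : V ⊗[k] W →ₗ[k] Z :=
  TensorProduct.lift (LinearMap.mk₂ k f (fun a a' b => (h1 b).1 a a')
      (fun c a b => (h1 b).2 c a) (fun a b b' => (h2 a).1 b b') (fun c a b => (h2 a).2 c b))

theorem linOf_tmul (f : V → W → Z) (h1 : ∀ b, Lin k (fun a => f a b))
    (h2 : ∀ a, Lin k (fun b => f a b)) (v : V) (w : W) :
    linOf f h1 h2 (v ⊗ₜ w) = f v w := by simp [linOf]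

end Sweedler

/-! ### R-matrix identities in Sweedler form -/

section RMatrix
variable {k H : Type*} [Field k] [Ring H] [HopfAlgebra k H]
variable {R : (H ⊗[k] H)ˣ} {Z : Type*} [AddCommGroup Z] [Module k Z]

theorem sw_comul_comul (h : H) (f : H → H → H → Z) (h1 : ∀ b c, Lin k (fun a => f a b c))
    (h2 : ∀ a c, Lin k (fun b => f a b c)) (h3 : ∀ a b, Lin k (fun c => f a b c)) :
    sw (Coalgebra.comul (R := k) h) (fun a b => sw (Coalgebra.comul (R := k) a)
        (fun c d => f c d b)) =
      sw (Coalgebra.comul (R := k) h) (fun a b => sw (Coalgebra.comul (R := k) b)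
        (fun c d => f a c d)) :=
  sw_coassoc (Coalgebra.coassoc_apply) h f h1 h2 h3

theorem sw_comulH_mul (h h' : H) (f : H → H → Z) (h1 : ∀ b, Lin k (fun a => f a b))
    (h2 : ∀ a, Lin k (fun b => f a b)) :
    sw (Coalgebra.comul (R := k) (h * h')) f =
      sw (Coalgebra.comul (R := k) h) fun a b => sw (Coalgebra.comul (R := k) h') fun c d =>
        f (a * c) (b * d) := by
  rw [Bialgebra.comul_mul]
  conv_lhs => rw [eq_sw (Coalgebra.comul (R := k) h), eq_sw (Coalgebra.comul (R := k) h')]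
  simp only [sw_mul, mul_sw, Algebra.TensorProduct.tmul_mul_tmul]
  simp (disch := fun_prop) only [sw_sw, sw_tmul]
  rw [sw_comm]

theorem sw_counit_comul (h : H) (f : H → Z) (hf : Lin k f) :
    sw (Coalgebra.comul (R := k) h) (fun a b => Coalgebra.counit (R := k) a • f b) = f h :=
  sw_counit_left (fun v => by rw [Coalgebra.rTensor_counit_comul]; simp) h f hf

theorem sw_comul_counit (h : H) (f : H → Z) (hf : Lin k f) :
    sw (Coalgebra.comul (R := k) h) (fun a b => Coalgebra.counit (R := k) b • f a) = f h :=
  sw_counit_right (fun v => by rw [Coalgebra.lTensor_counit_comul]; simp) h f hf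

variable (R) in
theorem sw_rev_cancel (f : H → H → Z) (h1 : ∀ b, Lin k (fun a => f a b))
    (h2 : ∀ a, Lin k (fun b => f a b)) :
    sw (revR R : H ⊗[k] H) (fun a b => sw (R : H ⊗[k] H) fun c d => f (b * c) (a * d)) =
      f 1 1 := by
  have := IsUniversalRMatrix.rev_cancel R (linOf f h1 h2)
  simp only [linOf_tmul] at this
  exact this

variable (R) in
theorem sw_cancel_rev (f : H → H → Z) (h1 : ∀ b, Lin k (fun a => f a b))
    (h2 : ∀ a, Lin k (fun b => f a b)) :
    sw (R : H ⊗[k] H) (fun c d => sw (revR R : H ⊗[k] H) fun a b => f (c * b) (d * a)) =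
      f 1 1 := by
  have := IsUniversalRMatrix.cancel_rev R (linOf f h1 h2)
  simp only [linOf_tmul] at this
  exact this

theorem sw_counit_R (hR : IsUniversalRMatrix R) (f : H → Z) (hf : Lin k f) :
    sw (R : H ⊗[k] H) (fun a b => Coalgebra.counit (R := k) a • f b) = f 1 :=
  hR.counit_left (IsLinearMap.mk' f hf)

theorem sw_R_counit (hR : IsUniversalRMatrix R) (f : H → Z) (hf : Lin k f) :
    sw (R : H ⊗[k] H) (fun a b => Coalgebra.counit (R := k) b • f a) = f 1 :=
  hR.counit_right (IsLinearMap.mk' f hf)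

theorem sw_hexL (hR : IsUniversalRMatrix R) (f : H → H → H → Z)
    (h1 : ∀ b c, Lin k (fun a => f a b c))
    (h2 : ∀ a c, Lin k (fun b => f a b c)) (h3 : ∀ a b, Lin k (fun c => f a b c)) :
    sw (R : H ⊗[k] H) (fun a b => sw (Coalgebra.comul (R := k) a) fun c d => f c d b) =
      sw (R : H ⊗[k] H) fun a b => sw (R : H ⊗[k] H) fun c d => f a c (b * d) := by
  have := hR.hexL (linOf (fun u c => sw u fun a b => f a b c) (by fun_prop) (by fun_prop))
  simp only [linOf_tmul] at this
  simp (disch := fun_prop) only [sw_tmul] at this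
  exact this

theorem sw_hexR (hR : IsUniversalRMatrix R) (f : H → H → H → Z)
    (h1 : ∀ b c, Lin k (fun a => f a b c))
    (h2 : ∀ a c, Lin k (fun b => f a b c)) (h3 : ∀ a b, Lin k (fun c => f a b c)) :
    sw (R : H ⊗[k] H) (fun a b => sw (Coalgebra.comul (R := k) b) fun c d => f a c d) =
      sw (R : H ⊗[k] H) fun a b => sw (R : H ⊗[k] H) fun c d => f (a * c) d b := by
  have := hR.hexR (linOf (fun a u => sw u fun b c => f a b c) (by fun_prop) (by fun_prop))
  simp only [linOf_tmul] at this
  simp (disch := fun_prop) only [sw_tmul] at this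
  exact this

theorem sw_qc (hR : IsUniversalRMatrix R) (h : H) (f : H → H → Z)
    (h1 : ∀ b, Lin k (fun a => f a b)) (h2 : ∀ a, Lin k (fun b => f a b)) :
    sw (R : H ⊗[k] H) (fun a b => sw (Coalgebra.comul (R := k) h) fun c d =>
        f (a * c) (b * d)) =
      sw (R : H ⊗[k] H) fun a b => sw (Coalgebra.comul (R := k) h) fun c d =>
        f (d * a) (c * b) := by
  have := hR.qc (linOf f h1 h2) h
  simp only [linOf_tmul] at this
  exact this

theorem sw_yangBaxter (hR : IsUniversalRMatrix R) (f : H → H → H → Z)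
    (h1 : ∀ b c, Lin k (fun a => f a b c))
    (h2 : ∀ a c, Lin k (fun b => f a b c)) (h3 : ∀ a b, Lin k (fun c => f a b c)) :
    sw (R : H ⊗[k] H) (fun a b => sw (R : H ⊗[k] H) fun c d => sw (R : H ⊗[k] H) fun p q =>
        f (a * c) (b * p) (d * q)) =
      sw (R : H ⊗[k] H) fun a b => sw (R : H ⊗[k] H) fun c d => sw (R : H ⊗[k] H) fun p q =>
        f (c * a) (p * b) (q * d) := by
  have := hR.yangBaxter (linOf (fun u c => sw u fun a b => f a b c) (by fun_prop) (by fun_prop))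
  simp only [linOf_tmul] at this
  simp (disch := fun_prop) only [sw_tmul] at this
  exact this

section
variable {V W : Type*}
  [AddCommGroup V] [Module k V] [Module H V] [IsScalarTower k H V]
  [AddCommGroup W] [Module k W] [Module H W] [IsScalarTower k H W]

theorem act₂_tmul_sw (x : H ⊗[k] H) (v : V) (w : W) :
    act₂ x (v ⊗ₜ[k] w) = sw x fun a b => (a • v) ⊗ₜ (b • w) := act₂_legs x v w

theorem act₂_sw (x : H ⊗[k] H) (t : V ⊗[k] W) :
    act₂ x t = sw t fun v w => sw x fun a b => (a • v) ⊗ₜ (b • w) := by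
  rw [apply_eq_sw]; simp only [act₂_tmul_sw]

variable (R) in
theorem braid_tmul_sw (v : V) (w : W) :
    braid R (v ⊗ₜ[k] w) = sw (R : H ⊗[k] H) fun a b => (b • w) ⊗ₜ[k] (a • v) :=
  braid_tmul R v w

variable (R) in
theorem braid_sw (t : V ⊗[k] W) :
    braid R t = sw t fun v w => sw (R : H ⊗[k] H) fun a b => (b • w) ⊗ₜ[k] (a • v) := by
  rw [apply_eq_sw]; simp only [braid_tmul_sw]

end
end RMatrix
end BraidedDouble

namespace BraidedDouble

/-! ### Bialgebras in H-modules and their co-opposites -/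

section BrBialg
variable {k H : Type*} [Field k] [Ring H] [HopfAlgebra k H]
variable {B : Type*} [Ring B] [Algebra k B] [Module H B] [IsScalarTower k H B]

/-- A bialgebra in `H`-modules with explicit coproduct and counit. -/
structure BrBialg (R : (H ⊗[k] H)ˣ) (Δ : B →ₗ[k] B ⊗[k] B) (ε : B →ₗ[k] k) : Prop where
  smul_mul : ∀ (h : H) (a b : B),
    h • (a * b) = sw (Coalgebra.comul (R := k) h) fun x y => (x • a) * (y • b)
  smul_one : ∀ h : H, h • (1 : B) = Coalgebra.counit (R := k) h • (1 : B)
  comul_smul : ∀ (h : H) (b : B),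
    Δ (h • b) = sw (Coalgebra.comul (R := k) h) fun x y => sw (Δ b) fun c d => (x • c) ⊗ₜ (y • d)
  counit_smul : ∀ (h : H) (b : B), ε (h • b) = Coalgebra.counit (R := k) h * ε b
  coassoc : ∀ b, TensorProduct.assoc k B B B (Δ.rTensor B (Δ b)) = Δ.lTensor B (Δ b)
  counit_left : ∀ b, TensorProduct.lid k B (ε.rTensor B (Δ b)) = b
  counit_right : ∀ b, TensorProduct.rid k B (ε.lTensor B (Δ b)) = b
  comul_mul : ∀ a b : B, Δ (a * b) = sw (Δ a) fun a₁ a₂ => sw (Δ b) fun b₁ b₂ =>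
    sw (R : H ⊗[k] H) fun r s => (a₁ * s • b₁) ⊗ₜ ((r • a₂) * b₂)
  comul_one : Δ 1 = 1 ⊗ₜ 1
  counit_mul : ∀ a b, ε (a * b) = ε a * ε b
  counit_one : ε 1 = 1

section comulTensor
variable {A : Type*} [AddCommGroup A] [Module k A] [Module H A] [IsScalarTower k H A]
  (R : (H ⊗[k] H)ˣ) (Δ : A →ₗ[k] A ⊗[k] A)

theorem comulTensor_tmul (ψ : A ⊗[k] A →ₗ[k] A ⊗[k] A) (a b : A) :
    comulTensor Δ ψ (a ⊗ₜ b) = sw (Δ a) fun a₁ a₂ => sw (Δ b) fun b₁ b₂ =>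
      sw (ψ (a₂ ⊗ₜ b₁)) fun x y => (a₁ ⊗ₜ x) ⊗ₜ (y ⊗ₜ b₂) := by
  have : ∀ s t : A ⊗[k] A, ((TensorProduct.assoc k A A (A ⊗[k] A)).symm.toLinearMap ∘ₗ
    LinearMap.lTensor A
      ((TensorProduct.assoc k A A A).toLinearMap ∘ₗ LinearMap.rTensor A ψ ∘ₗ
        (TensorProduct.assoc k A A A).symm.toLinearMap) ∘ₗ
    (TensorProduct.assoc k A A (A ⊗[k] A)).toLinearMap) (s ⊗ₜ t) =
      sw s fun a₁ a₂ => sw t fun b₁ b₂ =>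
      sw (ψ (a₂ ⊗ₜ b₁)) fun x y => (a₁ ⊗ₜ x) ⊗ₜ (y ⊗ₜ b₂) := fun s t => by
    conv_lhs => rw [eq_sw s, eq_sw t]
    simp only [sw_tmul_left, tmul_sw, map_sw]
    rw [sw_comm]
    refine sw_congr fun a₁ a₂ => sw_congr fun b₁ b₂ => ?_
    simp only [LinearMap.comp_apply, LinearEquiv.coe_coe, TensorProduct.assoc_tmul,
      LinearMap.lTensor_tmul, TensorProduct.assoc_symm_tmul, LinearMap.rTensor_tmul]
    conv_lhs => rw [eq_sw (ψ (a₂ ⊗ₜ b₁))]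
    simp only [sw_tmul_left, tmul_sw, map_sw, TensorProduct.assoc_tmul,
      TensorProduct.assoc_symm_tmul]
  rw [← this]; rfl

theorem comulTensor_braid_tmul (a b : A) :
    comulTensor Δ (braid R) (a ⊗ₜ b) = sw (Δ a) fun a₁ a₂ => sw (Δ b) fun b₁ b₂ =>
      sw (R : H ⊗[k] H) fun r s => (a₁ ⊗ₜ (s • b₁)) ⊗ₜ ((r • a₂) ⊗ₜ b₂) := by
  rw [comulTensor_tmul]
  simp only [braid_tmul_sw]
  simp (disch := fun_prop) only [sw_sw, sw_tmul]

end comulTensor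

theorem BraidedHopf.toBrBialg {R : (H ⊗[k] H)ˣ} [Coalgebra k B] (hB : BraidedHopf R B) :
    BrBialg R (Coalgebra.comul (R := k) (A := B)) Coalgebra.counit where
  smul_mul h a b := by
    have := hB.smul_mul h (a ⊗ₜ b)
    simpa only [act₂_tmul_sw, map_sw, LinearMap.mul'_apply] using this
  smul_one := hB.smul_one
  comul_smul h b := by
    rw [hB.comul_smul, act₂_sw, sw_comm]
  counit_smul := hB.counit_smul
  coassoc := Coalgebra.coassoc_apply
  counit_left b := by rw [Coalgebra.rTensor_counit_comul]; simp
  counit_right b := by rw [Coalgebra.lTensor_counit_comul]; simp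
  comul_mul a b := by
    have := LinearMap.congr_fun hB.comul_mul (a ⊗ₜ b)
    simpa only [LinearMap.comp_apply, LinearMap.mul'_apply, comulTensor_braid_tmul, map_sw,
      TensorProduct.map_tmul] using this
  comul_one := hB.comul_one
  counit_mul := hB.counit_mul
  counit_one := hB.counit_one

section
variable (R : (H ⊗[k] H)ˣ) (Δ : B →ₗ[k] B ⊗[k] B)

theorem cop_apply (b : B) : (braidInv R ∘ₗ Δ) b = sw (Δ b) fun b₁ b₂ =>
      sw (revR R : H ⊗[k] H) fun p q => (q • b₂) ⊗ₜ (p • b₁) := by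
  rw [braidInv_eq, LinearMap.comp_apply, braid_sw]

theorem sw_cop {Z : Type*} [AddCommGroup Z] [Module k Z] (b : B) (f : B → B → Z)
    (h1 : ∀ b, Lin k (fun a => f a b)) (h2 : ∀ a, Lin k (fun b => f a b)) :
    sw ((braidInv R ∘ₗ Δ) b) f = sw (Δ b) fun b₁ b₂ =>
      sw (revR R : H ⊗[k] H) fun p q => f (q • b₂) (p • b₁) := by
  rw [cop_apply]; simp (disch := fun_prop) only [sw_sw, sw_tmul]

end

namespace BrBialg
variable {R : (H ⊗[k] H)ˣ} {Δ : B →ₗ[k] B ⊗[k] B} {ε : B →ₗ[k] k} (hB : BrBialg R Δ ε)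
include hB

section sw
variable {Z : Type*} [AddCommGroup Z] [Module k Z]

theorem sw_coassoc (v : B) (f : B → B → B → Z) (h1 : ∀ b c, Lin k (fun a => f a b c))
    (h2 : ∀ a c, Lin k (fun b => f a b c)) (h3 : ∀ a b, Lin k (fun c => f a b c)) :
    sw (Δ v) (fun a b => sw (Δ a) (fun c d => f c d b)) =
      sw (Δ v) (fun a b => sw (Δ b) (fun c d => f a c d)) :=
  BraidedDouble.sw_coassoc hB.coassoc v f h1 h2 h3

theorem sw_counit_left (v : B) (f : B → Z) (hf : Lin k f) :
    sw (Δ v) (fun a b => ε a • f b) = f v :=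
  BraidedDouble.sw_counit_left hB.counit_left v f hf

theorem sw_counit_right (v : B) (f : B → Z) (hf : Lin k f) :
    sw (Δ v) (fun a b => ε b • f a) = f v :=
  BraidedDouble.sw_counit_right hB.counit_right v f hf

theorem sw_comul_smul (h : H) (b : B) (f : B → B → Z)
    (h1 : ∀ b, Lin k (fun a => f a b)) (h2 : ∀ a, Lin k (fun b => f a b)) :
    sw (Δ (h • b)) f = sw (Coalgebra.comul (R := k) h) fun x y => sw (Δ b) fun c d =>
      f (x • c) (y • d) := by
  rw [hB.comul_smul]; simp (disch := fun_prop) only [sw_sw, sw_tmul]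

theorem sw_comul_mul (a b : B) (f : B → B → Z)
    (h1 : ∀ b, Lin k (fun a => f a b)) (h2 : ∀ a, Lin k (fun b => f a b)) :
    sw (Δ (a * b)) f = sw (Δ a) fun a₁ a₂ => sw (Δ b) fun b₁ b₂ =>
      sw (R : H ⊗[k] H) fun r s => f (a₁ * s • b₁) ((r • a₂) * b₂) := by
  rw [hB.comul_mul]; simp (disch := fun_prop) only [sw_sw, sw_tmul]

end sw

/-- The co-opposite is a bialgebra for the inverse braiding. -/
theorem cop (hR : IsUniversalRMatrix R) : BrBialg (revR R) (braidInv R ∘ₗ Δ) ε := by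
  have hQ := hR.revR
  -- H-linearity of Ψ⁻¹ Δ reduces to the reversed R-matrix intertwining the coproduct of H with its
  -- opposite.
  have esmul : ∀ (h : H) (b : B), (braidInv R ∘ₗ Δ) (h • b) =
      sw (Coalgebra.comul (R := k) h) fun x y => sw ((braidInv R ∘ₗ Δ) b) fun c d =>
        (x • c) ⊗ₜ (y • d) := fun h b => by
    simp (disch := fun_prop) only [sw_cop]
    rw [cop_apply]
    simp (disch := fun_prop) only [hB.sw_comul_smul, smul_smul]
    rw [sw_comm]; conv_rhs => rw [sw_comm]
    refine sw_congr fun b₁ b₂ => ?_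
    rw [sw_comm]; conv_rhs => rw [sw_comm]
    exact sw_qc hQ h (fun u v => (v • b₂) ⊗ₜ[k] (u • b₁)) (by fun_prop) (by fun_prop)
  refine ⟨hB.smul_mul, hB.smul_one, esmul, hB.counit_smul, ?_, ?_, ?_, ?_, ?_, hB.counit_mul,
    hB.counit_one⟩
  · intro b
    rw [assoc_rTensor_apply, lTensor_apply]
    have l : ∀ c (f : B → B → B ⊗[k] (B ⊗[k] B)) (h : H), (∀ b, Lin k (fun a => f a b)) →
        (∀ a, Lin k (fun b => f a b)) → sw ((braidInv R ∘ₗ Δ) (h • c)) f =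
          sw (Coalgebra.comul (R := k) h) fun x y => sw (Δ c) fun b₁ b₂ =>
            sw (revR R : H ⊗[k] H) fun p q => f ((x * q) • b₂) ((y * p) • b₁) :=
      fun c f h h1 h2 => by
        rw [esmul]; simp (disch := fun_prop) only [sw_sw, sw_tmul, sw_cop, mul_smul]
    simp (disch := fun_prop) only [sw_cop R Δ b]
    simp (disch := fun_prop) only [l]
    simp (disch := fun_prop) only [sw_hexR hQ, sw_hexL hQ]
    simp (disch := fun_prop) only [sw_rot (revR R : H ⊗[k] H) (revR R : H ⊗[k] H) (Δ _)]
    rw [hB.sw_coassoc b (fun c₁ c₂ c₃ => sw (revR R : H ⊗[k] H) fun p q =>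
      sw (revR R : H ⊗[k] H) fun p' q' => sw (revR R : H ⊗[k] H) fun p'' q'' =>
      ((q * q') • c₃) ⊗ₜ[k] (((p * q'') • c₂) ⊗ₜ[k] ((p' * p'') • c₁))) (by fun_prop)
      (by fun_prop) (by fun_prop)]
    refine sw_congr fun b₁ b₂ => sw_congr fun c₁ c₂ => ?_
    -- Once Δ is coassociative, both sides differ only in the order of three reversed R-matrices
    -- acting on the three legs.
    rw [sw_yangBaxter hQ (fun p q r => (r • c₂) ⊗ₜ[k] ((q • c₁) ⊗ₜ[k] (p • b₁)))
      (by fun_prop) (by fun_prop) (by fun_prop), sw_rot]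
    exact sw_congr fun _ _ => sw_comm _ _ _
  · intro b
    rw [lid_rTensor_apply]
    simp (disch := fun_prop) only [sw_cop, hB.counit_smul, mul_smul]
    simp (disch := fun_prop) only [sw_R_counit hQ, one_smul, hB.sw_counit_right]
  · intro b
    rw [rid_lTensor_apply]
    simp (disch := fun_prop) only [sw_cop, hB.counit_smul, mul_smul]
    simp (disch := fun_prop) only [sw_counit_R hQ, one_smul, hB.sw_counit_left]
  · intro a b
    simp (disch := fun_prop) only [sw_cop]
    rw [cop_apply]
    simp (disch := fun_prop) only [hB.sw_comul_mul, hB.smul_mul, sw_tmul_left, tmul_sw, smul_smul]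
    conv_rhs => enter [2, a₁, a₂]; rw [sw_comm]
    refine sw_congr fun a₁ a₂ => sw_congr fun b₁ b₂ => ?_
    simp (disch := fun_prop) only [sw_hexL hQ]
    simp (disch := fun_prop) only [sw_comulH_mul]
    conv_lhs => enter [2, r, s, 2, a, b, 2, c, d]; rw [sw_comm]
    simp (disch := fun_prop) only [sw_hexR hQ]
    conv_lhs => enter [2, r, s, 2, a, b]; rw [sw_rot]
    simp (disch := fun_prop) only [sw_hexR hQ]
    simp only [sw_comm (R : H ⊗[k] H) (revR R : H ⊗[k] H), mul_assoc]
    conv_lhs =>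
      enter [2, p, q, 2, t, u, 2, x, y]
      -- The copy of R from the braided multiplicativity of Δ cancels one of the four reversed
      -- copies made by the hexagons. Of the other three, two belong to the co-opposite coproducts
      -- and one is the new braiding.
      rw [sw_rev_cancel R (fun v w => ((u * v) • a₂ * (q * y) • b₂) ⊗ₜ[k]
        ((p * t) • a₁ * (x * w) • b₁)) (by fun_prop) (by fun_prop)]
    simp only [mul_one]
    rw [sw_rot]
    conv_rhs => rw [sw_comm]; enter [2, p, q]; rw [sw_comm]
  · rw [cop_apply, hB.comul_one]
    simp (disch := fun_prop) only [sw_tmul, hB.smul_one]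
    simp only [← TensorProduct.smul_tmul' _ (1 : B)]
    rw [sw_R_counit hQ (fun p => (1 : B) ⊗ₜ[k] (Coalgebra.counit (R := k) p • (1 : B)))
      (by fun_prop)]
    simp

end BrBialg
end BrBialg
end BraidedDouble

namespace BraidedDouble
section
variable {k H : Type*} [Field k] [Ring H] [HopfAlgebra k H]

/-! ### Braided tensor squares and twisted products -/

section hexagons
variable {R : (H ⊗[k] H)ˣ} {Z : Type*} [AddCommGroup Z] [Module k Z]
variable {U X U' X' : Type*} [AddCommGroup U] [Module k U] [AddCommGroup X] [Module k X]
  [AddCommGroup U'] [Module k U'] [AddCommGroup X'] [Module k X']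

theorem sw_hexL₁ (hR : IsUniversalRMatrix R) (t : U ⊗[k] X) (f : U → X → H → H → H → Z)
    (h1 : ∀ u v b c, Lin k (fun a => f u v a b c)) (h2 : ∀ u v a c, Lin k (fun b => f u v a b c))
    (h3 : ∀ u v a b, Lin k (fun c => f u v a b c)) :
    sw (R : H ⊗[k] H) (fun a b => sw t fun u v =>
      sw (Coalgebra.comul (R := k) a) fun c d => f u v c d b) =
      sw t fun u v => sw (R : H ⊗[k] H) fun a b => sw (R : H ⊗[k] H) fun c d =>
        f u v a c (b * d) := by
  rw [sw_comm]; simp (disch := fun_prop) only [sw_hexL hR]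

theorem sw_hexR₁ (hR : IsUniversalRMatrix R) (t : U ⊗[k] X) (f : U → X → H → H → H → Z)
    (h1 : ∀ u v b c, Lin k (fun a => f u v a b c)) (h2 : ∀ u v a c, Lin k (fun b => f u v a b c))
    (h3 : ∀ u v a b, Lin k (fun c => f u v a b c)) :
    sw (R : H ⊗[k] H) (fun a b => sw t fun u v =>
      sw (Coalgebra.comul (R := k) b) fun c d => f u v a c d) =
      sw t fun u v => sw (R : H ⊗[k] H) fun a b => sw (R : H ⊗[k] H) fun c d =>
        f u v (a * c) d b := by
  rw [sw_comm]; simp (disch := fun_prop) only [sw_hexR hR]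

theorem sw_hexR₂ (hR : IsUniversalRMatrix R) (t : U ⊗[k] X) (t' : U → X → U' ⊗[k] X')
    (f : U → X → U' → X' → H → H → H → Z)
    (h1 : ∀ u v x y b c, Lin k (fun a => f u v x y a b c))
    (h2 : ∀ u v x y a c, Lin k (fun b => f u v x y a b c))
    (h3 : ∀ u v x y a b, Lin k (fun c => f u v x y a b c)) :
    sw (R : H ⊗[k] H) (fun a b => sw t fun u v => sw (t' u v) fun x y =>
      sw (Coalgebra.comul (R := k) b) fun c d => f u v x y a c d) =
      sw t fun u v => sw (t' u v) fun x y => sw (R : H ⊗[k] H) fun a b =>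
        sw (R : H ⊗[k] H) fun c d => f u v x y (a * c) d b := by
  rw [sw_comm]; simp (disch := fun_prop) only [sw_hexR₁ hR]

end hexagons

theorem IsInvariant₂.sw {V W : Type*}
    [AddCommGroup V] [Module k V] [Module H V] [IsScalarTower k H V]
    [AddCommGroup W] [Module k W] [Module H W] [IsScalarTower k H W] {f : V ⊗[k] W →ₗ[k] k}
    (hf : IsInvariant₂ H f) (h : H) (v : V) (w : W) :
    sw (Coalgebra.comul (R := k) h) (fun x y => f ((x • v) ⊗ₜ (y • w))) =
      Coalgebra.counit (R := k) h * f (v ⊗ₜ w) := by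
  rw [← hf, act₂_tmul_sw, map_sw]

namespace BrBialg
variable {B : Type*} [Ring B] [Algebra k B] [Module H B] [IsScalarTower k H B]
variable {R : (H ⊗[k] H)ˣ} {Δ : B →ₗ[k] B ⊗[k] B} {ε : B →ₗ[k] k} 
variable {Z : Type*} [AddCommGroup Z] [Module k Z]

variable (R Δ) in
theorem sw_delta (a b : B) (f : B ⊗[k] B → B ⊗[k] B → Z) (h1 : ∀ b, Lin k (fun a => f a b))
    (h2 : ∀ a, Lin k (fun b => f a b)) :
    sw (comulTensor Δ (braid R) (a ⊗ₜ b)) f = sw (Δ a) fun a₁ a₂ => sw (Δ b) fun b₁ b₂ =>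
      sw (R : H ⊗[k] H) fun r s => f (a₁ ⊗ₜ (s • b₁)) ((r • a₂) ⊗ₜ b₂) := by
  rw [comulTensor_braid_tmul]
  simp (disch := fun_prop) only [sw_sw, sw_tmul]

theorem twistMul_eq_sw (Δ : B →ₗ[k] B ⊗[k] B) (ψ : B ⊗[k] B →ₗ[k] B ⊗[k] B)
    (σ : B ⊗[k] B →ₗ[k] k) (x : B ⊗[k] B) :
    twistMul Δ ψ σ x = sw (comulTensor Δ ψ x) fun p q => σ q • LinearMap.mul' k B p := by
  rw [twistMul, LinearMap.comp_apply, LinearMap.comp_apply, ← LinearMap.comp_apply, apply_eq_sw]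
  exact sw_congr fun a b => by simp

theorem conv_eq_sw {X : Type*} [AddCommGroup X] [Module k X]
    (Δ : X →ₗ[k] X ⊗[k] X) (f g : X →ₗ[k] k) (x : X) :
    conv Δ f g x = sw (Δ x) fun p q => f p * g q := by
  rw [conv, LinearMap.comp_apply, LinearMap.comp_apply, ← LinearMap.comp_apply, apply_eq_sw]
  exact sw_congr fun a b => by simp

variable (R Δ) in
theorem twistMul_tmul (σ : B ⊗[k] B →ₗ[k] k) (a b : B) :
    twistMul Δ (braid R) σ (a ⊗ₜ b) = sw (Δ a) fun a₁ a₂ => sw (Δ b) fun b₁ b₂ =>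
      sw (R : H ⊗[k] H) fun r s => σ ((r • a₂) ⊗ₜ b₂) • (a₁ * s • b₁) := by
  rw [twistMul_eq_sw]
  simp (disch := fun_prop) only [sw_delta, LinearMap.mul'_apply]

variable (hB : BrBialg R Δ ε) (hR : IsUniversalRMatrix R)
include hB 

/-- The hexagons let the braiding pass each coproduct, so the braided tensor square of a coalgebra
is again a coalgebra. -/
theorem delta_coassoc (hR : IsUniversalRMatrix R) (x : B ⊗[k] B) :
    TensorProduct.assoc k _ _ _ ((comulTensor Δ (braid R)).rTensor (B ⊗[k] B)
      (comulTensor Δ (braid R) x)) =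
    (comulTensor Δ (braid R)).lTensor (B ⊗[k] B) (comulTensor Δ (braid R) x) := by
  induction x using TensorProduct.induction_on with
  | zero => simp
  | add x y hx hy => simp only [map_add, hx, hy]
  | tmul a b =>
    rw [assoc_rTensor_apply, lTensor_apply]
    simp (disch := fun_prop) only [sw_delta, hB.sw_comul_smul, smul_smul]
    simp (disch := fun_prop) only [sw_hexL hR, sw_hexR hR, sw_hexL₁ hR, sw_hexR₁ hR, sw_hexR₂ hR]
    conv_lhs =>
      enter [2, a₁, a₂]; rw [sw_comm]; enter [2, u, v, 2, b₁, b₂]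
      rw [sw_rot (R : H ⊗[k] H) (R : H ⊗[k] H) (Δ b₁)]
    conv_rhs =>
      enter [2, a₁, a₂, 2, b₁, b₂]; rw [sw_rot (R : H ⊗[k] H) (R : H ⊗[k] H) (Δ a₂)]
      enter [2, c, d]; rw [sw_rot (R : H ⊗[k] H) (R : H ⊗[k] H) (Δ b₂)]
    conv_rhs => enter [2, a₁, a₂]; rw [sw_comm]
    simp (disch := fun_prop) only [hB.sw_coassoc]
    refine sw_congr fun a₁ a₂ => sw_congr fun a₃ a₄ => sw_congr fun b₁ b₂ => sw_congr fun b₃ b₄ => ?_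
    rw [sw_rot]
    exact sw_congr fun _ _ => sw_comm _ _ _

theorem sw_delta_coassoc (hR : IsUniversalRMatrix R) (x : B ⊗[k] B)
    (f : B ⊗[k] B → B ⊗[k] B → B ⊗[k] B → Z) (h1 : ∀ b c, Lin k (fun a => f a b c))
    (h2 : ∀ a c, Lin k (fun b => f a b c)) (h3 : ∀ a b, Lin k (fun c => f a b c)) :
    sw (comulTensor Δ (braid R) x)
      (fun a b => sw (comulTensor Δ (braid R) a) (fun c d => f c d b)) =
      sw (comulTensor Δ (braid R) x)
      (fun a b => sw (comulTensor Δ (braid R) b) (fun c d => f a c d)) :=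
  BraidedDouble.sw_coassoc (hB.delta_coassoc hR) x f h1 h2 h3

theorem comul_mul' (x : B ⊗[k] B) : Δ (LinearMap.mul' k B x) =
    sw (comulTensor Δ (braid R) x) fun p q => LinearMap.mul' k B p ⊗ₜ LinearMap.mul' k B q := by
  induction x using TensorProduct.induction_on with
  | zero =>
    rw [map_zero, map_zero, map_zero]
    exact (IsLinearMap.map_zero (by fun_prop : Lin k fun t => sw t fun p q =>
      LinearMap.mul' k B p ⊗ₜ LinearMap.mul' k B q)).symm
  | add x y hx hy =>
    rw [map_add, map_add, hx, hy, map_add]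
    exact ((by fun_prop : Lin k fun t => sw t fun p q =>
      LinearMap.mul' k B p ⊗ₜ LinearMap.mul' k B q).1 _ _).symm
  | tmul a b =>
    simp (disch := fun_prop) only [sw_delta, LinearMap.mul'_apply, hB.comul_mul]

/-- In a twisted product σ consumes the last leg of Δ_{B ⊗ B}, so coassociativity leaves the first
leg with the ordinary product. A pairing that sees only the first leg cannot notice the twist; this
is what makes the cross relation compatible with twisting. -/
theorem comul_twistMul (hR : IsUniversalRMatrix R) (σ : B ⊗[k] B →ₗ[k] k) (x : B ⊗[k] B) :
    Δ (twistMul Δ (braid R) σ x) = sw (comulTensor Δ (braid R) x) fun p q =>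
      LinearMap.mul' k B p ⊗ₜ twistMul Δ (braid R) σ q := by
  simp only [twistMul_eq_sw, map_sw, map_smul, hB.comul_mul', tmul_sw, smul_sw]
  rw [hB.sw_delta_coassoc hR x (fun p q r => σ r • LinearMap.mul' k B p ⊗ₜ[k] LinearMap.mul' k B q)
    (by fun_prop) (by fun_prop) (by fun_prop)]
  simp only [TensorProduct.tmul_smul]

/-- The counit kills the ordinary product of the first legs. The cocycle can thus be read off from
the twisted algebra, which is how σ and τ reappear in the formula for σ ∘ τ. -/
theorem counit_twistMul (hR : IsUniversalRMatrix R) (σ : B ⊗[k] B →ₗ[k] k) (a b : B) :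
    ε (twistMul Δ (braid R) σ (a ⊗ₜ b)) = σ (a ⊗ₜ b) := by
  rw [twistMul_tmul]
  simp only [map_sw, map_smul, mul_assoc, hB.smul_mul, hB.counit_mul, hB.counit_smul]
  have : ∀ (x y z w : k), x • (y * (z * w)) = z • y • w • x := fun x y z w => by
    simp only [smul_eq_mul]; ring
  simp (disch := fun_prop) only [this, sw_R_counit hR]
  simp (disch := fun_prop) only [smul_sw, sw_R_counit hR, one_smul, hB.sw_counit_left, ← smul_sw]

/-- Quasi-cocommutativity moves the middle part of `h` past the R-matrix of the braiding. Two
neighbouring parts of `h` then act diagonally on the arguments of σ and disappear by invariance. -/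
theorem smul_twistMul (hR : IsUniversalRMatrix R) {σ : B ⊗[k] B →ₗ[k] k} (hσ : IsInvariant₂ H σ)
    (h : H) (a b : B) :
    h • twistMul Δ (braid R) σ (a ⊗ₜ b) = sw (Coalgebra.comul (R := k) h) fun x y =>
      twistMul Δ (braid R) σ ((x • a) ⊗ₜ (y • b)) := by
  simp only [twistMul_tmul]
  simp (disch := fun_prop) only [hB.sw_comul_smul, smul_sw, smul_comm h (_ : k), hB.smul_mul, smul_smul]
  simp only [sw_comm _ (Δ b)]
  simp only [sw_comm _ (Δ a)]
  refine sw_congr fun a₁ a₂ => sw_congr fun b₁ b₂ => ?_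
  simp (disch := fun_prop) only [sw_comul_comul]
  conv_rhs =>
    enter [2, p, q]
    rw [← sw_comul_comul q (fun c e d => sw (R : H ⊗[k] H) fun r s =>
      σ (((r * c) • a₂) ⊗ₜ[k] (d • b₂)) • (p • a₁ * (s * e) • b₁)) (by fun_prop) (by fun_prop)
      (by fun_prop)]
    enter [2, e, d]
    rw [sw_comm, sw_qc hR e (fun r s => σ ((r • a₂) ⊗ₜ[k] (d • b₂)) • (p • a₁ * s • b₁))
      (by fun_prop) (by fun_prop), sw_comm]
  simp (disch := fun_prop) only [sw_comul_comul]
  conv_rhs =>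
    rw [← sw_comul_comul h (fun p c q => sw (Coalgebra.comul (R := k) q) fun x y =>
      sw (R : H ⊗[k] H) fun r s =>
      σ (((x * r) • a₂) ⊗ₜ[k] (y • b₂)) • (p • a₁ * (c * s) • b₁)) (by fun_prop) (by fun_prop)
      (by fun_prop)]
    enter [2, p, q, 2, c, d]
    rw [sw_comm]
    simp only [mul_smul, ← ksw_smul, hσ.sw]
  simp only [← smul_sw]
  rw [sw_comul_counit h (fun p => sw (Coalgebra.comul (R := k) p) fun c d =>
      sw (R : H ⊗[k] H) fun r s => σ ((r • a₂) ⊗ₜ[k] b₂) • (c • a₁ * d • s • b₁)) (by fun_prop)]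
  rw [sw_comm]
  simp only [mul_smul, smul_sw]

/-- Colinearity and H-linearity of the twisted product bring both bracketings to an ordinary triple
product of first legs, weighted by one or the other side of the cocycle identity on the second legs.
-/
theorem twistMul_assoc (hR : IsUniversalRMatrix R) {σ : B ⊗[k] B →ₗ[k] k}
    (hσ : IsTwoCocycle H Δ ε (braid R) σ) (a b c : B) :
    twistMul Δ (braid R) σ (a ⊗ₜ twistMul Δ (braid R) σ (b ⊗ₜ c)) =
      twistMul Δ (braid R) σ (twistMul Δ (braid R) σ (a ⊗ₜ b) ⊗ₜ c) := by
  rw [twistMul_tmul R Δ σ a, twistMul_tmul R Δ σ (twistMul _ _ _ _) c]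
  simp only [hB.comul_twistMul hR]
  simp (disch := fun_prop) only [sw_sw, sw_tmul, sw_delta]
  simp (disch := fun_prop) only [hB.smul_twistMul hR hσ.invariant, LinearMap.mul'_apply, hB.smul_mul, mul_sw, smul_sw, map_sw, sw_tmul_left, ksw_smul]
  simp (disch := fun_prop) only [sw_hexL hR, sw_hexR hR, hσ.cocycle, smul_smul, mul_assoc]
  refine sw_congr fun a₁ a₂ => sw_congr fun b₁ b₂ => ?_
  conv_rhs => rw [sw_comm]
  refine sw_congr fun c₁ c₂ => ?_
  rw [sw_rot]
  exact sw_congr fun _ _ => sw_comm _ _ _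

theorem twistMul_one_left (hR : IsUniversalRMatrix R) {σ : B ⊗[k] B →ₗ[k] k}
    (h1 : ∀ b, σ (1 ⊗ₜ b) = ε b) (b : B) : twistMul Δ (braid R) σ (1 ⊗ₜ b) = b := by
  rw [twistMul_tmul, hB.comul_one]
  simp (disch := fun_prop) only [sw_tmul, hB.smul_one, one_mul]
  simp only [← TensorProduct.smul_tmul' _ (1 : B), map_smul, h1, smul_eq_mul, mul_smul]
  simp (disch := fun_prop) only [sw_counit_R hR, one_smul, hB.sw_counit_right]

theorem twistMul_one_right (hR : IsUniversalRMatrix R) {σ : B ⊗[k] B →ₗ[k] k}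
    (h1 : ∀ b, σ (b ⊗ₜ 1) = ε b) (b : B) : twistMul Δ (braid R) σ (b ⊗ₜ 1) = b := by
  rw [twistMul_tmul, hB.comul_one]
  simp (disch := fun_prop) only [sw_tmul, hB.smul_one, h1, hB.counit_smul, mul_smul,
    mul_smul_comm, mul_one]
  simp (disch := fun_prop) only [sw_counit_R hR, one_smul, hB.sw_counit_right, Bialgebra.counit_one]

end BrBialg
end
end BraidedDouble

/-! ### Covariant maps and bosonised coproducts -/

namespace BraidedDouble
section
variable {k H : Type*} [Field k] [Ring H] [HopfAlgebra k H]

/-- A product on `B` that is `H`-linear and a left comodule map, such as a twisted product. -/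
structure ColinearMul {B : Type*} [Ring B] [Algebra k B] [Module H B] [IsScalarTower k H B]
    (R : (H ⊗[k] H)ˣ) (Δ : B →ₗ[k] B ⊗[k] B) (m : B ⊗[k] B →ₗ[k] B) : Prop where
  smul : ∀ (h : H) (a b : B), h • m (a ⊗ₜ b) =
    sw (Coalgebra.comul (R := k) h) fun x y => m ((x • a) ⊗ₜ (y • b))
  comul : ∀ a b : B, Δ (m (a ⊗ₜ b)) = sw (Δ a) fun a₁ a₂ => sw (Δ b) fun b₁ b₂ =>
    sw (R : H ⊗[k] H) fun r s => (a₁ * s • b₁) ⊗ₜ m ((r • a₂) ⊗ₜ b₂)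

namespace BrBialg
variable {B : Type*} [Ring B] [Algebra k B] [Module H B] [IsScalarTower k H B]
variable {R : (H ⊗[k] H)ˣ} {Δ : B →ₗ[k] B ⊗[k] B} {ε : B →ₗ[k] k} (hB : BrBialg R Δ ε)
include hB

theorem colinearMul_mul' : ColinearMul R Δ (LinearMap.mul' k B) :=
  ⟨hB.smul_mul, hB.comul_mul⟩

theorem colinearMul_twistMul (hR : IsUniversalRMatrix R) {σ : B ⊗[k] B →ₗ[k] k}
    (hσ : IsInvariant₂ H σ) : ColinearMul R Δ (twistMul Δ (braid R) σ) where
  smul := hB.smul_twistMul hR hσ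
  comul a b := by
    rw [hB.comul_twistMul hR]
    simp (disch := fun_prop) only [sw_delta, LinearMap.mul'_apply]

end BrBialg

section Half
variable {V : Type*} [AddCommGroup V] [Module k V] [Module H V] [IsScalarTower k H V]
variable {X Y : Type*} [Ring X] [Algebra k X] [Ring Y] [Algebra k Y]

/-- `ι(h) j(v) = j(h₍₁₎ ▷ v) ι(h₍₂₎)`. -/
def Cov (ι : H →ₐ[k] X) (j : V →ₗ[k] X) : Prop :=
  ∀ h v, ι h * j v = sw (Coalgebra.comul (R := k) h) fun x y => j (x • v) * ι y

/-- The diagonal map `H → X ⊗ Y`. -/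
noncomputable def diag (ι : H →ₐ[k] X) (ι' : H →ₐ[k] Y) : H →ₐ[k] X ⊗[k] Y :=
  (Algebra.TensorProduct.map ι ι').comp (Bialgebra.comulAlgHom k H)

theorem diag_apply (ι : H →ₐ[k] X) (ι' : H →ₐ[k] Y) (h : H) :
    diag ι ι' h = sw (Coalgebra.comul (R := k) h) fun x y => ι x ⊗ₜ ι' y := by
  rw [diag, AlgHom.comp_apply, Bialgebra.comulAlgHom_apply]
  conv_lhs => rw [eq_sw (Coalgebra.comul (R := k) h), map_sw]
  rfl

variable (R : (H ⊗[k] H)ˣ)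

/-- `v ↦ R⁽²⁾ ⊗ (R⁽¹⁾ ▷ v)` in `X ⊗ Y`. -/
noncomputable def twin (ι : H →ₐ[k] X) (j : V →ₗ[k] Y) (v : V) : X ⊗[k] Y :=
  sw (R : H ⊗[k] H) fun r s => ι s ⊗ₜ j (r • v)

@[fun_prop]
theorem Lin.twin {W : Type*} [AddCommGroup W] [Module k W] (ι : H →ₐ[k] X) (j : V →ₗ[k] Y)
    {f : W → V} (hf : Lin k f) : Lin k fun w => BraidedDouble.twin R ι j (f w) := by
  unfold BraidedDouble.twin; fun_prop

/-- `b ↦ b₍₁₎ R⁽²⁾ ⊗ (R⁽¹⁾ ▷ b₍₂₎)` in `X ⊗ Y`. -/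
noncomputable def bos (Δ : V →ₗ[k] V ⊗[k] V) (ι : H →ₐ[k] X) (jX : V →ₗ[k] X) (jY : V →ₗ[k] Y) :
    V →ₗ[k] X ⊗[k] Y :=
  IsLinearMap.mk' (fun b => sw (Δ b) fun b₁ b₂ => (jX b₁ ⊗ₜ 1) * twin R ι jY b₂)
    (by have : Lin k (fun b => sw (Δ b) fun b₁ b₂ => (jX b₁ ⊗ₜ 1) * twin R ι jY b₂) := by fun_prop
        exact this)

variable {R}
variable {Δ : V →ₗ[k] V ⊗[k] V} {ι : H →ₐ[k] X} {jX : V →ₗ[k] X} {jY : V →ₗ[k] Y} {ι' : H →ₐ[k] Y}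

theorem bos_apply (b : V) : bos R Δ ι jX jY b =
    sw (Δ b) fun b₁ b₂ => (jX b₁ ⊗ₜ 1) * twin R ι jY b₂ := rfl

theorem bos_eq_sw (b : V) : bos R Δ ι jX jY b = sw (Δ b) fun b₁ b₂ =>
    sw (R : H ⊗[k] H) fun r s => (jX b₁ * ι s) ⊗ₜ jY (r • b₂) := by
  simp only [bos_apply, twin, mul_sw, Algebra.TensorProduct.tmul_mul_tmul, one_mul]

theorem Cov.diag_mul_left (hX : Cov ι jX) (h : H) (v : V) :
    diag ι ι' h * (jX v ⊗ₜ 1) =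
      sw (Coalgebra.comul (R := k) h) fun x y => (jX (x • v) ⊗ₜ 1) * diag ι ι' y := by
  simp only [diag_apply, sw_mul, mul_sw, Algebra.TensorProduct.tmul_mul_tmul, one_mul, mul_one,
    hX _ _, sw_tmul_left]
  exact sw_comul_comul h (fun a b c => (jX (a • v) * ι b) ⊗ₜ ι' c) (by fun_prop) (by fun_prop)
    (by fun_prop)

/-- Diagonal elements of H pass `twin` because the R-matrix hidden in it satisfies R Δ = Δᵒᵖ R. -/
theorem Cov.diag_mul_twin (hR : IsUniversalRMatrix R) (hY : Cov ι' jY) (h : H) (v : V) :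
    diag ι ι' h * twin R ι jY v =
      sw (Coalgebra.comul (R := k) h) fun x y => twin R ι jY (x • v) * diag ι ι' y := by
  simp only [diag_apply, twin, sw_mul, mul_sw, Algebra.TensorProduct.tmul_mul_tmul,
    hY _ _, tmul_sw, ← map_mul, smul_smul]
  rw [sw_comm]
  conv_lhs =>
    enter [2, a, b]; rw [sw_comm]
  rw [← sw_comul_comul h (fun a c d => sw (R : H ⊗[k] H) fun r s =>
    ι (a * s) ⊗ₜ (jY ((c * r) • v) * ι' d)) (by fun_prop) (by fun_prop) (by fun_prop)]
  conv_lhs =>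
    enter [2, a, b]; rw [sw_comm]
    rw [← sw_qc hR a (fun r s => ι s ⊗ₜ (jY (r • v) * ι' b)) (by fun_prop) (by fun_prop), sw_comm]
  rw [sw_comul_comul h (fun c d b => sw (R : H ⊗[k] H) fun r s =>
    ι (s * d) ⊗ₜ (jY ((r * c) • v) * ι' b)) (by fun_prop) (by fun_prop) (by fun_prop)]

/-- The coproduct is a morphism of `H`-modules. -/
def ComulSMul (Δ : V →ₗ[k] V ⊗[k] V) : Prop := ∀ (h : H) (b : V),
  Δ (h • b) = sw (Coalgebra.comul (R := k) h) fun x y => sw (Δ b) fun c d => (x • c) ⊗ₜ (y • d)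

theorem Cov.bos (hR : IsUniversalRMatrix R) (hΔ : ComulSMul (H := H) Δ)
    (hX : Cov ι jX) (hY : Cov ι' jY) : Cov (diag ι ι') (bos R Δ ι jX jY) := by
  intro h v
  simp only [bos_apply, hΔ _ _]
  simp (disch := fun_prop) only [sw_sw, sw_tmul, mul_sw, sw_mul, ← mul_assoc, hX.diag_mul_left]
  simp only [mul_assoc, hY.diag_mul_twin hR]
  simp only [mul_sw]
  rw [sw_comm]
  simp only [sw_comm _ (Δ v)]
  refine sw_congr fun _ _ => ?_
  exact (sw_comul_comul h (fun a b c => (jX (a • _) ⊗ₜ[k] (1 : Y)) * (twin R ι jY (b • _) * diag ι ι' c))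
    (by fun_prop) (by fun_prop) (by fun_prop)).symm

/-- Moving the R-leg in X past `jX v` splits that leg by a coproduct. The hexagon turns this into
two copies of R, one restoring `twin` and the other braiding `w` with `v`. -/
theorem Cov.twin_mul (hR : IsUniversalRMatrix R) (hX : Cov ι jX) (w v : V) :
    twin R ι jY w * (jX v ⊗ₜ 1) =
      sw (R : H ⊗[k] H) fun r s => (jX (s • v) ⊗ₜ 1) * twin R ι jY (r • w) := by
  simp only [twin, sw_mul, mul_sw, Algebra.TensorProduct.tmul_mul_tmul, one_mul, mul_one, hX _ _,
    sw_tmul_left, smul_smul]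
  rw [sw_hexR hR (fun a b c => (jX (b • v) * ι c) ⊗ₜ jY (a • w)) (by fun_prop) (by fun_prop)
    (by fun_prop), sw_comm]

end Half

section
variable {B : Type*} [Ring B] [Algebra k B] [Module H B] [IsScalarTower k H B]
variable {X Y : Type*} [Ring X] [Algebra k X] [Ring Y] [Algebra k Y]

/-- A covariant map that transports the product `m` to that of `X`. -/
structure Half (m : B ⊗[k] B →ₗ[k] B) (ι : H →ₐ[k] X) (j : B →ₗ[k] X) : Prop where
  cov : Cov ι j
  mul : ∀ b b', j b * j b' = j (m (b ⊗ₜ b'))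
  one : j 1 = 1

variable {R : (H ⊗[k] H)ˣ} {Δ : B →ₗ[k] B ⊗[k] B} {ε : B →ₗ[k] k} {m : B ⊗[k] B →ₗ[k] B}
  {ι : H →ₐ[k] X} {jX : B →ₗ[k] X} {jY : B →ₗ[k] Y} {ι' : H →ₐ[k] Y}

/-- The exchange rule `Cov.twin_mul` produces exactly the braiding in the coproduct of a product.
The first factor carries the ordinary product and the second an arbitrary colinear `m`, so one
statement serves the coproduct of the double and its coaction on the twisted double. -/
theorem Half.bos (hB : BrBialg R Δ ε) (hR : IsUniversalRMatrix R) (hm : ColinearMul R Δ m)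
    (hX : Half (LinearMap.mul' k B) ι jX) (hY : Half m ι' jY) :
    Half m (diag ι ι') (bos R Δ ι jX jY) where
  cov := hX.cov.bos hR hB.comul_smul hY.cov
  mul b b' := by
    -- `twin` is multiplicative by H-linearity of `m` and the hexagon for (Δ ⊗ id) R.
    have e : ∀ v w, twin R ι jY v * twin R ι jY w = twin R ι jY (m (v ⊗ₜ w)) := fun v w => by
      simp only [twin, sw_mul, mul_sw, Algebra.TensorProduct.tmul_mul_tmul, hY.mul, ← map_mul,
        hm.smul, map_sw, tmul_sw]
      rw [sw_hexL hR (fun a b c => ι c ⊗ₜ jY (m ((a • v) ⊗ₜ (b • w)))) (by fun_prop) (by fun_prop)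
        (by fun_prop)]
      exact sw_comm _ _ _
    have e' : ∀ v w : B, (jX v ⊗ₜ[k] (1 : Y)) * (jX w ⊗ₜ 1) = jX (v * w) ⊗ₜ 1 := fun v w => by
      rw [Algebra.TensorProduct.tmul_mul_tmul, hX.mul, LinearMap.mul'_apply, one_mul]
    simp only [bos_apply, hm.comul]
    simp (disch := fun_prop) only [sw_sw, sw_tmul, ← e, ← e', sw_mul, mul_sw]
    rw [sw_comm]
    refine sw_congr fun _ _ => sw_congr fun _ _ => ?_
    simp only [mul_assoc]
    simp only [← mul_assoc (twin R ι jY _) (jX _ ⊗ₜ[k] (1 : Y)), hX.cov.twin_mul hR]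
    simp only [mul_assoc, mul_sw, sw_mul]
  one := by
    rw [bos_apply, hB.comul_one]
    simp (disch := fun_prop) only [sw_tmul, twin, hX.one, hY.one, hB.smul_one, map_smul,
      TensorProduct.tmul_smul, sw_counit_R hR, map_one]
    rw [← Algebra.TensorProduct.one_def, one_mul]

end
end
end BraidedDouble

/-! ### Contractions with the pairing and the product `star` -/

namespace BraidedDouble
section
variable {k H : Type*} [Field k] [Ring H] [HopfAlgebra k H]
variable {B C : Type*}
  [Ring B] [Algebra k B] [Module H B] [IsScalarTower k H B]
  [Ring C] [Algebra k C] [Module H C] [IsScalarTower k H C]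
variable {X Y Z : Type*} [Ring X] [Algebra k X] [Ring Y] [Algebra k Y]
  [AddCommGroup Z] [Module k Z]

section star
variable (R : (H ⊗[k] H)ˣ) (ΔC : C →ₗ[k] C ⊗[k] C) (ΔB : B →ₗ[k] B ⊗[k] B)

/-- `(F ⋆ G)(c, b) = R⁻⁽¹⁾ F(c₍₂₎, b₍₁₎) R⁽²⁾ ⊗ G(R⁻⁽²⁾ ▷ c₍₁₎, R⁽¹⁾ ▷ b₍₂₎)`. -/
noncomputable def star (ι : H →ₐ[k] X) (F : C → B → X) (G : C → B → Y) (c : C) (b : B) :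
    X ⊗[k] Y :=
  sw (ΔC c) fun c₁ c₂ => sw (ΔB b) fun b₁ b₂ => sw (revR R : H ⊗[k] H) fun p q =>
    sw (R : H ⊗[k] H) fun r s => (ι q * F c₂ b₁ * ι s) ⊗ₜ G (p • c₁) (r • b₂)

/-- `ev(c₍₂₎, b₍₁₎) G(c₍₁₎, b₍₂₎)`. -/
noncomputable def evL (ev : C ⊗[k] B →ₗ[k] k) (G : C → B → X) (c : C) (b : B) : X :=
  sw (ΔC c) fun c₁ c₂ => sw (ΔB b) fun b₁ b₂ => ev (c₂ ⊗ₜ b₁) • G c₁ b₂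

/-- `R⁻⁽¹⁾ F(c₍₂₎, b₍₁₎) R⁽²⁾ ev(R⁻⁽²⁾ ▷ c₍₁₎, R⁽¹⁾ ▷ b₍₂₎)`. -/
noncomputable def evR (ev : C ⊗[k] B →ₗ[k] k) (ι : H →ₐ[k] X) (F : C → B → X) (c : C) (b : B) : X :=
  sw (ΔC c) fun c₁ c₂ => sw (ΔB b) fun b₁ b₂ => sw (revR R : H ⊗[k] H) fun p q =>
    sw (R : H ⊗[k] H) fun r s => ev ((p • c₁) ⊗ₜ (r • b₂)) • (ι q * F c₂ b₁ * ι s)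

/-- `(R⁻⁽¹⁾ ▷ b) (R⁻⁽²⁾ ▷ c)`. -/
noncomputable def revProd (jB : B →ₗ[k] X) (jC : C →ₗ[k] X) (c : C) (b : B) : X :=
  sw (revR R : H ⊗[k] H) fun p q => jB (q • b) * jC (p • c)

end star

variable {R : (H ⊗[k] H)ˣ} {ΔC : C →ₗ[k] C ⊗[k] C} {εC : C →ₗ[k] k}
  {ΔB : B →ₗ[k] B ⊗[k] B} {εB : B →ₗ[k] k}
variable (hC : BrBialg R ΔC εC) (hB : BrBialg R ΔB εB)
include hC hB

section
variable {F : C → B → X} {G : C → B → Y} {ι : H →ₐ[k] X} {ι' : H →ₐ[k] Y}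
  (ev f : C ⊗[k] B →ₗ[k] k)

/-- In `evL` the pairing takes the last leg of `c` and the first of `b`, the same end from which
`star` feeds its first factor. Coassociativity suffices. -/
theorem evL_star (hF1 : ∀ b, Lin k (fun c => F c b)) (hF2 : ∀ c, Lin k (fun b => F c b))
    (hG1 : ∀ b, Lin k (fun c => G c b)) (hG2 : ∀ c, Lin k (fun b => G c b)) (c : C) (b : B) :
    evL ΔC ΔB ev (star R ΔC ΔB ι F G) c b = star R ΔC ΔB ι (evL ΔC ΔB ev F) G c b := by
  unfold evL star
  simp only [smul_sw, sw_mul, mul_sw, sw_tmul_left, TensorProduct.smul_tmul', smul_mul_assoc,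
    mul_smul_comm]
  simp only [sw_comm (R : H ⊗[k] H) (ΔC _), sw_comm (R : H ⊗[k] H) (ΔB _),
    sw_comm (revR R : H ⊗[k] H) (ΔC _), sw_comm (revR R : H ⊗[k] H) (ΔB _),
    sw_comm (Coalgebra.comul (R := k) (_ : H)) (ΔC _),
    sw_comm (Coalgebra.comul (R := k) (_ : H)) (ΔB _), sw_comm (ΔB _) (ΔC _)]
  simp (disch := fun_prop) only [hC.sw_coassoc, hB.sw_coassoc]

/-- A pairing between the two factors may be attached to either neighbour. The hexagons account for
the R-matrices that then have to cross it, and these are the ones built into `evR`. -/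
theorem star_evL (hR : IsUniversalRMatrix R)
    (hF1 : ∀ b, Lin k (fun c => F c b)) (hF2 : ∀ c, Lin k (fun b => F c b))
    (hG1 : ∀ b, Lin k (fun c => G c b)) (hG2 : ∀ c, Lin k (fun b => G c b)) (c : C) (b : B) :
    star R ΔC ΔB ι F (evL ΔC ΔB ev G) c b = star R ΔC ΔB ι (evR R ΔC ΔB ev ι F) G c b := by
  have hQ := hR.revR
  unfold evL star evR
  simp (disch := fun_prop) only [hC.sw_comul_smul, hB.sw_comul_smul, smul_sw, sw_mul, mul_sw, sw_tmul_left, tmul_sw, TensorProduct.tmul_smul, TensorProduct.smul_tmul', smul_mul_assoc,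
    mul_smul_comm, ← mul_assoc, ← map_mul]
  simp only [sw_comm (R : H ⊗[k] H) (ΔC _), sw_comm (R : H ⊗[k] H) (ΔB _),
    sw_comm (revR R : H ⊗[k] H) (ΔC _), sw_comm (revR R : H ⊗[k] H) (ΔB _),
    sw_comm (Coalgebra.comul (R := k) (_ : H)) (ΔC _),
    sw_comm (Coalgebra.comul (R := k) (_ : H)) (ΔB _), sw_comm (ΔB _) (ΔC _)]
  simp (disch := fun_prop) only [hC.sw_coassoc, hB.sw_coassoc]
  refine sw_congr fun c₁ c₂ => sw_congr fun c₃ c₄ => sw_congr fun b₁ b₂ => sw_congr fun b₃ b₄ => ?_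
  simp (disch := fun_prop) only [sw_hexL hQ, sw_hexL hR, sw_hexR hQ, sw_hexR hR, sw_hexL₁ hQ, sw_hexL₁ hR, sw_hexR₁ hQ, sw_hexR₁ hR, sw_hexR₂ hQ, sw_hexR₂ hR, smul_smul, map_mul, mul_assoc]
  simp only [sw_comm (R : H ⊗[k] H) (revR R : H ⊗[k] H)]
  refine sw_congr fun _ _ => sw_congr fun _ _ => ?_
  rw [sw_comm]

theorem evR_star (hR : IsUniversalRMatrix R)
    (hF1 : ∀ b, Lin k (fun c => F c b)) (hF2 : ∀ c, Lin k (fun b => F c b))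
    (hG1 : ∀ b, Lin k (fun c => G c b)) (hG2 : ∀ c, Lin k (fun b => G c b)) (c : C) (b : B) :
    evR R ΔC ΔB ev (diag ι ι') (star R ΔC ΔB ι F G) c b =
      star R ΔC ΔB ι F (evR R ΔC ΔB ev ι' G) c b := by
  have hQ := hR.revR
  unfold star evR
  simp (disch := fun_prop) only [hC.sw_comul_smul, hB.sw_comul_smul, smul_sw, sw_mul, mul_sw, sw_tmul_left, tmul_sw, TensorProduct.tmul_smul, TensorProduct.smul_tmul', smul_mul_assoc,
    mul_smul_comm, diag_apply, Algebra.TensorProduct.tmul_mul_tmul, ← mul_assoc, ← map_mul]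
  simp only [sw_comm (R : H ⊗[k] H) (ΔC _), sw_comm (R : H ⊗[k] H) (ΔB _),
    sw_comm (revR R : H ⊗[k] H) (ΔC _), sw_comm (revR R : H ⊗[k] H) (ΔB _),
    sw_comm (Coalgebra.comul (R := k) (_ : H)) (ΔC _),
    sw_comm (Coalgebra.comul (R := k) (_ : H)) (ΔB _), sw_comm (ΔB _) (ΔC _)]
  simp (disch := fun_prop) only [hC.sw_coassoc, hB.sw_coassoc]
  refine sw_congr fun c₁ c₂ => sw_congr fun c₃ c₄ => sw_congr fun b₁ b₂ => sw_congr fun b₃ b₄ => ?_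
  simp (disch := fun_prop) only [sw_hexL hQ, sw_hexL hR, sw_hexR hQ, sw_hexR hR, sw_hexL₁ hQ, sw_hexL₁ hR, sw_hexR₁ hQ, sw_hexR₁ hR, sw_hexR₂ hQ, sw_hexR₂ hR, smul_smul, map_mul, mul_assoc]
  simp only [sw_comm (R : H ⊗[k] H) (revR R : H ⊗[k] H),
    sw_comm (R : H ⊗[k] H) (Coalgebra.comul (R := k) (_ : H))]
  simp (disch := fun_prop) only [sw_hexR₁ hQ, map_mul, mul_assoc]
  conv_rhs => rw [← sw_rot]
  refine sw_congr fun _ _ => sw_congr fun _ _ => sw_congr fun _ _ => ?_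
  rw [sw_rot]
  exact sw_congr fun _ _ => sw_comm _ _ _

end

section
variable {ι : H →ₐ[k] X} {ι' : H →ₐ[k] Y} {jB : B →ₗ[k] X} {jC : C →ₗ[k] X} {jB' : B →ₗ[k] Y}
  {jC' : C →ₗ[k] Y}

omit hC hB in
theorem bos_cop (hR : IsUniversalRMatrix R) (hjC : Cov ι jC) (c : C) :
    bos (revR R) (braidInv R ∘ₗ ΔC) ι jC jC' c = sw (ΔC c) fun c₁ c₂ =>
      sw (revR R : H ⊗[k] H) fun p q => (ι q * jC c₂) ⊗ₜ jC' (p • c₁) := by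
  have hQ := hR.revR
  rw [bos_eq_sw]
  simp (disch := fun_prop) only [sw_cop, hjC _ _, sw_tmul_left, smul_smul]
  simp (disch := fun_prop) only [sw_hexR hQ]
  exact sw_congr fun _ _ => sw_comm _ _ _

omit hC hB in
theorem bos_mul_bos (hR : IsUniversalRMatrix R) (hjC : Cov ι jC) (c : C) (b : B) :
    bos (revR R) (braidInv R ∘ₗ ΔC) ι jC jC' c * bos R ΔB ι jB jB' b =
      star R ΔC ΔB ι (fun c b => jC c * jB b) (fun c b => jC' c * jB' b) c b := by
  rw [bos_cop hR hjC, bos_eq_sw, star]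
  simp only [sw_mul, mul_sw, Algebra.TensorProduct.tmul_mul_tmul, mul_assoc]
  rw [sw_rot]
  refine sw_congr fun _ _ => sw_congr fun _ _ => sw_comm _ _ _

omit hC hB in
-- A Yang–Baxter equation with two reversed R-matrices and one ordinary one: the reversed pair is
-- the coproduct of a single leg, and R intertwines that coproduct with its opposite.
theorem sw_mixed (hR : IsUniversalRMatrix R) (f : H → H → H → Z)
    (h1 : ∀ b c, Lin k (fun a => f a b c))
    (h2 : ∀ a c, Lin k (fun b => f a b c)) (h3 : ∀ a b, Lin k (fun c => f a b c)) :
    sw (revR R : H ⊗[k] H) (fun a b => sw (revR R : H ⊗[k] H) fun c d =>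
      sw (R : H ⊗[k] H) fun r s => f (r * d) (s * b) (a * c)) =
    sw (revR R : H ⊗[k] H) fun a b => sw (revR R : H ⊗[k] H) fun c d =>
      sw (R : H ⊗[k] H) fun r s => f (b * r) (d * s) (a * c) := by
  rw [← sw_hexR hR.revR (fun a c d => sw (R : H ⊗[k] H) fun r s => f (r * c) (s * d) a)
    (by fun_prop) (by fun_prop) (by fun_prop),
    ← sw_hexR hR.revR (fun a c d => sw (R : H ⊗[k] H) fun r s => f (d * r) (c * s) a)
    (by fun_prop) (by fun_prop) (by fun_prop)]
  refine sw_congr fun p q => ?_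
  rw [sw_comm, sw_qc hR q (fun x y => f x y p) (by fun_prop) (by fun_prop), sw_comm]

/-- Products in the order c b turn into `star` almost by definition (`bos_mul_bos`); the order b c
with a reversed braiding does so as well, but only after covariance, the mixed Yang–Baxter equation
and one cancellation. Having `star` for both orders is what transports the cross relations. -/
theorem revProd_bos (hR : IsUniversalRMatrix R) (hjB : Cov ι jB) (hjC : Cov ι jC) (c : C) (b : B) :
    revProd R (bos R ΔB ι jB jB') (bos (revR R) (braidInv R ∘ₗ ΔC) ι jC jC') c b =
      star R ΔC ΔB ι (revProd R jB jC) (revProd R jB' jC') c b := by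
  have hQ := hR.revR
  unfold revProd star
  simp only [bos_cop hR hjC, bos_eq_sw]
  simp (disch := fun_prop) only [hB.sw_comul_smul, hC.sw_comul_smul, sw_mul, mul_sw, sw_tmul_left,
    tmul_sw, Algebra.TensorProduct.tmul_mul_tmul, ← mul_assoc]
  simp only [sw_comm (R : H ⊗[k] H) (ΔC _), sw_comm (R : H ⊗[k] H) (ΔB _),
    sw_comm (revR R : H ⊗[k] H) (ΔC _), sw_comm (revR R : H ⊗[k] H) (ΔB _),
    sw_comm (Coalgebra.comul (R := k) (_ : H)) (ΔC _),
    sw_comm (Coalgebra.comul (R := k) (_ : H)) (ΔB _), sw_comm (ΔB _) (ΔC _)]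
  refine sw_congr fun c₁ c₂ => sw_congr fun b₁ b₂ => ?_
  simp only [smul_smul, sw_comm (revR R : H ⊗[k] H) (Coalgebra.comul (R := k) (_ : H)),
    sw_comm (R : H ⊗[k] H) (Coalgebra.comul (R := k) (_ : H))]
  simp (disch := fun_prop) only [sw_hexL hQ]
  simp (disch := fun_prop) only [sw_comulH_mul]
  simp (disch := fun_prop) only [sw_hexR hQ, sw_hexR₁ hQ]
  simp only [← mul_assoc]
  simp only [mul_assoc (jB _) (ι _) (ι _), ← map_mul ι]
  conv_lhs =>
    rw [sw_rot]; enter [2, p, q]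
    rw [← sw_rot]; enter [2, c, d, 2, c', d']
    rw [sw_comm, sw_mixed hR (fun x y z => (jB ((d * d') • b₁) * ι y * jC ((p * c') • c₂)) ⊗ₜ[k]
      (jB' ((x * q) • b₂) * jC' ((z * c) • c₁))) (by fun_prop) (by fun_prop) (by fun_prop)]
  simp only [map_mul ι, mul_assoc (jB _) (ι _) (ι _), mul_assoc (jB _ * ι _), mul_assoc (ι _) (ι _) (jC _), mul_assoc (jB _) _ (jC _), hjC _ _]
  simp only [hjB _ _, sw_mul, mul_sw, sw_tmul_left, smul_smul]
  simp (disch := fun_prop) only [sw_hexR hR]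
  simp only [sw_comm (revR R : H ⊗[k] H) (R : H ⊗[k] H)]
  simp (disch := fun_prop) only [sw_hexR₂ hQ]
  refine sw_congr fun r s => ?_
  simp only [mul_assoc]
  -- Of the copies of R made by the hexagon, one meets a reversed copy on the legs b₂ and c₂ and
  -- cancels.
  have key := sw_cancel_rev R (fun x y => sw (revR R : H ⊗[k] H) fun a b =>
          sw (revR R : H ⊗[k] H) fun a' b' =>
            sw (revR R : H ⊗[k] H) fun a'' b'' =>
              sw (revR R : H ⊗[k] H) fun p q =>
                  (jB ((b * b') • b₁) * (ι q * (jC ((y * a') • c₂) * ι s))) ⊗ₜ[k]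
                    (jB' ((b'' * (r * x)) • b₂) * jC' ((a'' * (p * a)) • c₁)))
    (by fun_prop) (by fun_prop)
  simp only [mul_assoc, one_mul, mul_one] at key
  rw [key]
  conv_rhs =>
    enter [2, a, b]; rw [sw_rot]
  conv_rhs => rw [← sw_rot]

end
end
end BraidedDouble

namespace BraidedDouble
section
variable {k H : Type*} [Field k] [Ring H] [HopfAlgebra k H]
variable {B C : Type*}
  [Ring B] [Algebra k B] [Module H B] [IsScalarTower k H B]
  [Ring C] [Algebra k C] [Module H C] [IsScalarTower k H C]
variable {X Y : Type*} [Ring X] [Algebra k X] [Ring Y] [Algebra k Y]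

section rel
variable (R : (H ⊗[k] H)ˣ) (ΔC : C →ₗ[k] C ⊗[k] C) (ΔB : B →ₗ[k] B ⊗[k] B)
  (ev : C ⊗[k] B →ₗ[k] k)

/-- The cross relation of the braided Drinfeld double. -/
def DoubleRel (ι : H →ₐ[k] X) (jB : B →ₗ[k] X) (jC : C →ₗ[k] X) : Prop :=
  ∀ c b, evL ΔC ΔB ev (revProd R jB jC) c b = evR R ΔC ΔB ev ι (fun c b => jC c * jB b) c b

/-- The cross relation `c b = (R⁻⁽¹⁾ ▷ b₍₂₎) (R⁻⁽²⁾ ▷ c₍₁₎) ev(c₍₂₎, b₍₁₎)`. -/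
def StraightRel (jB : B →ₗ[k] X) (jC : C →ₗ[k] X) : Prop :=
  ∀ c b, jC c * jB b = evL ΔC ΔB ev (revProd R jB jC) c b

/-- The cross relation `(R⁻⁽¹⁾ ▷ b) (R⁻⁽²⁾ ▷ c) =
R⁻⁽¹⁾ c₍₂₎ b₍₁₎ R⁽²⁾ ev(R⁻⁽²⁾ ▷ c₍₁₎, R⁽¹⁾ ▷ b₍₂₎)`. -/
def ReverseRel (ι : H →ₐ[k] X) (jB : B →ₗ[k] X) (jC : C →ₗ[k] X) : Prop :=
  ∀ c b, revProd R jB jC c b = evR R ΔC ΔB ev ι (fun c b => jC c * jB b) c b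

end rel

section
variable {R : (H ⊗[k] H)ˣ} {ΔC : C →ₗ[k] C ⊗[k] C} {εC : C →ₗ[k] k}
  {ΔB : B →ₗ[k] B ⊗[k] B} {εB : B →ₗ[k] k} {ev : C ⊗[k] B →ₗ[k] k}
variable {ι : H →ₐ[k] X} {ι' : H →ₐ[k] Y} {jB : B →ₗ[k] X} {jC : C →ₗ[k] X} {jB' : B →ₗ[k] Y}
  {jC' : C →ₗ[k] Y}

variable (R) in
@[fun_prop]
theorem revProd_lin_left (jB : B →ₗ[k] X) (jC : C →ₗ[k] X) (b : B) :
    Lin k (fun c => revProd R jB jC c b) := by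
  unfold revProd; fun_prop

variable (R) in
@[fun_prop]
theorem revProd_lin_right (jB : B →ₗ[k] X) (jC : C →ₗ[k] X) (c : C) :
    Lin k (fun b => revProd R jB jC c b) := by
  unfold revProd; fun_prop

theorem star_congr_left {F F' : C → B → X} {G : C → B → Y} (h : ∀ c b, F c b = F' c b) (c : C)
    (b : B) : star R ΔC ΔB ι F G c b = star R ΔC ΔB ι F' G c b := by
  rw [funext₂ h]

theorem star_congr_right {F : C → B → X} {G G' : C → B → Y} (h : ∀ c b, G c b = G' c b) (c : C)
    (b : B) : star R ΔC ΔB ι F G c b = star R ΔC ΔB ι F G' c b := by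
  rw [funext₂ h]

theorem evL_congr {F F' : C → B → X} (h : ∀ c b, F c b = F' c b) (c : C)
    (b : B) : evL ΔC ΔB ev F c b = evL ΔC ΔB ev F' c b := by
  rw [funext₂ h]

theorem evR_congr {F F' : C → B → X} (h : ∀ c b, F c b = F' c b) (c : C)
    (b : B) : evR R ΔC ΔB ev ι F c b = evR R ΔC ΔB ev ι F' c b := by
  rw [funext₂ h]

variable (hC : BrBialg R ΔC εC) (hB : BrBialg R ΔB εB) (hR : IsUniversalRMatrix R)
  (hjB : Cov ι jB) (hjC : Cov ι jC)
include hC hB hR hjB hjC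

/-- Write P, P′ for the products c b in the two algebras, Q, Q′ for the reversed ones, L for `evL`
and E for `evR`. Then L(Q ⋆ Q′) = L(Q) ⋆ Q′ = E(P) ⋆ Q′ = P ⋆ L(Q′) = P ⋆ E(P′) = E(P ⋆ P′). -/
theorem DoubleRel.bos (h : DoubleRel R ΔC ΔB ev ι jB jC) (h' : DoubleRel R ΔC ΔB ev ι' jB' jC') :
    DoubleRel R ΔC ΔB ev (diag ι ι') (bos R ΔB ι jB jB')
      (bos (revR R) (braidInv R ∘ₗ ΔC) ι jC jC') := fun c b => by
  rw [evL_congr (revProd_bos hC hB hR hjB hjC),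
    evL_star hC hB ev (by fun_prop) (by fun_prop) (by fun_prop) (by fun_prop), star_congr_left h,
    ← star_evL hC hB ev hR (by fun_prop) (by fun_prop) (by fun_prop) (by fun_prop),
    star_congr_right h',
    ← evR_star hC hB ev hR (by fun_prop) (by fun_prop) (by fun_prop) (by fun_prop)]
  exact evR_congr (fun c b => (bos_mul_bos hR hjC c b).symm) c b

/-- The chain for `DoubleRel.bos` stops at P ⋆ L(Q′), which is now P ⋆ P′. This gives the coaction
of the double on the twisted double. -/
theorem StraightRel.bos (h : DoubleRel R ΔC ΔB ev ι jB jC) (h' : StraightRel R ΔC ΔB ev jB' jC') :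
    StraightRel R ΔC ΔB ev (bos R ΔB ι jB jB')
      (bos (revR R) (braidInv R ∘ₗ ΔC) ι jC jC') := fun c b => by
  rw [evL_congr (revProd_bos hC hB hR hjB hjC),
    evL_star hC hB ev (by fun_prop) (by fun_prop) (by fun_prop) (by fun_prop), star_congr_left h,
    ← star_evL hC hB ev hR (by fun_prop) (by fun_prop) (by fun_prop) (by fun_prop),
    bos_mul_bos hR hjC]
  exact star_congr_right h' c b

/-- Here the same chain reads L(Q) ⋆ Q′ = P ⋆ Q′ = P ⋆ E(P′): a straight and a reverse relation
combine to a double relation. The double thus gets a representation from two simpler algebras,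
neither of which need satisfy its relation. -/
theorem ReverseRel.bos (h : StraightRel R ΔC ΔB ev jB jC) (h' : ReverseRel R ΔC ΔB ev ι' jB' jC') :
    DoubleRel R ΔC ΔB ev (diag ι ι') (bos R ΔB ι jB jB')
      (bos (revR R) (braidInv R ∘ₗ ΔC) ι jC jC') := fun c b => by
  rw [evL_congr (revProd_bos hC hB hR hjB hjC),
    evL_star hC hB ev (by fun_prop) (by fun_prop) (by fun_prop) (by fun_prop),
    ← star_congr_left h, star_congr_right h',
    ← evR_star hC hB ev hR (by fun_prop) (by fun_prop) (by fun_prop) (by fun_prop)]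
  exact evR_congr (fun c b => (bos_mul_bos hR hjC c b).symm) c b

end

/-! ### The maps of the definitions in Sweedler form -/

section frozen
variable [Coalgebra k B] [Coalgebra k C] (R : (H ⊗[k] H)ˣ) (ev : C ⊗[k] B →ₗ[k] k)

theorem contract_tmul (c c' : C) (b b' : B) :
    contract ev ((c ⊗ₜ c') ⊗ₜ (b ⊗ₜ b')) = ev (c' ⊗ₜ b) • (c ⊗ₜ b') := by
  simp [contract]

theorem contract_sw (x : C ⊗[k] C) (y : B ⊗[k] B) :
    contract ev (x ⊗ₜ y) = sw x fun c c' => sw y fun b b' => ev (c' ⊗ₜ b) • (c ⊗ₜ b') := by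
  conv_lhs => rw [eq_sw x, eq_sw y]
  simp only [sw_tmul_left, tmul_sw, map_sw, contract_tmul]
  exact sw_comm _ _ _

theorem cross_tmul (c : C) (b : B) :
    cross R ev (c ⊗ₜ b) = sw (Coalgebra.comul (R := k) c) fun c₁ c₂ =>
      sw (Coalgebra.comul (R := k) b) fun b₁ b₂ => sw (revR R : H ⊗[k] H) fun p q =>
        ev (c₂ ⊗ₜ b₁) • ((q • b₂) ⊗ₜ (p • c₁)) := by
  rw [cross, LinearMap.comp_apply, LinearMap.comp_apply, TensorProduct.map_tmul, contract_sw,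
    braidInv_eq]
  simp only [map_sw, map_smul, braid_tmul_sw, smul_sw]

theorem mul_map_cross (jB : B →ₗ[k] X) (jC : C →ₗ[k] X) (c : C) (b : B) :
    LinearMap.mul' k X (TensorProduct.map jB jC (cross R ev (c ⊗ₜ b))) =
      evL Coalgebra.comul Coalgebra.comul ev (revProd R jB jC) c b := by
  rw [cross_tmul]
  simp only [map_sw, map_smul, TensorProduct.map_tmul, LinearMap.mul'_apply, evL, revProd, smul_sw]

theorem coactBy_sw {V : Type*} [AddCommGroup V] [Module k V] [Module H V]
    [IsScalarTower k H V] (x : H ⊗[k] H) (v : V) :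
    coactBy x v = sw x fun p q => p ⊗ₜ (q • v) := by
  rw [coactBy, LinearMap.comp_apply, TensorProduct.mk_apply, act₂_tmul_sw]
  simp only [smul_eq_mul, mul_one]

theorem sw_flip {V W Z : Type*} [AddCommGroup V] [Module k V] [AddCommGroup W] [Module k W]
    [AddCommGroup Z] [Module k Z] (t : V ⊗[k] W) (f : W → V → Z)
    (h1 : ∀ b, Lin k (fun a => f a b)) (h2 : ∀ a, Lin k (fun b => f a b)) :
    sw (TensorProduct.comm k V W t) f = sw t fun a b => f b a := by
  conv_lhs => rw [eq_sw t]
  simp only [map_sw, TensorProduct.comm_tmul]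
  simp (disch := fun_prop) only [sw_sw, sw_tmul]

theorem deltaB_eq (jB : B →ₗ[k] X) (ι : H →ₐ[k] X) (b : B) :
    deltaB R jB ι.toLinearMap b = sw (Coalgebra.comul (R := k) b) fun b₁ b₂ =>
      sw (R : H ⊗[k] H) fun r s => (jB b₁ * ι s) ⊗ₜ (r • b₂) := by
  simp only [deltaB, LinearMap.comp_apply]
  conv_lhs => rw [eq_sw (Coalgebra.comul (R := k) b)]
  simp only [map_sw, LinearMap.lTensor_tmul, coactBy_sw, tmul_sw]
  refine sw_congr fun b₁ b₂ => ?_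
  rw [sw_flip _ _ (by fun_prop) (by fun_prop)]
  simp only [tmul_sw, map_sw, LinearEquiv.coe_coe, TensorProduct.assoc_symm_tmul, LinearMap.rTensor_tmul,
    LinearMap.comp_apply, TensorProduct.map_tmul, LinearMap.mul'_apply, AlgHom.toLinearMap_apply]

theorem deltaC_eq (jC : C →ₗ[k] X) (ι : H →ₐ[k] X) (c : C) :
    deltaC R jC ι.toLinearMap c = sw (Coalgebra.comul (R := k) c) fun c₁ c₂ =>
      sw (revR R : H ⊗[k] H) fun p q => (ι q * jC c₂) ⊗ₜ (p • c₁) := by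
  simp only [deltaC, LinearMap.comp_apply]
  conv_lhs => rw [eq_sw (Coalgebra.comul (R := k) c)]
  simp only [map_sw, LinearEquiv.coe_coe, TensorProduct.comm_tmul, LinearMap.lTensor_tmul, coactBy_sw, tmul_sw]
  refine sw_congr fun b₁ b₂ => ?_
  rw [revR_val, sw_flip _ _ (by fun_prop) (by fun_prop)]
  simp only [tmul_sw, map_sw, LinearEquiv.coe_coe, TensorProduct.assoc_symm_tmul, LinearMap.rTensor_tmul,
    LinearMap.comp_apply, TensorProduct.map_tmul, LinearMap.mul'_apply, AlgHom.toLinearMap_apply,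
    TensorProduct.comm_tmul]

theorem mulEv_tmul (a a' : X) (c : C) (b : B) :
    mulEv ev ((a ⊗ₜ c) ⊗ₜ (a' ⊗ₜ b)) = ev (c ⊗ₜ b) • (a * a') := by
  simp [mulEv]

theorem mulEv_deltaC_deltaB (jB : B →ₗ[k] X) (jC : C →ₗ[k] X) (ι : H →ₐ[k] X) (c : C) (b : B) :
    mulEv ev (deltaC R jC ι.toLinearMap c ⊗ₜ deltaB R jB ι.toLinearMap b) =
      evR R Coalgebra.comul Coalgebra.comul ev ι (fun c b => jC c * jB b) c b := by
  rw [deltaB_eq, deltaC_eq, evR]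
  simp only [sw_tmul_left, tmul_sw, map_sw, mulEv_tmul, mul_assoc]
  rw [sw_rot]
  exact sw_congr fun _ _ => sw_congr fun _ _ => sw_comm _ _ _

end frozen
end
end BraidedDouble

/-! ### Presentations and universal properties of the double and the twisted double -/

namespace BraidedDouble
section
variable {k H : Type*} [Field k] [Ring H] [HopfAlgebra k H]
variable {B C : Type*}
  [Ring B] [Algebra k B] [Coalgebra k B] [Module H B] [IsScalarTower k H B]
  [Ring C] [Algebra k C] [Coalgebra k C] [Module H C] [IsScalarTower k H C]
variable {X Y : Type*} [Ring X] [Algebra k X] [Ring Y] [Algebra k Y]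

/-- Covariant maps from `B` and `C` into an algebra with a map from `H`. -/
structure Triple (mB : B ⊗[k] B →ₗ[k] B) (mC : C ⊗[k] C →ₗ[k] C) (ι : H →ₐ[k] X)
    (jB : B →ₗ[k] X) (jC : C →ₗ[k] X) : Prop where
  left : Half mB ι jB
  right : Half mC ι jC

theorem mul_map_rTensor {V : Type*} [AddCommGroup V] [Module k V] [Module H V]
    [IsScalarTower k H V] (j : V →ₗ[k] X) (ι : H →ₗ[k] X) (h : H) (v : V) :
    LinearMap.mul' k X (TensorProduct.map j ι
        (LinearMap.rTensor H ((Algebra.lsmul k k V).toLinearMap.flip v)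
          (Coalgebra.comul (R := k) h))) =
      sw (Coalgebra.comul (R := k) h) fun x y => j (x • v) * ι y := by
  conv_lhs => rw [eq_sw (Coalgebra.comul (R := k) h)]
  simp only [map_sw]
  rfl

/-- The homomorphism from the tensor algebra. -/
noncomputable def preLift (ι : H →ₐ[k] X) (jB : B →ₗ[k] X) (jC : C →ₗ[k] X) :
    TensorAlgebra k (B × H × C) →ₐ[k] X :=
  TensorAlgebra.lift k (jB.coprod (ι.toLinearMap.coprod jC))

section
variable (ι : H →ₐ[k] X) (jB : B →ₗ[k] X) (jC : C →ₗ[k] X)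

@[simp] theorem preLift_preB (b : B) : preLift ι jB jC (preB b) = jB b := by
  simp [preLift, preB]

@[simp] theorem preLift_preH (h : H) : preLift ι jB jC (preH h) = ι h := by
  simp [preLift, preH]

@[simp] theorem preLift_preC (c : C) : preLift ι jB jC (preC c) = jC c := by
  simp [preLift, preC]

theorem map_comp_preLift {T : Type*} [Ring T] [Algebra k T] {V W : Type*} [AddCommGroup V] [Module k V] [AddCommGroup W]
    [Module k W] (g : T →ₐ[k] X) (j : V →ₗ[k] T) (i : W →ₗ[k] T) (x : V ⊗[k] W) :
    g (LinearMap.mul' k T (TensorProduct.map j i x)) =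
      LinearMap.mul' k X (TensorProduct.map (g.toLinearMap ∘ₗ j) (g.toLinearMap ∘ₗ i) x) := by
  conv_lhs => rw [eq_sw x]
  conv_rhs => rw [eq_sw x]
  simp only [map_sw, TensorProduct.map_tmul, LinearMap.mul'_apply, map_mul]
  rfl

theorem preAlgHom_ext {f g : TensorAlgebra k (B × H × C) →ₐ[k] X}
    (hB : ∀ b, f (preB b) = g (preB b)) (hH : ∀ h, f (preH h) = g (preH h))
    (hC : ∀ c, f (preC c) = g (preC c)) : f = g := by
  refine TensorAlgebra.hom_ext (LinearMap.ext fun x => ?_)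
  obtain ⟨b, h, c⟩ := x
  have : TensorAlgebra.ι k (b, h, c) = preB b + preH h + preC c := by
    simp only [preB, preH, preC, LinearMap.comp_apply, ← map_add]; simp
  simp only [LinearMap.comp_apply, AlgHom.toLinearMap_apply, this, map_add, hB, hH, hC]

end

theorem mulEv_map {T : Type*} [Ring T] [Algebra k T] (ev : C ⊗[k] B →ₗ[k] k) (g : T →ₐ[k] X) (R : (H ⊗[k] H)ˣ) (jB : B →ₗ[k] T)
    (jC : C →ₗ[k] T) (ι : H →ₗ[k] T) (c : C) (b : B) :
    g (mulEv ev (deltaC R jC ι c ⊗ₜ deltaB R jB ι b)) =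
      mulEv ev (deltaC R (g.toLinearMap ∘ₗ jC) (g.toLinearMap ∘ₗ ι) c ⊗ₜ
        deltaB R (g.toLinearMap ∘ₗ jB) (g.toLinearMap ∘ₗ ι) b) := by
  have h1 : deltaC R (g.toLinearMap ∘ₗ jC) (g.toLinearMap ∘ₗ ι) c =
      g.toLinearMap.rTensor C (deltaC R jC ι c) := by
    simp only [deltaC, LinearMap.comp_apply, ← LinearMap.rTensor_comp_apply]
    congr 2
    ext; simp
  have h2 : deltaB R (g.toLinearMap ∘ₗ jB) (g.toLinearMap ∘ₗ ι) b =
      g.toLinearMap.rTensor B (deltaB R jB ι b) := by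
    simp only [deltaB, LinearMap.comp_apply, ← LinearMap.rTensor_comp_apply]
    congr 2
    ext; simp
  rw [h1, h2]
  generalize deltaC R jC ι c = x
  generalize deltaB R jB ι b = y
  conv_lhs => rw [eq_sw x, eq_sw y]
  conv_rhs => rw [eq_sw x, eq_sw y]
  simp only [sw_tmul_left, tmul_sw, map_sw, mulEv_tmul, LinearMap.rTensor_tmul, map_smul, map_mul,
    AlgHom.toLinearMap_apply]

section Drin
variable (R : (H ⊗[k] H)ˣ) (ev : C ⊗[k] B →ₗ[k] k)

namespace Drin

theorem rel {x y : TensorAlgebra k (B × H × C)} (h : DrinRel R ev x y) :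
    RingQuot.mkAlgHom k (DrinRel R ev) x = RingQuot.mkAlgHom k (DrinRel R ev) y :=
  RingQuot.mkAlgHom_rel k h

/-- The structure map of `H` as a homomorphism of algebras. -/
noncomputable def inHAlg : H →ₐ[k] Drin R ev :=
  AlgHom.ofLinearMap (inH R ev) ((rel R ev DrinRel.one_H).trans (map_one _))
    fun x y => (rel R ev (DrinRel.mul_H x y)).trans (map_mul _ _ _)

@[simp] theorem inHAlg_apply (h : H) : inHAlg R ev h = inH R ev h := rfl

theorem inHAlg_toLinearMap : (inHAlg R ev).toLinearMap = inH R ev := rfl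

theorem cov_inB : Cov (inHAlg R ev) (inB R ev) := fun h b => by
  have := rel R ev (DrinRel.HB h b)
  rw [map_mul, map_comp_preLift, mul_map_rTensor] at this
  exact this

theorem cov_inC : Cov (inHAlg R ev) (inC R ev) := fun h c => by
  have := rel R ev (DrinRel.HC h c)
  rw [map_mul, map_comp_preLift, mul_map_rTensor] at this
  exact this

theorem triple : Triple (LinearMap.mul' k B) (LinearMap.mul' k C) (inHAlg R ev) (inB R ev)
    (inC R ev) where
  left := ⟨cov_inB R ev, fun b b' => ((rel R ev (DrinRel.mul_B b b')).trans (map_mul _ _ _)).symm,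
    (rel R ev DrinRel.one_B).trans (map_one _)⟩
  right := ⟨cov_inC R ev, fun b b' => ((rel R ev (DrinRel.mul_C b b')).trans (map_mul _ _ _)).symm,
    (rel R ev DrinRel.one_C).trans (map_one _)⟩

theorem doubleRel : DoubleRel R Coalgebra.comul Coalgebra.comul ev (inHAlg R ev) (inB R ev)
    (inC R ev) := fun c b => by
  have := rel R ev (DrinRel.cross b c)
  rw [map_comp_preLift, mul_map_cross, mulEv_map] at this
  rw [← mulEv_deltaC_deltaB]
  exact this

variable {R ev}

/-- The universal property of the braided Drinfeld double. -/
noncomputable def lift {ι : H →ₐ[k] X} {jB : B →ₗ[k] X} {jC : C →ₗ[k] X}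
    (h : Triple (LinearMap.mul' k B) (LinearMap.mul' k C) ι jB jC)
    (hd : DoubleRel R Coalgebra.comul Coalgebra.comul ev ι jB jC) : Drin R ev →ₐ[k] X :=
  RingQuot.liftAlgHom k ⟨preLift ι jB jC, fun x y r => by
    have eB : (preLift ι jB jC).toLinearMap ∘ₗ preB = jB := by ext; simp
    have eC : (preLift ι jB jC).toLinearMap ∘ₗ preC = jC := by ext; simp
    have eH : (preLift ι jB jC).toLinearMap ∘ₗ preH = ι.toLinearMap := by ext; simp
    cases r with
    | mul_B b b' => simp [h.left.mul]
    | one_B => simp [h.left.one]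
    | mul_H b b' => simp
    | one_H => simp
    | mul_C b b' => simp [h.right.mul]
    | one_C => simp [h.right.one]
    | HB g b =>
      rw [map_mul, map_comp_preLift, mul_map_rTensor, eB, eH, preLift_preB, preLift_preH]
      exact h.left.cov g b
    | HC g b =>
      rw [map_mul, map_comp_preLift, mul_map_rTensor, eC, eH, preLift_preC, preLift_preH]
      exact h.right.cov g b
    | cross b c =>
      rw [map_comp_preLift, mul_map_cross, mulEv_map, eB, eC, eH, mulEv_deltaC_deltaB]
      exact hd c b⟩

section
variable {ι : H →ₐ[k] X} {jB : B →ₗ[k] X} {jC : C →ₗ[k] X}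
    (h : Triple (LinearMap.mul' k B) (LinearMap.mul' k C) ι jB jC)
    (hd : DoubleRel R Coalgebra.comul Coalgebra.comul ev ι jB jC)

@[simp] theorem lift_inB (b : B) : lift h hd (inB R ev b) = jB b :=
  (RingQuot.liftAlgHom_mkAlgHom_apply k _ _ _).trans (preLift_preB ι jB jC b)

@[simp] theorem lift_inC (b : C) : lift h hd (inC R ev b) = jC b :=
  (RingQuot.liftAlgHom_mkAlgHom_apply k _ _ _).trans (preLift_preC ι jB jC b)

@[simp] theorem lift_inH (b : H) : lift h hd (inH R ev b) = ι b :=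
  (RingQuot.liftAlgHom_mkAlgHom_apply k _ _ _).trans (preLift_preH ι jB jC b)
end

theorem algHom_ext {f g : Drin R ev →ₐ[k] X} (hB : ∀ b, f (inB R ev b) = g (inB R ev b))
    (hH : ∀ h, f (inH R ev h) = g (inH R ev h)) (hC : ∀ c, f (inC R ev c) = g (inC R ev c)) :
    f = g :=
  RingQuot.ringQuot_ext' k _ _ (preAlgHom_ext hB hH hC)

end Drin
end Drin

section Tw

/-- The defining relations of the twisted double. -/
inductive TwRel (R : (H ⊗[k] H)ˣ) (ev : C ⊗[k] B →ₗ[k] k) (mB : B ⊗[k] B →ₗ[k] B)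
    (mC : C ⊗[k] C →ₗ[k] C) :
    TensorAlgebra k (B × H × C) → TensorAlgebra k (B × H × C) → Prop
  | mul_B (b b' : B) : TwRel R ev mB mC (preB (mB (b ⊗ₜ b'))) (preB b * preB b')
  | one_B : TwRel R ev mB mC (preB (1 : B)) 1
  | mul_H (h h' : H) : TwRel R ev mB mC (preH (h * h')) (preH h * preH h')
  | one_H : TwRel R ev mB mC (preH (1 : H)) 1
  | mul_C (c c' : C) : TwRel R ev mB mC (preC (mC (c ⊗ₜ c'))) (preC c * preC c')
  | one_C : TwRel R ev mB mC (preC (1 : C)) 1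
  | HB (h : H) (b : B) : TwRel R ev mB mC (preH h * preB b)
      (LinearMap.mul' k _ (TensorProduct.map preB preH
        (LinearMap.rTensor H ((Algebra.lsmul k k B).toLinearMap.flip b)
          (Coalgebra.comul (R := k) h))))
  | HC (h : H) (c : C) : TwRel R ev mB mC (preH h * preC c)
      (LinearMap.mul' k _ (TensorProduct.map preC preH
        (LinearMap.rTensor H ((Algebra.lsmul k k C).toLinearMap.flip c)
          (Coalgebra.comul (R := k) h))))
  | cross (b : B) (c : C) : TwRel R ev mB mC (preC c * preB b)
      (LinearMap.mul' k _ (TensorProduct.map preB preC (BraidedDouble.cross R ev (c ⊗ₜ b))))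

/-- The twisted double: generated by `B` and `C` with twisted products and by `H`, with cross
relation `c b = (R⁻⁽¹⁾ ▷ b₍₂₎) (R⁻⁽²⁾ ▷ c₍₁₎) ev(c₍₂₎, b₍₁₎)`. -/
def Tw (R : (H ⊗[k] H)ˣ) (ev : C ⊗[k] B →ₗ[k] k) (mB : B ⊗[k] B →ₗ[k] B)
    (mC : C ⊗[k] C →ₗ[k] C) : Type _ := RingQuot (TwRel R ev mB mC)

variable (R : (H ⊗[k] H)ˣ) (ev : C ⊗[k] B →ₗ[k] k) (mB : B ⊗[k] B →ₗ[k] B)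
    (mC : C ⊗[k] C →ₗ[k] C)

noncomputable instance : Ring (Tw R ev mB mC) :=
  inferInstanceAs (Ring (RingQuot (TwRel R ev mB mC)))

noncomputable instance : Algebra k (Tw R ev mB mC) :=
  inferInstanceAs (Algebra k (RingQuot (TwRel R ev mB mC)))

namespace Tw

theorem rel {x y : TensorAlgebra k (B × H × C)} (h : TwRel R ev mB mC x y) :
    RingQuot.mkAlgHom k (TwRel R ev mB mC) x = RingQuot.mkAlgHom k (TwRel R ev mB mC) y :=
  RingQuot.mkAlgHom_rel k h

/-- The structure map of `B`. -/
noncomputable def ofB : B →ₗ[k] Tw R ev mB mC :=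
  (RingQuot.mkAlgHom k (TwRel R ev mB mC)).toLinearMap ∘ₗ preB

/-- The structure map of `C`. -/
noncomputable def ofC : C →ₗ[k] Tw R ev mB mC :=
  (RingQuot.mkAlgHom k (TwRel R ev mB mC)).toLinearMap ∘ₗ preC

/-- The structure map of `H`. -/
noncomputable def ofH : H →ₐ[k] Tw R ev mB mC :=
  AlgHom.ofLinearMap ((RingQuot.mkAlgHom k (TwRel R ev mB mC)).toLinearMap ∘ₗ preH)
    ((rel R ev mB mC TwRel.one_H).trans (map_one _))
    fun x y => (rel R ev mB mC (TwRel.mul_H x y)).trans (map_mul _ _ _)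

theorem cov_ofB : Cov (ofH R ev mB mC) (ofB R ev mB mC) := fun h b => by
  have := rel R ev mB mC (TwRel.HB h b)
  rw [map_mul, map_comp_preLift, mul_map_rTensor] at this
  exact this

theorem cov_ofC : Cov (ofH R ev mB mC) (ofC R ev mB mC) := fun h c => by
  have := rel R ev mB mC (TwRel.HC h c)
  rw [map_mul, map_comp_preLift, mul_map_rTensor] at this
  exact this

theorem triple : Triple mB mC (ofH R ev mB mC) (ofB R ev mB mC) (ofC R ev mB mC) where
  left := ⟨cov_ofB R ev mB mC,
    fun b b' => ((rel R ev mB mC (TwRel.mul_B b b')).trans (map_mul _ _ _)).symm,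
    (rel R ev mB mC TwRel.one_B).trans (map_one _)⟩
  right := ⟨cov_ofC R ev mB mC,
    fun b b' => ((rel R ev mB mC (TwRel.mul_C b b')).trans (map_mul _ _ _)).symm,
    (rel R ev mB mC TwRel.one_C).trans (map_one _)⟩

theorem straightRel : StraightRel R Coalgebra.comul Coalgebra.comul ev (ofB R ev mB mC)
    (ofC R ev mB mC) := fun c b => by
  have := rel R ev mB mC (TwRel.cross b c)
  rw [map_mul, map_comp_preLift, mul_map_cross] at this
  exact this

variable {R ev mB mC}

/-- The universal property of the twisted double. -/
noncomputable def lift {ι : H →ₐ[k] X} {jB : B →ₗ[k] X} {jC : C →ₗ[k] X}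
    (h : Triple mB mC ι jB jC)
    (hd : StraightRel R Coalgebra.comul Coalgebra.comul ev jB jC) : Tw R ev mB mC →ₐ[k] X :=
  RingQuot.liftAlgHom k ⟨preLift ι jB jC, fun x y r => by
    have eB : (preLift ι jB jC).toLinearMap ∘ₗ preB = jB := by ext; simp
    have eC : (preLift ι jB jC).toLinearMap ∘ₗ preC = jC := by ext; simp
    have eH : (preLift ι jB jC).toLinearMap ∘ₗ preH = ι.toLinearMap := by ext; simp
    cases r with
    | mul_B b b' => simp [h.left.mul]
    | one_B => simp [h.left.one]
    | mul_H b b' => simp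
    | one_H => simp
    | mul_C b b' => simp [h.right.mul]
    | one_C => simp [h.right.one]
    | HB g b =>
      rw [map_mul, map_comp_preLift, mul_map_rTensor, eB, eH, preLift_preB, preLift_preH]
      exact h.left.cov g b
    | HC g b =>
      rw [map_mul, map_comp_preLift, mul_map_rTensor, eC, eH, preLift_preC, preLift_preH]
      exact h.right.cov g b
    | cross b c =>
      rw [map_mul, map_comp_preLift, mul_map_cross, eB, eC, preLift_preC, preLift_preB]
      exact hd c b⟩

section
variable {ι : H →ₐ[k] X} {jB : B →ₗ[k] X} {jC : C →ₗ[k] X}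
    (h : Triple mB mC ι jB jC)
    (hd : StraightRel R Coalgebra.comul Coalgebra.comul ev jB jC)

@[simp] theorem lift_ofB (b : B) : lift h hd (ofB R ev mB mC b) = jB b :=
  (RingQuot.liftAlgHom_mkAlgHom_apply k _ _ _).trans (preLift_preB ι jB jC b)

@[simp] theorem lift_ofC (b : C) : lift h hd (ofC R ev mB mC b) = jC b :=
  (RingQuot.liftAlgHom_mkAlgHom_apply k _ _ _).trans (preLift_preC ι jB jC b)

@[simp] theorem lift_ofH (b : H) : lift h hd (ofH R ev mB mC b) = ι b :=
  (RingQuot.liftAlgHom_mkAlgHom_apply k _ _ _).trans (preLift_preH ι jB jC b)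
end

theorem algHom_ext {f g : Tw R ev mB mC →ₐ[k] X}
    (hB : ∀ b, f (ofB R ev mB mC b) = g (ofB R ev mB mC b))
    (hH : ∀ h, f (ofH R ev mB mC h) = g (ofH R ev mB mC h))
    (hC : ∀ c, f (ofC R ev mB mC c) = g (ofC R ev mB mC c)) : f = g :=
  RingQuot.ringQuot_ext' k _ _ (preAlgHom_ext hB hH hC)

end Tw
end Tw
end
end BraidedDouble

/-! ### The bialgebra structure of the double -/

namespace BraidedDouble
section
variable {k H : Type*} [Field k] [Ring H] [HopfAlgebra k H]

section bos
variable {V : Type*} [AddCommGroup V] [Module k V] [Module H V] [IsScalarTower k H V]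
variable {X Y X' Y' : Type*} [Ring X] [Algebra k X] [Ring Y] [Algebra k Y] [Ring X'] [Algebra k X']
  [Ring Y'] [Algebra k Y']
variable {R : (H ⊗[k] H)ˣ} {Δ : V →ₗ[k] V ⊗[k] V} {ι : H →ₐ[k] X} {jX : V →ₗ[k] X}
  {jY : V →ₗ[k] Y} {ι' : H →ₐ[k] X'} {jX' : V →ₗ[k] X'}

theorem map_bos (f : X →ₐ[k] X') (g : Y →ₐ[k] Y') (b : V) :
    Algebra.TensorProduct.map f g (bos R Δ ι jX jY b) =
      bos R Δ (f.comp ι) (f.toLinearMap ∘ₗ jX) (g.toLinearMap ∘ₗ jY) b := by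
  simp only [bos_eq_sw, map_sw, Algebra.TensorProduct.map_tmul, map_mul]
  rfl

theorem map_diag {ιY : H →ₐ[k] Y} (f : X →ₐ[k] X') (g : Y →ₐ[k] Y') (h : H) :
    Algebra.TensorProduct.map f g (diag ι ιY h) = diag (f.comp ι) (g.comp ιY) h := by
  simp only [diag_apply, map_sw, Algebra.TensorProduct.map_tmul]
  rfl

theorem assoc_diag {ιY : H →ₐ[k] Y} (h : H) :
    Algebra.TensorProduct.assoc k k k X X' Y (diag (diag ι ι') ιY h) =
      diag ι (diag ι' ιY) h := by
  simp only [diag_apply, sw_tmul_left, tmul_sw, map_sw, Algebra.TensorProduct.assoc_tmul]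
  exact sw_comul_comul h (fun a b c => ι a ⊗ₜ (ι' b ⊗ₜ ιY c)) (by fun_prop) (by fun_prop)
    (by fun_prop)

/-- After coassociativity of Δ, one hexagon splits the R-leg acting on a coproduct and the other
splits the R-leg sent to the diagonal of H; both sides then carry the same three copies of R. -/
theorem assoc_bos (hR : IsUniversalRMatrix R) (hΔ : ComulSMul (H := H) Δ)
    (hc : ∀ v, TensorProduct.assoc k V V V (Δ.rTensor V (Δ v)) = Δ.lTensor V (Δ v)) (b : V) :
    Algebra.TensorProduct.assoc k k k X X' Y (bos R Δ (diag ι ι') (bos R Δ ι jX jX') jY b) =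
      bos R Δ ι jX (bos R Δ ι' jX' jY) b := by
  simp only [bos_eq_sw, diag_apply, hΔ _ _, sw_tmul_left, tmul_sw, map_sw, sw_mul, mul_sw,
    Algebra.TensorProduct.tmul_mul_tmul, Algebra.TensorProduct.assoc_tmul]
  simp (disch := fun_prop) only [sw_sw, sw_tmul, tmul_sw, smul_smul]
  simp only [sw_comm (R : H ⊗[k] H) (Δ _),
    sw_comm (Coalgebra.comul (R := k) (_ : H)) (Δ _)]
  simp (disch := fun_prop) only [sw_coassoc hc]
  refine sw_congr fun b₁ b₂ => sw_congr fun b₃ b₄ => ?_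
  simp (disch := fun_prop) only [sw_hexL hR, sw_hexR hR, sw_hexL₁ hR, sw_hexR₁ hR, mul_assoc,
    map_mul]
  rw [sw_rot]
  exact sw_congr fun _ _ => sw_comm _ _ _

theorem lid_bos (hR : IsUniversalRMatrix R) {ε : V →ₗ[k] k}
    (hε : ∀ b, TensorProduct.lid k V (ε.rTensor V (Δ b)) = b) (e : X →ₐ[k] k)
    (he : ∀ h, e (ι h) = Coalgebra.counit (R := k) h) (hj : ∀ v, e (jX v) = ε v) (b : V) :
    TensorProduct.lid k Y (e.toLinearMap.rTensor Y (bos R Δ ι jX jY b)) = jY b := by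
  simp only [bos_eq_sw, map_sw, LinearMap.rTensor_tmul, TensorProduct.lid_tmul,
    AlgHom.toLinearMap_apply, map_mul, he, hj, mul_smul]
  simp (disch := fun_prop) only [← smul_sw, sw_R_counit hR, one_smul, sw_counit_left hε]

theorem rid_bos (hR : IsUniversalRMatrix R) {ε : V →ₗ[k] k}
    (hε : ∀ b, TensorProduct.rid k V (ε.lTensor V (Δ b)) = b)
    (hH : ∀ (h : H) (b : V), ε (h • b) = Coalgebra.counit (R := k) h * ε b) (e : Y →ₐ[k] k)
    (hj : ∀ v, e (jY v) = ε v) (b : V) :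
    TensorProduct.rid k X (e.toLinearMap.lTensor X (bos R Δ ι jX jY b)) = jX b := by
  simp only [bos_eq_sw, map_sw, LinearMap.lTensor_tmul, TensorProduct.rid_tmul,
    AlgHom.toLinearMap_apply, hH, hj, mul_smul]
  simp (disch := fun_prop) only [sw_counit_R hR, map_one, mul_one, sw_counit_right hε]

theorem lid_diag {ιY : H →ₐ[k] Y} (e : X →ₐ[k] k)
    (he : ∀ h, e (ι h) = Coalgebra.counit (R := k) h) (h : H) :
    TensorProduct.lid k Y (e.toLinearMap.rTensor Y (diag ι ιY h)) = ιY h := by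
  simp only [diag_apply, map_sw, LinearMap.rTensor_tmul, TensorProduct.lid_tmul,
    AlgHom.toLinearMap_apply, he]
  exact sw_counit_comul h (fun x => ιY x) (by fun_prop)

theorem rid_diag {ιY : H →ₐ[k] Y} (e : Y →ₐ[k] k)
    (he : ∀ h, e (ιY h) = Coalgebra.counit (R := k) h) (h : H) :
    TensorProduct.rid k X (e.toLinearMap.lTensor X (diag ι ιY h)) = ι h := by
  simp only [diag_apply, map_sw, LinearMap.lTensor_tmul, TensorProduct.rid_tmul,
    AlgHom.toLinearMap_apply, he]
  exact sw_comul_counit h (fun x => ι x) (by fun_prop)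

end bos

section
variable {B C : Type*}
  [Ring B] [Algebra k B] [Coalgebra k B] [Module H B] [IsScalarTower k H B]
  [Ring C] [Algebra k C] [Coalgebra k C] [Module H C] [IsScalarTower k H C]
variable {X Y : Type*} [Ring X] [Algebra k X] [Ring Y] [Algebra k Y]
variable {R : (H ⊗[k] H)ˣ}

theorem Triple.bos (hC : BrBialg R (Coalgebra.comul (R := k) (A := C)) Coalgebra.counit)
    (hB : BrBialg R (Coalgebra.comul (R := k) (A := B)) Coalgebra.counit)
    (hR : IsUniversalRMatrix R) {mB : B ⊗[k] B →ₗ[k] B}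
    {mC : C ⊗[k] C →ₗ[k] C} (hmB : ColinearMul R Coalgebra.comul mB)
    (hmC : ColinearMul (revR R) (braidInv R ∘ₗ Coalgebra.comul) mC)
    {ι : H →ₐ[k] X} {ι' : H →ₐ[k] Y} {jB : B →ₗ[k] X} {jC : C →ₗ[k] X} {jB' : B →ₗ[k] Y}
    {jC' : C →ₗ[k] Y} (hX : Triple (LinearMap.mul' k B) (LinearMap.mul' k C) ι jB jC)
    (hY : Triple mB mC ι' jB' jC') :
    Triple mB mC (diag ι ι') (bos R Coalgebra.comul ι jB jB')
      (bos (revR R) (braidInv R ∘ₗ Coalgebra.comul) ι jC jC') :=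
  ⟨Half.bos hB hR hmB hX.left hY.left, Half.bos (hC.cop hR) hR.revR hmC hX.right hY.right⟩

variable (ev : C ⊗[k] B →ₗ[k] k)
  (hC : BrBialg R (Coalgebra.comul (R := k) (A := C)) Coalgebra.counit)
  (hB : BrBialg R (Coalgebra.comul (R := k) (A := B)) Coalgebra.counit)
  (hR : IsUniversalRMatrix R)

namespace Drin

/-- The coproduct of the braided Drinfeld double. -/
noncomputable def comul : Drin R ev →ₐ[k] Drin R ev ⊗[k] Drin R ev :=
  lift (Triple.bos hC hB hR hB.colinearMul_mul' (hC.cop hR).colinearMul_mul' (triple R ev)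
    (triple R ev))
    (DoubleRel.bos hC hB hR (cov_inB R ev) (cov_inC R ev) (doubleRel R ev) (doubleRel R ev))

theorem comul_inB (b : B) : comul ev hC hB hR (inB R ev b) =
    bos R Coalgebra.comul (inHAlg R ev) (inB R ev) (inB R ev) b := lift_inB _ _ _

theorem comul_inC (c : C) : comul ev hC hB hR (inC R ev c) =
    bos (revR R) (braidInv R ∘ₗ Coalgebra.comul) (inHAlg R ev) (inC R ev) (inC R ev) c :=
  lift_inC _ _ _

theorem comul_inH (h : H) : comul ev hC hB hR (inH R ev h) =
    diag (inHAlg R ev) (inHAlg R ev) h := lift_inH _ _ _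

theorem half_counit {V : Type*} [Ring V] [Algebra k V] [Module H V] [IsScalarTower k H V]
    {R : (H ⊗[k] H)ˣ} {Δ : V →ₗ[k] V ⊗[k] V} {ε : V →ₗ[k] k} (hV : BrBialg R Δ ε) :
    Half (LinearMap.mul' k V) (Bialgebra.counitAlgHom k H) ε where
  cov h v := by
    simp only [hV.counit_smul, Bialgebra.counitAlgHom_apply]
    rw [← sw_comul_counit (k := k) h (fun x => Coalgebra.counit (R := k) x * ε v) (by fun_prop)]
    exact sw_congr fun _ _ => by rw [smul_eq_mul]; ring
  mul b b' := by rw [LinearMap.mul'_apply, hV.counit_mul]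
  one := hV.counit_one

/-- The counit of the braided Drinfeld double. -/
noncomputable def counit : Drin R ev →ₐ[k] k :=
  lift (ι := Bialgebra.counitAlgHom k H) (jB := Coalgebra.counit) (jC := Coalgebra.counit)
    ⟨half_counit hB, half_counit hC⟩ (fun c b => by
      -- Under the counits both sides of the cross relation collapse to ev(c, b).
      unfold evL evR revProd
      simp only [hB.counit_smul, hC.counit_smul, Bialgebra.counitAlgHom_apply]
      have e1 : ∀ x y z w : k, x * y * (z * w) = z • x • (y * w) := fun x y z w => by
        simp only [smul_eq_mul]; ring
      have e2 : ∀ x y z w v : k, x • (y * (z * w) * v) = v • y • z • w • x := fun x y z w v => by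
        simp only [smul_eq_mul]; ring
      simp (disch := fun_prop) only [e1, e2, sw_counit_R hR.revR, sw_R_counit hR,
        sw_R_counit hR.revR, Bialgebra.counit_one, one_smul]
      have e3 : ∀ x y z : k, x • (y * z) = y • z • x := fun x y z => by
        simp only [smul_eq_mul]; ring
      simp (disch := fun_prop) only [e3, hB.sw_counit_right, hC.sw_counit_left, ← smul_sw,
        hB.sw_counit_left, hC.sw_counit_right])

@[simp]
theorem counit_inB (b : B) : counit ev hC hB hR (inB R ev b) = Coalgebra.counit (R := k) b := lift_inB _ _ _

@[simp]
theorem counit_inC (c : C) : counit ev hC hB hR (inC R ev c) = Coalgebra.counit (R := k) c :=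
  lift_inC _ _ _

@[simp]
theorem counit_inH (h : H) : counit ev hC hB hR (inH R ev h) = Coalgebra.counit (R := k) h :=
  lift_inH _ _ _

end Drin

/-- The bialgebra structure of the braided Drinfeld double. -/
noncomputable def drinBialgebra : DrinBialgebra R ev where
  comul := Drin.comul ev hC hB hR
  counit := Drin.counit ev hC hB hR
  comul_H h := by
    rw [Drin.comul_inH, diag_apply]
    conv_rhs => rw [eq_sw (Coalgebra.comul (R := k) h), map_sw]
    rfl
  comul_B b := by
    rw [Drin.comul_inB, bos_eq_sw, ← Drin.inHAlg_toLinearMap, deltaB_eq]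
    simp only [map_sw, LinearMap.lTensor_tmul]
  comul_C c := by
    rw [Drin.comul_inC, bos_cop hR (Drin.cov_inC R ev), ← Drin.inHAlg_toLinearMap, deltaC_eq]
    simp only [map_sw, LinearMap.lTensor_tmul]
  counit_H := Drin.counit_inH ev hC hB hR
  counit_B := Drin.counit_inB ev hC hB hR
  counit_C := Drin.counit_inC ev hC hB hR
  coassoc x := by
    have : ((Algebra.TensorProduct.assoc k k k _ _ _).toAlgHom.comp (Algebra.TensorProduct.map
      (Drin.comul ev hC hB hR) (AlgHom.id k _))).comp (Drin.comul ev hC hB hR) =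
      (Algebra.TensorProduct.map (AlgHom.id k _) (Drin.comul ev hC hB hR)).comp
        (Drin.comul ev hC hB hR) := by
      have eB : (Drin.comul ev hC hB hR).toLinearMap ∘ₗ inB R ev =
        bos R Coalgebra.comul (Drin.inHAlg R ev) (inB R ev) (inB R ev) :=
        LinearMap.ext (Drin.comul_inB ev hC hB hR)
      have eC : (Drin.comul ev hC hB hR).toLinearMap ∘ₗ inC R ev =
        bos (revR R) (braidInv R ∘ₗ Coalgebra.comul) (Drin.inHAlg R ev) (inC R ev) (inC R ev) :=
        LinearMap.ext (Drin.comul_inC ev hC hB hR)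
      have eH : (Drin.comul ev hC hB hR).comp (Drin.inHAlg R ev) =
        diag (Drin.inHAlg R ev) (Drin.inHAlg R ev) :=
        AlgHom.ext (Drin.comul_inH ev hC hB hR)
      refine Drin.algHom_ext (fun b => ?_) (fun h => ?_) (fun c => ?_)
      · simp only [AlgHom.comp_apply, Drin.comul_inB]
        rw [map_bos, map_bos, eB, eH]
        exact assoc_bos hR hB.comul_smul hB.coassoc b
      · simp only [AlgHom.comp_apply, Drin.comul_inH]
        rw [map_diag, map_diag, eH]
        exact assoc_diag h
      · simp only [AlgHom.comp_apply, Drin.comul_inC]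
        rw [map_bos, map_bos, eC, eH]
        exact assoc_bos hR.revR (hC.cop hR).comul_smul (hC.cop hR).coassoc c
    exact AlgHom.congr_fun this x
  counit_left x := by
    have : ((Algebra.TensorProduct.lid k _).toAlgHom.comp (Algebra.TensorProduct.map
      (Drin.counit ev hC hB hR) (AlgHom.id k _))).comp (Drin.comul ev hC hB hR) = AlgHom.id k _ := by
      refine Drin.algHom_ext (fun b => ?_) (fun h => ?_) (fun c => ?_)
      · rw [AlgHom.comp_apply, Drin.comul_inB]
        exact lid_bos hR hB.counit_left _ (Drin.counit_inH ev hC hB hR)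
          (Drin.counit_inB ev hC hB hR) b
      · rw [AlgHom.comp_apply, Drin.comul_inH]
        exact lid_diag _ (Drin.counit_inH ev hC hB hR) h
      · rw [AlgHom.comp_apply, Drin.comul_inC]
        exact lid_bos hR.revR (hC.cop hR).counit_left _ (Drin.counit_inH ev hC hB hR)
          (Drin.counit_inC ev hC hB hR) c
    exact AlgHom.congr_fun this x
  counit_right x := by
    have : ((Algebra.TensorProduct.rid k k _).toAlgHom.comp (Algebra.TensorProduct.map
      (AlgHom.id k _) (Drin.counit ev hC hB hR))).comp (Drin.comul ev hC hB hR) = AlgHom.id k _ := by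
      refine Drin.algHom_ext (fun b => ?_) (fun h => ?_) (fun c => ?_)
      · rw [AlgHom.comp_apply, Drin.comul_inB]
        exact rid_bos hR hB.counit_right hB.counit_smul _
          (Drin.counit_inB ev hC hB hR) b
      · rw [AlgHom.comp_apply, Drin.comul_inH]
        exact rid_diag _ (Drin.counit_inH ev hC hB hR) h
      · rw [AlgHom.comp_apply, Drin.comul_inC]
        exact rid_bos hR.revR (hC.cop hR).counit_right hC.counit_smul _
          (Drin.counit_inC ev hC hB hR) c
    exact AlgHom.congr_fun this x

theorem DrinBialgebra.eq (D D' : DrinBialgebra R ev) : D = D' := by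
  refine DrinBialgebra.ext (Drin.algHom_ext (fun b => ?_) (fun h => ?_) fun c => ?_)
    (Drin.algHom_ext (fun b => ?_) (fun h => ?_) fun c => ?_)
  · rw [D.comul_B, D'.comul_B]
  · rw [D.comul_H, D'.comul_H]
  · rw [D.comul_C, D'.comul_C]
  · rw [D.counit_B, D'.counit_B]
  · rw [D.counit_H, D'.counit_H]
  · rw [D.counit_C, D'.counit_C]

end
end
end BraidedDouble

/-! ### The cross map as a distributive law -/

namespace BraidedDouble
section
variable {k H : Type*} [Field k] [Ring H] [HopfAlgebra k H]
variable {B C : Type*}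
  [Ring B] [Algebra k B] [Coalgebra k B] [Module H B] [IsScalarTower k H B]
  [Ring C] [Algebra k C] [Coalgebra k C] [Module H C] [IsScalarTower k H C]
variable {Z : Type*} [AddCommGroup Z] [Module k Z]
variable {R : (H ⊗[k] H)ˣ} {ev : C ⊗[k] B →ₗ[k] k}

theorem sw_ksmul {V W : Type*} [AddCommGroup V] [Module k V] [AddCommGroup W] [Module k W] (a : k)
    (t : V ⊗[k] W) (f : V → W → Z) (h1 : ∀ b, Lin k (fun a => f a b))
    (h2 : ∀ a, Lin k (fun b => f a b)) : sw (a • t) f = a • sw t f :=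
  (by fun_prop : Lin k fun t => sw t f).2 a t

section transfer
variable (hev : IsInvariant₂ H ev) (hR : IsUniversalRMatrix R)
include hev hR

/-- The hexagon merges the two acting legs into a diagonal action, invariance of `ev` replaces that
by a counit, and a counit on one leg of an R-matrix leaves 1 on the other. -/
theorem ev_collapse (c : C) (b : B) (f : H → Z) (hf : Lin k f) :
    sw (revR R : H ⊗[k] H) (fun p q => sw (revR R : H ⊗[k] H) fun p' q' =>
      ev ((p • c) ⊗ₜ (p' • b)) • f (q * q')) = ev (c ⊗ₜ b) • f 1 := by
  rw [← sw_hexL hR.revR (fun p p' q => ev ((p • c) ⊗ₜ (p' • b)) • f q) (by fun_prop) (by fun_prop)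
    (by fun_prop)]
  simp only [← ksw_smul, hev.sw, mul_smul]
  exact sw_counit_R hR.revR (fun q => ev (c ⊗ₜ b) • f q) (by fun_prop)

theorem ev_collapse' (c : C) (b : B) (f : H → Z) (hf : Lin k f) :
    sw (revR R : H ⊗[k] H) (fun p q => sw (revR R : H ⊗[k] H) fun p' q' =>
      ev ((q' • c) ⊗ₜ (q • b)) • f (p * p')) = ev (c ⊗ₜ b) • f 1 := by
  rw [← sw_hexR hR.revR (fun p q q' => ev ((q • c) ⊗ₜ (q' • b)) • f p) (by fun_prop) (by fun_prop)
    (by fun_prop)]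
  simp only [← ksw_smul, hev.sw, mul_smul]
  exact sw_R_counit hR.revR (fun q => ev (c ⊗ₜ b) • f q) (by fun_prop)

/-- Invariance moves an action from one argument of `ev` to the other at the price of an antipode.
For an R-matrix leg that antipode only exchanges R with its reverse, so none has to be written. -/
theorem ev_transfer (c : C) (b : B) (f : H → Z) (hf : Lin k f) :
    sw (revR R : H ⊗[k] H) (fun p q => ev ((p • c) ⊗ₜ b) • f q) =
      sw (R : H ⊗[k] H) fun r s => ev (c ⊗ₜ (s • b)) • f r := by
  -- Two reversed copies are inserted free of charge, one of which will cancel R.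
  have h : ∀ r s : H, ev (c ⊗ₜ (s • b)) • f r =
      sw (revR R : H ⊗[k] H) fun p q => sw (revR R : H ⊗[k] H) fun p' q' =>
        ev ((p • c) ⊗ₜ ((p' * s) • b)) • f (q * (q' * r)) := fun r s => by
    have := ev_collapse hev hR c (s • b) (fun x => f (x * r)) (by fun_prop)
    simp only [one_mul] at this
    simp only [← this, smul_smul, mul_assoc]
  simp only [h]
  rw [← sw_rot]
  refine sw_congr fun p q => ?_
  rw [sw_rev_cancel R (fun x y => ev ((p • c) ⊗ₜ (y • b)) • f (q * x)) (by fun_prop) (by fun_prop)]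
  simp

end transfer

theorem ev_absorb (hev : IsInvariant₂ H ev) (hR : IsUniversalRMatrix R) (c : C) (b : B)
    (f : H → H → Z) (h1 : ∀ b, Lin k (fun a => f a b)) (h2 : ∀ a, Lin k (fun b => f a b)) :
    sw (revR R : H ⊗[k] H) (fun u v => sw (revR R : H ⊗[k] H) fun p q =>
      sw (Coalgebra.comul (R := k) q) fun x y => ev ((v • c) ⊗ₜ (x • b)) • f (p * u) y) =
    sw (revR R : H ⊗[k] H) fun p q => ev (c ⊗ₜ b) • f p q := by
  simp (disch := fun_prop) only [sw_hexR hR.revR]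
  rw [← sw_rot]
  refine sw_congr fun p q => ?_
  simp only [mul_assoc]
  rw [ev_collapse' hev hR c b (fun x => f (p * x) q) (by fun_prop), mul_one]

section cross
variable (hC : BrBialg R (Coalgebra.comul (R := k) (A := C)) Coalgebra.counit)
  (hB : BrBialg R (Coalgebra.comul (R := k) (A := B)) Coalgebra.counit)

variable (R ev) in
theorem sw_cross (c : C) (b : B) (f : B → C → Z) (h1 : ∀ b, Lin k (fun a => f a b))
    (h2 : ∀ a, Lin k (fun b => f a b)) :
    sw (cross R ev (c ⊗ₜ b)) f = sw (Coalgebra.comul (R := k) c) fun c₁ c₂ =>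
      sw (Coalgebra.comul (R := k) b) fun b₁ b₂ => sw (revR R : H ⊗[k] H) fun p q =>
        ev (c₂ ⊗ₜ b₁) • f (q • b₂) (p • c₁) := by
  rw [cross_tmul]
  simp (disch := fun_prop) only [sw_sw, sw_ksmul, sw_tmul]

include hC hB

/-- The parts of `h` acting on the paired legs vanish by invariance; the remaining two pass the
braiding by quasi-cocommutativity. -/
theorem cross_smul (hev : IsInvariant₂ H ev) (hR : IsUniversalRMatrix R) (h : H) (c : C) (b : B)
    (f : B → C → Z) (h1 : ∀ b, Lin k (fun a => f a b)) (h2 : ∀ a, Lin k (fun b => f a b)) :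
    sw (Coalgebra.comul (R := k) h) (fun x y => sw (cross R ev (c ⊗ₜ b)) fun u v =>
      f (x • u) (y • v)) =
    sw (Coalgebra.comul (R := k) h) (fun x y => sw (cross R ev ((x • c) ⊗ₜ (y • b))) f) := by
  simp (disch := fun_prop) only [sw_cross, hC.sw_comul_smul, hB.sw_comul_smul, smul_smul]
  simp only [sw_comm (Coalgebra.comul (R := k) (_ : H)) (Coalgebra.comul (R := k) (_ : C)),
    sw_comm (Coalgebra.comul (R := k) (_ : H)) (Coalgebra.comul (R := k) (_ : B))]
  refine sw_congr fun c₁ c₂ => sw_congr fun b₁ b₂ => ?_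
  simp (disch := fun_prop) only [sw_comul_comul]
  conv_rhs =>
    enter [2, a, b]
    rw [← sw_comul_comul b (fun c d e => sw (revR R : H ⊗[k] H) fun p q =>
      ev ((c • c₂) ⊗ₜ[k] (d • b₁)) • f ((q * e) • b₂) ((p * a) • c₁)) (by fun_prop) (by fun_prop)
      (by fun_prop)]
    simp only [← smul_sw, ← ksw_smul, hev.sw, mul_smul]
    rw [sw_counit_comul b (fun e => ev (c₂ ⊗ₜ[k] b₁) • sw (revR R : H ⊗[k] H) fun p q =>
      f (q • e • b₂) (p • a • c₁)) (by fun_prop)]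
  simp only [← smul_sw]
  congr 1
  rw [sw_comm]
  conv_rhs => rw [sw_comm]
  simp only [smul_smul]
  exact (sw_qc hR.revR h (fun x y => f (y • b₂) (x • c₁)) (by fun_prop) (by fun_prop)).symm

/-- Passing a product means passing its factors in turn. The pairing meets only the first leg of the
coproduct, where a colinear product is the ordinary one, so multiplicativity of `ev` applies
whatever `mB` is. -/
theorem cross_mul_right (hev : IsInvariant₂ H ev) (hR : IsUniversalRMatrix R)
    (hmul : ∀ c b b', ev (c ⊗ₜ (b * b')) = sw (Coalgebra.comul (R := k) c) fun c₁ c₂ =>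
      ev (c₂ ⊗ₜ b) * ev (c₁ ⊗ₜ b')) {mB : B ⊗[k] B →ₗ[k] B}
    (hm : ColinearMul R Coalgebra.comul mB) (c : C) (b b' : B) :
    cross R ev (c ⊗ₜ mB (b ⊗ₜ b')) = sw (cross R ev (c ⊗ₜ b)) fun u v =>
      sw (cross R ev (v ⊗ₜ b')) fun u' v' => mB (u ⊗ₜ u') ⊗ₜ v' := by
  have hQ := hR.revR
  simp (disch := fun_prop) only [sw_cross]
  rw [cross_tmul]
  simp (disch := fun_prop) only [hm.comul, sw_sw, sw_tmul, hmul, ksw_smul, hm.smul, hC.sw_comul_smul, smul_sw, sw_tmul_left]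
  simp only [sw_comm (R : H ⊗[k] H) (Coalgebra.comul (R := k) (_ : C)),
    sw_comm (Coalgebra.comul (R := k) (_ : B)) (Coalgebra.comul (R := k) (_ : C)),
    sw_comm (revR R : H ⊗[k] H) (Coalgebra.comul (R := k) (_ : C)),
    sw_comm (revR R : H ⊗[k] H) (Coalgebra.comul (R := k) (_ : B)),
    sw_comm (Coalgebra.comul (R := k) (_ : H)) (Coalgebra.comul (R := k) (_ : C)),
    sw_comm (Coalgebra.comul (R := k) (_ : H)) (Coalgebra.comul (R := k) (_ : B))]
  simp (disch := fun_prop) only [hC.sw_coassoc]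
  refine sw_congr fun c₁ c₂ => sw_congr fun c₃ c₄ => sw_congr fun b₁ b₂ => sw_congr fun b₃ b₄ => ?_
  simp (disch := fun_prop) only [sw_hexL hQ, sw_hexR hQ, smul_smul]
  simp only [mul_comm (ev (c₄ ⊗ₜ[k] b₁))]
  -- On the right-hand side a reversed copy acting on c₃ becomes a copy of R acting on b₃. This is
  -- the braiding that the coproduct of `mB` shows on the left.
  have key := fun p q x y : H => ev_transfer hev hR c₃ b₃ (fun r => ev (c₄ ⊗ₜ b₁) •
      (mB (((q * r) • b₂) ⊗ₜ (y • b₄)) ⊗ₜ[k] ((x * p) • c₁))) (by fun_prop)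
  simp only [smul_smul] at key
  conv_rhs =>
    enter [2, p, q]; rw [sw_comm]; enter [2, x, y]
    rw [key]
  rw [← sw_rot]
  exact sw_comm _ _ _

omit hC in
/-- The cross map in terms of the co-opposite coproduct. -/
theorem sw_cross_cop (hev : IsInvariant₂ H ev) (hR : IsUniversalRMatrix R) (c : C) (b : B)
    (f : B → C → Z) (h1 : ∀ b, Lin k (fun a => f a b)) (h2 : ∀ a, Lin k (fun b => f a b)) :
    sw (cross R ev (c ⊗ₜ b)) f = sw ((braidInv R ∘ₗ Coalgebra.comul) c) fun c₁ c₂ =>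
      sw (revR R : H ⊗[k] H) fun p q => sw (Coalgebra.comul (R := k) (q • b)) fun b₁ b₂ =>
        ev (c₁ ⊗ₜ b₁) • f b₂ (p • c₂) := by
  have hQ := hR.revR
  simp (disch := fun_prop) only [sw_cross, sw_cop, hB.sw_comul_smul]
  simp only [sw_comm (Coalgebra.comul (R := k) (_ : H)) (Coalgebra.comul (R := k) (_ : B)),
    sw_comm (revR R : H ⊗[k] H) (Coalgebra.comul (R := k) (_ : B))]
  refine sw_congr fun c₁ c₂ => sw_congr fun b₁ b₂ => ?_
  simp (disch := fun_prop) only [sw_hexR hQ, smul_smul]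
  rw [← sw_rot]
  simp only [mul_assoc]
  conv_rhs =>
    enter [2, p, q]
    rw [ev_collapse' hev hR c₂ b₁ (fun x => f (q • b₂) ((p * x) • c₁)) (by fun_prop)]
  simp only [mul_one]

include hB in
-- The mirror image of `cross_mul_right`. Since `mC` is colinear for the co-opposite coproduct, the
-- cross map is first rewritten with it, so that the pairing again meets a leg carrying the ordinary
-- product.
theorem cross_mul_left (hev : IsInvariant₂ H ev) (hR : IsUniversalRMatrix R)
    (hmul : ∀ c c' b, ev ((c * c') ⊗ₜ b) = sw (Coalgebra.comul (R := k) b) fun b₁ b₂ =>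
      ev (c' ⊗ₜ b₁) * ev (c ⊗ₜ b₂)) {mC : C ⊗[k] C →ₗ[k] C}
    (hm : ColinearMul (revR R) (braidInv R ∘ₗ Coalgebra.comul) mC) (c c' : C) (b : B) :
    cross R ev (mC (c ⊗ₜ c') ⊗ₜ b) = sw (cross R ev (c' ⊗ₜ b)) fun u v =>
      sw (cross R ev (c ⊗ₜ u)) fun u' v' => u' ⊗ₜ mC (v' ⊗ₜ v) := by
  have hQ := hR.revR
  rw [eq_sw (cross R ev (mC (c ⊗ₜ c') ⊗ₜ b))]
  simp (disch := fun_prop) only [sw_cross_cop hB hev hR]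
  simp (disch := fun_prop) only [hm.comul, sw_sw, sw_tmul, hmul, ksw_smul, hm.smul, hB.sw_comul_smul, smul_sw, tmul_sw]
  generalize (braidInv R ∘ₗ Coalgebra.comul : C →ₗ[k] C ⊗[k] C) = Δ'
  simp only [sw_comm (Coalgebra.comul (R := k) (_ : H)) (Coalgebra.comul (R := k) (_ : B)),
    sw_comm (revR R : H ⊗[k] H) (Coalgebra.comul (R := k) (_ : B)),
    sw_comm (revR R : H ⊗[k] H) (Δ' _),
    sw_comm (Coalgebra.comul (R := k) (_ : H)) (Δ' _),
    sw_comm (Coalgebra.comul (R := k) (_ : B)) (Δ' _)]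
  simp (disch := fun_prop) only [hB.sw_coassoc]
  rw [sw_comm]
  refine sw_congr fun c₁' c₂' => sw_congr fun c₁ c₂ => sw_congr fun b₁ b₂ => sw_congr fun b₃ b₄ => ?_
  simp only [sw_comm (Coalgebra.comul (R := k) (_ : H)) (revR R : H ⊗[k] H)]
  conv_lhs => enter [2, u, v, 2, p, q, 2, x, y]; rw [sw_comm]
  simp (disch := fun_prop) only [sw_comul_comul]
  conv_lhs => enter [2, u, v, 2, p, q]; simp only [sw_comm _ (Coalgebra.comul (R := k) p)]
  simp (disch := fun_prop) only [sw_hexL hQ]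
  simp (disch := fun_prop) only [sw_comulH_mul, smul_smul]
  have key := fun c d e g : H => ev_absorb hev hR c₁' (d • b₁) (fun p y =>
    sw (Coalgebra.comul (R := k) y) fun m n => ev (c₁ ⊗ₜ ((m * e) • b₃)) •
      (((n * g) • b₄) ⊗ₜ[k] mC ((p • c₂) ⊗ₜ (c • c₂')))) (by fun_prop) (by fun_prop)
  simp only [smul_smul, smul_sw] at key
  rw [sw_rot]
  refine sw_congr fun c d => ?_
  conv_lhs =>
    simp only [sw_comm _ (Coalgebra.comul (R := k) d)]
    enter [2, x, y]
    simp only [sw_comm _ (Coalgebra.comul (R := k) y)]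
    enter [2, m, n]
    rw [key]
  simp only [sw_comm (revR R : H ⊗[k] H) (Coalgebra.comul (R := k) (_ : H))]
  refine sw_congr fun _ _ => ?_
  rw [sw_comm]
  refine sw_congr fun _ _ => ?_
  rw [sw_comm]

theorem cross_one_left (hR : IsUniversalRMatrix R)
    (h1 : ∀ b, ev (1 ⊗ₜ b) = Coalgebra.counit (R := k) b) (b : B) :
    cross R ev (1 ⊗ₜ b) = b ⊗ₜ 1 := by
  rw [cross_tmul, hC.comul_one]
  simp (disch := fun_prop) only [sw_tmul, h1, hC.smul_one, TensorProduct.tmul_smul]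
  simp (disch := fun_prop) only [← smul_sw, sw_counit_R hR.revR, one_smul, hB.sw_counit_left]

theorem cross_one_right (hR : IsUniversalRMatrix R)
    (h1 : ∀ c, ev (c ⊗ₜ 1) = Coalgebra.counit (R := k) c) (c : C) :
    cross R ev (c ⊗ₜ 1) = 1 ⊗ₜ c := by
  rw [cross_tmul, hB.comul_one]
  simp (disch := fun_prop) only [sw_tmul, h1, hB.smul_one]
  simp only [← TensorProduct.smul_tmul' _ (1 : B)]
  simp (disch := fun_prop) only [← smul_sw, sw_R_counit hR.revR, one_smul, hC.sw_counit_right]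

end cross
end
end BraidedDouble

/-! ### The Fock representation and the vacuum expectation -/

namespace BraidedDouble
section
variable {k H : Type*} [Field k] [Ring H] [HopfAlgebra k H]

/-- An associative unital colinear product. -/
structure UnitalColinear {B : Type*} [Ring B] [Algebra k B] [Module H B] [IsScalarTower k H B]
    (R : (H ⊗[k] H)ˣ) (Δ : B →ₗ[k] B ⊗[k] B) (m : B ⊗[k] B →ₗ[k] B) : Prop
    extends ColinearMul R Δ m where
  assoc : ∀ a b c, m (a ⊗ₜ m (b ⊗ₜ c)) = m (m (a ⊗ₜ b) ⊗ₜ c)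
  one_left : ∀ a, m (1 ⊗ₜ a) = a
  one_right : ∀ a, m (a ⊗ₜ 1) = a

namespace BrBialg
variable {B : Type*} [Ring B] [Algebra k B] [Module H B] [IsScalarTower k H B]
variable {R : (H ⊗[k] H)ˣ} {Δ : B →ₗ[k] B ⊗[k] B} {ε : B →ₗ[k] k} (hB : BrBialg R Δ ε)
include hB

theorem unitalColinear_mul' : UnitalColinear R Δ (LinearMap.mul' k B) where
  toColinearMul := hB.colinearMul_mul'
  assoc a b c := by simp only [LinearMap.mul'_apply, mul_assoc]
  one_left a := by rw [LinearMap.mul'_apply, one_mul]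
  one_right a := by rw [LinearMap.mul'_apply, mul_one]

theorem unitalColinear_twistMul (hR : IsUniversalRMatrix R) {σ : B ⊗[k] B →ₗ[k] k}
    (hσ : IsTwoCocycle H Δ ε (braid R) σ) : UnitalColinear R Δ (twistMul Δ (braid R) σ) where
  toColinearMul := hB.colinearMul_twistMul hR hσ.invariant
  assoc a b c := hB.twistMul_assoc hR hσ a b c
  one_left a := hB.twistMul_one_left hR hσ.one_left a
  one_right a := hB.twistMul_one_right hR hσ.one_right a

end BrBialg

variable {B C : Type*}
  [Ring B] [Algebra k B] [Coalgebra k B] [Module H B] [IsScalarTower k H B]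
  [Ring C] [Algebra k C] [Coalgebra k C] [Module H C] [IsScalarTower k H C]

/-- The properties of a weak duality pairing, elementwise. -/
structure PairingLaws (ev : C ⊗[k] B →ₗ[k] k) : Prop where
  invariant : IsInvariant₂ H ev
  mul_left : ∀ c c' b, ev ((c * c') ⊗ₜ b) = sw (Coalgebra.comul (R := k) b) fun b₁ b₂ =>
    ev (c' ⊗ₜ b₁) * ev (c ⊗ₜ b₂)
  mul_right : ∀ c b b', ev (c ⊗ₜ (b * b')) = sw (Coalgebra.comul (R := k) c) fun c₁ c₂ =>
    ev (c₂ ⊗ₜ b) * ev (c₁ ⊗ₜ b')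
  one_left : ∀ b : B, ev (1 ⊗ₜ b) = Coalgebra.counit (R := k) b
  one_right : ∀ c : C, ev (c ⊗ₜ 1) = Coalgebra.counit (R := k) c

theorem IsWeakDuality.laws {R : (H ⊗[k] H)ˣ} {hC : BraidedHopf R C} {hB : BraidedHopf R B}
    {ev : C ⊗[k] B →ₗ[k] k} (hev : IsWeakDuality hC hB ev) : PairingLaws (H := H) ev where
  invariant := hev.invariant
  mul_left c c' b := by
    have := hev.mul_left (c ⊗ₜ c') b
    rw [LinearMap.mul'_apply] at this
    rw [this]
    conv_lhs => rw [eq_sw (Coalgebra.comul (R := k) b)]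
    simp only [tmul_sw, map_sw, contract_tmul, map_smul, smul_eq_mul]
  mul_right c b b' := by
    have := hev.mul_right c (b ⊗ₜ b')
    rw [LinearMap.mul'_apply] at this
    rw [this]
    conv_lhs => rw [eq_sw (Coalgebra.comul (R := k) c)]
    simp only [sw_tmul_left, map_sw, contract_tmul, map_smul, smul_eq_mul]
  one_left := hev.one_left
  one_right := hev.one_right

section fock
variable (R : (H ⊗[k] H)ˣ) (ev : C ⊗[k] B →ₗ[k] k) (mB : B ⊗[k] B →ₗ[k] B)
  (mC : C ⊗[k] C →ₗ[k] C)

/-- The diagonal action of `H` on `B ⊗ C`. -/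
noncomputable def fockH : H →ₐ[k] Module.End k (B ⊗[k] C) :=
  (Module.endTensorEndAlgHom (R := k) (S := k) (A := k)).comp
    (diag (Algebra.lsmul k k B) (Algebra.lsmul k k C))

/-- The action of `B` on `B ⊗ C` by multiplication. -/
noncomputable def fockB : B →ₗ[k] Module.End k (B ⊗[k] C) :=
  LinearMap.rTensorHom C ∘ₗ TensorProduct.curry mB

/-- The action of `C` on `B ⊗ C` by the cross map and multiplication. -/
noncomputable def fockC : C →ₗ[k] Module.End k (B ⊗[k] C) :=
  LinearMap.compRight k (LinearMap.lTensor B mC ∘ₗ (TensorProduct.assoc k B C C).toLinearMap) ∘ₗ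
    LinearMap.rTensorHom C ∘ₗ TensorProduct.curry (cross R ev)

theorem fockH_tmul (h : H) (b : B) (c : C) : fockH (k := k) h (b ⊗ₜ c) =
    sw (Coalgebra.comul (R := k) h) fun x y => (x • b) ⊗ₜ (y • c) := by
  rw [fockH, AlgHom.comp_apply, diag_apply, map_sw]
  simp only [sw, LinearMap.sum_apply]
  rfl

theorem fockB_tmul (b b' : B) (c : C) : fockB (C := C) mB b (b' ⊗ₜ c) = mB (b ⊗ₜ b') ⊗ₜ c := rfl

theorem fockC_tmul (c : C) (b : B) (c' : C) : fockC R ev mC c (b ⊗ₜ c') =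
    sw (cross R ev (c ⊗ₜ b)) fun u v => u ⊗ₜ mC (v ⊗ₜ c') := by
  change LinearMap.lTensor B mC (TensorProduct.assoc k B C C (cross R ev (c ⊗ₜ b) ⊗ₜ c')) = _
  conv_lhs => rw [eq_sw (cross R ev (c ⊗ₜ b))]
  simp only [sw_tmul_left, map_sw]
  rfl

variable {R ev mB mC}
variable (hC : BrBialg R (Coalgebra.comul (R := k) (A := C)) Coalgebra.counit)
  (hB : BrBialg R (Coalgebra.comul (R := k) (A := B)) Coalgebra.counit)
  (hev : PairingLaws (H := H) ev) (hR : IsUniversalRMatrix R)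
  (hmB : UnitalColinear R Coalgebra.comul mB)
  (hmC : UnitalColinear (revR R) (braidInv R ∘ₗ Coalgebra.comul) mC)

include hmB in
theorem half_fockB : Half mB (fockH (k := k) (H := H) (B := B) (C := C)) (fockB (C := C) mB) where
  cov h b := by
    ext b' c
    simp only [TensorProduct.AlgebraTensorModule.curry_apply, TensorProduct.curry_apply,
      LinearMap.coe_restrictScalars, Module.End.mul_apply, fockB_tmul, fockH_tmul, hmB.smul,
      sw_tmul_left]
    simp (disch := fun_prop) only [sw_comul_comul]
    simp only [sw, LinearMap.sum_apply, Module.End.mul_apply]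
    refine Finset.sum_congr rfl fun i _ => ?_
    rw [fockH_tmul, map_sw]
    rfl
  mul b b' := by
    ext x c
    simp only [TensorProduct.AlgebraTensorModule.curry_apply, TensorProduct.curry_apply,
      LinearMap.coe_restrictScalars, Module.End.mul_apply, fockB_tmul, hmB.assoc]
  one := by
    ext x c
    simp only [TensorProduct.AlgebraTensorModule.curry_apply, TensorProduct.curry_apply,
      LinearMap.coe_restrictScalars, fockB_tmul, hmB.one_left, Module.End.one_apply]

include hC hB hev hR hmC in
-- Covariance, multiplicativity and unitality of this action are H-linearity of the cross map, its
-- compatibility with `mC` and its value at 1.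
theorem half_fockC : Half mC (fockH (k := k) (H := H) (B := B) (C := C)) (fockC R ev mC) where
  cov h c := by
    ext b c'
    simp only [TensorProduct.AlgebraTensorModule.curry_apply, TensorProduct.curry_apply,
      LinearMap.coe_restrictScalars, Module.End.mul_apply, fockC_tmul, fockH_tmul, hmC.smul,
      map_sw, tmul_sw]
    rw [sw_comm]
    simp only [sw_comm (cross R ev _)]
    rw [← sw_comul_comul h (fun x p q => sw (cross R ev (c ⊗ₜ b)) fun u v =>
      (x • u) ⊗ₜ[k] mC ((p • v) ⊗ₜ (q • c'))) (by fun_prop) (by fun_prop) (by fun_prop)]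
    have e := fun g q : H => cross_smul hC hB hev.invariant hR g c b
      (fun u v => u ⊗ₜ[k] mC (v ⊗ₜ (q • c'))) (by fun_prop) (by fun_prop)
    simp only [e]
    rw [sw_comul_comul h (fun x p q => sw (cross R ev ((x • c) ⊗ₜ (p • b))) fun u v =>
      u ⊗ₜ[k] mC (v ⊗ₜ (q • c'))) (by fun_prop) (by fun_prop) (by fun_prop)]
    simp only [sw, LinearMap.sum_apply, Module.End.mul_apply]
    refine Finset.sum_congr rfl fun i _ => ?_
    rw [fockH_tmul, map_sw]
    simp only [fockC_tmul]
    rfl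
  mul c c' := by
    ext b x
    simp only [TensorProduct.AlgebraTensorModule.curry_apply, TensorProduct.curry_apply,
      LinearMap.coe_restrictScalars, Module.End.mul_apply, fockC_tmul, hmC.assoc, map_sw,
      cross_mul_left hC hB hev.invariant hR hev.mul_left hmC.toColinearMul]
    simp (disch := fun_prop) only [sw_sw, sw_tmul]
  one := by
    ext x c
    simp only [TensorProduct.AlgebraTensorModule.curry_apply, TensorProduct.curry_apply,
      LinearMap.coe_restrictScalars, fockC_tmul, cross_one_left hC hB hR hev.one_left,
      Module.End.one_apply]
    simp (disch := fun_prop) only [sw_tmul, hmC.one_left]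

include hC hB hev hR hmB in
-- Acting by `c` after `b` is the cross map applied to `c` and a product with left factor `b`, so
-- `cross_mul_right` is the whole content.
theorem straightRel_fock : StraightRel R Coalgebra.comul Coalgebra.comul ev (fockB (C := C) mB)
    (fockC R ev mC) := fun c b => by
  rw [← mul_map_cross]
  ext b' x
  simp only [TensorProduct.AlgebraTensorModule.curry_apply, TensorProduct.curry_apply,
    LinearMap.coe_restrictScalars, Module.End.mul_apply, fockB_tmul, fockC_tmul]
  rw [cross_mul_right hC hB hev.invariant hR hev.mul_right hmB.toColinearMul]
  conv_rhs => rw [eq_sw (cross R ev (c ⊗ₜ b))]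
  simp (disch := fun_prop) only [sw_sw, sw_tmul, map_sw]
  simp only [sw, LinearMap.sum_apply, TensorProduct.map_tmul, LinearMap.mul'_apply,
    Module.End.mul_apply]
  refine Finset.sum_congr rfl fun i _ => ?_
  rw [fockC_tmul, map_sw]
  rfl

variable (hC : BrBialg R (Coalgebra.comul (R := k) (A := C)) Coalgebra.counit)
  (hB : BrBialg R (Coalgebra.comul (R := k) (A := B)) Coalgebra.counit)
  (hev : PairingLaws (H := H) ev) (hR : IsUniversalRMatrix R)
  (hmB : UnitalColinear R Coalgebra.comul mB)
  (hmC : UnitalColinear (revR R) (braidInv R ∘ₗ Coalgebra.comul) mC)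

namespace Tw

/-- The representation of the twisted double on `B ⊗ C`. -/
noncomputable def fock : Tw R ev mB mC →ₐ[k] Module.End k (B ⊗[k] C) :=
  lift ⟨half_fockB hmB, half_fockC hC hB hev hR hmC⟩ (straightRel_fock hC hB hev hR hmB)

/-- The vacuum expectation `x ↦ (ε ⊗ ε) (x · (1 ⊗ 1))`. -/
noncomputable def vac : Tw R ev mB mC →ₗ[k] k :=
  LinearMap.mul' k k ∘ₗ TensorProduct.map (Coalgebra.counit (R := k)) (Coalgebra.counit (R := k)) ∘ₗ
    LinearMap.applyₗ (1 ⊗ₜ 1) ∘ₗ (fock hC hB hev hR hmB hmC).toLinearMap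

/-- A normally ordered word acts on 1 ⊗ 1 without reordering: `c` crosses the unit trivially and `h`
acts on the unit of B by its counit. -/
theorem fock_triple (b : B) (h : H) (c : C) :
    fock hC hB hev hR hmB hmC (ofB R ev mB mC b * ofH R ev mB mC h * ofC R ev mB mC c) (1 ⊗ₜ 1) =
      b ⊗ₜ (h • c) := by
  simp only [fock, map_mul, lift_ofB, lift_ofH, lift_ofC, Module.End.mul_apply, fockC_tmul,
    cross_one_right hC hB hR hev.one_right]
  simp (disch := fun_prop) only [sw_tmul, hmC.one_right, fockH_tmul, hB.smul_one, map_sw]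
  simp only [← TensorProduct.smul_tmul' _ (1 : B), map_smul, fockB_tmul, hmB.one_right]
  exact sw_counit_comul (k := k) h (fun y => b ⊗ₜ[k] (y • c)) (by fun_prop)

theorem vac_triple (b : B) (h : H) (c : C) :
    vac hC hB hev hR hmB hmC (ofB R ev mB mC b * ofH R ev mB mC h * ofC R ev mB mC c) =
      Coalgebra.counit (R := k) b * (Coalgebra.counit (R := k) h * Coalgebra.counit (R := k) c) := by
  simp only [vac, LinearMap.comp_apply, AlgHom.toLinearMap_apply, LinearMap.applyₗ_apply_apply,
    fock_triple, TensorProduct.map_tmul, LinearMap.mul'_apply, hC.counit_smul]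

/-- The right word produces b′ ⊗ (h′ ▷ c′) from the vacuum, so only one crossing, of `c` with b′,
remains. For twisted products the two counits are σ and τ, by `BrBialg.counit_twistMul`. -/
theorem vac_mul (b b' : B) (h h' : H) (c c' : C) :
    vac hC hB hev hR hmB hmC ((ofB R ev mB mC b * ofH R ev mB mC h * ofC R ev mB mC c) *
      (ofB R ev mB mC b' * ofH R ev mB mC h' * ofC R ev mB mC c')) =
      sw (cross R ev (c ⊗ₜ b')) fun u v => Coalgebra.counit (R := k) (mB (b ⊗ₜ (h • u))) *
        Coalgebra.counit (R := k) (mC (v ⊗ₜ (h' • c'))) := by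
  simp only [vac, LinearMap.comp_apply, AlgHom.toLinearMap_apply, LinearMap.applyₗ_apply_apply]
  rw [map_mul, Module.End.mul_apply, fock_triple]
  simp only [fock, map_mul, lift_ofB, lift_ofH, lift_ofC, Module.End.mul_apply, fockC_tmul, map_sw,
    fockH_tmul, fockB_tmul, TensorProduct.map_tmul, LinearMap.mul'_apply, hC.counit_smul]
  refine sw_congr fun u v => ?_
  have := sw_comul_counit (k := k) h (fun x => Coalgebra.counit (R := k) (mB (b ⊗ₜ (x • u))) *
    Coalgebra.counit (R := k) (mC (v ⊗ₜ (h' • c')))) (by fun_prop)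
  rw [← this]
  refine sw_congr fun x y => ?_
  rw [smul_eq_mul]; ring

end Tw
end fock
end
end BraidedDouble

/-! ### The coregular representation on C -/

namespace BraidedDouble
section
variable {k H : Type*} [Field k] [Ring H] [HopfAlgebra k H]
variable {B C : Type*}
  [Ring B] [Algebra k B] [Coalgebra k B] [Module H B] [IsScalarTower k H B]
  [Ring C] [Algebra k C] [Coalgebra k C] [Module H C] [IsScalarTower k H C]
variable {Z : Type*} [AddCommGroup Z] [Module k Z]
variable (R : (H ⊗[k] H)ˣ) (ev : C ⊗[k] B →ₗ[k] k)

theorem sw_linearMap_apply {V W M N : Type*} [AddCommGroup V] [Module k V] [AddCommGroup W]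
    [Module k W] [AddCommGroup M] [Module k M] [AddCommGroup N] [Module k N] (t : V ⊗[k] W)
    (F : V → W → M →ₗ[k] N) (y : M) : (sw t F) y = sw t fun a b => F a b y := by
  simp only [sw, LinearMap.sum_apply]

theorem Lin.map_sw {V W M N : Type*} [AddCommGroup V] [Module k V] [AddCommGroup W]
    [Module k W] [AddCommGroup M] [Module k M] [AddCommGroup N] [Module k N] {g : M → N}
    (hg : Lin k g) (t : V ⊗[k] W) (f : V → W → M) : g (sw t f) = sw t fun a b => g (f a b) :=
  BraidedDouble.map_sw (IsLinearMap.mk' g hg) t f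

/-- The right action `c ◁ b = R⁻⁽¹⁾ c₍₂₎ ev(R⁻⁽²⁾ ▷ c₍₁₎, b)`. -/
noncomputable def coreg (c : C) (b : B) : C :=
  sw ((braidInv R ∘ₗ Coalgebra.comul) c) fun c₁ c₂ => ev (c₂ ⊗ₜ b) • c₁

@[fun_prop]
theorem Lin.coreg_left {W : Type*} [AddCommGroup W] [Module k W] {f : W → C} (hf : Lin k f)
    (b : B) : Lin k fun w => coreg R ev (f w) b := by unfold coreg; fun_prop

@[fun_prop]
theorem Lin.coreg_right {W : Type*} [AddCommGroup W] [Module k W] {f : W → B} (hf : Lin k f)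
    (c : C) : Lin k fun w => coreg R ev c (f w) := by unfold coreg; fun_prop

/-- The left action `b ▷ c = (R⁽²⁾ ▷ c) ◁ (R⁽¹⁾ ▷ b)` of `B` on `C`. -/
noncomputable def coregB : B →ₗ[k] Module.End k C :=
  TensorProduct.curry (linOf (fun b c => sw (R : H ⊗[k] H) fun r s =>
    coreg R ev (s • c) (r • b)) (by fun_prop) (by fun_prop))

theorem coregB_apply (b : B) (c : C) : coregB R ev b c = sw (R : H ⊗[k] H) fun r s =>
    coreg R ev (s • c) (r • b) := by
  rw [coregB, TensorProduct.curry_apply, linOf_tmul]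

/-- The left multiplication of `C`. -/
noncomputable def coregC : C →ₗ[k] Module.End k C := LinearMap.mul k C

theorem coregC_apply (c c' : C) : coregC (k := k) c c' = c * c' := rfl

variable {R ev}
variable (hC : BrBialg R (Coalgebra.comul (R := k) (A := C)) Coalgebra.counit)
  (hB : BrBialg R (Coalgebra.comul (R := k) (A := B)) Coalgebra.counit)
  (hev : PairingLaws (H := H) ev) (hR : IsUniversalRMatrix R)

include hC hev hR in
theorem smul_coreg (h : H) (c : C) (b : B) : h • coreg R ev c b =
    sw (Coalgebra.comul (R := k) h) fun x y => coreg R ev (x • c) (y • b) := by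
  have hC' := hC.cop hR
  unfold coreg
  simp (disch := fun_prop) only [hC'.sw_comul_smul, smul_sw]
  simp only [sw_comm (Coalgebra.comul (R := k) (_ : H))]
  refine sw_congr fun c₁ c₂ => ?_
  rw [sw_comul_comul h (fun x y z => ev ((y • c₂) ⊗ₜ (z • b)) • (x • c₁)) (by fun_prop)
    (by fun_prop) (by fun_prop)]
  simp only [← ksw_smul, hev.invariant.sw, mul_smul]
  rw [sw_comul_counit h (fun x => ev (c₂ ⊗ₜ b) • x • c₁) (by fun_prop), smul_comm]

include hev hR in
-- Two transfers, one for R and one for its reverse, move both R-legs from the arguments in B to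
-- those in C. There they cancel the reversed R-matrix of the co-opposite coproduct.
theorem ev_mul_cop (c : C) (b b' : B) : ev (c ⊗ₜ (b * b')) =
    sw ((braidInv R ∘ₗ Coalgebra.comul) c) fun c₁ c₂ => sw (R : H ⊗[k] H) fun r s =>
      ev (c₁ ⊗ₜ (r • b)) * ev (c₂ ⊗ₜ (s • b')) := by
  have e : ∀ c₁ c₂ : C, sw (R : H ⊗[k] H) (fun r s => ev (c₁ ⊗ₜ (r • b)) * ev (c₂ ⊗ₜ (s • b'))) =
      sw (R : H ⊗[k] H) fun r s => ev ((r • c₁) ⊗ₜ b) * ev ((s • c₂) ⊗ₜ b') := fun c₁ c₂ => by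
    have h1 := ev_transfer hev.invariant hR.revR c₁ b (fun q => ev ((q • c₂) ⊗ₜ b')) (by fun_prop)
    have h2 := ev_transfer hev.invariant hR c₂ b' (fun q => ev (c₁ ⊗ₜ (q • b))) (by fun_prop)
    rw [revR_revR] at h1
    simp only [smul_eq_mul] at h1 h2
    rw [h1]
    simp only [mul_comm (ev (c₁ ⊗ₜ (_ • b)))]
    exact h2.symm
  simp only [e]
  rw [hev.mul_right]
  simp (disch := fun_prop) only [sw_cop, smul_smul]
  refine sw_congr fun c₁ c₂ => ?_
  rw [sw_comm, sw_cancel_rev R (fun x y => ev ((x • c₂) ⊗ₜ b) * ev ((y • c₁) ⊗ₜ b')) (by fun_prop)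
    (by fun_prop)]
  simp only [one_smul]

include hC hev hR in
theorem coreg_mul_right (c : C) (b b' : B) : coreg R ev c (b * b') =
    sw (R : H ⊗[k] H) fun r s => coreg R ev (coreg R ev c (s • b')) (r • b) := by
  have hC' := hC.cop hR
  unfold coreg
  simp (disch := fun_prop) only [map_sw, map_smul, sw_sw, sw_ksmul, ev_mul_cop hev hR, ksw_smul,
    smul_sw, smul_smul]
  simp only [sw_comm (R : H ⊗[k] H)]
  generalize (braidInv R ∘ₗ Coalgebra.comul : C →ₗ[k] C ⊗[k] C) = Δ' at *
  simp (disch := fun_prop) only [hC'.sw_coassoc, mul_comm]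

include hC hev hR in
theorem coreg_mul_left (c y : C) (b : B) : coreg R ev (c * y) b =
    sw ((braidInv R ∘ₗ Coalgebra.comul) c) fun c₁ c₂ => sw (Coalgebra.comul (R := k) b) fun b₁ b₂ =>
      sw (revR R : H ⊗[k] H) fun p q =>
        ev ((p • c₂) ⊗ₜ b₂) • (c₁ * (q • coreg R ev y b₁)) := by
  have hC' := hC.cop hR
  unfold coreg
  simp (disch := fun_prop) only [hC'.sw_comul_mul, hev.mul_left, ksw_smul, smul_sw, mul_sw]
  refine sw_congr fun c₁ c₂ => ?_
  rw [sw_rot]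
  refine sw_congr fun b₁ b₂ => ?_
  rw [sw_comm]
  refine sw_congr fun p q => sw_congr fun y₁ y₂ => ?_
  rw [smul_comm q (ev (y₂ ⊗ₜ b₁)) y₁, mul_smul_comm (ev (y₂ ⊗ₜ b₁)), smul_smul, mul_comm (ev _)]

include hC hB hev hR in
-- The law `coreg_mul_right` acts by the right factor first, up to a braiding. Precomposing with a
-- braiding, as `coregB` does, turns this into a left action by the hexagons.
theorem half_coregB : Half (LinearMap.mul' k B) (Algebra.lsmul k k C : H →ₐ[k] Module.End k C)
    (coregB R ev) where
  cov h b := by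
    ext c
    simp only [Module.End.mul_apply, coregB_apply, Algebra.lsmul_apply]
    simp only [sw_linearMap_apply, Module.End.mul_apply, coregB_apply, smul_sw, Algebra.lsmul_apply, smul_smul,
      smul_coreg hC hev hR]
    conv_rhs => rw [sw_comm]
    exact (sw_qc hR h (fun x y => coreg R ev (y • c) (x • b)) (by fun_prop) (by fun_prop)).symm
  mul b b' := by
    ext c
    simp only [Module.End.mul_apply, coregB_apply, LinearMap.mul'_apply, smul_sw,
      smul_coreg hC hev hR, hB.smul_mul]
    simp (disch := fun_prop) only [Lin.map_sw (Lin.coreg_left R ev Lin.id' _),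
      Lin.map_sw (Lin.coreg_right R ev Lin.id' _), coreg_mul_right hC hev hR, LinearMap.mul'_apply,
      smul_smul]
    simp only [sw_comm (R : H ⊗[k] H) (Coalgebra.comul (R := k) (_ : H))]
    simp (disch := fun_prop) only [sw_hexL hR, sw_hexR hR, smul_smul]
    conv_rhs => rw [sw_rot]
  one := by
    ext c
    simp only [coregB_apply, Module.End.one_apply, hB.smul_one,
      (Lin.coreg_right R ev Lin.id' _).2, map_smul]
    rw [sw_counit_R hR (fun s => coreg R ev (s • c) 1) (by fun_prop)]
    simp (disch := fun_prop) only [one_smul, coreg, hev.one_right, (hC.cop hR).sw_counit_right]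

include hC in
theorem half_coregC : Half (LinearMap.mul' k C) (Algebra.lsmul k k C : H →ₐ[k] Module.End k C)
    coregC where
  cov h b := by
    ext c
    simp only [sw_linearMap_apply, Module.End.mul_apply, Algebra.lsmul_apply, coregC_apply]
    exact hC.smul_mul h b c
  mul b b' := by
    ext c
    simp only [Module.End.mul_apply, coregC_apply, LinearMap.mul'_apply, mul_assoc]
  one := by
    ext c
    simp only [coregC_apply, Module.End.one_apply, one_mul]

include hC hB hev hR in
-- The reversed braiding of `revProd` cancels a copy of R coming from `coregB`. What is left is the
-- rule `coreg_mul_left` for acting on a product in C, read as an identity of operators.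
theorem reverseRel_coreg : ReverseRel R Coalgebra.comul Coalgebra.comul ev
    (Algebra.lsmul k k C : H →ₐ[k] Module.End k C) (coregB R ev) coregC := fun c b => by
  have hC' := hC.cop hR
  unfold revProd evR
  ext y
  simp only [sw_linearMap_apply, LinearMap.smul_apply, Module.End.mul_apply, coregB_apply,
    coregC_apply, Algebra.lsmul_apply]
  simp only [hC.smul_mul, Lin.map_sw (Lin.coreg_left R ev Lin.id' _), mul_sw, smul_sw]
  simp only [sw_comm (revR R : H ⊗[k] H) (R : H ⊗[k] H), sw_comm (revR R : H ⊗[k] H) (Coalgebra.comul (R := k) (_ : H))]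
  simp (disch := fun_prop) only [sw_hexR hR, sw_hexR₂ hR.revR, smul_smul]
  have key := fun a b' : H => sw_cancel_rev R (fun u v => coreg R ev ((v • c) * (b' • y))
    ((a * u) • b)) (by fun_prop) (by fun_prop)
  simp only [one_smul, mul_one] at key
  simp only [mul_assoc, key]
  simp only [coreg_mul_left hC hev hR]
  simp (disch := fun_prop) only [hB.sw_comul_smul, sw_cop]
  simp only [sw_comm (R : H ⊗[k] H) (Coalgebra.comul (R := k) (_ : C)),
    sw_comm (R : H ⊗[k] H) (revR R : H ⊗[k] H),
    sw_comm (R : H ⊗[k] H) (Coalgebra.comul (R := k) (_ : B)),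
    sw_comm (Coalgebra.comul (R := k) (_ : H)) (Coalgebra.comul (R := k) (_ : B)),
    sw_comm (revR R : H ⊗[k] H) (Coalgebra.comul (R := k) (_ : B))]
  refine sw_congr fun c₁ c₂ => ?_
  simp (disch := fun_prop) only [sw_hexL hR, sw_hexR hR.revR, smul_smul]
  refine sw_congr fun b₁ b₂ => ?_
  simp only [sw_comm (R : H ⊗[k] H) (revR R : H ⊗[k] H),
    sw_comm (R : H ⊗[k] H) (Coalgebra.comul (R := k) _)]
  simp (disch := fun_prop) only [sw_hexR hR.revR]
  rw [sw_comm]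
  refine sw_congr fun p q => sw_congr fun p' q' => ?_
  rw [sw_comm]
end
end BraidedDouble

/-! ### Normal ordering: words span -/

namespace BraidedDouble
section
variable {k H : Type*} [Field k] [Ring H] [HopfAlgebra k H]

section antipode
variable {Z : Type*} [AddCommGroup Z] [Module k Z]

theorem sw_mul_eq {A : Type*} [Ring A] [Algebra k A] {V W : Type*} [AddCommGroup V] [Module k V]
    [AddCommGroup W] [Module k W] (t : V ⊗[k] W) (f : V →ₗ[k] A) (g : W →ₗ[k] A) :
    sw t (fun a b => f a * g b) = LinearMap.mul' k A (TensorProduct.map f g t) := by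
  conv_rhs => rw [eq_sw t]
  simp only [map_sw, TensorProduct.map_tmul, LinearMap.mul'_apply]

variable {T : H →ₗ[k] H} (hT : ∀ h, HopfAlgebra.antipode k (T h) = h)
  (hS : Function.Injective (HopfAlgebra.antipode k (A := H)))
include hT hS

/-- The antipode reverses products and undoes `T`, so applying it yields its own axiom; injectivity
brings the identity back. -/
theorem sw_skew_left (h : H) :
    sw (Coalgebra.comul (R := k) h) (fun a b => T b * a) = algebraMap k H (Coalgebra.counit h) := by
  apply hS
  simp only [map_sw, HopfAlgebra.antipode_mul_antidistrib, hT]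
  have := sw_mul_eq (Coalgebra.comul (R := k) h) (HopfAlgebra.antipode k (A := H)) LinearMap.id
  simp only [LinearMap.id_apply] at this
  rw [this]
  have e := HopfAlgebra.mul_antipode_rTensor_comul_apply (R := k) h
  rw [LinearMap.rTensor] at e
  rw [e, Algebra.algebraMap_eq_smul_one, map_smul, HopfAlgebra.antipode_one]

theorem sw_skew_right (h : H) :
    sw (Coalgebra.comul (R := k) h) (fun a b => b * T a) = algebraMap k H (Coalgebra.counit h) := by
  apply hS
  simp only [map_sw, HopfAlgebra.antipode_mul_antidistrib, hT]
  have := sw_mul_eq (Coalgebra.comul (R := k) h) LinearMap.id (HopfAlgebra.antipode k (A := H))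
  simp only [LinearMap.id_apply] at this
  rw [this]
  have e := HopfAlgebra.mul_antipode_lTensor_comul_apply (R := k) h
  rw [LinearMap.lTensor] at e
  rw [e, Algebra.algebraMap_eq_smul_one, map_smul, HopfAlgebra.antipode_one]

theorem sw_skew_left' (h : H) (f : H → H → Z) (h1 : ∀ b, Lin k (fun a => f a b))
    (h2 : ∀ a, Lin k (fun b => f a b)) :
    sw (Coalgebra.comul (R := k) h) (fun a b => sw (Coalgebra.comul (R := k) b) fun c d =>
      f d (T c * a)) = f h 1 := by
  rw [← sw_comul_comul h (fun a c d => f d (T c * a)) (by fun_prop) (by fun_prop) (by fun_prop)]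
  simp only [← Lin.map_sw (h2 _), sw_skew_left hT hS, Algebra.algebraMap_eq_smul_one, (h2 _).2]
  exact sw_counit_comul h (fun d => f d 1) (by fun_prop)

theorem sw_skew_right' (h : H) (f : H → H → Z) (h1 : ∀ b, Lin k (fun a => f a b))
    (h2 : ∀ a, Lin k (fun b => f a b)) :
    sw (Coalgebra.comul (R := k) h) (fun a b => sw (Coalgebra.comul (R := k) b) fun c d =>
      f (c * T a) d) = f 1 h := by
  rw [← sw_comul_comul h (fun a c d => f (c * T a) d) (by fun_prop) (by fun_prop) (by fun_prop)]
  have e : ∀ b u, f u b = (fun u => f u b) u := fun _ _ => rfl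
  have := fun a b => Lin.map_sw (h1 b) (Coalgebra.comul (R := k) a) fun c d => d * T c
  simp only [← this, sw_skew_right hT hS, Algebra.algebraMap_eq_smul_one]
  have e := fun b (r : k) => (h1 b).2 r 1
  simp only [e]
  exact sw_counit_comul h (fun d => f 1 d) (by fun_prop)

end antipode

theorem sw_mem {V W Z : Type*} [AddCommGroup V] [Module k V]
    [AddCommGroup W] [Module k W] [AddCommGroup Z] [Module k Z] (S : Submodule k Z)
    (t : V ⊗[k] W) {f : V → W → Z} (h : ∀ a b, f a b ∈ S) : sw t f ∈ S :=
  S.sum_mem fun _ _ => h _ _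

variable {B C : Type*}
  [Ring B] [Algebra k B] [Coalgebra k B] [Module H B] [IsScalarTower k H B]
  [Ring C] [Algebra k C] [Coalgebra k C] [Module H C] [IsScalarTower k H C]
variable {X : Type*} [Ring X] [Algebra k X]

section word

/-- `b ⊗ (h ⊗ c) ↦ b h c`. -/
noncomputable def word (ι : H →ₐ[k] X) (jB : B →ₗ[k] X) (jC : C →ₗ[k] X) :
    B ⊗[k] (H ⊗[k] C) →ₗ[k] X :=
  LinearMap.mul' k X ∘ₗ TensorProduct.map jB
    (LinearMap.mul' k X ∘ₗ TensorProduct.map ι.toLinearMap jC)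

variable {ι : H →ₐ[k] X} {jB : B →ₗ[k] X} {jC : C →ₗ[k] X}

theorem word_tmul (b : B) (h : H) (c : C) :
    word ι jB jC (b ⊗ₜ (h ⊗ₜ c)) = jB b * ι h * jC c := by
  rw [mul_assoc]; rfl

theorem word_mem (b : B) (h : H) (c : C) :
    jB b * ι h * jC c ∈ LinearMap.range (word ι jB jC) :=
  ⟨_, word_tmul b h c⟩

theorem map_word_mem {Y : Type*} [AddCommGroup Y] [Module k Y] (F : X →ₗ[k] Y)
    (S : Submodule k Y) (hF : ∀ b h c, F (jB b * ι h * jC c) ∈ S) {t : X}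
    (ht : t ∈ LinearMap.range (word ι jB jC)) : F t ∈ S := by
  obtain ⟨x, rfl⟩ := ht
  induction x with
  | zero => simp
  | add x y hx hy => rw [map_add, map_add]; exact S.add_mem hx hy
  | tmul b y =>
    induction y with
    | zero => simp
    | add x y hx hy => rw [TensorProduct.tmul_add, map_add, map_add]; exact S.add_mem hx hy
    | tmul h c => rw [word_tmul]; exact hF b h c

variable {mB : B ⊗[k] B →ₗ[k] B} {mC : C ⊗[k] C →ₗ[k] C} (hX : Triple mB mC ι jB jC)
  {T : H →ₗ[k] H} (hT : ∀ h, HopfAlgebra.antipode k (T h) = h)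
  (hS : Function.Injective (HopfAlgebra.antipode k (A := H)))
include hX

theorem mul_jC_mem {t : X} (ht : t ∈ LinearMap.range (word ι jB jC)) (c : C) :
    t * jC c ∈ LinearMap.range (word ι jB jC) :=
  map_word_mem (LinearMap.mulRight k (jC c)) _ (fun b h c' => by
    rw [LinearMap.mulRight_apply, mul_assoc, hX.right.mul]; exact word_mem _ _ _) ht

theorem jB_mul_mem {t : X} (ht : t ∈ LinearMap.range (word ι jB jC)) (b : B) :
    jB b * t ∈ LinearMap.range (word ι jB jC) :=
  map_word_mem (LinearMap.mulLeft k (jB b)) _ (fun b' h c' => by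
    rw [LinearMap.mulLeft_apply, ← mul_assoc, ← mul_assoc, hX.left.mul]; exact word_mem _ _ _) ht

theorem ι_mul_mem {t : X} (ht : t ∈ LinearMap.range (word ι jB jC)) (h : H) :
    ι h * t ∈ LinearMap.range (word ι jB jC) :=
  map_word_mem (LinearMap.mulLeft k (ι h)) _ (fun b' h' c' => by
    rw [LinearMap.mulLeft_apply, ← mul_assoc, ← mul_assoc, hX.left.cov]
    simp only [sw_mul, mul_assoc (jB _), ← map_mul]
    exact sw_mem _ _ fun _ _ => by rw [← mul_assoc]; exact word_mem _ _ _) ht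

include hT hS in
-- The covariance relation solved for the opposite order. The inverse of the antipode of H is needed
-- here.
theorem jC_mul_ι (c : C) (h : H) : jC c * ι h =
    sw (Coalgebra.comul (R := k) h) fun x y => ι y * jC (T x • c) := by
  simp only [hX.right.cov _ _, smul_smul]
  rw [sw_skew_right' hT hS h (fun u d => jC (u • c) * ι d) (by fun_prop) (by fun_prop), one_smul]

include hT hS in
theorem mul_ι_mem {t : X} (ht : t ∈ LinearMap.range (word ι jB jC)) (h : H) :
    t * ι h ∈ LinearMap.range (word ι jB jC) :=
  map_word_mem (LinearMap.mulRight k (ι h)) _ (fun b' h' c' => by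
    rw [LinearMap.mulRight_apply, mul_assoc, jC_mul_ι hX hT hS]
    simp only [mul_sw, ← mul_assoc]
    simp only [mul_assoc (jB _), ← map_mul]
    exact sw_mem _ _ fun _ _ => by rw [← mul_assoc]; exact word_mem _ _ _) ht

include hT hS in
theorem jC_mul_mem (hcross : ∀ c b, jC c * jB b ∈ LinearMap.range (word ι jB jC)) {t : X}
    (ht : t ∈ LinearMap.range (word ι jB jC)) (c : C) :
    jC c * t ∈ LinearMap.range (word ι jB jC) :=
  map_word_mem (LinearMap.mulLeft k (jC c)) _ (fun b' h' c' => by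
    rw [LinearMap.mulLeft_apply, ← mul_assoc, ← mul_assoc]
    exact mul_jC_mem hX (mul_ι_mem hX hT hS (hcross _ _) _) _) ht

include hT hS in
theorem evR_mem {R : (H ⊗[k] H)ˣ} {ΔC : C →ₗ[k] C ⊗[k] C} {ΔB : B →ₗ[k] B ⊗[k] B}
    {ev : C ⊗[k] B →ₗ[k] k} {F : C → B → X}
    (hF : ∀ c b, F c b ∈ LinearMap.range (word ι jB jC)) (c : C) (b : B) :
    evR R ΔC ΔB ev ι F c b ∈ LinearMap.range (word ι jB jC) :=
  sw_mem _ _ fun _ _ => sw_mem _ _ fun _ _ => sw_mem _ _ fun _ _ => sw_mem _ _ fun _ _ =>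
    Submodule.smul_mem _ _ (mul_ι_mem hX hT hS (ι_mul_mem hX (hF _ _) _) _)

theorem one_mem_range_word : 1 ∈ LinearMap.range (word ι jB jC) :=
  ⟨1 ⊗ₜ (1 ⊗ₜ 1), by rw [word_tmul, hX.left.one, hX.right.one, map_one, one_mul, one_mul]⟩

theorem jB_mul_jC_mem (b : B) (c : C) : jB b * jC c ∈ LinearMap.range (word ι jB jC) := by
  have := word_mem (ι := ι) (jB := jB) (jC := jC) b 1 c
  rwa [map_one, mul_one] at this

end word

theorem preAlg_mul_mem (g : TensorAlgebra k (B × H × C) →ₐ[k] X) (S : Submodule k X)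
    (hB : ∀ b, ∀ t ∈ S, g (preB b) * t ∈ S) (hH : ∀ h, ∀ t ∈ S, g (preH h) * t ∈ S)
    (hC : ∀ c, ∀ t ∈ S, g (preC c) * t ∈ S) (x : TensorAlgebra k (B × H × C)) {t : X}
    (ht : t ∈ S) : g x * t ∈ S := by
  induction x using TensorAlgebra.induction generalizing t with
  | algebraMap r => rw [AlgHom.commutes, ← Algebra.smul_def]; exact S.smul_mem _ ht
  | ι x =>
    obtain ⟨b, h, c⟩ := x
    have : TensorAlgebra.ι k (b, h, c) = preB b + preH h + preC c := by
      simp only [preB, preH, preC, LinearMap.comp_apply, ← map_add]; simp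
    rw [this, map_add, map_add, add_mul, add_mul]
    exact S.add_mem (S.add_mem (hB _ _ ht) (hH _ _ ht)) (hC _ _ ht)
  | mul x y hx hy => rw [map_mul, mul_assoc]; exact hx (hy ht)
  | add x y hx hy => rw [map_add, add_mul]; exact S.add_mem (hx ht) (hy ht)

section
variable (R : (H ⊗[k] H)ˣ) (ev : C ⊗[k] B →ₗ[k] k)
  (hS : Function.Bijective (HopfAlgebra.antipode k (A := H)))
include hS

theorem exists_skew : ∃ T : H →ₗ[k] H, ∀ h, HopfAlgebra.antipode k (T h) = h :=
  ⟨(LinearEquiv.ofBijective _ hS).symm.toLinearMap,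
    fun h => (LinearEquiv.ofBijective _ hS).apply_symm_apply h⟩

/-- The span of words contains 1 and is stable under left multiplication by all generators; the only
critical reordering, c b, is the straight relation itself. -/
theorem Tw.word_surjective (mB : B ⊗[k] B →ₗ[k] B) (mC : C ⊗[k] C →ₗ[k] C) :
    Function.Surjective (word (ofH R ev mB mC) (ofB R ev mB mC) (ofC R ev mB mC)) := by
  obtain ⟨T, hT⟩ := exists_skew (k := k) hS
  have hX := triple R ev mB mC
  intro x
  obtain ⟨x, rfl⟩ := RingQuot.mkAlgHom_surjective k (TwRel R ev mB mC) x
  have := preAlg_mul_mem (RingQuot.mkAlgHom k (TwRel R ev mB mC))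
    (LinearMap.range (word (ofH R ev mB mC) (ofB R ev mB mC) (ofC R ev mB mC)))
    (fun b t ht => jB_mul_mem hX ht b) (fun h t ht => ι_mul_mem hX ht h)
    (fun c t ht => jC_mul_mem hX hT hS.1 (fun c b => by
      rw [straightRel R ev mB mC c b]
      simp only [evL, revProd]
      refine sw_mem _ _ fun _ _ => sw_mem _ _ fun _ _ => Submodule.smul_mem _ _ ?_
      exact sw_mem _ _ fun _ _ => jB_mul_jC_mem hX _ _) ht c) x (one_mem_range_word hX)
  rw [mul_one] at this
  exact this

end

section
variable {R : (H ⊗[k] H)ˣ} {ev f : C ⊗[k] B →ₗ[k] k}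
  (hC : BrBialg R (Coalgebra.comul (R := k) (A := C)) Coalgebra.counit)
  (hB : BrBialg R (Coalgebra.comul (R := k) (A := B)) Coalgebra.counit)
  (hR : IsUniversalRMatrix R)
  (hf : ∀ c b, sw (Coalgebra.comul (R := k) c) (fun c₁ c₂ => sw (Coalgebra.comul (R := k) b)
    fun b₁ b₂ => f (c₁ ⊗ₜ b₂) * ev (c₂ ⊗ₜ b₁)) =
      Coalgebra.counit (R := k) c * Coalgebra.counit (R := k) b)
include hC hB hR hf

/-- The hexagons gather the R-legs into actions of single elements on `c` and on `b`. The inverse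
property then holds for the acted-on elements, and the counits left behind absorb the R-matrices. -/
theorem sw_inverse_pairing {Z : Type*} [AddCommGroup Z] [Module k Z] (c : C) (b : B)
    (F : H → H → Z) (h1 : ∀ b, Lin k (fun a => F a b)) (h2 : ∀ a, Lin k (fun b => F a b)) :
    sw (Coalgebra.comul (R := k) c) (fun c₁ c₂ => sw (Coalgebra.comul (R := k) b) fun b₁ b₂ =>
      sw (revR R : H ⊗[k] H) fun p q => sw (R : H ⊗[k] H) fun r s =>
        sw (revR R : H ⊗[k] H) fun p' q' => sw (R : H ⊗[k] H) fun r' s' =>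
          (f ((p • c₁) ⊗ₜ (r • b₂)) * ev ((p' • c₂) ⊗ₜ (r' • b₁))) • F (q * q') (s' * s)) =
      Coalgebra.counit (R := k) c • Coalgebra.counit (R := k) b • F 1 1 := by
  have e : sw (revR R : H ⊗[k] H) (fun p q => sw (R : H ⊗[k] H) fun r s =>
      (sw (Coalgebra.comul (R := k) (p • c)) (fun c₁ c₂ => sw (Coalgebra.comul (R := k) (r • b))
        fun b₁ b₂ => f (c₁ ⊗ₜ b₂) * ev (c₂ ⊗ₜ b₁))) • F q s) =
      Coalgebra.counit (R := k) c • Coalgebra.counit (R := k) b • F 1 1 := by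
    simp only [hf, hB.counit_smul, hC.counit_smul]
    have e1 : ∀ x y z w : k, ∀ v : Z, (x * y * (z * w)) • v = z • x • y • w • v :=
      fun x y z w v => by simp only [smul_smul]; congr 1; ring
    simp (disch := fun_prop) only [e1, sw_counit_R hR]
    simp (disch := fun_prop) only [sw_counit_R hR.revR]
  rw [← e]
  simp (disch := fun_prop) only [hC.sw_comul_smul, hB.sw_comul_smul, ksw_smul]
  simp only [sw_comm (R : H ⊗[k] H) (Coalgebra.comul (R := k) (_ : C)),
    sw_comm (revR R : H ⊗[k] H) (Coalgebra.comul (R := k) (_ : C)),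
    sw_comm (Coalgebra.comul (R := k) (_ : H)) (Coalgebra.comul (R := k) (_ : C)),
    sw_comm (Coalgebra.comul (R := k) (_ : H)) (Coalgebra.comul (R := k) (_ : B)),
    sw_comm (R : H ⊗[k] H) (Coalgebra.comul (R := k) (_ : B)),
    sw_comm (R : H ⊗[k] H) (Coalgebra.comul (R := k) (_ : H)),
    sw_comm (revR R : H ⊗[k] H) (Coalgebra.comul (R := k) (_ : B))]
  refine sw_congr fun c₁ c₂ => sw_congr fun b₁ b₂ => ?_
  simp (disch := fun_prop) only [sw_hexL hR, sw_hexL hR.revR]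
  simp only [sw_comm (R : H ⊗[k] H) (revR R : H ⊗[k] H)]
  refine sw_congr fun _ _ => sw_congr fun _ _ => ?_
  rw [sw_comm]

/-- The double relation contains c b only inside a contraction with `ev`. Contracting once more with
a convolution inverse isolates c b and makes it a combination of reordered words. -/
theorem evR_evR {ι : H →ₐ[k] X} {M : C → B → X} (h1 : ∀ b, Lin k (fun c => M c b))
    (h2 : ∀ c, Lin k (fun b => M c b)) (c : C) (b : B) :
    evR R Coalgebra.comul Coalgebra.comul f ι
      (fun c b => evR R Coalgebra.comul Coalgebra.comul ev ι M c b) c b = M c b := by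
  unfold evR
  simp only [mul_sw, sw_mul, smul_sw, mul_smul_comm, smul_mul_assoc, smul_smul]
  simp only [sw_comm (R : H ⊗[k] H) (Coalgebra.comul (R := k) (_ : C)),
    sw_comm (R : H ⊗[k] H) (Coalgebra.comul (R := k) (_ : B)),
    sw_comm (revR R : H ⊗[k] H) (Coalgebra.comul (R := k) (_ : C)),
    sw_comm (revR R : H ⊗[k] H) (Coalgebra.comul (R := k) (_ : B)),
    sw_comm (Coalgebra.comul (R := k) (_ : B)) (Coalgebra.comul (R := k) (_ : C))]
  simp (disch := fun_prop) only [← hC.sw_coassoc, hB.sw_coassoc]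
  simp only [mul_assoc, ← map_mul]
  simp only [← mul_assoc (ι _) (ι _), ← map_mul]
  have key := fun (c c₁ : C) (b b₁ : B) => sw_inverse_pairing hC hB hR hf c b
    (fun u v => ι u * (M c₁ b₁ * ι v)) (by fun_prop) (by fun_prop)
  simp only [sw_comm _ (Coalgebra.comul (R := k) b)]
  simp (disch := fun_prop) only [key, map_one, one_mul, mul_one, hC.sw_counit_left,
    hB.sw_counit_right]

theorem Drin.word_surjective
    (hS : Function.Bijective (HopfAlgebra.antipode k (A := H))) :
    Function.Surjective (word (inHAlg R ev) (inB R ev) (inC R ev)) := by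
  obtain ⟨T, hT⟩ := exists_skew (k := k) hS
  have hX := triple R ev
  intro x
  obtain ⟨x, rfl⟩ := RingQuot.mkAlgHom_surjective k (DrinRel R ev) x
  have := preAlg_mul_mem (RingQuot.mkAlgHom k (DrinRel R ev))
    (LinearMap.range (word (inHAlg R ev) (inB R ev) (inC R ev)))
    (fun b t ht => jB_mul_mem hX ht b) (fun h t ht => ι_mul_mem hX ht h)
    (fun c t ht => jC_mul_mem hX hT hS.1 (fun c b => by
      rw [← evR_evR hC hB hR hf (ι := inHAlg R ev) (M := fun c b => inC R ev c * inB R ev b)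
        (by fun_prop) (by fun_prop) c b]
      refine evR_mem hX hT hS.1 (fun c b => ?_) c b
      rw [← doubleRel R ev]
      simp only [evL, revProd]
      refine sw_mem _ _ fun _ _ => sw_mem _ _ fun _ _ => Submodule.smul_mem _ _ ?_
      exact sw_mem _ _ fun _ _ => jB_mul_jC_mem hX _ _) ht c) x (one_mem_range_word hX)
  rw [mul_one] at this
  exact this

end
end
end BraidedDouble

/-! ### A separating representation: words are independent -/

namespace BraidedDouble
section
variable {k H : Type*} [Field k] [Ring H] [HopfAlgebra k H]
variable {B C : Type*}
  [Ring B] [Algebra k B] [Coalgebra k B] [Module H B] [IsScalarTower k H B]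
  [Ring C] [Algebra k C] [Coalgebra k C] [Module H C] [IsScalarTower k H C]
variable {X Y : Type*} [Ring X] [Algebra k X] [Ring Y] [Algebra k Y]

theorem Half.inc {m : B ⊗[k] B →ₗ[k] B} {ι : H →ₐ[k] X} {j : B →ₗ[k] X} (h : Half m ι j)
    (ι' : H →ₐ[k] Y) : Half m (diag ι ι')
      ((Algebra.TensorProduct.includeLeft : X →ₐ[k] X ⊗[k] Y).toLinearMap ∘ₗ j) where
  cov g v := h.cov.diag_mul_left g v
  mul b b' := by
    simp only [LinearMap.comp_apply, AlgHom.toLinearMap_apply, ← map_mul, h.mul]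
  one := by simp only [LinearMap.comp_apply, AlgHom.toLinearMap_apply, map_one, h.one]

theorem rTensor_word {P : Type*} [AddCommGroup P] [Module k P] (φ : X →ₗ[k] P) (ι : H →ₐ[k] X)
    (x y : X) (g g' : H) :
    φ.rTensor H ((x ⊗ₜ 1) * diag ι (AlgHom.id k H) g * ((y ⊗ₜ 1) * diag ι (AlgHom.id k H) g')) =
      sw (Coalgebra.comul (R := k) g) fun a b => sw (Coalgebra.comul (R := k) g') fun a' b' =>
        φ (x * ι a * (y * ι a')) ⊗ₜ (b * b') := by
  simp only [diag_apply, sw_mul, mul_sw, Algebra.TensorProduct.tmul_mul_tmul, map_sw,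
    LinearMap.rTensor_tmul, AlgHom.coe_id, id_eq, one_mul]
  exact sw_comm _ _ _

theorem map_word_bos {P Q : Type*} [AddCommGroup P] [Module k P] [AddCommGroup Q] [Module k Q]
    (φ : X →ₗ[k] P) (ψ : Y →ₗ[k] Q) {R R' : (H ⊗[k] H)ˣ} {ΔB : B →ₗ[k] B ⊗[k] B}
    {ΔC : C →ₗ[k] C ⊗[k] C} {ι : H →ₐ[k] X} {ι' : H →ₐ[k] Y} {jB : B →ₗ[k] X} {jC : C →ₗ[k] X}
    {jB' : B →ₗ[k] Y} {jC' : C →ₗ[k] Y} (b : B) (h : H) (c : C) :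
    TensorProduct.map φ ψ (bos R ΔB ι jB jB' b * diag ι ι' h * bos R' ΔC ι jC jC' c) =
      sw (ΔB b) fun b₁ b₂ => sw (R : H ⊗[k] H) fun r s => sw (Coalgebra.comul (R := k) h) fun x y =>
        sw (ΔC c) fun c₁ c₂ => sw (R' : H ⊗[k] H) fun p q =>
          φ (jB b₁ * ι (s * x) * (jC c₁ * ι q)) ⊗ₜ ψ (jB' (r • b₂) * ι' y * jC' (p • c₂)) := by
  simp only [bos_eq_sw, diag_apply, sw_mul, mul_sw, map_sw, Algebra.TensorProduct.tmul_mul_tmul,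
    TensorProduct.map_tmul, map_mul, mul_assoc]
  simp only [sw_comm (ΔB b) (ΔC c), sw_comm (R : H ⊗[k] H) (ΔC c),
    sw_comm (Coalgebra.comul (R := k) h) (ΔC c), sw_comm (ΔB b) (R' : H ⊗[k] H),
    sw_comm (R : H ⊗[k] H) (R' : H ⊗[k] H), sw_comm (Coalgebra.comul (R := k) h) (R' : H ⊗[k] H),
    sw_comm (ΔB b) (Coalgebra.comul (R := k) h), sw_comm (R : H ⊗[k] H) (Coalgebra.comul (R := k) h)]

theorem StraightRel.map {R : (H ⊗[k] H)ˣ} {ΔC : C →ₗ[k] C ⊗[k] C} {ΔB : B →ₗ[k] B ⊗[k] B}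
    {ev : C ⊗[k] B →ₗ[k] k} {jB : B →ₗ[k] X} {jC : C →ₗ[k] X} (h : StraightRel R ΔC ΔB ev jB jC)
    (g : X →ₐ[k] Y) : StraightRel R ΔC ΔB ev (g.toLinearMap ∘ₗ jB) (g.toLinearMap ∘ₗ jC) :=
  fun c b => by
    have := congrArg g (h c b)
    simp only [evL, revProd, map_mul, map_sw, map_smul] at this
    exact this

section
variable {R : (H ⊗[k] H)ˣ} {ev : C ⊗[k] B →ₗ[k] k}
  (hC : BrBialg R (Coalgebra.comul (R := k) (A := C)) Coalgebra.counit)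
  (hB : BrBialg R (Coalgebra.comul (R := k) (A := B)) Coalgebra.counit)
  (hev : PairingLaws (H := H) ev) (hR : IsUniversalRMatrix R)

variable (k H B C) in
/-- The algebra of the regular representation. -/
def RegAlg : Type _ := Module.End k (B ⊗[k] C) ⊗[k] H

noncomputable instance : Ring (RegAlg k H B C) :=
  inferInstanceAs (Ring (Module.End k (B ⊗[k] C) ⊗[k] H))

noncomputable instance : Algebra k (RegAlg k H B C) :=
  inferInstanceAs (Algebra k (Module.End k (B ⊗[k] C) ⊗[k] H))

variable (k H B C) in
noncomputable def regInc : Module.End k (B ⊗[k] C) →ₐ[k] RegAlg k H B C :=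
  Algebra.TensorProduct.includeLeft

variable (k H B C) in
/-- The action of `H` on `B ⊗ C` together with a free copy of `H`. -/
noncomputable def regH : H →ₐ[k] RegAlg k H B C :=
  diag (fockH (k := k) (H := H) (B := B) (C := C)) (AlgHom.id k H)

variable (k H B C) in
noncomputable def regB : B →ₗ[k] RegAlg k H B C :=
  (regInc k H B C).toLinearMap ∘ₗ fockB (C := C) (LinearMap.mul' k B)

variable (R ev) in
noncomputable def regC : C →ₗ[k] RegAlg k H B C :=
  (regInc k H B C).toLinearMap ∘ₗ fockC R ev (LinearMap.mul' k C)

include hC hB hev hR in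
theorem triple_reg : Triple (LinearMap.mul' k B) (LinearMap.mul' k C) (regH k H B C)
    (regB k H B C) (regC R ev) :=
  ⟨(half_fockB hB.unitalColinear_mul').inc _,
    (half_fockC hC hB hev hR (hC.cop hR).unitalColinear_mul').inc _⟩

include hC hB hev hR in
theorem straightRel_reg : StraightRel R Coalgebra.comul Coalgebra.comul ev (regB k H B C)
    (regC R ev) :=
  (straightRel_fock hC hB hev hR hB.unitalColinear_mul').map _

variable (k H B C) in
/-- Evaluation at the vacuum, projected to `B ⊗ H`. -/
noncomputable def regEval : RegAlg k H B C →ₗ[k] B ⊗[k] H :=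
  (LinearMap.rTensor H ((TensorProduct.rid k B).toLinearMap ∘ₗ
    LinearMap.lTensor B (Coalgebra.counit (R := k)) ∘ₗ LinearMap.applyₗ (1 ⊗ₜ[k] 1)) :
      Module.End k (B ⊗[k] C) ⊗[k] H →ₗ[k] B ⊗[k] H)

include hC hB hev hR in
-- On the vacuum H acts only by its counit, so the operators alone would forget it. The free copy of
-- H in the second tensor factor retains the product of `g` and `g'`.
theorem regEval_word (b : B) (g g' : H) (c : C) :
    regEval k H B C (regB k H B C b * regH k H B C g * (regC R ev c * regH k H B C g')) =
      Coalgebra.counit (R := k) c • b ⊗ₜ (g * g') := by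
  have := rTensor_word ((TensorProduct.rid k B).toLinearMap ∘ₗ
    LinearMap.lTensor B (Coalgebra.counit (R := k)) ∘ₗ LinearMap.applyₗ (1 ⊗ₜ[k] 1))
    (fockH (k := k) (H := H) (B := B) (C := C)) (fockB (C := C) (LinearMap.mul' k B) b)
    (fockC R ev (LinearMap.mul' k C) c) g g'
  refine this.trans ?_
  have e : ∀ h : H, fockH (k := k) h ((1 : B) ⊗ₜ[k] (1 : C)) =
      Coalgebra.counit (R := k) h • (1 ⊗ₜ[k] 1) := fun h => by
    simp only [fockH_tmul, hB.smul_one, hC.smul_one, TensorProduct.tmul_smul,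
      ← TensorProduct.smul_tmul']
    exact sw_comul_counit (k := k) h (fun x => Coalgebra.counit (R := k) x • ((1 : B) ⊗ₜ[k] (1 : C)))
      (by fun_prop)
  have e2 : ∀ a : H, TensorProduct.rid k B (LinearMap.lTensor B (Coalgebra.counit (R := k))
      (fockB (C := C) (LinearMap.mul' k B) b (fockH (k := k) a (1 ⊗ₜ c)))) =
      Coalgebra.counit (R := k) a • Coalgebra.counit (R := k) c • b := fun a => by
    simp only [fockH_tmul, hB.smul_one, map_sw, fockB_tmul, LinearMap.mul'_apply, mul_smul_comm,
      mul_one, LinearMap.lTensor_tmul, TensorProduct.rid_tmul, hC.counit_smul, mul_smul]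
    have := sw_comul_counit (k := k) a (fun x => Coalgebra.counit (R := k) x •
      Coalgebra.counit (R := k) c • b) (by fun_prop)
    rw [← this]
    exact sw_congr fun x y => by simp only [smul_smul]; congr 1; ring
  have e3 : ∀ a a' : H, ((TensorProduct.rid k B).toLinearMap ∘ₗ
      LinearMap.lTensor B (Coalgebra.counit (R := k)) ∘ₗ LinearMap.applyₗ (1 ⊗ₜ[k] 1))
        ((fockB (C := C) (LinearMap.mul' k B) b) * fockH (k := k) a *
          (fockC R ev (LinearMap.mul' k C) c * fockH (k := k) a')) =
      Coalgebra.counit (R := k) a' • Coalgebra.counit (R := k) a • Coalgebra.counit (R := k) c • b :=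
    fun a a' => by
    simp only [LinearMap.comp_apply, LinearMap.applyₗ_apply_apply, Module.End.mul_apply, e,
      map_smul, fockC_tmul, cross_one_right hC hB hR hev.one_right]
    simp (disch := fun_prop) only [sw_tmul, LinearMap.mul'_apply, mul_one]
    exact congrArg _ (e2 a)
  simp only [e3, ← TensorProduct.smul_tmul']
  have key := fun x y : H => sw_counit_comul (k := k) g' (fun b' => Coalgebra.counit (R := k) x •
      Coalgebra.counit (R := k) c • (b ⊗ₜ[k] (y * b'))) (by fun_prop)
  simp only [key]
  exact sw_counit_comul (k := k) g (fun y => Coalgebra.counit (R := k) c • (b ⊗ₜ[k] (y * g')))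
    (by fun_prop)

variable (k C) in
/-- The endomorphism algebra of `C`. -/
def CoregAlg : Type _ := Module.End k C

noncomputable instance : Ring (CoregAlg k C) := inferInstanceAs (Ring (Module.End k C))

noncomputable instance : Algebra k (CoregAlg k C) := inferInstanceAs (Algebra k (Module.End k C))

variable (k C) in
/-- The identification of `CoregAlg k C` with the endomorphism algebra. -/
noncomputable def CoregAlg.of : Module.End k C →ₐ[k] CoregAlg k C := AlgHom.id k (Module.End k C)

variable (k C) in
/-- Evaluation at the unit. -/
noncomputable def CoregAlg.eval : CoregAlg k C →ₗ[k] C :=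
  (LinearMap.applyₗ (1 : C) : Module.End k C →ₗ[k] C)

theorem CoregAlg.eval_of (f : Module.End k C) : eval k C (of k C f) = f 1 := rfl

theorem Half.map {m : B ⊗[k] B →ₗ[k] B} {ι : H →ₐ[k] X} {j : B →ₗ[k] X} (h : Half m ι j)
    (g : X →ₐ[k] Y) : Half m (g.comp ι) (g.toLinearMap ∘ₗ j) where
  cov a v := by
    have := congrArg g (h.cov a v)
    simp only [map_mul, map_sw] at this
    exact this
  mul b b' := by
    simp only [LinearMap.comp_apply, AlgHom.toLinearMap_apply, ← map_mul, h.mul]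
  one := by simp only [LinearMap.comp_apply, AlgHom.toLinearMap_apply, map_one, h.one]

theorem ReverseRel.map {R : (H ⊗[k] H)ˣ} {ΔC : C →ₗ[k] C ⊗[k] C} {ΔB : B →ₗ[k] B ⊗[k] B}
    {ev : C ⊗[k] B →ₗ[k] k} {ι : H →ₐ[k] X} {jB : B →ₗ[k] X} {jC : C →ₗ[k] X}
    (h : ReverseRel R ΔC ΔB ev ι jB jC)
    (g : X →ₐ[k] Y) : ReverseRel R ΔC ΔB ev (g.comp ι) (g.toLinearMap ∘ₗ jB) (g.toLinearMap ∘ₗ jC) :=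
  fun c b => by
    have := congrArg g (h c b)
    simp only [evR, revProd, map_mul, map_sw, map_smul] at this
    exact this

/-- The representation that separates the triangular decomposition. -/
noncomputable def Drin.sep : Drin R ev →ₐ[k] RegAlg k H B C ⊗[k] CoregAlg k C :=
  lift (Triple.bos hC hB hR hB.colinearMul_mul' (hC.cop hR).colinearMul_mul'
      (triple_reg hC hB hev hR) ⟨(half_coregB hC hB hev hR).map (CoregAlg.of k C),
        (half_coregC hC).map (CoregAlg.of k C)⟩)
    (ReverseRel.bos hC hB hR (triple_reg hC hB hev hR).left.cov
      (triple_reg hC hB hev hR).right.cov (straightRel_reg hC hB hev hR)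
      ((reverseRel_coreg hC hB hev hR).map (CoregAlg.of k C)))

theorem Drin.sep_word (b : B) (h : H) (c : C) :
    TensorProduct.map (regEval k H B C) (CoregAlg.eval k C)
      (sep hC hB hev hR (inB R ev b * inH R ev h * inC R ev c)) =
    sw (Coalgebra.comul (R := k) b) fun b₁ b₂ => sw (R : H ⊗[k] H) fun r s =>
      sw (revR R : H ⊗[k] H) fun p q => sw (Coalgebra.comul (R := k) h) fun h₁ h₂ =>
        (b₁ ⊗ₜ (s * q * h₂)) ⊗ₜ coregB R ev (r • b₂) ((p * h₁) • c) := by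
  have hC' := hC.cop hR
  simp only [sep, map_mul, lift_inB, lift_inC, lift_inH]
  refine (map_word_bos (R := R) (R' := revR R) _ _ b h c).trans ?_
  have e : ∀ (y : H) (b : B) (c : C), ((CoregAlg.of k C).toLinearMap ∘ₗ coregB R ev) b *
      ((CoregAlg.of k C).comp (Algebra.lsmul k k C : H →ₐ[k] Module.End k C)) y *
      ((CoregAlg.of k C).toLinearMap ∘ₗ coregC) c =
        CoregAlg.of k C (coregB R ev b * Algebra.lsmul k k C y * coregC c) := fun _ _ _ => by
    simp only [map_mul]; rfl
  simp only [e, CoregAlg.eval_of, Module.End.mul_apply, coregC_apply, mul_one,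
    Algebra.lsmul_apply]
  simp only [regEval_word hC hB hev hR, ← TensorProduct.smul_tmul']
  simp (disch := fun_prop) only [← smul_sw, hC'.sw_counit_left, smul_smul, mul_assoc]
  refine sw_congr fun b₁ b₂ => sw_congr fun r s => ?_
  rw [sw_comm]
  exact (sw_qc hR.revR h (fun x y => (b₁ ⊗ₜ[k] (s * y)) ⊗ₜ[k] coregB R ev (r • b₂) (x • c))
    (by fun_prop) (by fun_prop)).symm

section inverse
variable (R ev)

/-- Removes the action of `B` on `C`. -/
noncomputable def stripB (S : B →ₗ[k] B) : (B ⊗[k] H) ⊗[k] C →ₗ[k] (B ⊗[k] H) ⊗[k] C :=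
  linOf (fun u c => sw u fun b g => sw (Coalgebra.comul (R := k) b) fun b₁ b₂ =>
    sw (R : H ⊗[k] H) fun r s => (b₁ ⊗ₜ (s * g)) ⊗ₜ coregB R ev (r • S b₂) c)
    (by fun_prop) (by fun_prop)

variable (C) in
/-- Multiplies by the R-matrix. -/
noncomputable def stripR : (B ⊗[k] H) ⊗[k] C →ₗ[k] (B ⊗[k] H) ⊗[k] C :=
  linOf (fun u c => sw u fun b g => sw (R : H ⊗[k] H) fun x y => (b ⊗ₜ (x * g)) ⊗ₜ (y • c))
    (by fun_prop) (by fun_prop)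

variable (B C) in
/-- Removes the action of `H` on `C`. -/
noncomputable def stripH (T : H →ₗ[k] H) : (B ⊗[k] H) ⊗[k] C →ₗ[k] (B ⊗[k] H) ⊗[k] C :=
  linOf (fun u c => sw u fun b g => sw (Coalgebra.comul (R := k) g) fun x y =>
    (b ⊗ₜ y) ⊗ₜ (T x • c)) (by fun_prop) (by fun_prop)

variable {R ev}
variable {S : B →ₗ[k] B} (hS1 : ∀ (h : H) b, S (h • b) = h • S b)
  (hS2 : ∀ b, sw (Coalgebra.comul (R := k) b) (fun b₁ b₂ => S b₁ * b₂) =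
    algebraMap k B (Coalgebra.counit (R := k) b))

include hC hB hev hR hS1 hS2 in
-- A further leg of `b`, sent through the map `S`, acts on the result; by coassociativity S(b₂) b₃
-- appears and collapses to a counit. The R-legs multiply consistently by the hexagon.
theorem stripB_apply (b : B) (g : H) (c : C) :
    stripB R ev S (sw (Coalgebra.comul (R := k) b) fun b₁ b₂ => sw (R : H ⊗[k] H) fun r s =>
      (b₁ ⊗ₜ (s * g)) ⊗ₜ coregB R ev (r • b₂) c) = (b ⊗ₜ g) ⊗ₜ c := by
  have hcB := half_coregB hC hB hev hR
  simp only [map_sw, stripB, linOf_tmul]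
  simp (disch := fun_prop) only [sw_tmul]
  simp only [← Module.End.mul_apply, hcB.mul, LinearMap.mul'_apply]
  simp only [sw_comm (R : H ⊗[k] H) (Coalgebra.comul (R := k) (_ : B)), ← mul_assoc]
  simp (disch := fun_prop) only [hB.sw_coassoc]
  have key : ∀ b₁ b₂ b₃ : B, sw (R : H ⊗[k] H) (fun r s => sw (R : H ⊗[k] H) fun r' s' =>
      (b₁ ⊗ₜ[k] (s' * s * g)) ⊗ₜ[k] coregB R ev ((r' • S b₂) * (r • b₃)) c) =
      sw (R : H ⊗[k] H) fun r s => (b₁ ⊗ₜ[k] (s * g)) ⊗ₜ[k] coregB R ev (r • (S b₂ * b₃)) c := by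
    intro b₁ b₂ b₃
    simp only [hB.smul_mul]
    simp only [Lin.map_sw (by fun_prop : Lin k fun x => coregB R ev x c), tmul_sw]
    rw [sw_comm, sw_hexL hR (fun x y s => (b₁ ⊗ₜ[k] (s * g)) ⊗ₜ[k]
      coregB R ev ((x • S b₂) * (y • b₃)) c) (by fun_prop) (by fun_prop) (by fun_prop)]
  simp only [key]
  have key2 : ∀ a b : B, sw (Coalgebra.comul (R := k) b) (fun b₁ b₂ => sw (R : H ⊗[k] H) fun r s =>
      (a ⊗ₜ[k] (s * g)) ⊗ₜ[k] coregB R ev (r • (S b₁ * b₂)) c) =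
      Coalgebra.counit (R := k) b • ((a ⊗ₜ[k] g) ⊗ₜ[k] c) := fun a b => by
    rw [sw_comm]
    have e : ∀ r s : H, sw (Coalgebra.comul (R := k) b) (fun b₁ b₂ =>
        (a ⊗ₜ[k] (s * g)) ⊗ₜ[k] coregB R ev (r • (S b₁ * b₂)) c) =
        Coalgebra.counit (R := k) r • Coalgebra.counit (R := k) b •
          ((a ⊗ₜ[k] (s * g)) ⊗ₜ[k] c) := fun r s => by
      rw [← Lin.map_sw (by fun_prop : Lin k fun x : B =>
        (a ⊗ₜ[k] (s * g)) ⊗ₜ[k] coregB R ev (r • x) c), hS2, Algebra.algebraMap_eq_smul_one,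
        smul_algebra_smul_comm]
      simp only [hB.smul_one, map_smul, hcB.one, LinearMap.smul_apply, TensorProduct.tmul_smul,
        Module.End.one_apply]
      rw [smul_comm]
    simp only [e]
    rw [sw_counit_R hR (fun s => Coalgebra.counit (R := k) b • ((a ⊗ₜ[k] (s * g)) ⊗ₜ[k] c))
      (by fun_prop), one_mul]
  simp only [key2]
  exact hB.sw_counit_right b (fun a => (a ⊗ₜ[k] g) ⊗ₜ[k] c) (by fun_prop)

variable {T : H →ₗ[k] H} (hT : ∀ h, HopfAlgebra.antipode k (T h) = h)
  (hS : Function.Injective (HopfAlgebra.antipode k (A := H)))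
include hC hB hev hR hS1 hS2 hT hS

/-- By `sep_word` the image of a word arises from it by an action of H on C, a reversed R-matrix and
an action of B on C. They are undone in the opposite order: `S` removes B, R cancels its reverse,
and the inverse antipode removes H. -/
theorem Drin.strip_word (b : B) (h : H) (c : C) :
    stripH B C T (stripR C R (stripB R ev S
      (TensorProduct.map (regEval k H B C) (CoregAlg.eval k C)
        (sep hC hB hev hR (inB R ev b * inH R ev h * inC R ev c))))) = (b ⊗ₜ h) ⊗ₜ c := by
  rw [sep_word]
  have e : ∀ F : H → H → H → H → B → B → H → H → (B ⊗[k] H) ⊗[k] C,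
      sw (Coalgebra.comul (R := k) b) (fun b₁ b₂ => sw (R : H ⊗[k] H) fun r s =>
      sw (revR R : H ⊗[k] H) fun p q => sw (Coalgebra.comul (R := k) h) fun h₁ h₂ =>
        F p q h₁ h₂ b₁ b₂ r s) = sw (revR R : H ⊗[k] H) fun p q =>
        sw (Coalgebra.comul (R := k) h) fun h₁ h₂ => sw (Coalgebra.comul (R := k) b) fun b₁ b₂ =>
        sw (R : H ⊗[k] H) fun r s => F p q h₁ h₂ b₁ b₂ r s := fun F => by
    rw [sw_rot]; exact sw_congr fun _ _ => by rw [sw_rot]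
  rw [e fun p q h₁ h₂ b₁ b₂ r s => (b₁ ⊗ₜ[k] (s * q * h₂)) ⊗ₜ[k]
    coregB R ev (r • b₂) ((p * h₁) • c)]
  simp only [mul_assoc]
  have e2 : ∀ (p q h₁ h₂ : H), stripB R ev S (sw (Coalgebra.comul (R := k) b) fun b₁ b₂ =>
      sw (R : H ⊗[k] H) fun r s => (b₁ ⊗ₜ[k] (s * (q * h₂))) ⊗ₜ[k]
        coregB R ev (r • b₂) ((p * h₁) • c)) = (b ⊗ₜ (q * h₂)) ⊗ₜ ((p * h₁) • c) :=
    fun p q h₁ h₂ => stripB_apply hC hB hev hR hS1 hS2 b _ _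
  rw [map_sw (stripB R ev S)]
  simp only [map_sw (stripB R ev S) (Coalgebra.comul (R := k) h)]
  simp only [e2]
  simp only [map_sw, stripR, linOf_tmul]
  simp (disch := fun_prop) only [sw_tmul]
  have key := fun x y : H => sw_cancel_rev R (fun u v =>
    stripH B C T ((b ⊗ₜ[k] (u * y)) ⊗ₜ[k] ((v * x) • c))) (by fun_prop) (by fun_prop)
  simp only [mul_assoc] at key
  rw [sw_comm]
  simp only [sw_comm (revR R : H ⊗[k] H) (R : H ⊗[k] H), smul_smul, key, one_mul]
  simp only [map_sw, stripH, linOf_tmul]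
  simp (disch := fun_prop) only [sw_tmul, smul_smul]
  rw [sw_skew_left' hT hS h (fun u v => (b ⊗ₜ[k] u) ⊗ₜ[k] (v • c)) (by fun_prop) (by fun_prop),
    one_smul]

theorem Drin.word_injective : Function.Injective (word (inHAlg R ev) (inB R ev) (inC R ev)) := by
  have : stripH B C T ∘ₗ stripR C R ∘ₗ stripB R ev S ∘ₗ
      TensorProduct.map (regEval k H B C) (CoregAlg.eval k C) ∘ₗ
        (sep hC hB hev hR).toLinearMap ∘ₗ word (inHAlg R ev) (inB R ev) (inC R ev) =
      (TensorProduct.assoc k B H C).symm.toLinearMap := by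
    refine TensorProduct.ext (LinearMap.ext fun b => TensorProduct.ext' fun h c => ?_)
    simp only [LinearMap.compr₂ₛₗ_apply, LinearMap.comp_apply, TensorProduct.mk_apply, word_tmul,
      AlgHom.toLinearMap_apply]
    exact strip_word hC hB hev hR hS1 hS2 hT hS b h c
  have hi : Function.Injective (stripH B C T ∘ₗ stripR C R ∘ₗ stripB R ev S ∘ₗ
      TensorProduct.map (regEval k H B C) (CoregAlg.eval k C) ∘ₗ
        (sep hC hB hev hR).toLinearMap ∘ₗ word (inHAlg R ev) (inB R ev) (inC R ev)) := by
    rw [this]; exact (TensorProduct.assoc k B H C).symm.injective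
  intro x y hxy
  exact hi (by simp only [LinearMap.comp_apply, hxy])

end inverse

end
end
end BraidedDouble

/-! ### The comodule isomorphism and the form on the double -/

namespace BraidedDouble
section
variable {k H : Type*} [Field k] [Ring H] [HopfAlgebra k H]
variable {B C : Type*}
  [Ring B] [Algebra k B] [Coalgebra k B] [Module H B] [IsScalarTower k H B]
  [Ring C] [Algebra k C] [Coalgebra k C] [Module H C] [IsScalarTower k H C]

section
variable {A Z : Type*} [Ring A] [Algebra k A] [AddCommGroup Z] [Module k Z]

theorem sw_comulTensor_comm (Δ : A →ₗ[k] A ⊗[k] A) (x y : A)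
    (f : A ⊗[k] A → A ⊗[k] A → Z) (h1 : ∀ b, Lin k (fun a => f a b))
    (h2 : ∀ a, Lin k (fun b => f a b)) :
    sw (comulTensor Δ (TensorProduct.comm k A A).toLinearMap (x ⊗ₜ y)) f =
      sw (Δ x) fun x₁ x₂ => sw (Δ y) fun y₁ y₂ => f (x₁ ⊗ₜ y₁) (x₂ ⊗ₜ y₂) := by
  rw [comulTensor_tmul]
  simp (disch := fun_prop) only [LinearEquiv.coe_coe, TensorProduct.comm_tmul, sw_tmul, sw_sw]

theorem twistMul_comm (Δ : A →ₗ[k] A ⊗[k] A) (σ : A ⊗[k] A →ₗ[k] k) (x y : A) :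
    twistMul Δ (TensorProduct.comm k A A).toLinearMap σ (x ⊗ₜ y) =
      sw (Δ x) fun x₁ x₂ => sw (Δ y) fun y₁ y₂ => σ (x₂ ⊗ₜ y₂) • (x₁ * y₁) := by
  rw [BrBialg.twistMul_eq_sw]
  simp (disch := fun_prop) only [sw_comulTensor_comm, LinearMap.mul'_apply]

theorem conv_comm (Δ : A →ₗ[k] A ⊗[k] A) (σ τ : A ⊗[k] A →ₗ[k] k) (x y : A) :
    conv (comulTensor Δ (TensorProduct.comm k A A).toLinearMap) σ τ (x ⊗ₜ y) =
      sw (Δ x) fun x₁ x₂ => sw (Δ y) fun y₁ y₂ => σ (x₁ ⊗ₜ y₁) * τ (x₂ ⊗ₜ y₂) := by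
  rw [BrBialg.conv_eq_sw]
  simp (disch := fun_prop) only [sw_comulTensor_comm]

end

variable {R : (H ⊗[k] H)ˣ} {ev : C ⊗[k] B →ₗ[k] k} {mB : B ⊗[k] B →ₗ[k] B}
  {mC : C ⊗[k] C →ₗ[k] C}
variable (hC : BrBialg R (Coalgebra.comul (R := k) (A := C)) Coalgebra.counit)
  (hB : BrBialg R (Coalgebra.comul (R := k) (A := B)) Coalgebra.counit)
  (hev : PairingLaws (H := H) ev) (hR : IsUniversalRMatrix R)
  (hmB : UnitalColinear R Coalgebra.comul mB)
  (hmC : UnitalColinear (revR R) (braidInv R ∘ₗ Coalgebra.comul) mC)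
  (hW : Function.Bijective (word (Drin.inHAlg R ev) (inB R ev) (inC R ev)))

include hW in
theorem Drin.word_ext {Z : Type*} [AddCommGroup Z] [Module k Z] {f g : Drin R ev →ₗ[k] Z}
    (h : ∀ b h c, f (inB R ev b * inH R ev h * inC R ev c) =
      g (inB R ev b * inH R ev h * inC R ev c)) : f = g := by
  refine LinearMap.ext fun x => ?_
  obtain ⟨x, rfl⟩ := hW.2 x
  induction x with
  | zero => simp
  | add x y hx hy => rw [map_add, map_add, map_add, hx, hy]
  | tmul b y =>
    induction y with
    | zero => simp
    | add x y hx hy => rw [TensorProduct.tmul_add, map_add, map_add, map_add, hx, hy]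
    | tmul g c => rw [word_tmul]; exact h b g c

include hW in
theorem Drin.form_ext {f g : Drin R ev ⊗[k] Drin R ev →ₗ[k] k}
    (h : ∀ b h c b' h' c', f ((inB R ev b * inH R ev h * inC R ev c) ⊗ₜ
        (inB R ev b' * inH R ev h' * inC R ev c')) =
      g ((inB R ev b * inH R ev h * inC R ev c) ⊗ₜ
        (inB R ev b' * inH R ev h' * inC R ev c'))) : f = g := by
  refine TensorProduct.ext (word_ext hW fun b g c => word_ext hW fun b' g' c' => ?_)
  simp only [LinearMap.compr₂ₛₗ_apply, TensorProduct.mk_apply]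
  exact h b g c b' g' c'

namespace Tw

variable (mB mC) in
/-- The left comodule isomorphism `b h c ↦ b h c` from the braided double. -/
noncomputable def theta : Drin R ev →ₗ[k] Tw R ev mB mC :=
  word (ofH R ev mB mC) (ofB R ev mB mC) (ofC R ev mB mC) ∘ₗ
    (LinearEquiv.ofBijective _ hW).symm.toLinearMap

theorem theta_word (b : B) (h : H) (c : C) :
    theta mB mC hW (inB R ev b * inH R ev h * inC R ev c) =
      ofB R ev mB mC b * ofH R ev mB mC h * ofC R ev mB mC c := by
  rw [← Drin.inHAlg_apply, ← word_tmul (ι := Drin.inHAlg R ev), theta, LinearMap.comp_apply,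
    LinearEquiv.coe_coe, ← LinearEquiv.ofBijective_apply (hf := hW),
    LinearEquiv.symm_apply_apply, word_tmul]

theorem theta_one : theta mB mC hW 1 = 1 := by
  have := theta_word (mB := mB) (mC := mC) hW 1 1 1
  have hD := Drin.triple R ev
  have hE := triple R ev mB mC
  rw [hD.left.one, hD.right.one, hE.left.one, hE.right.one, ← Drin.inHAlg_apply, map_one, map_one,
    one_mul, one_mul, one_mul, one_mul] at this
  exact this

theorem theta_surjective (hS : Function.Bijective (HopfAlgebra.antipode k (A := H))) :
    Function.Surjective (theta mB mC hW) := by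
  rw [theta, LinearMap.coe_comp]
  exact (word_surjective R ev hS mB mC).comp (LinearEquiv.surjective _)

/-- The coaction of the braided double. -/
noncomputable def coact : Tw R ev mB mC →ₐ[k] Drin R ev ⊗[k] Tw R ev mB mC :=
  lift (Triple.bos hC hB hR hmB.toColinearMul hmC.toColinearMul (Drin.triple R ev)
    (triple R ev mB mC))
    (StraightRel.bos hC hB hR (Drin.cov_inB R ev) (Drin.cov_inC R ev) (Drin.doubleRel R ev)
      (straightRel R ev mB mC))

/-- On a word, coproduct and coaction are the same expression in `bos` and `diag`, and all its
second legs are again words. No twisted product is ever evaluated. -/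
theorem coact_theta (x : Drin R ev) : coact hC hB hR hmB hmC (theta mB mC hW x) =
    LinearMap.lTensor _ (theta mB mC hW) (Drin.comul ev hC hB hR x) := by
  have : (coact hC hB hR hmB hmC).toLinearMap ∘ₗ theta mB mC hW =
      LinearMap.lTensor _ (theta mB mC hW) ∘ₗ (Drin.comul ev hC hB hR).toLinearMap := by
    refine Drin.word_ext hW fun b h c => ?_
    simp only [LinearMap.comp_apply, AlgHom.toLinearMap_apply, theta_word]
    simp only [map_mul, Drin.comul_inB, Drin.comul_inC, Drin.comul_inH, coact, lift_ofB, lift_ofC,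
      lift_ofH]
    rw [LinearMap.lTensor, map_word_bos]
    have := map_word_bos (LinearMap.id : Drin R ev →ₗ[k] Drin R ev)
      (LinearMap.id : Tw R ev mB mC →ₗ[k] Tw R ev mB mC) (R := R) (R' := revR R)
      (ΔB := Coalgebra.comul) (ΔC := braidInv R ∘ₗ Coalgebra.comul) (ι := Drin.inHAlg R ev)
      (ι' := ofH R ev mB mC) (jB := inB R ev) (jC := inC R ev) (jB' := ofB R ev mB mC)
      (jC' := ofC R ev mB mC) b h c
    rw [TensorProduct.map_id, LinearMap.id_apply] at this
    rw [this]
    simp only [LinearMap.id_apply, Drin.inHAlg_apply, theta_word]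
  exact LinearMap.congr_fun this x

theorem vac_theta (x : Drin R ev) : vac hC hB hev hR hmB hmC (theta mB mC hW x) =
    Drin.counit ev hC hB hR x := by
  have : vac hC hB hev hR hmB hmC ∘ₗ theta mB mC hW =
      (Drin.counit ev hC hB hR).toLinearMap := by
    refine Drin.word_ext hW fun b h c => ?_
    simp only [LinearMap.comp_apply, AlgHom.toLinearMap_apply, theta_word, vac_triple]
    simp only [map_mul, Drin.counit_inB, Drin.counit_inC, Drin.counit_inH, mul_assoc]
  exact LinearMap.congr_fun this x

/-- The inverse of `theta`. -/
noncomputable def proj : Tw R ev mB mC →ₗ[k] Drin R ev :=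
  (TensorProduct.rid k _).toLinearMap ∘ₗ
    LinearMap.lTensor _ (vac hC hB hev hR hmB hmC) ∘ₗ (coact hC hB hR hmB hmC).toLinearMap

/-- θ is colinear and `vac` restricts along it to the counit, so this is the counit axiom of the
double. -/
theorem proj_theta (x : Drin R ev) : proj hC hB hev hR hmB hmC (theta mB mC hW x) = x := by
  rw [proj, LinearMap.comp_apply, LinearMap.comp_apply, AlgHom.toLinearMap_apply, coact_theta,
    ← LinearMap.lTensor_comp_apply]
  have : vac hC hB hev hR hmB hmC ∘ₗ theta mB mC hW = (Drin.counit ev hC hB hR).toLinearMap :=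
    LinearMap.ext (vac_theta hC hB hev hR hmB hmC hW)
  rw [this]
  exact (drinBialgebra ev hC hB hR).counit_right x

theorem theta_proj (hS : Function.Bijective (HopfAlgebra.antipode k (A := H)))
    (x : Tw R ev mB mC) : theta mB mC hW (proj hC hB hev hR hmB hmC x) = x := by
  obtain ⟨y, rfl⟩ := theta_surjective hW hS x
  rw [proj_theta]

/-- The form `ω(x, y) = e(θ(x) θ(y))` on the braided double. -/
noncomputable def form : Drin R ev ⊗[k] Drin R ev →ₗ[k] k :=
  vac hC hB hev hR hmB hmC ∘ₗ LinearMap.mul' k _ ∘ₗ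
    TensorProduct.map (theta mB mC hW) (theta mB mC hW)

theorem form_tmul (x y : Drin R ev) : form hC hB hev hR hmB hmC hW (x ⊗ₜ y) =
    vac hC hB hev hR hmB hmC (theta mB mC hW x * theta mB mC hW y) := rfl

/-- The coaction is multiplicative and θ is colinear, so id ⊗ `vac` applied to the coaction of θ(x)
θ(y) gives x₁ y₁ ω(x₂, y₂). The ω-twisted product is thus the associative product of the twisted
double, transported along θ. -/
theorem twistMul_form (x y : Drin R ev) :
    twistMul (Drin.comul ev hC hB hR).toLinearMap (TensorProduct.comm k _ _).toLinearMap
      (form hC hB hev hR hmB hmC hW) (x ⊗ₜ y) =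
      proj hC hB hev hR hmB hmC (theta mB mC hW x * theta mB mC hW y) := by
  rw [twistMul_comm, proj, LinearMap.comp_apply, LinearMap.comp_apply, AlgHom.toLinearMap_apply (coact hC hB hR hmB hmC),
    map_mul (coact hC hB hR hmB hmC), coact_theta, coact_theta]
  simp only [AlgHom.toLinearMap_apply]
  conv_rhs => rw [eq_sw (Drin.comul ev hC hB hR x), eq_sw (Drin.comul ev hC hB hR y)]
  simp only [map_sw, LinearMap.lTensor_tmul, sw_mul, mul_sw, Algebra.TensorProduct.tmul_mul_tmul,
    LinearEquiv.coe_coe, TensorProduct.rid_tmul, form_tmul]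
  exact sw_comm _ _ _

/-- Both sides are the vacuum expectation of θ(x) θ(y) θ(z), bracketed differently. -/
theorem form_cocycle (hS : Function.Bijective (HopfAlgebra.antipode k (A := H)))
    (x y z : Drin R ev) :
    form hC hB hev hR hmB hmC hW (x ⊗ₜ twistMul (Drin.comul ev hC hB hR).toLinearMap
      (TensorProduct.comm k _ _).toLinearMap (form hC hB hev hR hmB hmC hW) (y ⊗ₜ z)) =
    form hC hB hev hR hmB hmC hW (twistMul (Drin.comul ev hC hB hR).toLinearMap
      (TensorProduct.comm k _ _).toLinearMap (form hC hB hev hR hmB hmC hW) (x ⊗ₜ y) ⊗ₜ z) := by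
  rw [twistMul_form, twistMul_form, form_tmul, form_tmul, theta_proj _ _ _ _ _ _ _ hS,
    theta_proj _ _ _ _ _ _ _ hS, mul_assoc]

theorem form_one_left (x : Drin R ev) : form hC hB hev hR hmB hmC hW (1 ⊗ₜ x) =
    Drin.counit ev hC hB hR x := by
  rw [form_tmul, theta_one, one_mul, vac_theta]

theorem form_one_right (x : Drin R ev) : form hC hB hev hR hmB hmC hW (x ⊗ₜ 1) =
    Drin.counit ev hC hB hR x := by
  rw [form_tmul, theta_one, mul_one, vac_theta]

theorem form_word (b b' : B) (h h' : H) (c c' : C) : form hC hB hev hR hmB hmC hW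
    ((inB R ev b * inH R ev h * inC R ev c) ⊗ₜ (inB R ev b' * inH R ev h' * inC R ev c')) =
      sw (cross R ev (c ⊗ₜ b')) fun u v => Coalgebra.counit (R := k) (mB (b ⊗ₜ (h • u))) *
        Coalgebra.counit (R := k) (mC (v ⊗ₜ (h' • c'))) := by
  rw [form_tmul, theta_word, theta_word, vac_mul]

end Tw

end
end BraidedDouble

/-! ### Coproducts of words under counits -/

namespace BraidedDouble
section
variable {k H : Type*} [Field k] [Ring H] [HopfAlgebra k H]
variable {B C : Type*}
  [Ring B] [Algebra k B] [Coalgebra k B] [Module H B] [IsScalarTower k H B]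
  [Ring C] [Algebra k C] [Coalgebra k C] [Module H C] [IsScalarTower k H C]
variable {Z : Type*} [AddCommGroup Z] [Module k Z]

section
variable {A : Type*} [AddCommGroup A] [Module k A]

theorem conv_assoc {Δ : A →ₗ[k] A ⊗[k] A}
    (hΔ : ∀ v, TensorProduct.assoc k A A A (Δ.rTensor A (Δ v)) = Δ.lTensor A (Δ v))
    (f g h : A →ₗ[k] k) : conv Δ (conv Δ f g) h = conv Δ f (conv Δ g h) := by
  refine LinearMap.ext fun x => ?_
  simp only [BrBialg.conv_eq_sw, sw_mul, kmul_sw, mul_assoc]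
  exact sw_coassoc hΔ x (fun a b c => f a * (g b * h c)) (by fun_prop) (by fun_prop) (by fun_prop)

theorem conv_counit_left {Δ : A →ₗ[k] A ⊗[k] A} {ε : A →ₗ[k] k}
    (hε : ∀ v, TensorProduct.lid k A (ε.rTensor A (Δ v)) = v) (f : A →ₗ[k] k) :
    conv Δ ε f = f := by
  refine LinearMap.ext fun x => ?_
  rw [BrBialg.conv_eq_sw]
  exact sw_counit_left hε x (fun a => f a) (by fun_prop)

end

section
variable {A : Type*} [Ring A] [Algebra k A]

theorem comulTensor_comm_coassoc {Δ : A →ₗ[k] A ⊗[k] A}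
    (hΔ : ∀ v, TensorProduct.assoc k A A A (Δ.rTensor A (Δ v)) = Δ.lTensor A (Δ v))
    (v : A ⊗[k] A) : TensorProduct.assoc k _ _ _
      ((comulTensor Δ (TensorProduct.comm k A A).toLinearMap).rTensor _
        (comulTensor Δ (TensorProduct.comm k A A).toLinearMap v)) =
      (comulTensor Δ (TensorProduct.comm k A A).toLinearMap).lTensor _
        (comulTensor Δ (TensorProduct.comm k A A).toLinearMap v) := by
  have : (TensorProduct.assoc k _ _ _).toLinearMap ∘ₗ
      (comulTensor Δ (TensorProduct.comm k A A).toLinearMap).rTensor _ ∘ₗ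
        comulTensor Δ (TensorProduct.comm k A A).toLinearMap =
      (comulTensor Δ (TensorProduct.comm k A A).toLinearMap).lTensor _ ∘ₗ
        comulTensor Δ (TensorProduct.comm k A A).toLinearMap := by
    refine TensorProduct.ext' fun x y => ?_
    simp only [LinearMap.comp_apply, LinearEquiv.coe_coe, assoc_rTensor_apply, lTensor_apply]
    simp (disch := fun_prop) only [sw_comulTensor_comm]
    have e : ∀ F : A → A → A → A → A → A → (A ⊗[k] A) ⊗[k] ((A ⊗[k] A) ⊗[k] (A ⊗[k] A)),
        (∀ b c y₁ y₂ y₃, Lin k fun a => F a b c y₁ y₂ y₃) →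
        (∀ a c y₁ y₂ y₃, Lin k fun b => F a b c y₁ y₂ y₃) →
        (∀ a b y₁ y₂ y₃, Lin k fun c => F a b c y₁ y₂ y₃) →
        (∀ a b c y₂ y₃, Lin k fun y₁ => F a b c y₁ y₂ y₃) →
        (∀ a b c y₁ y₃, Lin k fun y₂ => F a b c y₁ y₂ y₃) →
        (∀ a b c y₁ y₂, Lin k fun y₃ => F a b c y₁ y₂ y₃) →
        (sw (Δ x) fun x₁ x₃ => sw (Δ y) fun y₁ y₃ => sw (Δ x₁) fun x₁ x₂ =>
          sw (Δ y₁) fun y₁ y₂ => F x₁ x₂ x₃ y₁ y₂ y₃) =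
        (sw (Δ x) fun x₁ x₂ => sw (Δ y) fun y₁ y₂ => sw (Δ x₂) fun x₂ x₃ =>
          sw (Δ y₂) fun y₂ y₃ => F x₁ x₂ x₃ y₁ y₂ y₃) := fun F h1 h2 h3 h4 h5 h6 => by
      have e1 : ∀ x₁ x₃, (sw (Δ y) fun y₁ y₃ => sw (Δ x₁) fun x₁ x₂ =>
          sw (Δ y₁) fun y₁ y₂ => F x₁ x₂ x₃ y₁ y₂ y₃) = sw (Δ x₁) fun x₁ x₂ =>
          sw (Δ y) fun y₁ y₂ => sw (Δ y₂) fun y₂ y₃ => F x₁ x₂ x₃ y₁ y₂ y₃ := fun x₁ x₃ => by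
        rw [sw_comm]
        exact sw_congr fun x₁ x₂ => sw_coassoc hΔ y (F x₁ x₂ x₃) (by fun_prop) (by fun_prop)
          (by fun_prop)
      simp only [e1]
      rw [sw_coassoc hΔ x (fun x₁ x₂ x₃ => sw (Δ y) fun y₁ y₂ => sw (Δ y₂) fun y₂ y₃ =>
        F x₁ x₂ x₃ y₁ y₂ y₃) (by fun_prop) (by fun_prop) (by fun_prop)]
      exact sw_congr fun x₁ x₂ => sw_comm _ _ _
    exact e (fun x₁ x₂ x₃ y₁ y₂ y₃ => (x₁ ⊗ₜ y₁) ⊗ₜ ((x₂ ⊗ₜ y₂) ⊗ₜ (x₃ ⊗ₜ y₃)))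
      (by fun_prop) (by fun_prop) (by fun_prop) (by fun_prop) (by fun_prop) (by fun_prop)
  exact LinearMap.congr_fun this v

end

section wordSum
variable (R : (H ⊗[k] H)ˣ)

/-- The coproduct of a word `b h c` in the braided double, evaluated on a function. -/
noncomputable def wordSum (b : B) (h : H) (c : C) (Φ : B → H → C → B → H → C → Z) : Z :=
  sw (Coalgebra.comul (R := k) b) fun b₁ b₂ => sw (R : H ⊗[k] H) fun r s =>
    sw (Coalgebra.comul (R := k) h) fun x y => sw (Coalgebra.comul (R := k) c) fun c₁ c₂ =>
      sw (revR R : H ⊗[k] H) fun p q => Φ b₁ (s * x * q) c₂ (r • b₂) y (p • c₁)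

variable {R}
  (hC : BrBialg R (Coalgebra.comul (R := k) (A := C)) Coalgebra.counit)
  (hB : BrBialg R (Coalgebra.comul (R := k) (A := B)) Coalgebra.counit)
  (hR : IsUniversalRMatrix R)
include hC hB hR

local notation "ε" => Coalgebra.counit (R := k)

/-- This and the next lemmas cover the patterns in which some of the six slots of a word coproduct
are hit by counits. A counit on a slot erases the R-matrix legs in it, and with them the R-matrix.
-/
theorem wordSum_right_trivial (b : B) (h : H) (c : C) (φ : B → H → B → H → Z)
    (h1 : ∀ u b' v, Lin k fun b => φ b u b' v) (h2 : ∀ b b' v, Lin k fun u => φ b u b' v)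
    (h3 : ∀ b u v, Lin k fun b' => φ b u b' v) (h4 : ∀ b u b', Lin k fun v => φ b u b' v) :
    wordSum (k := k) R b h c (fun b₁ u c₂ b₂ v c₁ => ε c₂ • ε c₁ • φ b₁ u b₂ v) =
      ε c • sw (Coalgebra.comul (R := k) b) fun b₁ b₂ => sw (R : H ⊗[k] H) fun r s =>
        sw (Coalgebra.comul (R := k) h) fun x y => φ b₁ (s * x) (r • b₂) y := by
  simp only [wordSum, hC.counit_smul, mul_smul, ← smul_sw]
  simp (disch := fun_prop) only [sw_counit_R hR.revR, mul_one, hC.sw_counit_right, ← smul_sw]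

theorem wordSum_left_trivial (b : B) (h : H) (c : C) (φ : H → C → H → C → Z)
    (h1 : ∀ c v c', Lin k fun u => φ u c v c') (h2 : ∀ u v c', Lin k fun c => φ u c v c')
    (h3 : ∀ u c c', Lin k fun v => φ u c v c') (h4 : ∀ u c v, Lin k fun c' => φ u c v c') :
    wordSum (k := k) R b h c (fun b₁ u c₂ b₂ v c₁ => ε b₁ • ε b₂ • φ u c₂ v c₁) =
      ε b • sw (Coalgebra.comul (R := k) h) fun x y => sw (Coalgebra.comul (R := k) c) fun c₁ c₂ =>
        sw (revR R : H ⊗[k] H) fun p q => φ (x * q) c₂ y (p • c₁) := by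
  simp only [wordSum, hB.counit_smul, mul_smul, ← smul_sw]
  simp (disch := fun_prop) only [sw_counit_R hR, one_mul, hB.sw_counit_left, ← smul_sw]

theorem wordSum_only_left (b : B) (h : H) (c : C) (φ : B → B → Z)
    (h1 : ∀ b', Lin k fun b => φ b b') (h2 : ∀ b, Lin k fun b' => φ b b') :
    wordSum (k := k) R b h c (fun b₁ u c₂ b₂ v c₁ =>
        ε c₂ • ε c₁ • ε u • ε v • φ b₁ b₂) =
      ε h • ε c • sw (Coalgebra.comul (R := k) b) fun b₁ b₂ => φ b₁ b₂ := by
  rw [wordSum_right_trivial hC hB hR b h c (fun b₁ u b₂ v => ε u • ε v • φ b₁ b₂)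
    (by fun_prop) (by fun_prop) (by fun_prop) (by fun_prop), smul_comm]
  simp only [Bialgebra.counit_mul, mul_smul, ← smul_sw]
  simp (disch := fun_prop) only [sw_counit_comul, ← smul_sw, smul_comm (ε h)]
  simp (disch := fun_prop) only [sw_R_counit hR, smul_comm (ε h), one_smul, ← smul_sw]

theorem wordSum_only_right (b : B) (h : H) (c : C) (φ : C → C → Z)
    (h1 : ∀ b', Lin k fun b => φ b b') (h2 : ∀ b, Lin k fun b' => φ b b') :
    wordSum (k := k) R b h c (fun b₁ u c₂ b₂ v c₁ =>
        ε b₁ • ε b₂ • ε u • ε v • φ c₂ c₁) =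
      ε b • ε h • sw (Coalgebra.comul (R := k) c) fun c₁ c₂ => φ c₂ c₁ := by
  rw [wordSum_left_trivial hC hB hR b h c (fun u c v c' => ε u • ε v • φ c c')
    (by fun_prop) (by fun_prop) (by fun_prop) (by fun_prop)]
  simp only [Bialgebra.counit_mul, mul_smul, ← smul_sw]
  simp (disch := fun_prop) only [sw_R_counit hR.revR, one_smul, ← smul_sw]
  simp only [smul_sw]
  rw [sw_comm]
  simp only [← smul_sw]
  simp (disch := fun_prop) only [sw_counit_comul, smul_sw]

theorem wordSum_first_right (b : B) (h : H) (c : C) (φ : C → B → H → C → Z)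
    (h1 : ∀ b v c', Lin k fun c => φ c b v c') (h2 : ∀ c v c', Lin k fun b => φ c b v c')
    (h3 : ∀ c b c', Lin k fun v => φ c b v c') (h4 : ∀ c b v, Lin k fun c' => φ c b v c') :
    wordSum (k := k) R b h c (fun b₁ u c₂ b₂ v c₁ => ε b₁ • ε u • φ c₂ b₂ v c₁) =
      sw (Coalgebra.comul (R := k) c) fun c₁ c₂ => φ c₂ b h c₁ := by
  simp only [wordSum, Bialgebra.counit_mul, mul_smul, ← smul_sw]
  simp (disch := fun_prop) only [sw_R_counit hR.revR, one_smul, ← smul_sw, sw_counit_comul,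
    sw_R_counit hR, hB.sw_counit_left]

theorem wordSum_first_left (b : B) (h : H) (c : C) (φ : B → B → H → C → Z)
    (h1 : ∀ b v c', Lin k fun c => φ c b v c') (h2 : ∀ c v c', Lin k fun b => φ c b v c')
    (h3 : ∀ c b c', Lin k fun v => φ c b v c') (h4 : ∀ c b v, Lin k fun c' => φ c b v c') :
    wordSum (k := k) R b h c (fun b₁ u c₂ b₂ v c₁ => ε u • ε c₂ • φ b₁ b₂ v c₁) =
      sw (Coalgebra.comul (R := k) b) fun b₁ b₂ => φ b₁ b₂ h c := by
  simp only [wordSum, Bialgebra.counit_mul, mul_smul, ← smul_sw]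
  simp (disch := fun_prop) only [sw_R_counit hR.revR, one_smul, ← smul_sw, sw_counit_comul,
    sw_R_counit hR, hC.sw_counit_right]

theorem wordSum_mixed (b : B) (h : H) (c : C) (φ : B → H → C → Z)
    (h1 : ∀ v c', Lin k fun b => φ b v c') (h2 : ∀ b c', Lin k fun v => φ b v c')
    (h3 : ∀ b v, Lin k fun c' => φ b v c') :
    wordSum (k := k) R b h c (fun b₁ u c₂ b₂ v c₁ => ε b₂ • ε v • ε c₂ • φ b₁ u c₁) =
      sw (revR R : H ⊗[k] H) fun p q => φ b (h * q) (p • c) := by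
  simp only [wordSum, hB.counit_smul, mul_smul, ← smul_sw]
  simp (disch := fun_prop) only [hC.sw_counit_right, sw_comul_counit, sw_counit_R hR,
    one_mul, ← smul_sw, hB.sw_counit_right]

end wordSum

end
end BraidedDouble

/-! ### Forms on the double that see only part of a word -/

namespace BraidedDouble
section
variable {k H : Type*} [Field k] [Ring H] [HopfAlgebra k H]
variable {B C : Type*}
  [Ring B] [Algebra k B] [Coalgebra k B] [Module H B] [IsScalarTower k H B]
  [Ring C] [Algebra k C] [Coalgebra k C] [Module H C] [IsScalarTower k H C]

theorem comulTensor_comm_counit {A : Type*} [Ring A] [Algebra k A] {Δ : A →ₗ[k] A ⊗[k] A}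
    {ε : A →ₗ[k] k} (hε : ∀ v, TensorProduct.lid k A (ε.rTensor A (Δ v)) = v) (v : A ⊗[k] A) :
    TensorProduct.lid k _ ((LinearMap.mul' k k ∘ₗ TensorProduct.map ε ε).rTensor _
      (comulTensor Δ (TensorProduct.comm k A A).toLinearMap v)) = v := by
  have : (TensorProduct.lid k _).toLinearMap ∘ₗ
      (LinearMap.mul' k k ∘ₗ TensorProduct.map ε ε).rTensor _ ∘ₗ
        comulTensor Δ (TensorProduct.comm k A A).toLinearMap = LinearMap.id := by
    refine TensorProduct.ext' fun x y => ?_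
    simp only [LinearMap.comp_apply, LinearEquiv.coe_coe, lid_rTensor_apply]
    simp (disch := fun_prop) only [sw_comulTensor_comm, TensorProduct.map_tmul,
      LinearMap.mul'_apply, mul_smul, ← smul_sw]
    simp (disch := fun_prop) only [sw_counit_left hε, LinearMap.id_apply]
  exact LinearMap.congr_fun this v

variable {R : (H ⊗[k] H)ˣ} {ev : C ⊗[k] B →ₗ[k] k} 
variable (hC : BrBialg R (Coalgebra.comul (R := k) (A := C)) Coalgebra.counit)
  (hB : BrBialg R (Coalgebra.comul (R := k) (A := B)) Coalgebra.counit)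
  (hR : IsUniversalRMatrix R)
  (hW : Function.Bijective (word (Drin.inHAlg R ev) (inB R ev) (inC R ev)))

namespace Drin

variable (R ev) in
/-- The element `b h c` of the braided double. -/
noncomputable def wd (b : B) (h : H) (c : C) : Drin R ev := inB R ev b * inH R ev h * inC R ev c

include hW in
-- The triangular decomposition makes any function linear in its six arguments a well-defined form
-- on the double, although no compatibility with the relations is required.
theorem exists_form (F : B → H → C → B → H → C → k)
    (h1 : ∀ h c b' h' c', Lin k fun b => F b h c b' h' c')
    (h2 : ∀ b c b' h' c', Lin k fun h => F b h c b' h' c')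
    (h3 : ∀ b h b' h' c', Lin k fun c => F b h c b' h' c')
    (h4 : ∀ b h c h' c', Lin k fun b' => F b h c b' h' c')
    (h5 : ∀ b h c b' c', Lin k fun h' => F b h c b' h' c')
    (h6 : ∀ b h c b' h', Lin k fun c' => F b h c b' h' c') :
    ∃ f : Drin R ev ⊗[k] Drin R ev →ₗ[k] k, ∀ b h c b' h' c',
      f (wd R ev b h c ⊗ₜ wd R ev b' h' c') = F b h c b' h' c' := by
  let e := (LinearEquiv.ofBijective _ hW).symm
  have he : ∀ b h c, e (wd R ev b h c) = b ⊗ₜ (h ⊗ₜ c) := fun b h c => by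
    rw [wd, ← Drin.inHAlg_apply, ← word_tmul (ι := Drin.inHAlg R ev),
      ← LinearEquiv.ofBijective_apply (hf := hW), LinearEquiv.symm_apply_apply]
  refine ⟨linOf (fun x y => sw (e.toLinearMap x) fun b z => sw z fun h c =>
    sw (e.toLinearMap y) fun b' z' => sw z' fun h' c' => F b h c b' h' c')
    (by fun_prop) (by fun_prop), fun b h c b' h' c' => ?_⟩
  rw [linOf_tmul]
  simp (disch := fun_prop) only [LinearEquiv.coe_coe, he, sw_tmul]

theorem sw_comul_word {Z : Type*} [AddCommGroup Z] [Module k Z] (b : B) (h : H) (c : C)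
    (f : Drin R ev → Drin R ev → Z) (h1 : ∀ b, Lin k (fun a => f a b))
    (h2 : ∀ a, Lin k (fun b => f a b)) :
    sw (Drin.comul ev hC hB hR (wd R ev b h c)) f =
      wordSum (k := k) R b h c fun b₁ u c₂ b₂ v c₁ => f (wd R ev b₁ u c₂) (wd R ev b₂ v c₁) := by
  rw [wd, map_mul, map_mul, comul_inB, comul_inH, comul_inC, bos_cop hR (Drin.cov_inC R ev),
    bos_eq_sw, diag_apply, wordSum]
  simp only [sw_mul, mul_sw, Algebra.TensorProduct.tmul_mul_tmul]
  simp (disch := fun_prop) only [sw_sw, sw_tmul]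
  simp only [sw_comm (Coalgebra.comul (R := k) b) (Coalgebra.comul (R := k) c),
    sw_comm (R : H ⊗[k] H) (Coalgebra.comul (R := k) c),
    sw_comm (Coalgebra.comul (R := k) h) (Coalgebra.comul (R := k) c),
    sw_comm (Coalgebra.comul (R := k) b) (revR R : H ⊗[k] H),
    sw_comm (R : H ⊗[k] H) (revR R : H ⊗[k] H),
    sw_comm (Coalgebra.comul (R := k) h) (revR R : H ⊗[k] H),
    sw_comm (Coalgebra.comul (R := k) b) (Coalgebra.comul (R := k) h),
    sw_comm (R : H ⊗[k] H) (Coalgebra.comul (R := k) h)]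
  simp only [wd, ← Drin.inHAlg_apply, map_mul, mul_assoc]

/-- The coproduct of the tensor square of the braided double. -/
noncomputable abbrev comul₂ : Drin R ev ⊗[k] Drin R ev →ₗ[k]
    (Drin R ev ⊗[k] Drin R ev) ⊗[k] (Drin R ev ⊗[k] Drin R ev) :=
  comulTensor (Drin.comul ev hC hB hR).toLinearMap (TensorProduct.comm k _ _).toLinearMap

theorem conv_word (f g : Drin R ev ⊗[k] Drin R ev →ₗ[k] k) (b b' : B) (h h' : H) (c c' : C) :
    conv (comul₂ hC hB hR) f g (wd R ev b h c ⊗ₜ wd R ev b' h' c') =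
      wordSum (k := k) R b h c fun b₁ u c₂ b₂ v c₁ =>
        wordSum (k := k) R b' h' c' fun b₁' u' c₂' b₂' v' c₁' =>
          f (wd R ev b₁ u c₂ ⊗ₜ wd R ev b₁' u' c₂') * g (wd R ev b₂ v c₁ ⊗ₜ wd R ev b₂' v' c₁') := by
  rw [comul₂, conv_comm]
  simp only [AlgHom.toLinearMap_apply]
  rw [sw_comul_word hC hB hR b h c (fun x₁ x₂ => sw (Drin.comul ev hC hB hR (wd R ev b' h' c'))
    fun y₁ y₂ => f (x₁ ⊗ₜ y₁) * g (x₂ ⊗ₜ y₂)) (by fun_prop) (by fun_prop)]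
  simp (disch := fun_prop) only [sw_comul_word]

local notation "ε" => Coalgebra.counit (R := k)

/-- `f` is the form `(b h c, b' h' c') ↦ ρ(b, h ▷ b') ε(h') ε(c) ε(c')`. -/
def IsLeftForm (ρ : B ⊗[k] B →ₗ[k] k) (f : Drin R ev ⊗[k] Drin R ev →ₗ[k] k) : Prop :=
  ∀ b h c b' h' c', f (wd R ev b h c ⊗ₜ wd R ev b' h' c') =
    ε c • ε h' • ε c' • ρ (b ⊗ₜ (h • b'))

/-- `f` is the form `(b h c, b' h' c') ↦ ε(b) ε(h) ε(b') τ(c, h' ▷ c')`. -/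
def IsRightForm (τ : C ⊗[k] C →ₗ[k] k) (f : Drin R ev ⊗[k] Drin R ev →ₗ[k] k) : Prop :=
  ∀ b h c b' h' c', f (wd R ev b h c ⊗ₜ wd R ev b' h' c') =
    ε b • ε h • ε b' • τ (c ⊗ₜ (h' • c'))

/-- `f` is the form `(b h c, b' h' c') ↦ ε(b) ε(h) g(c, b') ε(h') ε(c')`. -/
def IsPairForm (g : C ⊗[k] B →ₗ[k] k) (f : Drin R ev ⊗[k] Drin R ev →ₗ[k] k) : Prop :=
  ∀ b h c b' h' c', f (wd R ev b h c ⊗ₜ wd R ev b' h' c') =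
    ε b • ε h • ε h' • ε c' • g (c ⊗ₜ b')

include hW in
theorem exists_leftForm (ρ : B ⊗[k] B →ₗ[k] k) :
    ∃ f : Drin R ev ⊗[k] Drin R ev →ₗ[k] k, IsLeftForm ρ f :=
  exists_form hW (fun b h c b' h' c' => ε c • ε h' • ε c' • ρ (b ⊗ₜ (h • b'))) (by fun_prop)
    (by fun_prop) (by fun_prop) (by fun_prop) (by fun_prop) (by fun_prop)

include hW in
theorem exists_rightForm (τ : C ⊗[k] C →ₗ[k] k) :
    ∃ f : Drin R ev ⊗[k] Drin R ev →ₗ[k] k, IsRightForm τ f :=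
  exists_form hW (fun b h c b' h' c' => ε b • ε h • ε b' • τ (c ⊗ₜ (h' • c'))) (by fun_prop)
    (by fun_prop) (by fun_prop) (by fun_prop) (by fun_prop) (by fun_prop)

include hW in
theorem exists_pairForm (g : C ⊗[k] B →ₗ[k] k) :
    ∃ f : Drin R ev ⊗[k] Drin R ev →ₗ[k] k, IsPairForm g f :=
  exists_form hW (fun b h c b' h' c' => ε b • ε h • ε h' • ε c' • g (c ⊗ₜ b')) (by fun_prop)
    (by fun_prop) (by fun_prop) (by fun_prop) (by fun_prop) (by fun_prop)

section conv
variable {ρ ρ' : B ⊗[k] B →ₗ[k] k} {τ τ' : C ⊗[k] C →ₗ[k] k} {g g' : C ⊗[k] B →ₗ[k] k}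
  {f f' : Drin R ev ⊗[k] Drin R ev →ₗ[k] k}

/-- The copy of R in the coproduct of the left word acts on the argument from the right word, and
there it is the braiding in Δ_{B ⊗ B}. Extending forms from B to the double is therefore
multiplicative for convolution. -/
theorem IsLeftForm.conv (hf : IsLeftForm ρ f) (hf' : IsLeftForm ρ' f') :
    IsLeftForm (conv (comulTensor Coalgebra.comul (braid R)) ρ ρ')
      (conv (comul₂ hC hB hR) f f') := fun b h c b' h' c' => by
  simp only [conv_word, hf _ _ _ _ _ _, hf' _ _ _ _ _ _]
  have e : ∀ x y z u x' y' z' u' : k, x • y • z • u * x' • y' • z' • u' =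
      z • z' • y • y' • x • x' • (u * u') := fun x y z u x' y' z' u' => by
    simp only [smul_eq_mul]; ring
  simp (disch := fun_prop) only [e, wordSum_only_left hC hB hR]
  have e2 : ∀ x y z : k, ε h' • ε c' • x • y • z = x • y • ε h' • ε c' • z := fun x y z => by
    simp only [smul_eq_mul]; ring
  simp only [← smul_sw, e2]
  rw [wordSum_right_trivial hC hB hR b h c (fun b₁ u b₂ v => ε h' • ε c' •
    sw (Coalgebra.comul (R := k) b') fun a b => ρ (b₁ ⊗ₜ (u • a)) * ρ' (b₂ ⊗ₜ (v • b)))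
    (by fun_prop) (by fun_prop) (by fun_prop) (by fun_prop), BrBialg.conv_eq_sw]
  simp (disch := fun_prop) only [BrBialg.sw_delta, hB.sw_comul_smul, ← smul_sw, mul_smul]
  congr 3
  refine sw_congr fun b₁ b₂ => ?_
  rw [sw_comm]
  refine sw_congr fun x y => ?_
  rw [sw_comm]

/-- On the side of C two reversed R-matrices remain, one from the co-opposite coproduct of `c` and
one from the braiding. They act jointly on the arguments of τ and collapse by invariance, so τ has
to be a morphism here. -/
theorem IsRightForm.conv (hτ : IsInvariant₂ H τ) (hf : IsRightForm τ f) (hf' : IsRightForm τ' f') :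
    IsRightForm (conv (comulTensor (braidInv R ∘ₗ Coalgebra.comul) (braid (revR R))) τ τ')
      (conv (comul₂ hC hB hR) f f') := fun b h c b' h' c' => by
  simp only [conv_word, hf _ _ _ _ _ _, hf' _ _ _ _ _ _]
  have e : ∀ x y z u x' y' z' u' : k, x • y • z • u * x' • y' • z' • u' =
      z • z' • x • x' • y • y' • (u * u') := fun x y z u x' y' z' u' => by
    simp only [smul_eq_mul]; ring
  simp (disch := fun_prop) only [e, wordSum_left_trivial hC hB hR]
  have e2 : ∀ x y z w t : k, ε b' • x • y • z • w • t = x • y • z • w • ε b' • t :=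
    fun x y z w t => by simp only [smul_eq_mul]; ring
  simp only [← smul_sw, e2]
  rw [wordSum_only_right hC hB hR b h c (fun c₂ c₁ => ε b' •
    sw (Coalgebra.comul (R := k) h') fun x y => sw (Coalgebra.comul (R := k) c') fun c₁' c₂' =>
      sw (revR R : H ⊗[k] H) fun p q => τ (c₂ ⊗ₜ ((x * q) • c₂')) * τ' (c₁ ⊗ₜ (y • p • c₁')))
    (by fun_prop) (by fun_prop), BrBialg.conv_eq_sw]
  have hC' := hC.cop hR
  simp (disch := fun_prop) only [BrBialg.sw_delta, hC'.sw_comul_smul, ← smul_sw, mul_smul]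
  simp (disch := fun_prop) only [sw_cop]
  congr 3
  refine sw_congr fun c₁ c₂ => ?_
  have key : ∀ X Y : C, (sw (revR R : H ⊗[k] H) fun p q => sw (revR R : H ⊗[k] H) fun r s =>
      τ ((q • c₂) ⊗ₜ (s • X)) * τ' ((r • p • c₁) ⊗ₜ Y)) = τ (c₂ ⊗ₜ X) * τ' (c₁ ⊗ₜ Y) :=
    fun X Y => by
      rw [sw_comm]
      have := ev_collapse' hτ hR c₂ X (fun u => τ' ((u • c₁) ⊗ₜ[k] Y)) (by fun_prop)
      simpa only [smul_eq_mul, mul_smul, one_smul] using this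
  conv_rhs => rw [sw_comm]
  refine sw_congr fun x y => ?_
  conv_rhs => rw [sw_comm]
  refine sw_congr fun c₁' c₂' => ?_
  conv_rhs => rw [sw_comm]
  exact sw_congr fun p q => (key _ _).symm

theorem IsPairForm.conv (hf : IsPairForm g f) (hf' : IsPairForm g' f') (b b' : B) (h h' : H)
    (c c' : C) : 
      conv (comul₂ hC hB hR) f f' (wd R ev b h c ⊗ₜ wd R ev b' h' c') = ε b • ε h • ε h' • ε c' •
        sw (Coalgebra.comul (R := k) c) fun c₁ c₂ => sw (Coalgebra.comul (R := k) b') fun b₁ b₂ =>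
          g (c₂ ⊗ₜ b₁) * g' (c₁ ⊗ₜ b₂) := by
  simp only [conv_word, hf _ _ _ _ _ _, hf' _ _ _ _ _ _]
  have e : ∀ x y z w u x' y' z' w' u' : k, x • y • z • w • u * x' • y' • z' • w' • u' =
      w • w' • z • z' • (x • x' • y • y' • (u * u')) := fun x y z w u x' y' z' w' u' => by
    simp only [smul_eq_mul]; ring
  simp (disch := fun_prop) only [e, wordSum_only_left hC hB hR]
  have e2 : ∀ x y z w t : k, ε h' • ε c' • x • y • z • w • t =
    x • y • z • w • ε h' • ε c' • t := fun x y z w t => by simp only [smul_eq_mul]; ring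
  simp only [← smul_sw, e2]
  rw [wordSum_only_right hC hB hR b h c (fun c₂ c₁ => ε h' • ε c' •
    sw (Coalgebra.comul (R := k) b') fun b₁ b₂ => g (c₂ ⊗ₜ b₁) * g' (c₁ ⊗ₜ b₂))
    (by fun_prop) (by fun_prop)]
  simp only [← smul_sw]

theorem conv_left_right (hf : IsLeftForm ρ f) (hf' : IsRightForm τ f') (b b' : B) (h h' : H)
    (c c' : C) : conv (comul₂ hC hB hR) f f' (wd R ev b h c ⊗ₜ wd R ev b' h' c') =
      sw (revR R : H ⊗[k] H) fun p q => ρ (b ⊗ₜ ((h * q) • b')) * τ ((p • c) ⊗ₜ (h' • c')) := by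
  simp only [conv_word, hf _ _ _ _ _ _, hf' _ _ _ _ _ _]
  have e : ∀ x y z u x' y' z' u' : k, x • y • z • u * x' • y' • z' • u' =
      y • z • z' • x' • y' • x • (u * u') := fun x y z u x' y' z' u' => by
    simp only [smul_eq_mul]; ring
  simp (disch := fun_prop) only [e, wordSum_first_left hC hB hR]
  simp (disch := fun_prop) only [hB.sw_counit_right]
  exact wordSum_mixed hC hB hR b h c (fun b₁ u c₁ => ρ (b₁ ⊗ₜ (u • b')) * τ (c₁ ⊗ₜ (h' • c')))
    (by fun_prop) (by fun_prop) (by fun_prop)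

end conv
end Drin

end
end BraidedDouble

/-! ### Factorisation and convolution inverse of the composite -/

namespace BraidedDouble
section
variable {k H : Type*} [Field k] [Ring H] [HopfAlgebra k H]
variable {B C : Type*}
  [Ring B] [Algebra k B] [Coalgebra k B] [Module H B] [IsScalarTower k H B]
  [Ring C] [Algebra k C] [Coalgebra k C] [Module H C] [IsScalarTower k H C]
variable {R : (H ⊗[k] H)ˣ} {ev : C ⊗[k] B →ₗ[k] k}
variable (hC : BrBialg R (Coalgebra.comul (R := k) (A := C)) Coalgebra.counit)
  (hB : BrBialg R (Coalgebra.comul (R := k) (A := B)) Coalgebra.counit)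
  (hev : PairingLaws (H := H) ev) (hR : IsUniversalRMatrix R)
  (hW : Function.Bijective (word (Drin.inHAlg R ev) (inB R ev) (inC R ev)))

local notation "ε" => Coalgebra.counit (R := k)

namespace Drin

section conv
variable {ρ ρ' : B ⊗[k] B →ₗ[k] k} {τ τ' : C ⊗[k] C →ₗ[k] k} {g g' : C ⊗[k] B →ₗ[k] k}
  {f f' f'' : Drin R ev ⊗[k] Drin R ev →ₗ[k] k}

theorem conv_pair_left_right (hf : IsPairForm g f) (hf' : IsLeftForm ρ f') (hf'' : IsRightForm τ f'')
    (b b' : B) (h h' : H) (c c' : C) :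
    conv (comul₂ hC hB hR) f (conv (comul₂ hC hB hR) f' f'')
      (wd R ev b h c ⊗ₜ wd R ev b' h' c') =
      sw (Coalgebra.comul (R := k) c) fun c₁ c₂ => sw (Coalgebra.comul (R := k) b') fun b₁ b₂ =>
        sw (revR R : H ⊗[k] H) fun p q =>
          g (c₂ ⊗ₜ b₁) • (ρ (b ⊗ₜ (h • q • b₂)) * τ ((p • c₁) ⊗ₜ (h' • c'))) := by
  rw [conv_word]
  simp only [hf _ _ _ _ _ _, conv_left_right hC hB hR hf' hf'']
  have e : ∀ x y z w u t : k, x • y • z • w • u * t = z • w • x • y • u • t :=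
    fun x y z w u t => by simp only [smul_eq_mul]; ring
  simp (disch := fun_prop) only [e, wordSum_first_left hC hB hR]
  simp only [← smul_sw]
  rw [wordSum_first_right hC hB hR b h c (fun c₂ b v c₁ =>
    sw (Coalgebra.comul (R := k) b') fun b₁ b₂ => g (c₂ ⊗ₜ b₁) • sw (revR R : H ⊗[k] H) fun p q =>
      ρ (b ⊗ₜ ((v * q) • b₂)) * τ ((p • c₁) ⊗ₜ (h' • c')))
    (by fun_prop) (by fun_prop) (by fun_prop) (by fun_prop)]
  simp only [mul_smul, smul_sw]

include hW in
theorem IsLeftForm.eq_counit (hf : IsLeftForm (LinearMap.mul' k k ∘ₗ TensorProduct.map ε ε) f) :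
    f = LinearMap.mul' k k ∘ₗ TensorProduct.map (Drin.counit ev hC hB hR).toLinearMap
      (Drin.counit ev hC hB hR).toLinearMap := by
  refine form_ext hW fun b h c b' h' c' => (hf b h c b' h' c').trans ?_
  simp only [LinearMap.comp_apply, TensorProduct.map_tmul, AlgHom.toLinearMap_apply, map_mul,
    counit_inB, counit_inC, counit_inH, LinearMap.mul'_apply, hB.counit_smul, smul_eq_mul]
  ring

include hW in
theorem IsRightForm.eq_counit (hf : IsRightForm (LinearMap.mul' k k ∘ₗ TensorProduct.map ε ε) f) :
    f = LinearMap.mul' k k ∘ₗ TensorProduct.map (Drin.counit ev hC hB hR).toLinearMap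
      (Drin.counit ev hC hB hR).toLinearMap := by
  refine form_ext hW fun b h c b' h' c' => (hf b h c b' h' c').trans ?_
  simp only [LinearMap.comp_apply, TensorProduct.map_tmul, AlgHom.toLinearMap_apply, map_mul,
    counit_inB, counit_inC, counit_inH, LinearMap.mul'_apply, hC.counit_smul, smul_eq_mul]
  ring

include hW in
theorem IsPairForm.conv_eq_counit (hf : IsPairForm g f) (hf' : IsPairForm g' f')
    (hg : ∀ c b, (sw (Coalgebra.comul (R := k) c) fun c₁ c₂ =>
      sw (Coalgebra.comul (R := k) b) fun b₁ b₂ => g (c₂ ⊗ₜ b₁) * g' (c₁ ⊗ₜ b₂)) = ε c * ε b) :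
    BraidedDouble.conv (comul₂ hC hB hR) f f' =
      LinearMap.mul' k k ∘ₗ TensorProduct.map (Drin.counit ev hC hB hR).toLinearMap
        (Drin.counit ev hC hB hR).toLinearMap := by
  refine form_ext hW fun b h c b' h' c' =>
    (IsPairForm.conv hC hB hR hf hf' b b' h h' c c').trans ?_
  simp only [hg, LinearMap.comp_apply, TensorProduct.map_tmul, AlgHom.toLinearMap_apply, map_mul,
    counit_inB, counit_inC, counit_inH, LinearMap.mul'_apply, smul_eq_mul]
  ring

end conv
end Drin

theorem conv_triple_inverse {A : Type*} [AddCommGroup A] [Module k A] {Δ : A →ₗ[k] A ⊗[k] A}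
    {e : A →ₗ[k] k} (hΔ : ∀ v, TensorProduct.assoc k A A A (Δ.rTensor A (Δ v)) = Δ.lTensor A (Δ v))
    (he : ∀ v, TensorProduct.lid k A (e.rTensor A (Δ v)) = v) {f f' g g' h h' : A →ₗ[k] k}
    (hf : conv Δ f f' = e) (hg : conv Δ g g' = e) (hh : conv Δ h h' = e) :
    conv Δ (conv Δ f (conv Δ g h)) (conv Δ h' (conv Δ g' f')) = e := by
  rw [conv_assoc hΔ, conv_assoc hΔ, ← conv_assoc hΔ h, hh, conv_counit_left he,
    ← conv_assoc hΔ g, hg, conv_counit_left he, hf]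

theorem isInvariant_self {V : Type*} [AddCommGroup V] [Module k V] (f : V →ₗ[k] k) :
    IsInvariant k f := fun h v => by
  rw [map_smul, smul_eq_mul, CommSemiring.counit_apply]

theorem isInvariant₂_self {V W : Type*} [AddCommGroup V] [Module k V] [AddCommGroup W] [Module k W]
    (f : V ⊗[k] W →ₗ[k] k) : IsInvariant₂ k f := fun h x => by
  rw [CommSemiring.counit_apply, CommSemiring.comul_apply, act₂_sw]
  simp (disch := fun_prop) only [sw_tmul, one_smul]
  have e : sw x (fun v w => v ⊗ₜ[k] (h • w)) = h • x := by
    conv_rhs => rw [eq_sw x, smul_sw]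
    exact sw_congr fun v w => TensorProduct.tmul_smul _ _ _
  exact (congrArg f e).trans (map_smul f h x)

namespace Tw
variable {σ : B ⊗[k] B →ₗ[k] k} {τ : C ⊗[k] C →ₗ[k] k}
  (hσ : IsTwoCocycle H Coalgebra.comul Coalgebra.counit (braid R) σ)
  (hτ : IsTwoCocycle H (braidInv R ∘ₗ Coalgebra.comul) Coalgebra.counit (braid (revR R)) τ)

/-- The form `σ ∘ τ` on the braided double. -/
noncomputable def composite : Drin R ev ⊗[k] Drin R ev →ₗ[k] k :=
  form hC hB hev hR (hB.unitalColinear_twistMul hR hσ)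
    ((hC.cop hR).unitalColinear_twistMul hR.revR hτ) hW

theorem composite_word (b b' : B) (h h' : H) (c c' : C) : composite hC hB hev hR hW hσ hτ
    (Drin.wd R ev b h c ⊗ₜ Drin.wd R ev b' h' c') =
      sw (cross R ev (c ⊗ₜ b')) fun u v => σ (b ⊗ₜ (h • u)) * τ (v ⊗ₜ (h' • c')) := by
  rw [composite, Drin.wd, Drin.wd, form_word]
  simp only [hB.counit_twistMul hR, (hC.cop hR).counit_twistMul hR.revR]

/-- In the product of the three partial forms only one reversed R-matrix survives the counits, and
it is the one in the cross map. Invertibility can thus be checked factor by factor, without an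
explicit inverse on words. -/
theorem composite_eq_conv {f g h : Drin R ev ⊗[k] Drin R ev →ₗ[k] k} (hf : Drin.IsPairForm ev f)
    (hg : Drin.IsLeftForm σ g) (hh : Drin.IsRightForm τ h) :
    composite hC hB hev hR hW hσ hτ =
      conv (Drin.comul₂ hC hB hR) f (conv (Drin.comul₂ hC hB hR) g h) := by
  refine Drin.form_ext hW fun b x c b' x' c' => ?_
  refine (composite_word hC hB hev hR hW hσ hτ b b' x x' c c').trans ?_
  refine Eq.trans ?_ (Drin.conv_pair_left_right hC hB hR hf hg hh b b' x x' c c').symm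
  simp (disch := fun_prop) only [sw_cross]

theorem composite_invertible {g : C ⊗[k] B →ₗ[k] k}
    (hg : ∀ c b, (sw (Coalgebra.comul (R := k) c) fun c₁ c₂ =>
      sw (Coalgebra.comul (R := k) b) fun b₁ b₂ => ev (c₂ ⊗ₜ b₁) * g (c₁ ⊗ₜ b₂)) = ε c * ε b)
    (hg' : ∀ c b, (sw (Coalgebra.comul (R := k) c) fun c₁ c₂ =>
      sw (Coalgebra.comul (R := k) b) fun b₁ b₂ => g (c₂ ⊗ₜ b₁) * ev (c₁ ⊗ₜ b₂)) = ε c * ε b) :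
    ∃ ω' : Drin R ev ⊗[k] Drin R ev →ₗ[k] k,
      conv (Drin.comul₂ hC hB hR) (composite hC hB hev hR hW hσ hτ) ω' =
        LinearMap.mul' k k ∘ₗ TensorProduct.map (Drin.counit ev hC hB hR).toLinearMap
          (Drin.counit ev hC hB hR).toLinearMap ∧
      conv (Drin.comul₂ hC hB hR) ω' (composite hC hB hev hR hW hσ hτ) =
        LinearMap.mul' k k ∘ₗ TensorProduct.map (Drin.counit ev hC hB hR).toLinearMap
          (Drin.counit ev hC hB hR).toLinearMap := by
  obtain ⟨σ', -, hσ₁, hσ₂⟩ := hσ.conv_invertible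
  obtain ⟨τ', hτ', hτ₁, hτ₂⟩ := hτ.conv_invertible
  obtain ⟨E, hE⟩ := Drin.exists_pairForm hW ev
  obtain ⟨G, hG⟩ := Drin.exists_pairForm hW g
  obtain ⟨s, hs⟩ := Drin.exists_leftForm hW σ
  obtain ⟨s', hs'⟩ := Drin.exists_leftForm hW σ'
  obtain ⟨t, ht⟩ := Drin.exists_rightForm hW τ
  obtain ⟨t', ht'⟩ := Drin.exists_rightForm hW τ'
  have hΔ := comulTensor_comm_coassoc (Δ := (Drin.comul ev hC hB hR).toLinearMap)
    (drinBialgebra ev hC hB hR).coassoc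
  have he := comulTensor_comm_counit (Δ := (Drin.comul ev hC hB hR).toLinearMap)
    (show ∀ v, TensorProduct.lid k _ ((Drin.counit ev hC hB hR).toLinearMap.rTensor _
      ((Drin.comul ev hC hB hR).toLinearMap v)) = v from
        (drinBialgebra ev hC hB hR).counit_left)
  rw [composite_eq_conv hC hB hev hR hW hσ hτ hE hs ht]
  -- The inverse factors in reverse order: that of τ, that of σ, that of `ev`.
  refine ⟨conv (Drin.comul₂ hC hB hR) t' (conv (Drin.comul₂ hC hB hR) s' G), ?_, ?_⟩
  · refine conv_triple_inverse hΔ he (hE.conv_eq_counit hC hB hR hW hG hg)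
      (Drin.IsLeftForm.eq_counit hC hB hR hW ?_) (Drin.IsRightForm.eq_counit hC hB hR hW ?_)
    · rw [← hσ₁]; exact hs.conv hC hB hR hs'
    · rw [← hτ₁]; exact ht.conv hC hB hR hτ.invariant ht'
  · refine conv_triple_inverse hΔ he (Drin.IsRightForm.eq_counit hC hB hR hW ?_)
      (Drin.IsLeftForm.eq_counit hC hB hR hW ?_) (hG.conv_eq_counit hC hB hR hW hE hg')
    · rw [← hτ₂]; exact ht'.conv hC hB hR hτ' ht
    · rw [← hσ₂]; exact hs'.conv hC hB hR hs

theorem isTwoCocycle_composite (hS : Function.Bijective (HopfAlgebra.antipode k (A := H)))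
    {g : C ⊗[k] B →ₗ[k] k}
    (hg : ∀ c b, (sw (Coalgebra.comul (R := k) c) fun c₁ c₂ =>
      sw (Coalgebra.comul (R := k) b) fun b₁ b₂ => ev (c₂ ⊗ₜ b₁) * g (c₁ ⊗ₜ b₂)) = ε c * ε b)
    (hg' : ∀ c b, (sw (Coalgebra.comul (R := k) c) fun c₁ c₂ =>
      sw (Coalgebra.comul (R := k) b) fun b₁ b₂ => g (c₂ ⊗ₜ b₁) * ev (c₁ ⊗ₜ b₂)) = ε c * ε b) :
    IsTwoCocycle k (Drin.comul ev hC hB hR).toLinearMap (Drin.counit ev hC hB hR).toLinearMap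
      (TensorProduct.comm k _ _).toLinearMap (composite hC hB hev hR hW hσ hτ) where
  invariant := isInvariant₂_self _
  conv_invertible := by
    obtain ⟨ω, h1, h2⟩ := composite_invertible hC hB hev hR hW hσ hτ hg hg'
    exact ⟨ω, isInvariant₂_self _, h1, h2⟩
  cocycle x y z := form_cocycle _ _ _ _ _ _ _ hS x y z
  one_left x := form_one_left _ _ _ _ _ _ _ x
  one_right x := form_one_right _ _ _ _ _ _ _ x

end Tw

end
end BraidedDouble

/-! ### Twisting by a linear form -/

namespace BraidedDouble
section
variable {k H : Type*} [Field k] [Ring H] [HopfAlgebra k H]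
variable {Z : Type*} [AddCommGroup Z] [Module k Z]

section twistBy
variable {A : Type*} [AddCommGroup A] [Module k A] (Δ : A →ₗ[k] A ⊗[k] A) (β : A →ₗ[k] k)

/-- The map `a ↦ a₍₁₎ β(a₍₂₎)`. -/
noncomputable def twistBy : A →ₗ[k] A :=
  (TensorProduct.rid k A).toLinearMap ∘ₗ LinearMap.lTensor A β ∘ₗ Δ

theorem twistBy_apply (a : A) : twistBy Δ β a = sw (Δ a) fun x y => β y • x :=
  rid_lTensor_apply β (Δ a)

variable {Δ}

/-- The twist uses only the last leg, so by coassociativity it is a left comodule map. -/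
theorem sw_comul_twistBy
    (hΔ : ∀ v, TensorProduct.assoc k A A A (Δ.rTensor A (Δ v)) = Δ.lTensor A (Δ v)) (a : A)
    (f : A → A → Z) (h1 : ∀ b, Lin k (fun a => f a b)) (h2 : ∀ a, Lin k (fun b => f a b)) :
    sw (Δ (twistBy Δ β a)) f = sw (Δ a) fun x y => f x (twistBy Δ β y) := by
  have e : ∀ x y, f x (twistBy Δ β y) = sw (Δ y) fun u v => β v • f x u := fun x y => by
    rw [twistBy_apply, Lin.map_sw (h2 x)]
    exact sw_congr fun u v => (h2 x).2 _ _
  simp only [e]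
  rw [← sw_coassoc hΔ a (fun x u v => β v • f x u) (by fun_prop) (by fun_prop) (by fun_prop),
    twistBy_apply, map_sw]
  simp only [map_smul, ← smul_sw]
  exact (Lin.map_sw (by fun_prop : Lin k fun t => sw t f) (Δ a) fun x y => β y • Δ x).trans
    (sw_congr fun x y => sw_ksmul _ _ _ h1 h2)

theorem twistBy_twistBy
    (hΔ : ∀ v, TensorProduct.assoc k A A A (Δ.rTensor A (Δ v)) = Δ.lTensor A (Δ v))
    (β' : A →ₗ[k] k) (a : A) : twistBy Δ β' (twistBy Δ β a) = twistBy Δ (conv Δ β' β) a := by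
  rw [twistBy_apply _ β', sw_comul_twistBy β hΔ a (fun x y => β' y • x) (by fun_prop) (by fun_prop),
    twistBy_apply]
  refine sw_congr fun x y => ?_
  rw [twistBy_apply, BrBialg.conv_eq_sw, map_sw]
  simp only [map_smul, smul_eq_mul, mul_comm]

theorem twistBy_counit {ε : A →ₗ[k] k} (hε : ∀ v, TensorProduct.rid k A (ε.lTensor A (Δ v)) = v)
    (a : A) : twistBy Δ ε a = a := hε a

theorem counit_twistBy {ε : A →ₗ[k] k} (hε : ∀ v, TensorProduct.lid k A (ε.rTensor A (Δ v)) = v)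
    (a : A) : ε (twistBy Δ β a) = β a := by
  rw [twistBy_apply, map_sw]
  simp only [map_smul, smul_eq_mul, mul_comm (β _)]
  exact sw_counit_left hε a (fun y => β y) (by fun_prop)

end twistBy

section
variable {A : Type*} [Ring A] [Algebra k A] {Δ : A →ₗ[k] A ⊗[k] A} {ψ : A ⊗[k] A →ₗ[k] A ⊗[k] A}

theorem coboundaryTwist_eq (β β' : A →ₗ[k] k) (σ : A ⊗[k] A →ₗ[k] k) :
    coboundaryTwist Δ ψ β β' σ = conv (comulTensor Δ ψ) (β' ∘ₗ LinearMap.mul' k A) σ ∘ₗ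
      TensorProduct.map (twistBy Δ β) (twistBy Δ β) := rfl
end

namespace BrBialg
variable {B : Type*} [Ring B] [Algebra k B] [Module H B] [IsScalarTower k H B]
variable {R : (H ⊗[k] H)ˣ} {Δ : B →ₗ[k] B ⊗[k] B} {ε β β' : B →ₗ[k] k}
variable (hB : BrBialg R Δ ε)
include hB

theorem twistBy_smul (hβ : IsInvariant H β) (h : H) (b : B) :
    twistBy Δ β (h • b) = h • twistBy Δ β b := by
  rw [twistBy_apply, twistBy_apply, smul_sw]
  simp (disch := fun_prop) only [hB.sw_comul_smul, hβ _ _, mul_smul]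
  rw [sw_comm]
  refine sw_congr fun b₁ b₂ => ?_
  exact (sw_comul_counit h (fun x => β b₂ • x • b₁) (by fun_prop)).trans (smul_comm _ _ _)

theorem sw_delta_twistBy (hβ : IsInvariant H β) (x : B ⊗[k] B) (f : B ⊗[k] B → B ⊗[k] B → Z)
    (h1 : ∀ b, Lin k (fun a => f a b)) (h2 : ∀ a, Lin k (fun b => f a b)) :
    sw (comulTensor Δ (braid R) (TensorProduct.map (twistBy Δ β) (twistBy Δ β) x)) f =
      sw (comulTensor Δ (braid R) x) fun p q =>
        f p (TensorProduct.map (twistBy Δ β) (twistBy Δ β) q) := by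
  have : IsLinearMap.mk' _ (by fun_prop : Lin k fun x => sw (comulTensor Δ (braid R)
        (TensorProduct.map (twistBy Δ β) (twistBy Δ β) x)) f) =
      IsLinearMap.mk' _ (by fun_prop : Lin k fun x => sw (comulTensor Δ (braid R) x) fun p q =>
        f p (TensorProduct.map (twistBy Δ β) (twistBy Δ β) q)) := by
    refine TensorProduct.ext' fun a b => ?_
    change sw (comulTensor Δ (braid R) (TensorProduct.map (twistBy Δ β) (twistBy Δ β) (a ⊗ₜ b))) f =
      sw (comulTensor Δ (braid R) (a ⊗ₜ b)) fun p q =>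
        f p (TensorProduct.map (twistBy Δ β) (twistBy Δ β) q)
    rw [TensorProduct.map_tmul]
    simp (disch := fun_prop) only [sw_delta, sw_comul_twistBy _ hB.coassoc, TensorProduct.map_tmul,
      hB.twistBy_smul hβ]
  exact LinearMap.congr_fun this x

theorem conv_comp_mul (f g : B →ₗ[k] k) :
    conv (comulTensor Δ (braid R)) (f ∘ₗ LinearMap.mul' k B) (g ∘ₗ LinearMap.mul' k B) =
      conv Δ f g ∘ₗ LinearMap.mul' k B := by
  refine LinearMap.ext fun x => ?_
  rw [LinearMap.comp_apply, conv_eq_sw, conv_eq_sw, hB.comul_mul']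
  simp (disch := fun_prop) only [sw_sw, sw_tmul, LinearMap.comp_apply]

theorem counit_comp_mul : ε ∘ₗ LinearMap.mul' k B = LinearMap.mul' k k ∘ₗ TensorProduct.map ε ε :=
  TensorProduct.ext' fun a b => by
    simp only [LinearMap.comp_apply, LinearMap.mul'_apply, TensorProduct.map_tmul, hB.counit_mul]

theorem delta_counit_left (hR : IsUniversalRMatrix R) (x : B ⊗[k] B) :
    TensorProduct.lid k _ ((LinearMap.mul' k k ∘ₗ TensorProduct.map ε ε).rTensor _
      (comulTensor Δ (braid R) x)) = x := by
  have : (TensorProduct.lid k _).toLinearMap ∘ₗ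
      (LinearMap.mul' k k ∘ₗ TensorProduct.map ε ε).rTensor _ ∘ₗ
        comulTensor Δ (braid R) = LinearMap.id := by
    refine TensorProduct.ext' fun a b => ?_
    simp only [LinearMap.comp_apply, LinearEquiv.coe_coe, lid_rTensor_apply]
    simp (disch := fun_prop) only [sw_delta, TensorProduct.map_tmul, LinearMap.comp_apply,
      LinearMap.mul'_apply, mul_smul, hB.counit_smul, ← smul_sw, LinearMap.id_apply]
    simp (disch := fun_prop) only [sw_R_counit hR, smul_sw, one_smul]
    simp (disch := fun_prop) only [← smul_sw, hB.sw_counit_left]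
  exact LinearMap.congr_fun this x

theorem twistBy_mul' (x : B ⊗[k] B) : twistBy Δ β (LinearMap.mul' k B x) =
    sw (comulTensor Δ (braid R) x) fun p q =>
      β (LinearMap.mul' k B q) • LinearMap.mul' k B p := by
  rw [twistBy_apply, hB.comul_mul']
  simp (disch := fun_prop) only [sw_sw, sw_tmul]

/-- The meaning of σ^β: the twist by β is multiplicative from the σ^β-twisted product to the
σ-twisted one. -/
theorem twistBy_twistMul (hR : IsUniversalRMatrix R) (hβ : IsInvariant H β)
    (h : conv Δ β β' = ε) (σ : B ⊗[k] B →ₗ[k] k) (x : B ⊗[k] B) :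
    twistBy Δ β (twistMul Δ (braid R) (coboundaryTwist Δ (braid R) β β' σ) x) =
      twistMul Δ (braid R) σ (TensorProduct.map (twistBy Δ β) (twistBy Δ β) x) := by
  -- Composition with the product preserves convolution, so β ∘ m cancels the factor β^{-*} ∘ m in
  -- σ^β and leaves σ on twisted arguments.
  have key : ∀ y, conv (comulTensor Δ (braid R)) (β ∘ₗ LinearMap.mul' k B)
      (coboundaryTwist Δ (braid R) β β' σ) y =
      σ (TensorProduct.map (twistBy Δ β) (twistBy Δ β) y) := fun y => by
    have e := congrArg (fun f => conv (comulTensor Δ (braid R)) f σ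
      (TensorProduct.map (twistBy Δ β) (twistBy Δ β) y)) (hB.conv_comp_mul β β')
    simp only [h, hB.counit_comp_mul, conv_counit_left (hB.delta_counit_left hR)] at e
    rw [← e, conv_assoc (hB.delta_coassoc hR), conv_eq_sw, conv_eq_sw, coboundaryTwist_eq]
    exact (hB.sw_delta_twistBy hβ y (fun p q => (β ∘ₗ LinearMap.mul' k B) p *
      conv (comulTensor Δ (braid R)) (β' ∘ₗ LinearMap.mul' k B) σ q)
      (by fun_prop) (by fun_prop)).symm
  rw [twistMul_eq_sw, twistMul_eq_sw, map_sw,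
    hB.sw_delta_twistBy hβ x (fun p q => σ q • LinearMap.mul' k B p) (by fun_prop) (by fun_prop)]
  simp only [map_smul, hB.twistBy_mul', smul_sw, ← key, conv_eq_sw, ksw_smul]
  rw [hB.sw_delta_coassoc hR x (fun p q r => coboundaryTwist Δ (braid R) β β' σ r •
    β (LinearMap.mul' k B q) • LinearMap.mul' k B p) (by fun_prop) (by fun_prop) (by fun_prop)]
  simp only [smul_smul, mul_comm, LinearMap.comp_apply]

end BrBialg

theorem bos_twistBy {V X Y : Type*} [Ring V] [Algebra k V] [Module H V] [IsScalarTower k H V]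
    [Ring X] [Algebra k X] [Ring Y] [Algebra k Y] {R : (H ⊗[k] H)ˣ} {Δ : V →ₗ[k] V ⊗[k] V}
    {ε β : V →ₗ[k] k} (hV : BrBialg R Δ ε) (hβ : IsInvariant H β) (ι : H →ₐ[k] X)
    (jX : V →ₗ[k] X) (jY : V →ₗ[k] Y) (v : V) :
    bos R Δ ι jX jY (twistBy Δ β v) = bos R Δ ι jX (jY ∘ₗ twistBy Δ β) v := by
  simp (disch := fun_prop) only [bos_eq_sw, sw_comul_twistBy _ hV.coassoc, LinearMap.comp_apply,
    hV.twistBy_smul hβ]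

end
end BraidedDouble

/-! ### Gauge maps between twisted doubles -/

namespace BraidedDouble
section
variable {k H : Type*} [Field k] [Ring H] [HopfAlgebra k H]
variable {B C : Type*}
  [Ring B] [Algebra k B] [Coalgebra k B] [Module H B] [IsScalarTower k H B]
  [Ring C] [Algebra k C] [Coalgebra k C] [Module H C] [IsScalarTower k H C]
variable {R : (H ⊗[k] H)ˣ} {ev : C ⊗[k] B →ₗ[k] k}
  {mB mB' : B ⊗[k] B →ₗ[k] B} {mC mC' : C ⊗[k] C →ₗ[k] C}
variable (hC : BrBialg R (Coalgebra.comul (R := k) (A := C)) Coalgebra.counit)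
  (hB : BrBialg R (Coalgebra.comul (R := k) (A := B)) Coalgebra.counit)
  (hev : PairingLaws (H := H) ev) (hR : IsUniversalRMatrix R)
  {β : B →ₗ[k] k} {γ : C →ₗ[k] k} (hβ : IsInvariant H β) (hγ : IsInvariant H γ)

section
include hC hR hγ

/-- Invariance of γ puts a counit on one leg of the reversed R-matrix, which then disappears. -/
theorem twistBy_cop (c : C) : twistBy (braidInv R ∘ₗ Coalgebra.comul) γ c =
    sw (Coalgebra.comul (R := k) c) fun c₁ c₂ => γ c₁ • c₂ := by
  rw [twistBy_apply]
  simp (disch := fun_prop) only [sw_cop, hγ _ _, mul_smul]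
  simp (disch := fun_prop) only [sw_counit_R hR.revR, one_smul]

theorem sw_comul_twistBy_cop {Z : Type*} [AddCommGroup Z] [Module k Z] (c : C) (f : C → C → Z)
    (h1 : ∀ b, Lin k (fun a => f a b)) (h2 : ∀ a, Lin k (fun b => f a b)) :
    sw (Coalgebra.comul (R := k) (twistBy (braidInv R ∘ₗ Coalgebra.comul) γ c)) f =
      sw (Coalgebra.comul (R := k) c) fun c₁ c₂ =>
        f (twistBy (braidInv R ∘ₗ Coalgebra.comul) γ c₁) c₂ := by
  have e : ∀ x y, f (twistBy (braidInv R ∘ₗ Coalgebra.comul) γ x) y =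
      sw (Coalgebra.comul (R := k) x) fun u v => γ u • f v y := fun x y => by
    rw [twistBy_cop hC hR hγ, Lin.map_sw (h1 y)]
    exact sw_congr fun u v => (h1 y).2 _ _
  simp only [e]
  rw [hC.sw_coassoc c (fun u v y => γ u • f v y) (by fun_prop) (by fun_prop) (by fun_prop),
    twistBy_cop hC hR hγ, map_sw]
  simp only [map_smul, ← smul_sw]
  exact (Lin.map_sw (by fun_prop : Lin k fun t => sw t f) (Coalgebra.comul (R := k) c)
    fun x y => γ x • Coalgebra.comul y).trans (sw_congr fun x y => sw_ksmul _ _ _ h1 h2)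

include hB hβ in
-- The twists evaluate the last leg of `b` and the first leg of `c`, while the pairing takes the
-- first leg of `b` and the last of `c`. The two operations do not interfere.
theorem StraightRel.twistBy {X : Type*} [Ring X] [Algebra k X] {jB : B →ₗ[k] X} {jC : C →ₗ[k] X}
    (h : StraightRel R Coalgebra.comul Coalgebra.comul ev jB jC) :
    StraightRel R Coalgebra.comul Coalgebra.comul ev (jB ∘ₗ twistBy Coalgebra.comul β)
      (jC ∘ₗ BraidedDouble.twistBy (braidInv R ∘ₗ Coalgebra.comul) γ) := fun c b => by
  have hC' := hC.cop hR
  rw [LinearMap.comp_apply, LinearMap.comp_apply, h, evL, evL]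
  simp (disch := fun_prop) only [sw_comul_twistBy_cop hC hR hγ, sw_comul_twistBy β hB.coassoc]
  simp only [revProd, LinearMap.comp_apply, hB.twistBy_smul hβ, hC'.twistBy_smul hγ]

end

theorem Half.twistBy {X : Type*} [Ring X] [Algebra k X] {R : (H ⊗[k] H)ˣ}
    {Δ : B →ₗ[k] B ⊗[k] B} {ε : B →ₗ[k] k} (hB : BrBialg R Δ ε) (hβ : IsInvariant H β)
    (h1 : β 1 = 1)
    (hm : ∀ x, twistBy Δ β (mB' x) = mB (TensorProduct.map (twistBy Δ β) (twistBy Δ β) x))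
    {ι : H →ₐ[k] X} {j : B →ₗ[k] X} (h : Half mB ι j) :
    Half mB' ι (j ∘ₗ BraidedDouble.twistBy Δ β) where
  cov g b := by
    simp only [LinearMap.comp_apply, h.cov _ _, hB.twistBy_smul hβ]
  mul a b := by
    rw [LinearMap.comp_apply, LinearMap.comp_apply, h.mul, LinearMap.comp_apply, hm,
      TensorProduct.map_tmul]
  one := by
    rw [LinearMap.comp_apply, twistBy_apply, hB.comul_one]
    simp (disch := fun_prop) only [sw_tmul, h1, one_smul, h.one]

namespace Tw

variable (hβ1 : β 1 = 1) (hγ1 : γ 1 = 1)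
  (hβm : ∀ x, twistBy Coalgebra.comul β (mB' x) =
    mB (TensorProduct.map (twistBy Coalgebra.comul β) (twistBy Coalgebra.comul β) x))
  (hγm : ∀ x, twistBy (braidInv R ∘ₗ Coalgebra.comul) γ (mC' x) =
    mC (TensorProduct.map (twistBy (braidInv R ∘ₗ Coalgebra.comul) γ)
      (twistBy (braidInv R ∘ₗ Coalgebra.comul) γ) x))

variable (ev) in
/-- The map `b ↦ b₍₁₎ β(b₍₂₎)`, `c ↦ c₍₂₎ γ(c₍₁₎)` between twisted doubles. -/
noncomputable def retwist : Tw R ev mB' mC' →ₐ[k] Tw R ev mB mC :=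
  lift (mB := mB') (mC := mC') (ι := ofH R ev mB mC)
    ⟨(triple R ev mB mC).left.twistBy hB hβ hβ1 hβm,
      (triple R ev mB mC).right.twistBy (hC.cop hR) hγ hγ1 hγm⟩
    ((straightRel R ev mB mC).twistBy hC hB hR hβ hγ)

theorem retwist_ofB (b : B) : retwist ev hC hB hR hβ hγ hβ1 hγ1 hβm hγm (ofB R ev mB' mC' b) =
    ofB R ev mB mC (twistBy Coalgebra.comul β b) := lift_ofB _ _ _

theorem retwist_ofC (c : C) : retwist ev hC hB hR hβ hγ hβ1 hγ1 hβm hγm (ofC R ev mB' mC' c) =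
    ofC R ev mB mC (twistBy (braidInv R ∘ₗ Coalgebra.comul) γ c) := lift_ofC _ _ _

theorem retwist_ofH (h : H) : retwist ev hC hB hR hβ hγ hβ1 hγ1 hβm hγm (ofH R ev mB' mC' h) =
    ofH R ev mB mC h := lift_ofH _ _ _

theorem coact_retwist (hmB : UnitalColinear R Coalgebra.comul mB)
    (hmC : UnitalColinear (revR R) (braidInv R ∘ₗ Coalgebra.comul) mC)
    (hmB' : UnitalColinear R Coalgebra.comul mB')
    (hmC' : UnitalColinear (revR R) (braidInv R ∘ₗ Coalgebra.comul) mC')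
    (x : Tw R ev mB' mC') :
    coact hC hB hR hmB hmC (retwist ev hC hB hR hβ hγ hβ1 hγ1 hβm hγm x) =
      LinearMap.lTensor _ (retwist ev hC hB hR hβ hγ hβ1 hγ1 hβm hγm).toLinearMap
        (coact hC hB hR hmB' hmC' x) := by
  have : (coact hC hB hR hmB hmC).comp (retwist ev hC hB hR hβ hγ hβ1 hγ1 hβm hγm) =
      (Algebra.TensorProduct.map (AlgHom.id k _) (retwist ev hC hB hR hβ hγ hβ1 hγ1 hβm hγm)).comp
        (coact hC hB hR hmB' hmC') := by
    refine algHom_ext (fun b => ?_) (fun h => ?_) (fun c => ?_)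
    · simp only [AlgHom.comp_apply, retwist_ofB]
      rw [coact, coact, lift_ofB, lift_ofB, bos_twistBy hB hβ, map_bos]
      have e : (retwist ev hC hB hR hβ hγ hβ1 hγ1 hβm hγm).toLinearMap ∘ₗ ofB R ev mB' mC' =
          ofB R ev mB mC ∘ₗ twistBy Coalgebra.comul β :=
        LinearMap.ext fun x => retwist_ofB _ _ _ _ _ _ _ _ _ x
      rw [e, AlgHom.id_comp]
      rfl
    · simp only [AlgHom.comp_apply, retwist_ofH]
      rw [coact, coact, lift_ofH, lift_ofH, map_diag]
      have e : (retwist ev hC hB hR hβ hγ hβ1 hγ1 hβm hγm).comp (ofH R ev mB' mC') =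
          ofH R ev mB mC := AlgHom.ext fun h => retwist_ofH _ _ _ _ _ _ _ _ _ h
      rw [e, AlgHom.id_comp]
    · simp only [AlgHom.comp_apply, retwist_ofC]
      rw [coact, coact, lift_ofC, lift_ofC, bos_twistBy (hC.cop hR) hγ, map_bos]
      have e : (retwist ev hC hB hR hβ hγ hβ1 hγ1 hβm hγm).toLinearMap ∘ₗ ofC R ev mB' mC' =
          ofC R ev mB mC ∘ₗ twistBy (braidInv R ∘ₗ Coalgebra.comul) γ :=
        LinearMap.ext fun x => retwist_ofC _ _ _ _ _ _ _ _ _ x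
      rw [e, AlgHom.id_comp]
      rfl
  exact AlgHom.congr_fun this x

section gauge
variable (hW : Function.Bijective (word (Drin.inHAlg R ev) (inB R ev) (inC R ev)))
  (hmB : UnitalColinear R Coalgebra.comul mB)
  (hmC : UnitalColinear (revR R) (braidInv R ∘ₗ Coalgebra.comul) mC)
  (hmB' : UnitalColinear R Coalgebra.comul mB')
  (hmC' : UnitalColinear (revR R) (braidInv R ∘ₗ Coalgebra.comul) mC')
  (f : Tw R ev mB' mC' →ₐ[k] Tw R ev mB mC)
  (hf : ∀ x, coact hC hB hR hmB hmC (f x) =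
    LinearMap.lTensor _ f.toLinearMap (coact hC hB hR hmB' hmC' x))
  (hS : Function.Bijective (HopfAlgebra.antipode k (A := H)))

/-- The linear form `e f θ` of a colinear algebra map between twisted doubles. -/
noncomputable def gauge : Drin R ev →ₗ[k] k :=
  vac hC hB hev hR hmB hmC ∘ₗ f.toLinearMap ∘ₗ theta mB' mC' hW

theorem gauge_one : gauge hC hB hev hR hW hmB hmC f 1 = 1 := by
  rw [gauge, LinearMap.comp_apply, LinearMap.comp_apply, theta_one, AlgHom.toLinearMap_apply,
    map_one, ← theta_one (mB := mB) (mC := mC) hW, vac_theta, map_one]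

include hf hS hmB' hmC'

/-- An element of the twisted double is recovered from its coaction by `vac`. A colinear map is
therefore determined by its composite with `vac`, and becomes a twist by that form. -/
theorem map_theta (x : Drin R ev) : f (theta mB' mC' hW x) = theta mB mC hW
    (twistBy (Drin.comul ev hC hB hR).toLinearMap (gauge hC hB hev hR hW hmB hmC f) x) := by
  rw [← theta_proj hC hB hev hR hmB hmC hW hS (f (theta mB' mC' hW x)), proj]
  simp only [LinearMap.comp_apply, AlgHom.toLinearMap_apply, hf, coact_theta]
  simp only [← LinearMap.lTensor_comp_apply]
  rfl

/-- Both sides compute `vac` of f(θ′(x) θ′(y)): the left one through the transported product of the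
source, the right one by multiplicativity of `f` and `map_theta`. -/
theorem conv_gauge (x : Drin R ev ⊗[k] Drin R ev) :
    conv (Drin.comul₂ hC hB hR) (gauge hC hB hev hR hW hmB hmC f ∘ₗ LinearMap.mul' k _)
      (form hC hB hev hR hmB' hmC' hW) x =
    form hC hB hev hR hmB hmC hW (TensorProduct.map
      (twistBy (Drin.comul ev hC hB hR).toLinearMap (gauge hC hB hev hR hW hmB hmC f))
      (twistBy (Drin.comul ev hC hB hR).toLinearMap (gauge hC hB hev hR hW hmB hmC f)) x) := by
  induction x with
  | zero => simp only [map_zero]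
  | add x y hx hy => simp only [map_add, hx, hy]
  | tmul x y =>
    rw [TensorProduct.map_tmul, form_tmul, ← map_theta hC hB hev hR hW hmB hmC hmB' hmC' f hf hS,
      ← map_theta hC hB hev hR hW hmB hmC hmB' hmC' f hf hS, ← map_mul,
      ← theta_proj hC hB hev hR hmB' hmC' hW hS (theta mB' mC' hW x * theta mB' mC' hW y),
      ← twistMul_form]
    change _ = gauge hC hB hev hR hW hmB hmC f _
    rw [BrBialg.twistMul_eq_sw, BrBialg.conv_eq_sw, map_sw]
    simp only [map_smul, smul_eq_mul, LinearMap.comp_apply, mul_comm]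

end gauge

end Tw
end
end BraidedDouble

/-! ### From isomorphisms of twisted doubles to coboundaries -/

namespace BraidedDouble
section
variable {k H : Type*} [Field k] [Ring H] [HopfAlgebra k H]

section
variable {A Z : Type*} [Ring A] [Algebra k A] [AddCommGroup Z] [Module k Z]

theorem sw_comulTensor_comm_twistBy {Δ : A →ₗ[k] A ⊗[k] A}
    (hΔ : ∀ v, TensorProduct.assoc k A A A (Δ.rTensor A (Δ v)) = Δ.lTensor A (Δ v)) (β : A →ₗ[k] k)
    (x y : A) (f : A ⊗[k] A → A ⊗[k] A → Z) (h1 : ∀ b, Lin k (fun a => f a b))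
    (h2 : ∀ a, Lin k (fun b => f a b)) :
    sw (comulTensor Δ (TensorProduct.comm k A A).toLinearMap
      (twistBy Δ β x ⊗ₜ twistBy Δ β y)) f =
      sw (comulTensor Δ (TensorProduct.comm k A A).toLinearMap (x ⊗ₜ y)) fun p q =>
        f p (TensorProduct.map (twistBy Δ β) (twistBy Δ β) q) := by
  simp (disch := fun_prop) only [sw_comulTensor_comm, sw_comul_twistBy β hΔ, TensorProduct.map_tmul]

theorem conv_comp_mul_comm (Δ : A →ₐ[k] A ⊗[k] A) (f g : A →ₗ[k] k) :
    conv (comulTensor Δ.toLinearMap (TensorProduct.comm k A A).toLinearMap)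
      (f ∘ₗ LinearMap.mul' k A) (g ∘ₗ LinearMap.mul' k A) =
      conv Δ.toLinearMap f g ∘ₗ LinearMap.mul' k A := by
  refine TensorProduct.ext' fun x y => ?_
  rw [conv_comm, LinearMap.comp_apply, BrBialg.conv_eq_sw, LinearMap.mul'_apply,
    AlgHom.toLinearMap_apply, AlgHom.toLinearMap_apply, AlgHom.toLinearMap_apply, map_mul Δ]
  conv_rhs => rw [eq_sw (Δ x), eq_sw (Δ y)]
  simp only [sw_mul, mul_sw, Algebra.TensorProduct.tmul_mul_tmul]
  simp (disch := fun_prop) only [sw_sw, sw_tmul, LinearMap.comp_apply, LinearMap.mul'_apply,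
    AlgHom.toLinearMap_apply]
  exact sw_comm _ _ _

end

namespace Tw
variable {B C : Type*}
  [Ring B] [Algebra k B] [Coalgebra k B] [Module H B] [IsScalarTower k H B]
  [Ring C] [Algebra k C] [Coalgebra k C] [Module H C] [IsScalarTower k H C]
variable {R : (H ⊗[k] H)ˣ} {ev : C ⊗[k] B →ₗ[k] k}
variable (hC : BrBialg R (Coalgebra.comul (R := k) (A := C)) Coalgebra.counit)
  (hB : BrBialg R (Coalgebra.comul (R := k) (A := B)) Coalgebra.counit)
  (hev : PairingLaws (H := H) ev) (hR : IsUniversalRMatrix R)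
  (hW : Function.Bijective (word (Drin.inHAlg R ev) (inB R ev) (inC R ev)))
  (hS : Function.Bijective (HopfAlgebra.antipode k (A := H)))

theorem _root_.BraidedDouble.Drin.comul_coassoc (x : Drin R ev) : TensorProduct.assoc k _ _ _
    ((Drin.comul ev hC hB hR).toLinearMap.rTensor _ ((Drin.comul ev hC hB hR).toLinearMap x)) =
      (Drin.comul ev hC hB hR).toLinearMap.lTensor _ ((Drin.comul ev hC hB hR).toLinearMap x) :=
  (drinBialgebra ev hC hB hR).coassoc x

section gauge
variable {mB mB' : B ⊗[k] B →ₗ[k] B} {mC mC' : C ⊗[k] C →ₗ[k] C}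
  (hmB : UnitalColinear R Coalgebra.comul mB)
  (hmC : UnitalColinear (revR R) (braidInv R ∘ₗ Coalgebra.comul) mC)
  (hmB' : UnitalColinear R Coalgebra.comul mB')
  (hmC' : UnitalColinear (revR R) (braidInv R ∘ₗ Coalgebra.comul) mC')
  (f : Tw R ev mB' mC' →ₐ[k] Tw R ev mB mC)
  (hf : ∀ x, coact hC hB hR hmB hmC (f x) =
    LinearMap.lTensor _ f.toLinearMap (coact hC hB hR hmB' hmC' x))
  (g : Tw R ev mB mC →ₐ[k] Tw R ev mB' mC')
  (hg : ∀ x, coact hC hB hR hmB' hmC' (g x) =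
    LinearMap.lTensor _ g.toLinearMap (coact hC hB hR hmB hmC x))
  (hfg : ∀ x, f (g x) = x) (hgf : ∀ x, g (f x) = x)

include hf hg hfg hS hmB' hmC' in
-- Since f g is the identity, the two twists compose to the identity under θ; applying `vac` leaves
-- the convolution product equal to the counit.
theorem conv_gauge_gauge : conv (Drin.comul ev hC hB hR).toLinearMap
    (gauge hC hB hev hR hW hmB hmC f) (gauge hC hB hev hR hW hmB' hmC' g) =
      (Drin.counit ev hC hB hR).toLinearMap := by
  refine LinearMap.ext fun x => ?_
  have h := hfg (theta mB mC hW x)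
  rw [map_theta hC hB hev hR hW hmB' hmC' hmB hmC g hg hS,
    map_theta hC hB hev hR hW hmB hmC hmB' hmC' f hf hS] at h
  have h' := congrArg (vac hC hB hev hR hmB hmC) h
  rw [vac_theta, vac_theta, twistBy_twistBy _ (Drin.comul_coassoc hC hB hR)] at h'
  exact (counit_twistBy (Δ := (Drin.comul ev hC hB hR).toLinearMap)
    (ε := (Drin.counit ev hC hB hR).toLinearMap) _ (drinBialgebra ev hC hB hR).counit_left x).symm.trans h'

include hf hg hfg hgf hS in
theorem exists_coboundary : ∃ u v : Drin R ev →ₗ[k] k,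
    IsUnitalInvertible k (Drin.comul ev hC hB hR).toLinearMap
      (Drin.counit ev hC hB hR).toLinearMap u v ∧
    form hC hB hev hR hmB' hmC' hW = coboundaryTwist (Drin.comul ev hC hB hR).toLinearMap
      (TensorProduct.comm k _ _).toLinearMap u v (form hC hB hev hR hmB hmC hW) := by
  have h1 := conv_gauge_gauge hC hB hev hR hW hS hmB hmC hmB' hmC' f hf g hg hfg
  have h2 := conv_gauge_gauge hC hB hev hR hW hS hmB' hmC' hmB hmC g hg f hf hgf
  refine ⟨gauge hC hB hev hR hW hmB hmC f, gauge hC hB hev hR hW hmB' hmC' g,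
    ⟨isInvariant_self _, isInvariant_self _, gauge_one _ _ _ _ _ _ _ _, h1, h2⟩, ?_⟩
  have hΔ := Drin.comul_coassoc (ev := ev) hC hB hR
  have hΔ₂ := comulTensor_comm_coassoc (Δ := (Drin.comul ev hC hB hR).toLinearMap) hΔ
  have hε₂ := comulTensor_comm_counit (Δ := (Drin.comul ev hC hB hR).toLinearMap)
    (ε := (Drin.counit ev hC hB hR).toLinearMap) (drinBialgebra ev hC hB hR).counit_left
  have hε : (Drin.counit ev hC hB hR).toLinearMap ∘ₗ LinearMap.mul' k _ = LinearMap.mul' k k ∘ₗ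
      TensorProduct.map (Drin.counit ev hC hB hR).toLinearMap
        (Drin.counit ev hC hB hR).toLinearMap := TensorProduct.ext' fun x y => by
    simp only [LinearMap.comp_apply, LinearMap.mul'_apply, TensorProduct.map_tmul,
      AlgHom.toLinearMap_apply, map_mul]
  -- The identity of `conv_gauge` is solved for the primed form by convolving with the gauge of `g`
  -- composed with the product.
  have e := congrArg (fun t => conv (Drin.comul₂ hC hB hR) t (form hC hB hev hR hmB' hmC' hW))
    (conv_comp_mul_comm (Drin.comul ev hC hB hR) (gauge hC hB hev hR hW hmB' hmC' g)
      (gauge hC hB hev hR hW hmB hmC f))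
  simp only [h2, hε] at e
  rw [conv_counit_left hε₂, conv_assoc hΔ₂] at e
  rw [← e, coboundaryTwist_eq]
  refine TensorProduct.ext' fun x y => ?_
  rw [LinearMap.comp_apply, TensorProduct.map_tmul, BrBialg.conv_eq_sw, BrBialg.conv_eq_sw,
    sw_comulTensor_comm_twistBy hΔ _ x y (fun p q => (gauge hC hB hev hR hW hmB' hmC' g ∘ₗ
      LinearMap.mul' k _) p * form hC hB hev hR hmB hmC hW q) (by fun_prop) (by fun_prop)]
  refine sw_congr fun p q => ?_
  rw [conv_gauge hC hB hev hR hW hmB hmC hmB' hmC' f hf hS]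

end gauge

end Tw

section inverse
variable {B : Type*} [Ring B] [Algebra k B] [Module H B] [IsScalarTower k H B]
variable {R : (H ⊗[k] H)ˣ} {Δ : B →ₗ[k] B ⊗[k] B} {ε β β' : B →ₗ[k] k} (hB : BrBialg R Δ ε)
include hB

theorem IsUnitalInvertible.map_one' (hβ : IsUnitalInvertible H Δ ε β β') : β' 1 = 1 := by
  have := LinearMap.congr_fun hβ.conv_right 1
  rw [BrBialg.conv_eq_sw, hB.comul_one, hB.counit_one] at this
  simp (disch := fun_prop) only [sw_tmul, hβ.map_one, one_mul] at this
  exact this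

theorem IsUnitalInvertible.twistBy_twistBy (hβ : IsUnitalInvertible H Δ ε β β') (b : B) :
    twistBy Δ β (twistBy Δ β' b) = b := by
  rw [BraidedDouble.twistBy_twistBy _ hB.coassoc, hβ.conv_right]
  exact twistBy_counit hB.counit_right b

theorem IsUnitalInvertible.twistBy_twistBy' (hβ : IsUnitalInvertible H Δ ε β β') (b : B) :
    twistBy Δ β' (twistBy Δ β b) = b := by
  rw [BraidedDouble.twistBy_twistBy _ hB.coassoc, hβ.conv_left]
  exact twistBy_counit hB.counit_right b

theorem IsUnitalInvertible.twistBy_map (hβ : IsUnitalInvertible H Δ ε β β')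
    {m m' : B ⊗[k] B →ₗ[k] B}
    (hm : ∀ x, twistBy Δ β (m' x) = m (TensorProduct.map (twistBy Δ β) (twistBy Δ β) x))
    (x : B ⊗[k] B) :
    twistBy Δ β' (m x) = m' (TensorProduct.map (twistBy Δ β') (twistBy Δ β') x) := by
  have h : twistBy Δ β ∘ₗ twistBy Δ β' = LinearMap.id :=
    LinearMap.ext (hβ.twistBy_twistBy hB)
  have e := hm (TensorProduct.map (twistBy Δ β') (twistBy Δ β') x)
  rw [← LinearMap.comp_apply (TensorProduct.map _ _), ← TensorProduct.map_comp, h, TensorProduct.map_id,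
    LinearMap.id_apply] at e
  rw [← e, hβ.twistBy_twistBy' hB]

end inverse

namespace Tw
variable {B C : Type*}
  [Ring B] [Algebra k B] [Coalgebra k B] [Module H B] [IsScalarTower k H B]
  [Ring C] [Algebra k C] [Coalgebra k C] [Module H C] [IsScalarTower k H C]
variable {R : (H ⊗[k] H)ˣ} {ev : C ⊗[k] B →ₗ[k] k}
variable (hC : BrBialg R (Coalgebra.comul (R := k) (A := C)) Coalgebra.counit)
  (hB : BrBialg R (Coalgebra.comul (R := k) (A := B)) Coalgebra.counit)
  (hev : PairingLaws (H := H) ev) (hR : IsUniversalRMatrix R)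
  (hW : Function.Bijective (word (Drin.inHAlg R ev) (inB R ev) (inC R ev)))
  (hS : Function.Bijective (HopfAlgebra.antipode k (A := H)))

variable {σ σ' : B ⊗[k] B →ₗ[k] k} {τ τ' : C ⊗[k] C →ₗ[k] k}
  (hσ : IsTwoCocycle H Coalgebra.comul Coalgebra.counit (braid R) σ)
  (hσ' : IsTwoCocycle H Coalgebra.comul Coalgebra.counit (braid R) σ')
  (hτ : IsTwoCocycle H (braidInv R ∘ₗ Coalgebra.comul) Coalgebra.counit (braid (revR R)) τ)
  (hτ' : IsTwoCocycle H (braidInv R ∘ₗ Coalgebra.comul) Coalgebra.counit (braid (revR R)) τ')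

include hS in
-- The inverse forms twist back, giving an algebra map in the other direction. The two are mutually
-- inverse on generators, hence everywhere, and `exists_coboundary` applies.
theorem composite_coboundary {β β' : B →ₗ[k] k} {γ γ' : C →ₗ[k] k}
    (hβ : IsUnitalInvertible H Coalgebra.comul Coalgebra.counit β β')
    (hγ : IsUnitalInvertible H (braidInv R ∘ₗ Coalgebra.comul) Coalgebra.counit γ γ')
    (hβσ : σ' = coboundaryTwist Coalgebra.comul (braid R) β β' σ)
    (hγτ : τ' = coboundaryTwist (braidInv R ∘ₗ Coalgebra.comul) (braid (revR R)) γ γ' τ) :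
    ∃ u v : Drin R ev →ₗ[k] k, IsUnitalInvertible k (Drin.comul ev hC hB hR).toLinearMap
      (Drin.counit ev hC hB hR).toLinearMap u v ∧
    composite hC hB hev hR hW hσ' hτ' = coboundaryTwist (Drin.comul ev hC hB hR).toLinearMap
      (TensorProduct.comm k _ _).toLinearMap u v (composite hC hB hev hR hW hσ hτ) := by
  have hC' := hC.cop hR
  have hβm := hB.twistBy_twistMul hR hβ.invariant hβ.conv_right σ
  have hγm := hC'.twistBy_twistMul hR.revR hγ.invariant hγ.conv_right τ
  rw [← hβσ] at hβm
  rw [← hγτ] at hγm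
  have hβm' := hβ.twistBy_map hB hβm
  have hγm' := hγ.twistBy_map hC' hγm
  have hβ1 := hβ.map_one' hB
  have hγ1 := hγ.map_one' hC'
  refine exists_coboundary hC hB hev hR hW hS _ _ _ _
    (retwist ev hC hB hR hβ.invariant hγ.invariant hβ.map_one hγ.map_one hβm hγm)
    (coact_retwist _ _ _ _ _ _ _ _ _ _ _ _ _)
    (retwist ev hC hB hR hβ.invariant' hγ.invariant' hβ1 hγ1 hβm' hγm')
    (coact_retwist _ _ _ _ _ _ _ _ _ _ _ _ _) (fun x => ?_) (fun x => ?_)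
  · refine AlgHom.congr_fun (φ₁ := (retwist ev hC hB hR hβ.invariant hγ.invariant hβ.map_one
      hγ.map_one hβm hγm).comp (retwist ev hC hB hR hβ.invariant' hγ.invariant' hβ1 hγ1 hβm' hγm'))
      (φ₂ := AlgHom.id k _) (algHom_ext (fun b => ?_) (fun h => ?_) (fun c => ?_)) x
    · rw [AlgHom.comp_apply, retwist_ofB, retwist_ofB, hβ.twistBy_twistBy hB, AlgHom.id_apply]
    · rw [AlgHom.comp_apply, retwist_ofH, retwist_ofH, AlgHom.id_apply]
    · rw [AlgHom.comp_apply, retwist_ofC, retwist_ofC, hγ.twistBy_twistBy hC', AlgHom.id_apply]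
  · refine AlgHom.congr_fun (φ₁ := (retwist ev hC hB hR hβ.invariant' hγ.invariant' hβ1 hγ1 hβm'
      hγm').comp (retwist ev hC hB hR hβ.invariant hγ.invariant hβ.map_one
      hγ.map_one hβm hγm))
      (φ₂ := AlgHom.id k _) (algHom_ext (fun b => ?_) (fun h => ?_) (fun c => ?_)) x
    · rw [AlgHom.comp_apply, retwist_ofB, retwist_ofB, hβ.twistBy_twistBy' hB, AlgHom.id_apply]
    · rw [AlgHom.comp_apply, retwist_ofH, retwist_ofH, AlgHom.id_apply]
    · rw [AlgHom.comp_apply, retwist_ofC, retwist_ofC, hγ.twistBy_twistBy' hC', AlgHom.id_apply]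

end Tw
end
end BraidedDouble

/-! ### Antipodes, restrictions to the generators, and the quotient -/

namespace BraidedDouble
section
variable {k H : Type*} [Field k] [Ring H] [HopfAlgebra k H]

/-- The counit serves as coboundary. Reflexivity is needed because a map of two variables descends
to quotients one variable at a time. -/
theorem BrBialg.cohomologous_refl {B : Type*} [Ring B] [Algebra k B] [Module H B]
    [IsScalarTower k H B] {R : (H ⊗[k] H)ˣ} {Δ : B →ₗ[k] B ⊗[k] B} {ε : B →ₗ[k] k}
    (hB : BrBialg R Δ ε) (hR : IsUniversalRMatrix R) {ψ : B ⊗[k] B →ₗ[k] B ⊗[k] B}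
    (hψ : ψ = braid R) (σ : TwoCocycle H Δ ε ψ) : Cohomologous σ σ := by
  subst hψ
  have hc : conv Δ ε ε = ε := conv_counit_left hB.counit_left ε
  refine ⟨ε, ε, ⟨hB.counit_smul, hB.counit_smul, hB.counit_one, hc, hc⟩, ?_⟩
  have ht : twistBy Δ ε = LinearMap.id := LinearMap.ext (twistBy_counit hB.counit_right)
  rw [coboundaryTwist_eq, ht, TensorProduct.map_id, LinearMap.comp_id, hB.counit_comp_mul,
    conv_counit_left (hB.delta_counit_left hR)]

variable {B C : Type*}
  [Ring B] [Algebra k B] [Coalgebra k B] [Module H B] [IsScalarTower k H B]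
  [Ring C] [Algebra k C] [Coalgebra k C] [Module H C] [IsScalarTower k H C]

theorem BraidedHopf.sw_antipode_left {R : (H ⊗[k] H)ˣ} (hB : BraidedHopf R B) (b : B) :
    sw (Coalgebra.comul (R := k) b) (fun b₁ b₂ => hB.antipode b₁ * b₂) =
      algebraMap k B (Coalgebra.counit b) := by
  rw [← hB.mul_antipode_left b]
  exact sw_lin (LinearMap.mul' k B ∘ₗ LinearMap.rTensor B hB.antipode) _

theorem BraidedHopf.sw_antipode_right {R : (H ⊗[k] H)ˣ} (hB : BraidedHopf R B) (b : B) :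
    sw (Coalgebra.comul (R := k) b) (fun b₁ b₂ => b₁ * hB.antipode b₂) =
      algebraMap k B (Coalgebra.counit b) := by
  rw [← hB.mul_antipode_right b]
  exact sw_lin (LinearMap.mul' k B ∘ₗ LinearMap.lTensor B hB.antipode) _

section inverse
variable {R : (H ⊗[k] H)ˣ} {hC : BraidedHopf R C} {hB : BraidedHopf R B} {ev : C ⊗[k] B →ₗ[k] k}
  (hev : IsWeakDuality hC hB ev)

include hev in
-- Multiplicativity of `ev` in its first argument turns the sum into the pairing of S(c₁) c₂ with
-- `b`.
theorem IsWeakDuality.sw_inverse (c : C) (b : B) :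
    (sw (Coalgebra.comul (R := k) c) fun c₁ c₂ => sw (Coalgebra.comul (R := k) b) fun b₁ b₂ =>
      ev (c₂ ⊗ₜ b₁) * (ev ∘ₗ LinearMap.rTensor B hC.antipode) (c₁ ⊗ₜ b₂)) =
    Coalgebra.counit (R := k) c * Coalgebra.counit (R := k) b := by
  simp only [LinearMap.comp_apply, LinearMap.rTensor_tmul, ← hev.laws.mul_left]
  refine (Lin.map_sw (k := k) (by fun_prop : Lin k fun x => ev (x ⊗ₜ b)) _ _).symm.trans ?_
  rw [hC.sw_antipode_left, Algebra.algebraMap_eq_smul_one, ← TensorProduct.smul_tmul', map_smul,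
    hev.one_left, smul_eq_mul]

include hev in
theorem IsWeakDuality.sw_inverse' (c : C) (b : B) :
    (sw (Coalgebra.comul (R := k) c) fun c₁ c₂ => sw (Coalgebra.comul (R := k) b) fun b₁ b₂ =>
      (ev ∘ₗ LinearMap.rTensor B hC.antipode) (c₂ ⊗ₜ b₁) * ev (c₁ ⊗ₜ b₂)) =
    Coalgebra.counit (R := k) c * Coalgebra.counit (R := k) b := by
  simp only [LinearMap.comp_apply, LinearMap.rTensor_tmul, ← hev.laws.mul_left]
  refine (Lin.map_sw (k := k) (by fun_prop : Lin k fun x => ev (x ⊗ₜ b)) _ _).symm.trans ?_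
  rw [hC.sw_antipode_right, Algebra.algebraMap_eq_smul_one, ← TensorProduct.smul_tmul', map_smul,
    hev.one_left, smul_eq_mul]

include hev in
theorem IsWeakDuality.word_bijective (hR : IsUniversalRMatrix R)
    (hS : Function.Bijective (HopfAlgebra.antipode k (A := H))) :
    Function.Bijective (word (Drin.inHAlg R ev) (inB R ev) (inC R ev)) := by
  obtain ⟨T, hT⟩ := exists_skew (k := k) hS
  -- Independence of words uses the antipode of B, spanning uses that of C through the inverse of
  -- the pairing, and both use the inverse antipode of H.
  refine ⟨Drin.word_injective hC.toBrBialg hB.toBrBialg hev.laws hR hB.antipode_smul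
    hB.sw_antipode_left hT hS.1, Drin.word_surjective hC.toBrBialg hB.toBrBialg hR
      (f := ev ∘ₗ LinearMap.rTensor B hC.antipode) (fun c b => ?_) hS⟩
  rw [← hev.sw_inverse c b]
  simp only [mul_comm]

end inverse

namespace Tw
variable {R : (H ⊗[k] H)ˣ} {ev : C ⊗[k] B →ₗ[k] k}
variable (hC : BrBialg R (Coalgebra.comul (R := k) (A := C)) Coalgebra.counit)
  (hB : BrBialg R (Coalgebra.comul (R := k) (A := B)) Coalgebra.counit)
  (hev : PairingLaws (H := H) ev) (hR : IsUniversalRMatrix R)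
  (hW : Function.Bijective (word (Drin.inHAlg R ev) (inB R ev) (inC R ev)))
  {σ : B ⊗[k] B →ₗ[k] k} {τ : C ⊗[k] C →ₗ[k] k}
  (hσ : IsTwoCocycle H Coalgebra.comul Coalgebra.counit (braid R) σ)
  (hτ : IsTwoCocycle H (braidInv R ∘ₗ Coalgebra.comul) Coalgebra.counit (braid (revR R)) τ)

theorem isComposite_composite : IsComposite σ τ (composite hC hB hev hR hW hσ hτ) :=
  fun b b' h h' c c' => by
    refine (composite_word hC hB hev hR hW hσ hτ b b' h h' c c').trans ?_
    exact sw_lin (LinearMap.mul' k k ∘ₗ TensorProduct.map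
        (σ ∘ₗ TensorProduct.mk k B B b ∘ₗ (Algebra.lsmul k k B).toLinearMap h)
        (τ ∘ₗ (TensorProduct.mk k C C).flip (h' • c'))) (cross R ev (c ⊗ₜ b'))

variable (R ev) in
theorem _root_.BraidedDouble.Drin.wd_eq :
    (∀ b : B, inB R ev b = Drin.wd R ev b 1 1) ∧ (∀ h : H, inH R ev h = Drin.wd R ev 1 h 1) ∧
      ∀ c : C, inC R ev c = Drin.wd R ev 1 1 c := by
  have h := Drin.triple R ev
  simp only [Drin.wd, h.left.one, h.right.one, ← Drin.inHAlg_apply, map_one, one_mul, mul_one,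
    implies_true, and_self]

theorem composite_inB (b b' : B) :
    composite hC hB hev hR hW hσ hτ (inB R ev b ⊗ₜ inB R ev b') = σ (b ⊗ₜ b') := by
  rw [(Drin.wd_eq R ev).1, (Drin.wd_eq R ev).1, composite_word,
    cross_one_left hC hB hR hev.one_left]
  simp (disch := fun_prop) only [sw_tmul, one_smul, hτ.one_left, hC.counit_one, mul_one]

theorem composite_inC (c c' : C) :
    composite hC hB hev hR hW hσ hτ (inC R ev c ⊗ₜ inC R ev c') = τ (c ⊗ₜ c') := by
  rw [(Drin.wd_eq R ev).2.2, (Drin.wd_eq R ev).2.2, composite_word,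
    cross_one_right hC hB hR hev.one_right]
  simp (disch := fun_prop) only [sw_tmul, one_smul, hσ.one_left, hB.counit_one, one_mul]

theorem composite_inH (h h' : H) : composite hC hB hev hR hW hσ hτ (inH R ev h ⊗ₜ inH R ev h') =
    Coalgebra.counit (R := k) (h * h') := by
  rw [(Drin.wd_eq R ev).2.1, (Drin.wd_eq R ev).2.1, composite_word,
    cross_one_left hC hB hR hev.one_left]
  simp (disch := fun_prop) only [sw_tmul, hσ.one_left, hτ.one_left, hB.counit_smul, hC.counit_smul,
    hB.counit_one, hC.counit_one, mul_one, Bialgebra.counit_mul]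

end Tw

theorem C2cop.isTwoCocycle {R : (H ⊗[k] H)ˣ} (τ : C2cop R C) :
    IsTwoCocycle H (braidInv R ∘ₗ Coalgebra.comul) Coalgebra.counit (braid (revR R)) τ.1 := by
  rw [← braidInv_eq]
  exact τ.2

end
end BraidedDouble

theorem theorem4p14 {k H B C : Type*} [Field k] [Ring H] [HopfAlgebra k H]
    [Ring B] [Algebra k B] [Coalgebra k B] [Module H B] [IsScalarTower k H B]
    [Ring C] [Algebra k C] [Coalgebra k C] [Module H C] [IsScalarTower k H C]
    (hS : Function.Bijective (HopfAlgebra.antipode k (A := H)))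
    (R : (H ⊗[k] H)ˣ) (hR : BraidedDouble.IsUniversalRMatrix R)
    (hC : BraidedDouble.BraidedHopf R C) (hB : BraidedDouble.BraidedHopf R B)
    (ev : C ⊗[k] B →ₗ[k] k) (hev : BraidedDouble.IsWeakDuality hC hB ev) :
    ∃ D : BraidedDouble.DrinBialgebra R ev, (∀ D' : BraidedDouble.DrinBialgebra R ev, D' = D) ∧
    ∃ circ : BraidedDouble.C2 R B → BraidedDouble.C2cop R C → BraidedDouble.C2Drin D,
      (∀ σ τ, BraidedDouble.IsComposite σ.1 τ.1 (circ σ τ).1) ∧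
      (∀ σ τ (ω : BraidedDouble.Drin R ev ⊗[k] BraidedDouble.Drin R ev →ₗ[k] k),
        BraidedDouble.IsComposite σ.1 τ.1 ω → ω = (circ σ τ).1) ∧
      (∀ σ τ (b b' : B), (circ σ τ).1
        (BraidedDouble.inB R ev b ⊗ₜ BraidedDouble.inB R ev b') = σ.1 (b ⊗ₜ b')) ∧
      (∀ σ τ (c c' : C), (circ σ τ).1
        (BraidedDouble.inC R ev c ⊗ₜ BraidedDouble.inC R ev c') = τ.1 (c ⊗ₜ c')) ∧
      (∀ σ τ (h h' : H), (circ σ τ).1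
        (BraidedDouble.inH R ev h ⊗ₜ BraidedDouble.inH R ev h') =
          Coalgebra.counit (R := k) (h * h')) ∧
      (∀ σ σ' τ τ', BraidedDouble.Cohomologous σ σ' → BraidedDouble.Cohomologous τ τ' →
        BraidedDouble.Cohomologous (circ σ τ) (circ σ' τ')) ∧
      (∃ F : BraidedDouble.H2 R B → BraidedDouble.H2cop R C → BraidedDouble.H2Drin D,
        ∀ σ τ, F (Quot.mk _ σ) (Quot.mk _ τ) = Quot.mk _ (circ σ τ)) := by
  have hC' := hC.toBrBialg
  have hB' := hB.toBrBialg
  have hW := hev.word_bijective hR hS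
  let circ : BraidedDouble.C2 R B → BraidedDouble.C2cop R C →
      BraidedDouble.C2Drin (BraidedDouble.drinBialgebra ev hC' hB' hR) := fun σ τ =>
    ⟨BraidedDouble.Tw.composite hC' hB' hev.laws hR hW σ.2 τ.isTwoCocycle,
      BraidedDouble.Tw.isTwoCocycle_composite hC' hB' hev.laws hR hW σ.2 τ.isTwoCocycle hS
        hev.sw_inverse hev.sw_inverse'⟩
  have hcirc : ∀ σ σ' τ τ', BraidedDouble.Cohomologous σ σ' → BraidedDouble.Cohomologous τ τ' →
      BraidedDouble.Cohomologous (circ σ τ) (circ σ' τ') := by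
    rintro σ σ' τ τ' ⟨β, β', hβ, hσ⟩ ⟨γ, γ', hγ, hτ⟩
    -- The inverse braiding is replaced by the braiding of the reversed R-matrix, the form in which
    -- the theory applies to C.
    have hτ₂ := hτ.trans (congrArg (fun ψ => BraidedDouble.coboundaryTwist
      (BraidedDouble.comulCop R C) ψ γ γ' τ.1) (BraidedDouble.braidInv_eq R))
    exact BraidedDouble.Tw.composite_coboundary hC' hB' hev.laws hR hW hS σ.2 σ'.2
      (BraidedDouble.C2cop.isTwoCocycle τ) (BraidedDouble.C2cop.isTwoCocycle τ') hβ hγ hσ hτ₂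
  refine ⟨BraidedDouble.drinBialgebra ev hC' hB' hR,
    fun D' => BraidedDouble.DrinBialgebra.eq ev _ _, circ,
    fun σ τ => BraidedDouble.Tw.isComposite_composite hC' hB' hev.laws hR hW σ.2
      (BraidedDouble.C2cop.isTwoCocycle τ), fun σ τ ω hω => ?_,
    fun σ τ => BraidedDouble.Tw.composite_inB hC' hB' hev.laws hR hW σ.2
      (BraidedDouble.C2cop.isTwoCocycle τ),
    fun σ τ => BraidedDouble.Tw.composite_inC hC' hB' hev.laws hR hW σ.2
      (BraidedDouble.C2cop.isTwoCocycle τ),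
    fun σ τ => BraidedDouble.Tw.composite_inH hC' hB' hev.laws hR hW σ.2
      (BraidedDouble.C2cop.isTwoCocycle τ), hcirc,
    Quot.map₂ circ (fun σ τ τ' => hcirc σ σ τ τ' (hB'.cohomologous_refl hR rfl σ))
      (fun σ σ' τ h => hcirc σ σ' τ τ h
        ((hC'.cop hR).cohomologous_refl hR.revR (BraidedDouble.braidInv_eq R) τ)), fun σ τ => rfl⟩
  -- Uniqueness: a bilinear form is determined by its values on words, since these span the double.
  refine BraidedDouble.Drin.form_ext hW fun b h c b' h' c' => ?_
  rw [hω b b' h h' c c']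
  exact (BraidedDouble.Tw.isComposite_composite hC' hB' hev.laws hR hW σ.2
    (BraidedDouble.C2cop.isTwoCocycle τ) b b' h h' c c').symm
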